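/- Let $\Gamma$ be a discrete subgroup of $G=\mathrm{SL}(2,\mathbb R)$ with $-1\in\Gamma$ such that $\Gamma/\{\pm1\}$ acts freely on the upper half plane $\mathcal H$ and the surface $\Sigma=\Gamma\backslash\mathcal H$ is noncompact of finite area. Let $\kappa\ge 1$ be the number of cusps of $\Sigma$ (the number of $\Gamma$-orbits of fixed points of parabolic elements of $\Gamma$), and let $g$ be the genus of the closed surface obtained from $\Sigma$ by adding one point for each cusp. Let $X=\Gamma\backslash G$, with the orientation and the metric $g_r$ ($r>0$) for which the left invariant fields $r^{-1}C, A, H$ form a positively oriented orthonormal frame, where $$C=\begin{pmatrix}0&1\\-1&0\end{pmatrix},\quad A=\begin{pmatrix}0&1\\1&0\end{pmatrix},\quad H=\begin{pmatrix}1&0\\0&-1\end{pmatrix}.$$ (1) The manifold $X$ has exactly $2^{2g+\kappa}$ spin structures, up to equivalence. (2) The circle fibration $X\to\Sigma$, $\Gamma p\mapsto\Gamma(p\cdot i)$, has continuous sections. Every such section $s$ gives a splitting $\pi_1(X)\cong s_*\pi_1(\Sigma)\times\langle k\rangle$, with $k$ the class of the fibre, and for the $j$-th cusp an element $h_j\in\pi_1(X)$,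 the image under $s$ of the loop in $\Sigma$ around the cusp (well defined up to conjugation and inversion). A spin structure on $X$ is called nontrivial along the $j$-th cusp if the left invariant frame $(r^{-1}C,A,H)$ along $h_j$ does not lift to a closed loop in the $\mathrm{Spin}(3)$-bundle; equivalently, if $\rho(h_j)=-1$ where the $\mathrm{Spin}(3)$-bundle is $\widetilde X\times_\rho\mathrm{Spin}(3)$ with $\rho:\pi_1(X)\to\{\pm1\}$. It is called totally nontrivial if it is nontrivial along every cusp. For every section $s$, totally nontrivial spin structures exist on $X$ if and only if $\kappa$ is even. -/

import Mathlib

open Matrix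
open scoped MatrixGroups

noncomputable section

namespace SpinQuotient

/-! ### The quotients `X = Γ\G` and `Σ = Γ\ℍ`, for a subgroup `Γ` of `G = SL(2, ℝ)` -/

/-- The space `X = Γ\G`, where `Γ` acts on `G = SL(2, ℝ)` by left multiplication. -/
abbrev X (Γ : Subgroup SL(2, ℝ)) : Type := MulAction.orbitRel.Quotient Γ SL(2, ℝ)

/-- The base surface `Σ = Γ\ℍ`. -/
abbrev Base (Γ : Subgroup SL(2, ℝ)) : Type := MulAction.orbitRel.Quotient Γ UpperHalfPlane

/-- The circle fibration `X → Σ`, `Γp ↦ Γ(p • i)`. -/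
def toBase (Γ : Subgroup SL(2, ℝ)) : X Γ → Base Γ :=
  Quotient.map (fun p : SL(2, ℝ) => p • UpperHalfPlane.I) (by
    rintro p q ⟨γ, rfl⟩
    exact ⟨γ, by simp [Subgroup.smul_def, mul_smul]⟩)

/-- `Γ` as a subgroup of `GL(2, ℝ)`; Mathlib's cusps are defined for such subgroups. -/
abbrev toGL (Γ : Subgroup SL(2, ℝ)) : Subgroup (GL (Fin 2) ℝ) :=
  Γ.map (SpecialLinearGroup.mapGL ℝ)

/-! ### Cusps, compactification and genus -/

/-- The compactified surface `Γ\(ℍ ∪ {cusps of Γ})`: the surface `Γ\ℍ` with one point added for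
every `Γ`-orbit of cusps. -/
def Compactified (Γ : Subgroup SL(2, ℝ)) : Type := Base Γ ⊕ CuspOrbits (toGL Γ)

/-- The inclusion of `Γ\ℍ` in its compactification. -/
def Compactified.ofBase {Γ : Subgroup SL(2, ℝ)} (x : Base Γ) : Compactified Γ := Sum.inl x

/-- The point of the compactification given by a cusp of `Γ`. -/
def Compactified.ofCusp {Γ : Subgroup SL(2, ℝ)} (c : OnePoint ℝ) (h : IsCusp c (toGL Γ)) :
    Compactified Γ := Sum.inr (Quotient.mk _ ⟨c, h⟩)

/-- The horoball topology: a set is open if its trace on `Γ\ℍ` is open and if, whenever it contains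
the class of a cusp `a • ∞`, it contains the image of a horoball `a • {z | M < Im z}` there. -/
instance (Γ : Subgroup SL(2, ℝ)) : TopologicalSpace (Compactified Γ) where
  IsOpen U := IsOpen (Compactified.ofBase ⁻¹' U) ∧
    ∀ (a : SL(2, ℝ)) (h : IsCusp (SpecialLinearGroup.mapGL ℝ a • OnePoint.infty) (toGL Γ)),
      Compactified.ofCusp _ h ∈ U →
      ∃ M : ℝ, ∀ z : UpperHalfPlane, M < z.im →
        Compactified.ofBase (Quotient.mk _ (a • z)) ∈ U
  isOpen_univ := ⟨isOpen_univ, fun _ _ _ => ⟨0, fun _ _ => trivial⟩⟩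
  isOpen_inter U V hU hV := ⟨hU.1.inter hV.1, fun a h hm => by
    obtain ⟨M, hM⟩ := hU.2 a h hm.1
    obtain ⟨N, hN⟩ := hV.2 a h hm.2
    exact ⟨max M N, fun z hz => ⟨hM z (lt_of_le_of_lt (le_max_left _ _) hz),
      hN z (lt_of_le_of_lt (le_max_right _ _) hz)⟩⟩⟩
  isOpen_sUnion S hS := by
    refine ⟨?_, fun a h hm => ?_⟩
    · rw [Set.preimage_sUnion]
      exact isOpen_biUnion fun U hU => (hS U hU).1
    · obtain ⟨U, hU, hmU⟩ := hm
      obtain ⟨M, hM⟩ := (hS U hU).2 a h hmU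
      exact ⟨M, fun z hz => ⟨U, hU, hM z hz⟩⟩

/-- The point `exp (2πit)` on the boundary of the closed unit disc. -/
def boundaryPoint (t : ℝ) : Metric.closedBall (0 : ℂ) 1 :=
  ⟨Circle.exp (2 * Real.pi * t), by
    rw [mem_closedBall_zero_iff]; exact (Circle.norm_coe _).le⟩

/-- The boundary of the disc, cut into `4g` equal edges, is glued according to the word
`a₁ b₁ a₁⁻¹ b₁⁻¹ ⋯ a_g b_g a_g⁻¹ b_g⁻¹`; for `g = 0` it is folded according to `a a⁻¹`. -/
inductive PolygonGlue (g : ℕ) :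
    Metric.closedBall (0 : ℂ) 1 → Metric.closedBall (0 : ℂ) 1 → Prop
  | edge_a (i : ℕ) (hi : i < g) (s : ℝ) (hs : s ∈ Set.Icc (0 : ℝ) 1) : PolygonGlue g
      (boundaryPoint ((4 * i + s) / (4 * g))) (boundaryPoint ((4 * i + 3 - s) / (4 * g)))
  | edge_b (i : ℕ) (hi : i < g) (s : ℝ) (hs : s ∈ Set.Icc (0 : ℝ) 1) : PolygonGlue g
      (boundaryPoint ((4 * i + 1 + s) / (4 * g))) (boundaryPoint ((4 * i + 4 - s) / (4 * g)))
  | fold (hg : g = 0) (s : ℝ) : PolygonGlue g (boundaryPoint s) (boundaryPoint (-s))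

/-- The closed orientable surface of genus `g`. -/
def ClosedSurface (g : ℕ) : Type := Quot (PolygonGlue g)

instance (g : ℕ) : TopologicalSpace (ClosedSurface g) :=
  inferInstanceAs (TopologicalSpace (Quot (PolygonGlue g)))

/-- `Γ\ℍ` is a surface of genus `g` with `κ` cusps: there are `κ` orbits of cusps, and adding one
point for each of them to `Γ\ℍ` gives a closed surface of genus `g`. (In particular the
compactification is compact, so `Γ` has finite covolume.) -/
def HasSignature (Γ : Subgroup SL(2, ℝ)) (g κ : ℕ) : Prop :=
  Finite (CuspOrbits (toGL Γ)) ∧ Nat.card (CuspOrbits (toGL Γ)) = κ ∧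
    Nonempty (Compactified Γ ≃ₜ ClosedSurface g)

/-! ### The double covering `Spin(3) → SO(3)` -/

/-- `SO(3)`. -/
abbrev SO3 : Type := Matrix.specialOrthogonalGroup (Fin 3) ℝ

/-- `Spin(3)`, the group of unit quaternions. -/
abbrev Spin3 : Type := Metric.sphere (0 : Quaternion ℝ) 1

/-- The basis `i, j, k` of the imaginary quaternions. -/
def imBasis : Fin 3 → Quaternion ℝ := ![⟨0, 1, 0, 0⟩, ⟨0, 0, 1, 0⟩, ⟨0, 0, 0, 1⟩]

/-- The coordinates of the imaginary part of a quaternion with respect to `i, j, k`. -/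
def imCoord (x : Quaternion ℝ) : Fin 3 → ℝ := ![x.imI, x.imJ, x.imK]

/-- The matrix, with respect to `i, j, k`, of `v ↦ q v q̄` on the imaginary quaternions. -/
def conjMatrix (q : Quaternion ℝ) : Matrix (Fin 3) (Fin 3) ℝ :=
  Matrix.of fun a b => imCoord (q * imBasis b * star q) a

lemma conjMatrix_eq (q : Quaternion ℝ) : conjMatrix q =
    !![q.re^2+q.imI^2-q.imJ^2-q.imK^2, 2*(q.imI*q.imJ-q.re*q.imK), 2*(q.imI*q.imK+q.re*q.imJ);
       2*(q.imI*q.imJ+q.re*q.imK), q.re^2-q.imI^2+q.imJ^2-q.imK^2, 2*(q.imJ*q.imK-q.re*q.imI);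
       2*(q.imI*q.imK-q.re*q.imJ), 2*(q.imJ*q.imK+q.re*q.imI), q.re^2-q.imI^2-q.imJ^2+q.imK^2] := by
  ext i j
  fin_cases i <;> fin_cases j <;>
    simp [conjMatrix, imCoord, imBasis, Quaternion.re_mul, Quaternion.imI_mul,
      Quaternion.imJ_mul, Quaternion.imK_mul] <;> ring

lemma conjMatrix_mem (q : Spin3) : conjMatrix q.1 ∈ Matrix.specialOrthogonalGroup (Fin 3) ℝ := by
  obtain ⟨q, hq⟩ := q
  have h : q.re ^ 2 + q.imI ^ 2 + q.imJ ^ 2 + q.imK ^ 2 = 1 := by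
    have h1 : ‖q‖ = 1 := by simpa using hq
    have h2 := Quaternion.normSq_eq_norm_mul_self q
    rw [h1, Quaternion.normSq_def'] at h2
    simpa using h2
  show conjMatrix q ∈ Matrix.specialOrthogonalGroup (Fin 3) ℝ
  rw [Matrix.mem_specialOrthogonalGroup_iff, Matrix.mem_orthogonalGroup_iff, conjMatrix_eq]
  generalize q.re = a at *
  generalize q.imI = b at *
  generalize q.imJ = c at *
  generalize q.imK = d at *
  constructor
  · have h4 : (a ^ 2 + b ^ 2 + c ^ 2 + d ^ 2) ^ 2 = 1 := by rw [h]; norm_num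
    ext i j
    fin_cases i <;> fin_cases j <;>
      simp [Matrix.mul_apply, Fin.sum_univ_three] <;>
      first
        | ring1
        | (rw [← h4]; ring1)
  · rw [Matrix.det_fin_three]
    have h6 : (a ^ 2 + b ^ 2 + c ^ 2 + d ^ 2) ^ 3 = 1 := by rw [h]; norm_num
    simp
    rw [← h6]; ring

/-- The double covering `Spin(3) → SO(3)`. -/
def spinToSO (q : Spin3) : SO3 := ⟨conjMatrix q.1, conjMatrix_mem q⟩

/-! ### The oriented orthonormal frame bundle of `X` -/

/-- The basis `(E, A, H)` of `sl(2, ℝ)`, where `E = r⁻¹ C`. Its left translates form a positively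
oriented orthonormal frame of `G` for the metric `g_r`. -/
def lieBasis (r : ℝ) : Fin 3 → Matrix (Fin 2) (Fin 2) ℝ :=
  ![r⁻¹ • !![0, 1; -1, 0], !![0, 1; 1, 0], !![1, 0; 0, -1]]

/-- The bundle of oriented `g_r`-orthonormal frames of `G`. The tangent space of `G` at `p` is the
space of matrices `p * sl(2, ℝ)`, in which `(p * E, p * A, p * H)` is an oriented orthonormal
basis; the other ones are obtained from it by the matrices of `SO(3)`. -/
def FrameG (r : ℝ) : Type :=
  {f : SL(2, ℝ) × (Fin 3 → Matrix (Fin 2) (Fin 2) ℝ) //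
    ∃ R : SO3, ∀ i, f.2 i = (f.1 : Matrix (Fin 2) (Fin 2) ℝ) * ∑ j, R.1 j i • lieBasis r j}

instance (r : ℝ) : TopologicalSpace (FrameG r) :=
  inferInstanceAs (TopologicalSpace {f : SL(2, ℝ) × (Fin 3 → Matrix (Fin 2) (Fin 2) ℝ) //
    ∃ R : SO3, ∀ i, f.2 i = (f.1 : Matrix (Fin 2) (Fin 2) ℝ) * ∑ j, R.1 j i • lieBasis r j})

/-- `Γ` acts on the frames of `G` by the differentials of the left translations. -/
instance (Γ : Subgroup SL(2, ℝ)) (r : ℝ) : MulAction Γ (FrameG r) where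
  smul γ f := ⟨(γ.1 * f.1.1, fun i => (γ.1 : Matrix (Fin 2) (Fin 2) ℝ) * f.1.2 i), by
    obtain ⟨R, hR⟩ := f.2
    exact ⟨R, fun i => by
      simp only [hR]
      exact (Matrix.mul_assoc _ _ _).symm⟩⟩
  one_smul f := by
    apply Subtype.ext
    refine Prod.ext (one_mul _) (funext fun i => ?_)
    show ((1 : SL(2, ℝ)) : Matrix (Fin 2) (Fin 2) ℝ) * f.1.2 i = f.1.2 i
    simp
  mul_smul γ δ f := by
    apply Subtype.ext
    refine Prod.ext (mul_assoc _ _ _) (funext fun i => ?_)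
    show ((γ.1 * δ.1 : SL(2, ℝ)) : Matrix (Fin 2) (Fin 2) ℝ) * f.1.2 i =
      (γ.1 : Matrix (Fin 2) (Fin 2) ℝ) * ((δ.1 : Matrix (Fin 2) (Fin 2) ℝ) * f.1.2 i)
    exact Matrix.mul_assoc _ _ _

/-- The right action of `SO(3)` on frames: `(v • R) i = ∑ j, R j i • v j`. -/
def FrameG.rotate {r : ℝ} (f : FrameG r) (R : SO3) : FrameG r :=
  ⟨(f.1.1, fun i => ∑ j, R.1 j i • f.1.2 j), by
    obtain ⟨T, hT⟩ := f.2
    refine ⟨T * R, fun i => ?_⟩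
    simp only [hT, Submonoid.coe_mul, Matrix.mul_apply, Finset.sum_smul, Finset.mul_sum,
      Finset.smul_sum, Matrix.mul_smul]
    rw [Finset.sum_comm]
    refine Finset.sum_congr rfl fun k _ => Finset.sum_congr rfl fun j _ => ?_
    rw [smul_smul, mul_comm]⟩

/-- The bundle `SO(X)` of oriented orthonormal frames of `X = Γ\G`. -/
abbrev FrameX (Γ : Subgroup SL(2, ℝ)) (r : ℝ) : Type := MulAction.orbitRel.Quotient Γ (FrameG r)

/-- The projection `SO(X) → X`. -/
def FrameX.base {Γ : Subgroup SL(2, ℝ)} {r : ℝ} : FrameX Γ r → X Γ :=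
  Quotient.map (fun f : FrameG r => f.1.1) (by
    rintro f f' ⟨γ, rfl⟩
    exact ⟨γ, rfl⟩)

/-- The right action of `SO(3)` on `SO(X)`. -/
def FrameX.rotate {Γ : Subgroup SL(2, ℝ)} {r : ℝ} (f : FrameX Γ r) (R : SO3) : FrameX Γ r :=
  Quotient.map (fun f : FrameG r => f.rotate R) (by
    rintro f f' ⟨γ, rfl⟩
    refine ⟨γ, Subtype.ext (Prod.ext rfl (funext fun i => ?_))⟩
    show (γ.1 : Matrix (Fin 2) (Fin 2) ℝ) * (∑ j, R.1 j i • f'.1.2 j) =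
      ∑ j, R.1 j i • ((γ.1 : Matrix (Fin 2) (Fin 2) ℝ) * f'.1.2 j)
    simp only [Finset.mul_sum, Matrix.mul_smul]) f

/-- The global section `(E, A, H)` of `SO(X)`: the left invariant trivialization. -/
def leftInvariantFrame (Γ : Subgroup SL(2, ℝ)) (r : ℝ) : X Γ → FrameX Γ r :=
  Quotient.map (fun p : SL(2, ℝ) =>
    (⟨(p, fun i => (p : Matrix (Fin 2) (Fin 2) ℝ) * lieBasis r i), 1, fun i => by
      simp [Matrix.one_apply]⟩ : FrameG r)) (by
    rintro p q ⟨γ, rfl⟩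
    refine ⟨γ, Subtype.ext (Prod.ext rfl (funext fun i => ?_))⟩
    show (γ.1 : Matrix (Fin 2) (Fin 2) ℝ) * ((q : Matrix (Fin 2) (Fin 2) ℝ) * lieBasis r i) =
      ((γ.1 * q : SL(2, ℝ)) : Matrix (Fin 2) (Fin 2) ℝ) * lieBasis r i
    exact (Matrix.mul_assoc _ _ _).symm)

/-! ### Spin structures -/

/-- A spin structure on `X`: a principal `Spin(3)`-bundle `P → X` (with `Spin(3)` acting on the
right) together with a continuous map `ξ : P → SO(X)` of bundles over `X` that is equivariant with
respect to `Spin(3) → SO(3)`. The projection `P → X` is the composite of `ξ` and `SO(X) → X`. -/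
structure SpinStructure (Γ : Subgroup SL(2, ℝ)) (r : ℝ) where
  P : Type
  [top : TopologicalSpace P]
  act : P → Spin3 → P
  act_one : ∀ p, act p 1 = p
  act_mul : ∀ p q q', act p (q * q') = act (act p q) q'
  ξ : P → FrameX Γ r
  continuous_ξ : Continuous ξ
  equivariant : ∀ p q, ξ (act p q) = (ξ p).rotate (spinToSO q)
  locally_trivial : ∀ x : X Γ, ∃ U : Set (X Γ), IsOpen U ∧ x ∈ U ∧
    ∃ φ : {p : P // (ξ p).base ∈ U} ≃ₜ U × Spin3,
      (∀ p, ((φ p).1 : X Γ) = (ξ p.1).base) ∧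
      ∀ p p' q, p'.1 = act p.1 q → (φ p').2 = (φ p).2 * q

attribute [instance] SpinStructure.top

/-- Two spin structures are equivalent if there is an isomorphism of principal `Spin(3)`-bundles
between them that commutes with the maps to `SO(X)`. -/
def SpinStructure.Equivalent {Γ : Subgroup SL(2, ℝ)} {r : ℝ} (S S' : SpinStructure Γ r) : Prop :=
  ∃ f : S.P ≃ₜ S'.P, (∀ p, S'.ξ (f p) = S.ξ p) ∧ ∀ p q, f (S.act p q) = S'.act (f p) q

instance SpinStructure.setoid (Γ : Subgroup SL(2, ℝ)) (r : ℝ) : Setoid (SpinStructure Γ r) where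
  r := SpinStructure.Equivalent
  iseqv :=
    { refl := fun S => ⟨Homeomorph.refl _, fun _ => rfl, fun _ _ => rfl⟩
      symm := by
        rintro S S' ⟨f, h1, h2⟩
        refine ⟨f.symm, fun p => ?_, fun p q => ?_⟩
        · rw [← h1, f.apply_symm_apply]
        · rw [f.symm_apply_eq, h2, f.apply_symm_apply]
      trans := by
        rintro S S' S'' ⟨f, h1, h2⟩ ⟨f', h1', h2'⟩
        refine ⟨f.trans f', fun p => ?_, fun p q => ?_⟩
        · simp [h1, h1']
        · simp [h2, h2'] }

/-- The set of spin structures on `X` (up to equivalence). -/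
def SpinStructures (Γ : Subgroup SL(2, ℝ)) (r : ℝ) : Type 1 :=
  Quotient (SpinStructure.setoid Γ r)

/-- The spin structure `S` is trivial along the loop `c` of `X` if the frame `(E, A, H)` along `c`
lifts to a closed loop in the bundle `P`. If `S` is `X̃ ×_ρ Spin(3)` for a representation
`ρ : π₁(X) → {±1}`, this says that `ρ(c) = 1`. -/
def SpinStructure.TrivialAlong {Γ : Subgroup SL(2, ℝ)} {r : ℝ} (S : SpinStructure Γ r)
    (c : unitInterval → X Γ) : Prop :=
  ∃ c' : C(unitInterval, S.P), c' 0 = c' 1 ∧ ∀ t, S.ξ (c' t) = leftInvariantFrame Γ r (c t)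

/-! ### Loops around the cusps -/

/-- The unipotent matrix `(1 t; 0 1)`. -/
def unip (t : ℝ) : SL(2, ℝ) := ⟨!![1, t; 0, 1], by simp [Matrix.det_fin_two]⟩

/-- `l > 0` is the width of `Γ` at the cusp `a • ∞`: for `N = {unip t}`, the group
`Γ ∩ a N a⁻¹` is infinite cyclic, generated by `a * unip l * a⁻¹`. -/
def IsWidth (Γ : Subgroup SL(2, ℝ)) (a : SL(2, ℝ)) (l : ℝ) : Prop :=
  0 < l ∧ ∀ t : ℝ, a * unip t * a⁻¹ ∈ Γ ↔ ∃ n : ℤ, t = n * l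

/-- The loop in `Γ\ℍ` around the cusp `a • ∞`: the image of the horocycle segment from `a • i` to
`(a * unip l * a⁻¹) • (a • i)`. -/
def cuspLoop (Γ : Subgroup SL(2, ℝ)) (a : SL(2, ℝ)) (l : ℝ) (t : unitInterval) : Base Γ :=
  Quotient.mk _ ((a * unip (t * l)) • UpperHalfPlane.I)

/-- `S` is nontrivial along the cusp `c`. Here `s : Γ\ℍ → X` is a section of the circle fibration;
it determines a splitting `π₁(X) = s_* π₁(Γ\ℍ) × ⟨k⟩`, where `k` is the class of the fibre, and
the element `h` of `π₁(X)` attached to the cusp is the image under `s` of the loop around it. -/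
def SpinStructure.NontrivialAlongCusp {Γ : Subgroup SL(2, ℝ)} {r : ℝ} (S : SpinStructure Γ r)
    (s : C(Base Γ, X Γ)) (c : OnePoint ℝ) : Prop :=
  ∀ (a : SL(2, ℝ)) (l : ℝ), SpecialLinearGroup.mapGL ℝ a • OnePoint.infty = c → IsWidth Γ a l →
    ¬ S.TrivialAlong (fun t => s (cuspLoop Γ a l t))

/-- `S` is totally nontrivial: it is nontrivial along every cusp. -/
def SpinStructure.TotallyNontrivial {Γ : Subgroup SL(2, ℝ)} {r : ℝ} (S : SpinStructure Γ r)
    (s : C(Base Γ, X Γ)) : Prop :=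
  ∀ c : OnePoint ℝ, IsCusp c (toGL Γ) → S.NontrivialAlongCusp s c

end SpinQuotient

end

noncomputable section

namespace SpinQuotient
open Filter Topology

/-! ### Circle-valued functions -/

/-! The left invariant fields trivialize the frame bundle of `X`, so a spin structure amounts to a
double covering of `X`: the set `Lifts` of points of `P` over the left invariant frame, from which
`P` is recovered as `Lifts ×_{±1} Spin(3)`. Every such covering consists of the square roots of a
continuous function `u : X → S¹` (`SpinStructure.exists_hasClass`), every `u` occurs
(`rootSpinStructure`), and `u` matters exactly modulo squares (`HasClass.exists_eq_mul_sq`,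
`HasClass.mul_sq`, `HasClass.equivalent`). Counting spin structures therefore means computing the
circle-valued functions on `X` modulo squares, a concrete form of `H¹(X; ℤ)` modulo two.

The circle bundle `X → Σ` is trivial. The automorphy factor `((cz + d) / |cz + d|)²` is trivial
along the cusps, so the circle bundle that it defines extends to the closed surface; there a circle
bundle has a section off any prescribed point, and this point may be taken to be a cusp. The result
is a continuous automorphic function of weight two (`exists_continuous_isEquivariant`), which gives
a fibre coordinate and `X ≃ Σ × S¹` (`exists_homeomorph`).

On the closed surface with `κ` punctures, a circle-valued function has a degree at each puncture,
defined up to sign. A function with a single singularity has degree zero there, because the changes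
of a logarithm along glued edges of the polygon cancel (`hasLogAt_polyCenter`,
`degAt_eq_zero_of_forall_ne`). Hence the `2g` functions winding along the edges, together with `κ -
1` dipoles joining one puncture `c₀` to the others, span all functions up to exponentials of real
functions, which are squares (`exists_surfaceFun_prod`); they are independent modulo squares
(`even_of_sq_eq_surfaceFun_prod`). The fibre coordinate adds one more generator, so there are `2^(2g
+ κ)` classes.

A spin structure is trivial along a cusp exactly when `u ∘ s` has a square root along the cusp loop,
that is, when its degree at the puncture is even (`exists_sqrt_cuspLoop_iff`). Each dipole has odd
degree at both of its ends, so if the degrees at the punctures other than `c₀` are odd, then the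
degree at `c₀` has the parity of `κ - 1`. All of them can be odd only for even `κ`, and the product
of all the basic functions realizes this (`forall_odd_degAt_iff`). -/

lemma exists_circle_lift {Y : Type*} [TopologicalSpace Y] [SimplyConnectedSpace Y]
    [LocallyPathConnectedSpace Y] (f : C(Y, Circle)) :
    ∃ v : C(Y, ℝ), ∀ y, Circle.exp (v y) = f y := by
  obtain ⟨y₀⟩ : Nonempty Y := inferInstance
  obtain ⟨v, ⟨-, hv⟩, -⟩ := Circle.isCoveringMap_exp.existsUnique_continuousMap_lifts f y₀
    (Complex.arg (f y₀)) (Circle.exp_arg _)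
  exact ⟨v, fun y => congrFun hv y⟩

lemma exists_int_of_circle_exp_eq_one {x : ℝ} (h : Circle.exp x = 1) :
    ∃ n : ℤ, x = 2 * Real.pi * n := by
  obtain ⟨n, hn⟩ := Circle.exp_eq_one.1 h
  exact ⟨n, by rw [hn]; ring⟩

lemma circle_exp_two_pi_int (n : ℤ) : Circle.exp (2 * Real.pi * n) = 1 :=
  Circle.exp_eq_one.2 ⟨n, by ring⟩

/-- A continuous function on a preconnected set with values in `2πℤ` is constant. -/
lemma exists_int_of_circle_exp_eq_one_on {Y : Type*} [TopologicalSpace Y] {s : Set Y}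
    (hs : IsPreconnected s) {v : Y → ℝ} (hv : ContinuousOn v s)
    (h : ∀ y ∈ s, Circle.exp (v y) = 1) : ∃ n : ℤ, ∀ y ∈ s, v y = 2 * Real.pi * n := by
  have hpi := Real.pi_pos
  choose! n hn using fun y hy => exists_int_of_circle_exp_eq_one (h y hy)
  rcases s.eq_empty_or_nonempty with rfl | ⟨y₀, hy₀⟩
  · exact ⟨0, by simp⟩
  refine ⟨n y₀, fun y hy => ?_⟩
  have hc : ContinuousOn n s := by
    -- The integer `n y` was picked pointwise. It is the rounding of `v y / 2π`, and rounding is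
    -- locally constant near an integer.
    have h1 : ContinuousOn (fun y => round (v y / (2 * Real.pi))) s := by
      intro y hy
      have h2 : ContinuousWithinAt (fun y => v y / (2 * Real.pi)) s y :=
        (hv y hy).div_const _
      have h3 : ∀ᶠ z in 𝓝[s] y, |v z / (2 * Real.pi) - n y| < 1 / 2 := by
        have := h2.tendsto
        rw [show v y / (2 * Real.pi) = n y by rw [hn y hy]; field_simp] at this
        have h4 := (Metric.tendsto_nhds.1 this) (1 / 2) (by norm_num)
        simpa [Real.dist_eq] using h4
      have h5 : ∀ᶠ z in 𝓝[s] y, round (v z / (2 * Real.pi)) = round (v y / (2 * Real.pi)) := by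
        filter_upwards [h3, self_mem_nhdsWithin] with z hz hzs
        rw [hn z hzs, hn y hy] at *
        rw [mul_div_cancel_left₀ _ (by positivity)] at hz ⊢
        rw [mul_div_cancel_left₀ _ (by positivity), round_intCast, round_intCast]
        have : |((n z - n y : ℤ) : ℝ)| < 1 := by push_cast; linarith
        have h6 : |n z - n y| < 1 := by exact_mod_cast this
        have := Int.abs_lt_one_iff.1 h6
        omega
      exact (tendsto_const_nhds.congr' (EventuallyEq.symm h5))
    refine h1.congr fun y hy => ?_
    simp only
    rw [hn y hy, mul_div_cancel_left₀ _ (by positivity), round_intCast]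
  have := hs.constant hc hy hy₀
  rw [hn y hy, this]

lemma continuousAt_circle_arg {z : Circle} (hz : (z : ℂ) ∈ Complex.slitPlane) :
    ContinuousAt (fun z : Circle => Complex.arg z) z :=
  (Complex.continuousAt_arg hz).comp continuous_subtype_val.continuousAt

/-- Near a point of continuity, a circle-valued function has a logarithm. -/
lemma eventually_circle_slitPlane (w : Circle) :
    ∀ᶠ z in 𝓝 w, ((z / w : Circle) : ℂ) ∈ Complex.slitPlane := by
  have : ContinuousAt (fun z : Circle => ((z / w : Circle) : ℂ)) w := by fun_prop
  refine this.eventually_mem (Complex.isOpen_slitPlane.mem_nhds ?_)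
  simp

lemma circle_exp_arg_div (z w : Circle) :
    z = w * Circle.exp (Complex.arg ((z / w : Circle) : ℂ)) := by
  rw [Circle.exp_arg]; simp

/-- The direction `z / |z|` of a complex number. -/
def dirn (z : ℂ) : Circle := Circle.exp (Complex.arg z)

lemma coe_dirn (z : ℂ) : (‖z‖ : ℂ) * (dirn z : ℂ) = z := by
  rw [dirn, Circle.coe_exp]; exact Complex.norm_mul_exp_arg_mul_I z

lemma coe_dirn_of_ne {z : ℂ} (hz : z ≠ 0) : (dirn z : ℂ) = z / ‖z‖ := by
  rw [eq_div_iff (by simpa using hz), mul_comm, coe_dirn]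

lemma dirn_mul {z w : ℂ} (hz : z ≠ 0) (hw : w ≠ 0) : dirn (z * w) = dirn z * dirn w := by
  apply Subtype.ext
  rw [Circle.coe_mul, coe_dirn_of_ne hz, coe_dirn_of_ne hw, coe_dirn_of_ne (mul_ne_zero hz hw)]
  push_cast [norm_mul]
  ring

lemma dirn_one : dirn 1 = 1 := by simp [dirn]

lemma dirn_real_mul {r : ℝ} (hr : 0 < r) (z : ℂ) : dirn (r * z) = dirn z := by
  rw [dirn, Complex.arg_real_mul _ hr, dirn]

lemma dirn_circle (z : Circle) : dirn z = z := Circle.exp_arg z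

lemma dirn_exp (z : ℂ) : dirn (Complex.exp z) = Circle.exp z.im := by
  apply Subtype.ext
  rw [coe_dirn_of_ne (Complex.exp_ne_zero z), Complex.norm_exp, Circle.coe_exp,
    Complex.ofReal_exp, ← Complex.exp_sub]
  congr 1
  apply Complex.ext <;> simp

lemma continuousAt_dirn {z : ℂ} (hz : z ≠ 0) : ContinuousAt dirn z := by
  have h : ContinuousAt (fun z : ℂ => z / ‖z‖) z :=
    continuousAt_id.div (by fun_prop) (by simpa using hz)
  refine Topology.IsInducing.subtypeVal.continuousAt_iff.2 (h.congr ?_)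
  filter_upwards [isOpen_ne.mem_nhds hz] with w hw
  exact (coe_dirn_of_ne hw).symm

/-- A continuous circle-valued function on the punctured plane is a power of `dirn` up to a
function with a logarithm. -/
lemma punctured_plane_log {f : ℂ → Circle} (hf : ∀ z ≠ 0, ContinuousAt f z) :
    ∃ (n : ℤ) (v : ℂ → ℝ), (∀ z ≠ 0, ContinuousAt v z) ∧
      ∀ z ≠ 0, f z = dirn z ^ n * Circle.exp (v z) := by
  have hc : Continuous fun w => f (Complex.exp w) := continuous_iff_continuousAt.2 fun w =>
    (hf _ (Complex.exp_ne_zero w)).comp Complex.continuous_exp.continuousAt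
  obtain ⟨v, hv⟩ := exists_circle_lift ⟨_, hc⟩
  simp only [ContinuousMap.coe_mk] at hv
  obtain ⟨n, hn⟩ := exists_int_of_circle_exp_eq_one_on (Y := ℂ) isPreconnected_univ
    (v := fun w => v (w + 2 * Real.pi * Complex.I) - v w) (by fun_prop) (fun w _ => by
      rw [Circle.exp_sub, hv, hv, Complex.exp_periodic w, div_self'])
  have hper : ∀ w, v (w + 2 * Real.pi * Complex.I) = v w + 2 * Real.pi * n := fun w => by
    linarith [hn w (Set.mem_univ _)]
  -- Translation by `2πi` adds `2πn` both to `v` and to `n * w.im`; their difference is periodic and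
  -- descends along `exp`.
  set V : ℂ → ℝ := fun w => v w - n * w.im with hV
  have hVc : Continuous V := by fun_prop
  have hVp : Function.Periodic V (2 * Real.pi * Complex.I) := fun w => by
    simp only [hV, hper]
    simp
    ring
  have hVe : ∀ {w w'}, Complex.exp w = Complex.exp w' → V w = V w' := fun {w w'} h => by
    obtain ⟨k, hk⟩ := Complex.exp_eq_exp_iff_exists_int.1 h
    rw [hk]
    exact hVp.int_mul k w'
  refine ⟨n, fun z => V (Complex.log z), fun z hz => ?_, fun z hz => ?_⟩
  -- `Complex.log` jumps on its cut, but `V` does not see multiples of `2πi`. Near `z` the branch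
  -- `log (z' / z) + log z` is continuous and gives the same values.
  · have h1 : ContinuousAt (fun z' => V (Complex.log (z' / z) + Complex.log z)) z := by
      refine hVc.continuousAt.comp ((ContinuousAt.clog (by fun_prop) ?_).add continuousAt_const)
      rw [div_self hz]
      exact Complex.one_mem_slitPlane
    refine h1.congr ?_
    filter_upwards [isOpen_ne.mem_nhds hz] with w hw
    apply hVe
    rw [Complex.exp_add, Complex.exp_log hz, Complex.exp_log hw,
      Complex.exp_log (div_ne_zero hw hz), div_mul_cancel₀ _ hz]
  · have h1 := hv (Complex.log z)
    rw [Complex.exp_log hz] at h1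
    simp only [hV]
    rw [← h1, dirn, ← Circle.exp_zsmul, ← Circle.exp_add, Complex.log_im]
    congr 1
    simp

/-- The same on a punctured disc. -/
lemma punctured_disc_log {f : ℂ → Circle} {r : ℝ} (hr : 0 < r)
    (hf : ContinuousOn f (Metric.closedBall 0 r \ {0})) :
    ∃ (n : ℤ) (v : ℂ → ℝ), ContinuousOn v (Metric.closedBall 0 r \ {0}) ∧
      ∀ z ∈ Metric.closedBall 0 r \ {0}, f z = dirn z ^ n * Circle.exp (v z) := by
  -- The radial retraction of the punctured plane onto the punctured disc.
  set ρ : ℂ → ℂ := fun z => ((min 1 (r / ‖z‖) : ℝ) : ℂ) * z with hρ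
  have hmem : ∀ z ≠ 0, ρ z ∈ Metric.closedBall 0 r \ {0} := fun z hz => by
    have h0 : 0 < ‖z‖ := norm_pos_iff.2 hz
    have h1 : 0 < min 1 (r / ‖z‖) := lt_min one_pos (by positivity)
    refine ⟨?_, ?_⟩
    · rw [mem_closedBall_zero_iff, hρ, norm_mul, Complex.norm_real, Real.norm_of_nonneg h1.le]
      calc _ ≤ (r / ‖z‖) * ‖z‖ := by gcongr; exact min_le_right _ _
        _ = r := by field_simp
    · simp only [hρ, Set.mem_singleton_iff, mul_eq_zero, hz, or_false]
      exact_mod_cast h1.ne'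
  have hid : ∀ z ∈ Metric.closedBall 0 r \ {0}, ρ z = z := fun z hz => by
    have h0 : 0 < ‖z‖ := norm_pos_iff.2 hz.2
    have h1 : 1 ≤ r / ‖z‖ := by
      rw [one_le_div h0]; simpa using hz.1
    simp [hρ, min_eq_left h1]
  have hρc : ∀ z ≠ 0, ContinuousAt ρ z := fun z hz => by
    have h0 : ‖z‖ ≠ 0 := norm_ne_zero_iff.2 hz
    have : ContinuousAt (fun z : ℂ => min 1 (r / ‖z‖)) z :=
      continuousAt_const.min (continuousAt_const.div continuous_norm.continuousAt h0)
    exact (Complex.continuous_ofReal.continuousAt.comp this).mul continuousAt_id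
  obtain ⟨n, v, hv, h⟩ := punctured_plane_log (f := f ∘ ρ) fun z hz => by
    have h1 : ContinuousWithinAt (f ∘ ρ) {0}ᶜ z :=
      (hf (ρ z) (hmem z hz)).comp (hρc z hz).continuousWithinAt fun w hw => hmem w hw
    exact h1.continuousAt (isOpen_compl_singleton.mem_nhds hz)
  exact ⟨n, v, fun z hz => (hv z hz.2).continuousWithinAt, fun z hz => by
    rw [← h z hz.2, Function.comp_apply, hid z hz]⟩

/-- Along one turn of the circle, `n * t` grows by `2πn` while `v` returns to its initial value; the
difference of the two is constant. -/
lemma eq_zero_of_dirn_zpow_eq_exp {n : ℤ} {v : ℂ → ℝ} {r : ℝ} (hr : 0 < r)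
    (hv : ContinuousOn v (Metric.sphere 0 r))
    (h : ∀ z ∈ Metric.sphere 0 r, dirn z ^ n = Circle.exp (v z)) : n = 0 := by
  set c : ℝ → ℂ := fun t => r * Complex.exp (t * Complex.I) with hc
  have hcs : ∀ t, c t ∈ Metric.sphere 0 r := fun t => by
    simp [hc, Complex.norm_exp_ofReal_mul_I, abs_of_pos hr]
  have hcd : ∀ t, dirn (c t) = Circle.exp t := fun t => by
    rw [hc, dirn_real_mul hr, dirn_exp]
    simp
  have hcc : Continuous c := by fun_prop
  obtain ⟨k, hk⟩ := exists_int_of_circle_exp_eq_one_on (Y := ℝ) isPreconnected_univ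
    (v := fun t => n * t - v (c t))
    (((continuous_const.mul continuous_id).sub
      (hv.comp_continuous hcc hcs)).continuousOn) (fun t _ => by
        rw [Circle.exp_sub, ← h _ (hcs t), hcd, ← Circle.exp_zsmul, zsmul_eq_mul, div_self'])
  have h1 := hk 0 trivial
  have h2 := hk (2 * Real.pi) trivial
  have h3 : c (2 * Real.pi) = c 0 := by simp [hc, Complex.exp_two_pi_mul_I]
  rw [h3] at h2
  have h4 : (n : ℝ) * (2 * Real.pi) = 0 := by rw [mul_zero] at h1; linarith
  simpa [Real.pi_ne_zero] using h4

end SpinQuotient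

namespace SpinQuotient
open Filter Topology

/-! ### Twists: circle bundles given by local frames -/

/-- A twist on `S` describes a principal circle bundle by means of local frames: `τ y` is the
quotient of a local frame near `y` by a fixed, not necessarily continuous, global frame. -/
def IsTwist {S : Type*} [TopologicalSpace S] (τ : S → S → Circle) : Prop :=
  ∀ y, ∀ᶠ z in 𝓝 y, ContinuousAt (fun x => τ z x / τ y x) z

/-- `h` defines a continuous section over `A` of the circle bundle defined by a twist. -/
def IsSectionOn {S : Type*} [TopologicalSpace S] (τ : S → S → Circle) (h : S → Circle)
    (A : Set S) : Prop :=
  ∀ y ∈ A, ContinuousWithinAt (fun x => h x / τ y x) A y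

/-- `h` defines a section which is continuous at `y`. -/
def IsSectionAt {S : Type*} [TopologicalSpace S] (τ : S → S → Circle) (h : S → Circle)
    (y : S) : Prop :=
  ContinuousAt (fun x => h x / τ y x) y

section Twist

variable {S T : Type*} [TopologicalSpace S] [TopologicalSpace T] {τ : S → S → Circle}

lemma IsTwist.comp (hτ : IsTwist τ) {f : T → S} (hf : Continuous f) :
    IsTwist fun a b => τ (f a) (f b) := fun y =>
  (hf.continuousAt.eventually (hτ (f y))).mono fun z hz =>
    ContinuousAt.comp (g := fun x => τ (f z) x / τ (f y) x) hz hf.continuousAt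

lemma IsTwist.eventually_section (hτ : IsTwist τ) (y : S) :
    ∀ᶠ z in 𝓝 y, IsSectionAt τ (τ y) z := by
  filter_upwards [hτ y] with z hz
  refine hz.inv.congr (Eventually.of_forall fun x => ?_)
  simp

lemma IsSectionOn.mono {h : S → Circle} {A B : Set S} (hh : IsSectionOn τ h B) (hAB : A ⊆ B) :
    IsSectionOn τ h A := fun y hy => (hh y (hAB hy)).mono hAB

/-- Two sections over closed sets can be glued if the common part is a retract of the second. -/
lemma IsSectionOn.glue {A B : Set S} (hA : IsClosed A) (hB : IsClosed B) {h₁ h₂ : S → Circle}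
    (H₁ : IsSectionOn τ h₁ A) (H₂ : IsSectionOn τ h₂ B) {π : S → S} (hπ : ContinuousOn π B)
    (hπm : Set.MapsTo π B (A ∩ B)) (hπi : ∀ x ∈ A ∩ B, π x = x) :
    ∃ h, IsSectionOn τ h (A ∪ B) := by
  classical
  set ρ : S → Circle := fun x => h₁ x / h₂ x
  have hρ : ContinuousOn ρ (A ∩ B) := fun y hy => by
    have h1 := (H₁ y hy.1).mono (Set.inter_subset_left (t := B))
    have h2 := (H₂ y hy.2).mono (Set.inter_subset_right (s := A))
    refine (h1.div' h2).congr (fun x _ => ?_) ?_ <;> simp [ρ]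
  -- On `B`, the second section is corrected by the ratio of the two sections on `A ∩ B`, extended
  -- to `B` through the retraction.
  set h : S → Circle := fun x => if x ∈ A then h₁ x else h₂ x * ρ (π x) with hh
  have hhA : ∀ x ∈ A, h x = h₁ x := fun x hx => by simp [hh, hx]
  have hhB : ∀ x ∈ B, h x = h₂ x * ρ (π x) := fun x hx => by
    by_cases hxA : x ∈ A
    · rw [hhA x hxA, hπi x ⟨hxA, hx⟩]; simp [ρ]
    · simp [hh, hxA]
  refine ⟨h, fun y _ => ContinuousWithinAt.union ?_ ?_⟩
  · by_cases hy : y ∈ A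
    · exact (H₁ y hy).congr (fun x hx => by rw [hhA x hx]) (by rw [hhA y hy])
    · exact continuousWithinAt_of_notMem_closure (by rwa [hA.closure_eq])
  · by_cases hy : y ∈ B
    · have h3 : ContinuousWithinAt (fun x => ρ (π x)) B y :=
        (hρ (π y) (hπm hy)).comp (hπ y hy) hπm
      refine ((H₂ y hy).mul h3).congr (fun x hx => ?_) ?_
      · rw [hhB x hx, mul_div_right_comm]; rfl
      · rw [hhB y hy, mul_div_right_comm]; rfl
    · exact continuousWithinAt_of_notMem_closure (by rwa [hB.closure_eq])

/-- Compactness subdivides `[a, b]` into finitely many pieces, each contained in one of the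
intervals provided by `hloc`, and `hglue` assembles the pieces. It is applied to each side of a
rectangle in turn. -/
lemma interval_induction {Q : ℝ → ℝ → Prop} {a b : ℝ} (hab : a ≤ b)
    (hmono : ∀ {s t s' t'}, s ≤ s' → t' ≤ t → Q s t → Q s' t')
    (hglue : ∀ {s t u}, s ≤ t → t ≤ u → Q s t → Q t u → Q s u)
    (hloc : ∀ t, ∃ ε > 0, Q (t - ε) (t + ε)) : Q a b := by
  choose ε hε hQ using hloc
  obtain ⟨t, ht0, htm, ⟨m, hm⟩, ht⟩ := exists_monotone_Icc_subset_open_cover_Icc hab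
    (c := fun s : ℝ => {x : Set.Icc a b | (x : ℝ) ∈ Set.Ioo (s - ε s) (s + ε s)})
    (fun s => isOpen_Ioo.preimage continuous_subtype_val)
    (fun x _ => Set.mem_iUnion.2 ⟨x, by constructor <;> linarith [hε x]⟩)
  have key : ∀ n, Q a (t n) := by
    intro n
    induction n with
    | zero =>
      rw [ht0]
      exact hmono (by linarith [hε a]) (by linarith [hε a]) (hQ a)
    | succ n ih =>
      have h1 : (t n : ℝ) ≤ t (n + 1) := htm (Nat.le_succ n)
      refine hglue (t n).2.1 h1 ih ?_
      obtain ⟨s, hs⟩ := ht n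
      have h2 := hs (Set.left_mem_Icc.2 (htm (Nat.le_succ n)))
      have h3 := hs (Set.right_mem_Icc.2 (htm (Nat.le_succ n)))
      exact hmono h2.1.le h3.2.le (hQ s)
  simpa [hm m le_rfl] using key m

/-- A circle bundle over a rectangle is trivial. -/
lemma IsTwist.exists_section_rectangle {τ : ℝ × ℝ → ℝ × ℝ → Circle} (hτ : IsTwist τ)
    {a b c d : ℝ} (hab : a ≤ b) (hcd : c ≤ d) :
    ∃ h, IsSectionOn τ h (Set.Icc a b ×ˢ Set.Icc c d) := by
  have hclosed : ∀ {s t u v : ℝ}, IsClosed (Set.Icc s t ×ˢ Set.Icc u v) :=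
    fun {s t u v} => isClosed_Icc.prod isClosed_Icc
  refine interval_induction (Q := fun c d => ∃ h, IsSectionOn τ h (Set.Icc a b ×ˢ Set.Icc c d))
    hcd ?_ ?_ ?_
  · rintro s t s' t' hs ht ⟨h, hh⟩
    exact ⟨h, hh.mono (Set.prod_mono le_rfl (Set.Icc_subset_Icc hs ht))⟩
  · rintro s t u hst htu ⟨h₁, H₁⟩ ⟨h₂, H₂⟩
    obtain ⟨h, hh⟩ := H₁.glue hclosed hclosed H₂ (π := fun x => (x.1, t)) (by fun_prop)
      (fun x hx => ⟨⟨hx.1, hst, le_rfl⟩, hx.1, le_rfl, htu⟩)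
      (fun x hx => Prod.ext rfl (le_antisymm hx.2.2.1 hx.1.2.2))
    refine ⟨h, hh.mono ?_⟩
    rw [← Set.prod_union, Set.Icc_union_Icc_eq_Icc hst htu]
  intro y
  -- A section over a thin horizontal strip around height `y` is built from left to right. The
  -- half-height `ε` is part of the property, since it shrinks at each gluing.
  refine interval_induction (Q := fun a b => ∃ ε > 0, ∃ h,
    IsSectionOn τ h (Set.Icc a b ×ˢ Set.Icc (y - ε) (y + ε))) hab ?_ ?_ ?_
  · rintro s t s' t' hs ht ⟨ε, hε, h, hh⟩
    exact ⟨ε, hε, h, hh.mono (Set.prod_mono (Set.Icc_subset_Icc hs ht) le_rfl)⟩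
  · rintro s t u hst htu ⟨ε₁, hε₁, h₁, H₁⟩ ⟨ε₂, hε₂, h₂, H₂⟩
    have hs : ∀ ε', min ε₁ ε₂ ≤ ε' →
        Set.Icc (y - min ε₁ ε₂) (y + min ε₁ ε₂) ⊆ Set.Icc (y - ε') (y + ε') :=
      fun ε' h => Set.Icc_subset_Icc (by linarith) (by linarith)
    replace H₁ := H₁.mono (Set.prod_mono le_rfl (hs _ (min_le_left _ _)))
    replace H₂ := H₂.mono (Set.prod_mono le_rfl (hs _ (min_le_right _ _)))
    obtain ⟨h, hh⟩ := H₁.glue hclosed hclosed H₂ (π := fun x => (t, x.2)) (by fun_prop)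
      (fun x hx => ⟨⟨⟨hst, le_rfl⟩, hx.2⟩, ⟨le_rfl, htu⟩, hx.2⟩)
      (fun x hx => Prod.ext (le_antisymm hx.2.1.1 hx.1.1.2) rfl)
    refine ⟨_, lt_min hε₁ hε₂, h, hh.mono ?_⟩
    rw [← Set.union_prod, Set.Icc_union_Icc_eq_Icc hst htu]
  intro x
  obtain ⟨ε, hε, h⟩ := Metric.eventually_nhds_iff_ball.1 (hτ.eventually_section (x, y))
  refine ⟨ε / 2, by positivity, ε / 2, by positivity, τ (x, y), fun z hz => ?_⟩
  refine ContinuousAt.continuousWithinAt (h z ?_)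
  rw [Metric.mem_ball, Prod.dist_eq, max_lt_iff, Real.dist_eq, Real.dist_eq, abs_lt, abs_lt]
  obtain ⟨⟨h1, h2⟩, h3, h4⟩ := hz
  constructor <;> constructor <;> linarith

/-- A circle bundle over the closed disc is trivial. -/
lemma IsTwist.exists_section_disc {τ : Metric.closedBall (0 : ℂ) 1 → Metric.closedBall (0 : ℂ) 1 →
    Circle} (hτ : IsTwist τ) : ∃ h, ∀ y, IsSectionAt τ h y := by
  -- The radial retraction of the plane onto the disc: the twist is pulled back to the square `[-1,
  -- 1]²`, and the section found there is restricted to the disc.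
  set r : ℝ × ℝ → Metric.closedBall (0 : ℂ) 1 := fun p =>
    ⟨(((max 1 ‖(⟨p.1, p.2⟩ : ℂ)‖)⁻¹ : ℝ) : ℂ) * ⟨p.1, p.2⟩, by
      have h1 : 0 < max 1 ‖(⟨p.1, p.2⟩ : ℂ)‖ := lt_max_of_lt_left one_pos
      rw [mem_closedBall_zero_iff, norm_mul, Complex.norm_real, Real.norm_of_nonneg (by positivity),
        inv_mul_le_one₀ h1]
      exact le_max_right _ _⟩ with hr
  have hrc : Continuous r := by
    have h0 : Continuous fun p : ℝ × ℝ => (⟨p.1, p.2⟩ : ℂ) :=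
      Complex.equivRealProdCLM.symm.continuous
    refine Continuous.subtype_mk ?_ _
    refine (Complex.continuous_ofReal.comp (Continuous.inv₀ (by fun_prop) fun p => ?_)).mul h0
    exact (lt_max_of_lt_left one_pos).ne'
  obtain ⟨h, hh⟩ := (hτ.comp hrc).exists_section_rectangle (a := -1) (b := 1) (c := -1) (d := 1)
    (by norm_num) (by norm_num)
  set i : Metric.closedBall (0 : ℂ) 1 → ℝ × ℝ := fun z => (z.1.re, z.1.im) with hi
  have hri : ∀ z, r (i z) = z := fun z => by
    have : ‖z.1‖ ≤ 1 := mem_closedBall_zero_iff.1 z.2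
    apply Subtype.ext
    simp [hr, hi, this]
  have him : ∀ z, i z ∈ Set.Icc (-1 : ℝ) 1 ×ˢ Set.Icc (-1 : ℝ) 1 := fun z => by
    have : ‖z.1‖ ≤ 1 := mem_closedBall_zero_iff.1 z.2
    exact ⟨abs_le.1 ((Complex.abs_re_le_norm _).trans this),
      abs_le.1 ((Complex.abs_im_le_norm _).trans this)⟩
  have hic : Continuous i := by fun_prop
  refine ⟨h ∘ i, fun z => ?_⟩
  have h1 := (hh (i z) (him z)).comp (f := i) (s := Set.univ) (x := z)
    hic.continuousAt.continuousWithinAt (fun x _ => him x)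
  rw [continuousWithinAt_univ] at h1
  simpa [IsSectionAt, Function.comp_def, hri] using h1

/-- Sections of a twist descend along quotient maps. -/
lemma IsTwist.isSectionAt_of_comp (hτ : IsTwist τ) {π : T → S} (hπ : IsQuotientMap π)
    {h : S → Circle} {O : Set S} (hO : IsOpen O)
    (hh : ∀ x, π x ∈ O → IsSectionAt (fun a b => τ (π a) (π b)) (h ∘ π) x) {y : S} (hy : y ∈ O) :
    IsSectionAt τ h y := by
  obtain ⟨V, hV, hVo, hyV⟩ := eventually_nhds_iff.1 (hτ y)
  have hVO := hVo.inter hO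
  have h1 : ContinuousOn ((fun x => h x / τ y x) ∘ π) (π ⁻¹' (V ∩ O)) := fun x hx => by
    have h2 : ContinuousAt (fun b => τ (π x) (π b) / τ y (π b)) x :=
      ContinuousAt.comp (g := fun b => τ (π x) b / τ y b) (hV _ hx.1) hπ.continuous.continuousAt
    refine (((hh x hx.2).mul h2).congr (Eventually.of_forall fun b => ?_)).continuousWithinAt
    simp
  have h3 := (hπ.continuousOn_isOpen_iff hVO).2 h1
  exact h3.continuousAt (hVO.mem_nhds ⟨hyV, hy⟩)

end Twist

end SpinQuotient

namespace SpinQuotient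
open Filter Topology

/-! ### The degree of a circle-valued function at an isolated singularity -/

section Degree

variable {S : Type*} [TopologicalSpace S]

/-- `f` is continuous in a punctured neighbourhood of `p`. -/
def PuncCont (f : S → Circle) (p : S) : Prop := ∀ᶠ x in 𝓝[≠] p, ContinuousAt f x

/-- `f` has a continuous logarithm in a punctured neighbourhood of `p`. -/
def HasLogAt (f : S → Circle) (p : S) : Prop :=
  ∃ y : S → ℝ, ∀ᶠ x in 𝓝[≠] p, ContinuousAt y x ∧ f x = Circle.exp (y x)

lemma PuncCont.mul {f g : S → Circle} {p : S} (hf : PuncCont f p) (hg : PuncCont g p) :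
    PuncCont (f * g) p := by
  filter_upwards [hf, hg] with x h1 h2 using h1.mul h2

lemma PuncCont.zpow {f : S → Circle} {p : S} (hf : PuncCont f p) (n : ℤ) :
    PuncCont (f ^ n) p := by
  filter_upwards [hf] with x h1 using h1.zpow n

lemma HasLogAt.mul {f g : S → Circle} {p : S} (hf : HasLogAt f p) (hg : HasLogAt g p) :
    HasLogAt (f * g) p := by
  obtain ⟨y, hy⟩ := hf
  obtain ⟨z, hz⟩ := hg
  refine ⟨y + z, ?_⟩
  filter_upwards [hy, hz] with x h1 h2
  exact ⟨h1.1.add h2.1, by simp [h1.2, h2.2, Circle.exp_add]⟩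

lemma HasLogAt.zpow {f : S → Circle} {p : S} (hf : HasLogAt f p) (n : ℤ) :
    HasLogAt (f ^ n) p := by
  obtain ⟨y, hy⟩ := hf
  refine ⟨fun x => n * y x, ?_⟩
  filter_upwards [hy] with x h1
  exact ⟨continuousAt_const.mul h1.1, by rw [Pi.pow_apply, h1.2, ← Circle.exp_zsmul, zsmul_eq_mul]⟩

lemma HasLogAt.congr {f g : S → Circle} {p : S} (hf : HasLogAt f p) (h : f =ᶠ[𝓝[≠] p] g) :
    HasLogAt g p := by
  obtain ⟨y, hy⟩ := hf
  refine ⟨y, ?_⟩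
  filter_upwards [hy, h] with x h1 h2
  exact ⟨h1.1, by rw [← h2, h1.2]⟩

lemma eventually_nhdsNE_nhds [T1Space S] {p : S} {P : S → Prop} (h : ∀ᶠ x in 𝓝[≠] p, P x) :
    ∀ᶠ x in 𝓝[≠] p, ∀ᶠ z in 𝓝 x, P z := by
  filter_upwards [eventually_eventually_nhdsWithin.2 h, self_mem_nhdsWithin] with x hx hxp
  rwa [isOpen_compl_singleton.nhdsWithin_eq hxp] at hx

lemma HasLogAt.puncCont [T1Space S] {f : S → Circle} {p : S} (hf : HasLogAt f p) :
    PuncCont f p := by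
  obtain ⟨y, hy⟩ := hf
  filter_upwards [eventually_nhdsNE_nhds hy] with x hx
  exact (Circle.exp.continuous.continuousAt.comp hx.self_of_nhds.1).congr
    (hx.mono fun z hz => hz.2.symm)

lemma PuncCont.congr [T1Space S] {f g : S → Circle} {p : S} (hf : PuncCont f p)
    (h : f =ᶠ[𝓝[≠] p] g) : PuncCont g p := by
  filter_upwards [hf, eventually_nhdsNE_nhds h] with x h1 h2
  exact h1.congr h2

lemma hasLogAt_exp {y : S → ℝ} {p : S} (hy : ∀ᶠ x in 𝓝[≠] p, ContinuousAt y x) :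
    HasLogAt (fun x => Circle.exp (y x)) p :=
  ⟨y, hy.mono fun _ h => ⟨h, rfl⟩⟩

lemma hasLogAt_of_continuousAt {f : S → Circle} {p : S} (hf : ∀ᶠ x in 𝓝 p, ContinuousAt f x) :
    HasLogAt f p := by
  refine ⟨fun x => Complex.arg (f p) + Complex.arg ((f x / f p : Circle) : ℂ), ?_⟩
  refine Filter.Eventually.filter_mono nhdsWithin_le_nhds ?_
  filter_upwards [hf, hf.self_of_nhds.eventually (eventually_circle_slitPlane (f p))] with x h1 h2
  refine ⟨continuousAt_const.add ((continuousAt_circle_arg h2).comp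
    (f := fun x => f x / f p) (h1.div' continuousAt_const)), ?_⟩
  rw [Circle.exp_add, Circle.exp_arg, ← circle_exp_arg_div]

/-- `k` generates the group of circle-valued functions on punctured neighbourhoods of `p`, modulo
functions with a logarithm. -/
def IsGenAt (k : S → Circle) (p : S) : Prop :=
  PuncCont k p ∧ (∀ f, PuncCont f p → ∃ n : ℤ, HasLogAt (f * k ^ (-n)) p) ∧
    ∀ n : ℤ, HasLogAt (k ^ n) p → n = 0

/-- Read in the chart, generation is `punctured_disc_log` and the absence of relations is
`eq_zero_of_dirn_zpow_eq_exp`. -/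
lemma isGenAt_dirn_of_chart (e : OpenPartialHomeomorph S ℂ) {p : S} (hp : p ∈ e.source)
    (h0 : e p = 0) : IsGenAt (fun x => dirn (e x)) p := by
  have hsrc : e.source ∈ 𝓝 p := e.open_source.mem_nhds hp
  have hsymm : e.symm 0 = p := by rw [← h0, e.left_inv hp]
  have ht0 : (0 : ℂ) ∈ e.target := h0 ▸ e.map_source hp
  have hne : ∀ x ∈ e.source, x ≠ p → e x ≠ 0 := fun x hx hxp h =>
    hxp (e.injOn hx hp (by rw [h, h0]))
  -- a punctured neighbourhood of `p` contains a punctured closed disc of the chart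
  have hball : ∀ P : S → Prop, (∀ᶠ x in 𝓝[≠] p, P x) → ∃ r > 0,
      Metric.closedBall 0 r ⊆ e.target ∧ ∀ z ∈ Metric.closedBall 0 r \ {0}, P (e.symm z) := by
    intro P hP
    rw [eventually_nhdsWithin_iff] at hP
    have h1 : ∀ᶠ z in 𝓝 (0 : ℂ), e.symm z ≠ p → P (e.symm z) := by
      have := e.continuousAt_symm ht0
      rw [ContinuousAt, hsymm] at this
      exact this.eventually hP
    have h2 : ∀ᶠ z in 𝓝 (0 : ℂ), z ∈ e.target := e.open_target.mem_nhds ht0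
    obtain ⟨r, hr, h⟩ := Metric.nhds_basis_closedBall.eventually_iff.1 (h1.and h2)
    refine ⟨r, hr, fun z hz => (h hz).2, fun z hz => (h hz.1).1 fun h3 => hz.2 ?_⟩
    rw [Set.mem_singleton_iff, ← e.right_inv (h hz.1).2, h3, h0]
  refine ⟨?_, fun f hf => ?_, fun n hn => ?_⟩
  · filter_upwards [nhdsWithin_le_nhds hsrc, self_mem_nhdsWithin] with x hx hxp
    exact (continuousAt_dirn (hne x hx hxp)).comp (e.continuousAt hx)
  · obtain ⟨r, hr, hrt, hrf⟩ := hball _ hf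
    obtain ⟨n, v, hv, h⟩ := punctured_disc_log (f := f ∘ e.symm) hr fun z hz =>
      ((hrf z hz).comp (e.continuousAt_symm (hrt hz.1))).continuousWithinAt
    refine ⟨n, fun x => v (e x), ?_⟩
    have h1 : ∀ᶠ x in 𝓝 p, e x ∈ Metric.ball (0 : ℂ) r :=
      (e.continuousAt hp).eventually_mem (Metric.isOpen_ball.mem_nhds (by simpa [h0]))
    filter_upwards [nhdsWithin_le_nhds hsrc, nhdsWithin_le_nhds h1, self_mem_nhdsWithin]
      with x hx hxr hxp
    have h2 : e x ∈ Metric.ball (0 : ℂ) r \ {0} := ⟨hxr, hne x hx hxp⟩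
    have h3 : Metric.ball (0 : ℂ) r \ {0} ⊆ Metric.closedBall 0 r \ {0} :=
      Set.sdiff_subset_sdiff_left Metric.ball_subset_closedBall
    refine ⟨((hv.mono h3).continuousAt ((Metric.isOpen_ball.sdiff isClosed_singleton).mem_nhds
      h2)).comp (e.continuousAt hx), ?_⟩
    have := h (e x) (h3 h2)
    rw [Function.comp_apply, e.left_inv hx] at this
    simp [this, mul_comm]
  · obtain ⟨y, hy⟩ := hn
    obtain ⟨r, hr, hrt, hrf⟩ := hball _ hy
    have hs : Metric.sphere (0 : ℂ) r ⊆ Metric.closedBall 0 r \ {0} := fun z hz =>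
      ⟨Metric.sphere_subset_closedBall hz, fun h => by
        rw [Set.mem_singleton_iff.1 h] at hz; simp at hz; exact hr.ne hz⟩
    refine eq_zero_of_dirn_zpow_eq_exp (v := y ∘ e.symm) hr (fun z hz => ?_) fun z hz => ?_
    · exact ((hrf z (hs hz)).1.comp (e.continuousAt_symm (hrt (hs hz).1))).continuousWithinAt
    · have := (hrf z (hs hz)).2
      rw [Pi.pow_apply, e.right_inv (hrt (hs hz).1)] at this
      exact this

/-- Every point has a neighbourhood homeomorphic to an open subset of the plane. -/
def LocallyPlanar (S : Type*) [TopologicalSpace S] : Prop :=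
  ∀ p : S, ∃ e : OpenPartialHomeomorph S ℂ, p ∈ e.source ∧ e p = 0

open Classical in
/-- A chosen generator at `p`. -/
def genAt (p : S) : S → Circle := if h : ∃ k, IsGenAt k p then h.choose else 1

open Classical in
/-- The degree of `f` at `p`, with respect to a chosen generator. -/
def degAt (f : S → Circle) (p : S) : ℤ :=
  if h : ∃ n : ℤ, HasLogAt (f * genAt p ^ (-n)) p then h.choose else 0


lemma isGenAt_genAt (hS : LocallyPlanar S) (p : S) : IsGenAt (genAt p) p := by
  have h : ∃ k, IsGenAt k p := by
    obtain ⟨e, hp, h0⟩ := hS p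
    exact ⟨_, isGenAt_dirn_of_chart e hp h0⟩
  rw [genAt, dif_pos h]
  exact h.choose_spec

lemma hasLogAt_degAt (hS : LocallyPlanar S) {f : S → Circle} {p : S} (hf : PuncCont f p) :
    HasLogAt (f * genAt p ^ (-degAt f p)) p := by
  have h := (isGenAt_genAt hS p).2.1 f hf
  rw [degAt, dif_pos h]
  exact h.choose_spec

lemma degAt_eq (hS : LocallyPlanar S) {f : S → Circle} {p : S} {n : ℤ} (hf : PuncCont f p)
    (h : HasLogAt (f * genAt p ^ (-n)) p) : degAt f p = n := by
  have h1 := (h.zpow (-1)).mul (hasLogAt_degAt hS hf)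
  have h2 : (f * genAt p ^ (-n)) ^ (-1 : ℤ) * (f * genAt p ^ (-degAt f p)) =
      genAt p ^ (n - degAt f p) := by
    rw [mul_zpow, ← _root_.zpow_mul, mul_mul_mul_comm, ← _root_.zpow_add]
    simp [sub_eq_add_neg]
  rw [h2] at h1
  have := (isGenAt_genAt hS p).2.2 _ h1
  omega

lemma degAt_mul (hS : LocallyPlanar S) {f g : S → Circle} {p : S} (hf : PuncCont f p)
    (hg : PuncCont g p) :
    degAt (f * g) p = degAt f p + degAt g p := by
  refine degAt_eq hS (hf.mul hg) ?_
  have := (hasLogAt_degAt hS hf).mul (hasLogAt_degAt hS hg)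
  rwa [mul_mul_mul_comm, ← _root_.zpow_add, ← neg_add] at this

lemma degAt_zpow (hS : LocallyPlanar S) {f : S → Circle} {p : S} (hf : PuncCont f p) (n : ℤ) :
    degAt (f ^ n) p = n * degAt f p := by
  refine degAt_eq hS (hf.zpow n) ?_
  have := (hasLogAt_degAt hS hf).zpow n
  rwa [mul_zpow, ← _root_.zpow_mul, neg_mul, mul_comm (degAt f p)] at this

lemma degAt_eq_zero_iff (hS : LocallyPlanar S) {f : S → Circle} {p : S} (hf : PuncCont f p) :
    degAt f p = 0 ↔ HasLogAt f p := by
  constructor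
  · intro h
    simpa [h] using hasLogAt_degAt hS hf
  · intro h
    exact degAt_eq hS hf (by simpa using h)

lemma degAt_congr [T1Space S] (hS : LocallyPlanar S)
    {f g : S → Circle} {p : S} (hf : PuncCont f p)
    (h : f =ᶠ[𝓝[≠] p] g) : degAt g p = degAt f p := by
  refine degAt_eq hS (hf.congr h) ((hasLogAt_degAt hS hf).congr ?_)
  filter_upwards [h] with x hx
  simp [hx]

/-- Two generators of an infinite cyclic group agree up to sign. The generators `genAt` are chosen
without orienting the surface, so the sign of a degree has no meaning; its parity and its vanishing
do. -/
lemma IsGenAt.abs_degAt (hS : LocallyPlanar S) {k : S → Circle} {p : S} (hk : IsGenAt k p) :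
    |degAt k p| = 1 := by
  obtain ⟨n, hn⟩ := hk.2.1 _ (isGenAt_genAt hS p).1
  have h1 := (degAt_eq_zero_iff hS ((isGenAt_genAt hS p).1.mul (hk.1.zpow (-n)))).2 hn
  rw [degAt_mul hS (isGenAt_genAt hS p).1 (hk.1.zpow _), degAt_zpow hS hk.1] at h1
  have h2 : degAt (genAt p) p = 1 := degAt_eq hS (isGenAt_genAt hS p).1
    ⟨0, Eventually.of_forall fun x => ⟨continuousAt_const, by simp⟩⟩
  rw [h2] at h1
  have h3 : n * degAt k p = 1 := by linarith
  exact Int.isUnit_iff_abs_eq.1 (IsUnit.of_mul_eq_one _ (by rw [mul_comm]; exact h3))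

lemma puncCont_of_finite [T1Space S] {f : S → Circle} {C : Set S} (hC : C.Finite)
    (hf : ∀ x ∉ C, ContinuousAt f x) (p : S) : PuncCont f p := by
  have h : ∀ᶠ x in 𝓝 p, x ∉ C \ {p} := (hC.sdiff).isClosed.isOpen_compl.mem_nhds (by simp)
  filter_upwards [nhdsWithin_le_nhds h, self_mem_nhdsWithin] with x hx hxp
  exact hf x fun hxC => hx ⟨hxC, hxp⟩

lemma degAt_eq_zero_of_notMem [T1Space S] (hS : LocallyPlanar S)
    {f : S → Circle} {C : Set S} (hC : C.Finite)
    (hf : ∀ x ∉ C, ContinuousAt f x) {p : S} (hp : p ∉ C) : degAt f p = 0 :=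
  (degAt_eq_zero_iff hS (puncCont_of_finite hC hf p)).2 <| hasLogAt_of_continuousAt <| by
    filter_upwards [hC.isClosed.isOpen_compl.mem_nhds hp] with x hx using hf x hx

end Degree

section Removal

variable {S : Type*} [TopologicalSpace S] [T4Space S]

/-- A section with a logarithm near an isolated singularity can be modified so that it extends. -/
lemma exists_section_extension {τ : S → S → Circle} {h : S → Circle} {p : S}
    (hh : HasLogAt (fun x => h x / τ p x) p) :
    ∃ y : S → ℝ, (∀ x ≠ p, ContinuousAt y x) ∧
      ∀ h' : S → Circle, (∀ x ≠ p, h' x = h x * Circle.exp (y x)) → h' p = τ p p →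
        IsSectionAt τ h' p := by
  obtain ⟨y, hy⟩ := hh
  rw [eventually_nhdsWithin_iff] at hy
  obtain ⟨U, hU, hUo, hpU⟩ := eventually_nhds_iff.1 hy
  obtain ⟨K, ⟨hK, hKc⟩, hKU⟩ := (closed_nhds_basis p).mem_iff.1 (hUo.mem_nhds hpU)
  obtain ⟨L, ⟨hL, hLc⟩, hLK⟩ := (closed_nhds_basis p).mem_iff.1 (interior_mem_nhds.2 hK)
  -- With a cutoff `χ` equal to one near `p` and zero off `K`, multiplying `h` by `exp (-χ y)` turns
  -- it into the frame `τ p` near `p`, and the exponent stays continuous away from `p` although `y`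
  -- is controlled on `K` only.
  obtain ⟨χ, hχ0, hχ1, -⟩ := exists_continuous_zero_one_of_isClosed
    (isOpen_interior (s := K)).isClosed_compl hLc
    (Set.disjoint_left.2 fun x hx hxL => hx (hLK hxL))
  refine ⟨fun x => -(χ x * y x), fun x hx => ?_, fun h' h1 h2 => ?_⟩
  · by_cases hxK : x ∈ K
    · exact (χ.continuous.continuousAt.mul (hU x (hKU hxK) hx).1).neg
    · refine continuousAt_const (y := (0 : ℝ)) |>.congr ?_
      filter_upwards [hKc.isOpen_compl.mem_nhds hxK] with z hz
      rw [hχ0 fun h => hz (interior_subset h)]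
      simp
  · refine continuousAt_const (y := (1 : Circle)) |>.congr ?_
    filter_upwards [hL] with x hx
    rcases eq_or_ne x p with rfl | hxp
    · rw [h2, div_self']
    · have h3 : h x / τ p x = _ := (hU x (hKU (interior_subset (hLK hx))) hxp).2
      rw [h1 x hxp]
      simp only [hχ1 hx]
      rw [ mul_div_right_comm, h3, ← Circle.exp_add]
      simp

/-- The case of a function. -/
lemma exists_function_extension {f : S → Circle} {p : S} (hf : HasLogAt f p) :
    ∃ (f' : S → Circle) (y : S → ℝ), (∀ x ≠ p, ContinuousAt y x) ∧
      (∀ x ≠ p, f' x = f x * Circle.exp (y x)) ∧ ContinuousAt f' p := by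
  classical
  obtain ⟨y, hy, h⟩ := exists_section_extension (τ := fun _ _ => 1) (h := f) (p := p)
    (by simpa using hf)
  refine ⟨fun x => if x = p then 1 else f x * Circle.exp (y x), y, hy,
    fun x hx => by simp [hx], ?_⟩
  have := h (fun x => if x = p then 1 else f x * Circle.exp (y x)) (fun x hx => by simp [hx])
    (by simp)
  simpa [IsSectionAt] using this

end Removal

section Dipole

variable {S : Type*} [TopologicalSpace S]

/-- There is a function, continuous off `p` and `q`, with degree `±1` at both points. -/
def HasDipole (p q : S) : Prop :=
  ∃ u : S → Circle, (∀ x, x ≠ p → x ≠ q → ContinuousAt u x) ∧ |degAt u p| = 1 ∧ |degAt u q| = 1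

lemma puncCont_of_pair [T1Space S] {u : S → Circle} {p q : S}
    (hu : ∀ x, x ≠ p → x ≠ q → ContinuousAt u x) (r : S) : PuncCont u r :=
  puncCont_of_finite (C := {p, q}) (by simp) (fun x hx => hu x (by grind) (by grind)) r

/-- In a chart centred at `p`, with `w` the coordinate of `q`, the quotient of the directions of `z`
and `z - w` winds in opposite senses around `0` and `w`. Turning the translation by `w` off towards
the edge of a disc makes the quotient equal to one there, so that it extends by one to the whole
surface. -/
lemma eventually_hasDipole [T2Space S] (hS : LocallyPlanar S) (p : S) :
    ∀ᶠ q in 𝓝 p, p = q ∨ HasDipole p q := by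
  obtain ⟨e, hp, h0⟩ := hS p
  have ht0 : (0 : ℂ) ∈ e.target := h0 ▸ e.map_source hp
  obtain ⟨R, hR, hRt⟩ := Metric.nhds_basis_closedBall.mem_iff.1 (e.open_target.mem_nhds ht0)
  have h1 : ∀ᶠ x in 𝓝 p, e x ∈ Metric.ball (0 : ℂ) R :=
    (e.continuousAt hp).eventually_mem (Metric.isOpen_ball.mem_nhds (by simpa [h0]))
  filter_upwards [h1, e.open_source.mem_nhds hp] with q hq hqs
  by_cases hpq : p = q
  · exact .inl hpq
  refine .inr ?_
  set w := e q with hw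
  have hw0 : w ≠ 0 := fun h => hpq (e.injOn hp hqs (by rw [h0, ← hw, h]))
  have hwR : ‖w‖ < R := by simpa using hq
  -- A radius strictly between `‖w‖` and `R`: the cutoff `l` is one up to `ρ`, hence around `w`, and
  -- zero from `R` on.
  set ρ : ℝ := (‖w‖ + R) / 2 with hρ
  have hρR : ρ < R := by linarith
  have hwρ : ‖w‖ < ρ := by linarith
  set l : ℝ → ℝ := fun t => max 0 (min 1 ((R - t) / (R - ρ))) with hl
  have hl1 : ∀ t ≤ ρ, l t = 1 := fun t ht => by
    have : 1 ≤ (R - t) / (R - ρ) := by rw [one_le_div (by linarith)]; linarith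
    simp [hl, this]
  have hl0 : ∀ t, R ≤ t → l t = 0 := fun t ht => by
    have : (R - t) / (R - ρ) ≤ 0 := div_nonpos_of_nonpos_of_nonneg (by linarith) (by linarith)
    simp [hl, this]
  have hlc : Continuous l := by fun_prop
  have hl01 : ∀ t, 0 ≤ l t ∧ l t ≤ 1 := fun t =>
    ⟨le_max_left _ _, max_le zero_le_one (min_le_left _ _)⟩
  set G : ℂ → ℂ := fun z => z - l ‖z‖ * w with hG
  have hGc : Continuous G := by fun_prop
  -- A zero satisfies `z = l ‖z‖ * w`, so `‖z‖ ≤ ‖w‖ < ρ`; there `l` is one. The cutoff thus creates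
  -- no further zeros.
  have hG0 : ∀ z, G z = 0 → z = w := fun z hz => by
    have h2 : z = l ‖z‖ * w := sub_eq_zero.1 hz
    have h3 : ‖z‖ ≤ ‖w‖ := by
      rw [h2, norm_mul, Complex.norm_real, Real.norm_of_nonneg (hl01 _).1]
      exact mul_le_of_le_one_left (norm_nonneg _) (hl01 _).2
    rw [hl1 _ (h3.trans hwρ.le)] at h2
    simpa using h2
  classical
  set D : Set S := e.symm '' Metric.closedBall 0 R with hD
  have hDc : IsClosed D := ((isCompact_closedBall _ _).image_of_continuousOn
    (e.continuousOn_symm.mono hRt)).isClosed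
  have hDs : D ⊆ e.source := by
    rintro _ ⟨z, hz, rfl⟩
    exact e.map_target (hRt hz)
  set f : S → Circle := fun x => dirn (e x) * (dirn (G (e x)))⁻¹ with hf
  set u : S → Circle := fun x => if x ∈ e.source then f x else 1 with hu
  have huf : ∀ x ∈ e.source, u =ᶠ[𝓝 x] f := fun x hx => by
    filter_upwards [e.open_source.mem_nhds hx] with y hy
    simp [hu, hy]
  have hDu : ∀ x ∉ D, u x = 1 := fun x hx => by
    by_cases hxs : x ∈ e.source
    · have h2 : R ≤ ‖e x‖ := by
        by_contra! h
        exact hx ⟨e x, by simpa using h.le, e.left_inv hxs⟩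
      simp [hu, hf, hG, hxs, hl0 _ h2]
    · simp [hu, hxs]
  have hc1 : ∀ x ∈ e.source, x ≠ p → ContinuousAt (fun x => dirn (e x)) x := fun x hx hxp =>
    (continuousAt_dirn fun h => hxp (e.injOn hx hp (by rw [h, h0]))).comp (e.continuousAt hx)
  have hc2 : ∀ x ∈ e.source, x ≠ q → ContinuousAt (fun x => dirn (G (e x))) x := fun x hx hxq =>
    ContinuousAt.comp (g := dirn) (f := fun x => G (e x))
      (continuousAt_dirn fun h => hxq (e.injOn hx hqs (hG0 _ h)))
      (hGc.continuousAt.comp (e.continuousAt hx))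
  have hP1 : ∀ x ∈ e.source, PuncCont (fun x => dirn (e x)) x := fun x hx => by
    have h2 : ∀ᶠ y in 𝓝[≠] x, y ≠ p := by
      rcases eq_or_ne x p with rfl | hxp
      · exact self_mem_nhdsWithin
      · exact nhdsWithin_le_nhds (isOpen_ne.mem_nhds hxp)
    filter_upwards [h2, nhdsWithin_le_nhds (e.open_source.mem_nhds hx)] with y hy hys
      using hc1 y hys hy
  have hP2 : ∀ x ∈ e.source, PuncCont (fun x => dirn (G (e x))) x := fun x hx => by
    have h2 : ∀ᶠ y in 𝓝[≠] x, y ≠ q := by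
      rcases eq_or_ne x q with rfl | hxp
      · exact self_mem_nhdsWithin
      · exact nhdsWithin_le_nhds (isOpen_ne.mem_nhds hxp)
    filter_upwards [h2, nhdsWithin_le_nhds (e.open_source.mem_nhds hx)] with y hy hys
      using hc2 y hys hy
  have hfe : f = (fun x => dirn (e x)) * (fun x => dirn (G (e x))) ^ (-1 : ℤ) := by
    ext x; simp [hf]
  have hdeg : ∀ x ∈ e.source, degAt u x =
      degAt (fun x => dirn (e x)) x - degAt (fun x => dirn (G (e x))) x := fun x hx => by
    have h2 : PuncCont f x := by rw [hfe]; exact (hP1 x hx).mul ((hP2 x hx).zpow _)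
    rw [degAt_congr hS h2 ((huf x hx).symm.filter_mono nhdsWithin_le_nhds), hfe,
      degAt_mul hS (hP1 x hx) ((hP2 x hx).zpow _), degAt_zpow hS (hP2 x hx)]
    ring
  refine ⟨u, fun x hxp hxq => ?_, ?_, ?_⟩
  · by_cases hxs : x ∈ e.source
    · exact ((hc1 x hxs hxp).mul (hc2 x hxs hxq).inv).congr (huf x hxs).symm
    · refine continuousAt_const (y := (1 : Circle)) |>.congr ?_
      filter_upwards [hDc.isOpen_compl.mem_nhds fun h => hxs (hDs h)] with z hz
      exact (hDu z hz).symm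
  · rw [hdeg p hp, (degAt_eq_zero_iff hS (hP2 p hp)).2, sub_zero]
    · exact (isGenAt_dirn_of_chart e hp h0).abs_degAt hS
    · refine hasLogAt_of_continuousAt ?_
      filter_upwards [e.open_source.mem_nhds hp, isOpen_ne.mem_nhds hpq] with y hy hyq
        using hc2 y hy hyq
  · rw [hdeg q hqs, (degAt_eq_zero_iff hS (hP1 q hqs)).2, zero_sub, abs_neg]
    · have h2 : IsGenAt (fun x => dirn (e x - w)) q :=
        isGenAt_dirn_of_chart (e.trans (Homeomorph.subRight w).toOpenPartialHomeomorph)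
          (by simpa using hqs) (by simp [hw])
      rw [← h2.abs_degAt hS]
      congr 1
      refine degAt_congr hS h2.1 (Filter.Eventually.filter_mono nhdsWithin_le_nhds ?_)
      have h3 : ∀ᶠ x in 𝓝 q, e x ∈ Metric.ball (0 : ℂ) ρ :=
        (e.continuousAt hqs).eventually_mem (Metric.isOpen_ball.mem_nhds (by simpa))
      filter_upwards [h3] with x hx
      have h4 : ‖e x‖ < ρ := by simpa using hx
      simp [hG, hl1 _ h4.le]
    · refine hasLogAt_of_continuousAt ?_
      filter_upwards [e.open_source.mem_nhds hqs, isOpen_ne.mem_nhds (Ne.symm hpq)] with y hy hyq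
        using hc1 y hy hyq

lemma HasDipole.symm {p q : S} (h : HasDipole p q) : HasDipole q p := by
  obtain ⟨u, h1, h2, h3⟩ := h
  exact ⟨u, fun x hx hy => h1 x hy hx, h3, h2⟩

/-- Multiplying the first dipole by the second or its inverse cancels the degree at `q`, so the
singularity at `q` can be removed; the correcting exponential does not affect the degrees at `p` and
`r`. -/
lemma HasDipole.trans [T4Space S] (hS : LocallyPlanar S) {p q r : S} (hpq : p ≠ q) (hqr : q ≠ r)
    (hpr : p ≠ r) (h₁ : HasDipole p q) (h₂ : HasDipole q r) : HasDipole p r := by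
  obtain ⟨u, hu, hup, huq⟩ := h₁
  obtain ⟨v, hv, hvq, hvr⟩ := h₂
  have hup' := puncCont_of_pair hu
  have hvp' := puncCont_of_pair hv
  -- The degree of `v` at `q` is its own inverse, so this `n = ±1` solves `degAt u q + n * degAt v q
  -- = 0`.
  set n : ℤ := -(degAt u q * degAt v q) with hn
  have hsq : degAt v q * degAt v q = 1 := by rw [← abs_mul_abs_self, hvq]; rfl
  have hn1 : |n| = 1 := by rw [hn, abs_neg, abs_mul, huq, hvq]; rfl
  have hw : ∀ x, PuncCont (u * v ^ n) x := fun x => (hup' x).mul ((hvp' x).zpow n)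
  have hdeg : ∀ x, degAt (u * v ^ n) x = degAt u x + n * degAt v x := fun x => by
    rw [degAt_mul hS (hup' x) ((hvp' x).zpow n), degAt_zpow hS (hvp' x)]
  have hq : degAt (u * v ^ n) q = 0 := by
    rw [hdeg, hn]; linear_combination (-degAt u q) * hsq
  obtain ⟨f, y, hy, hfy, hfc⟩ := exists_function_extension ((degAt_eq_zero_iff hS (hw q)).1 hq)
  have hfd : ∀ x ≠ q, degAt f x = degAt u x + n * degAt v x := fun x hx => by
    have h1 : HasLogAt (fun x => Circle.exp (y x)) x := hasLogAt_exp <|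
      nhdsWithin_le_nhds <| by filter_upwards [isOpen_ne.mem_nhds hx] with z hz using hy z hz
    have h2 : ((u * v ^ n) * fun x => Circle.exp (y x)) =ᶠ[𝓝[≠] x] f :=
      nhdsWithin_le_nhds <| by
        filter_upwards [isOpen_ne.mem_nhds hx] with z hz
        simp [hfy z hz]
    rw [degAt_congr hS ((hw x).mul h1.puncCont) h2, degAt_mul hS (hw x) h1.puncCont, hdeg,
      (degAt_eq_zero_iff hS h1.puncCont).2 h1, add_zero]
  refine ⟨f, fun x hxp hxr => ?_, ?_, ?_⟩
  · rcases eq_or_ne x q with rfl | hxq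
    · exact hfc
    · refine (((hu x hxp hxq).mul ((hv x hxq hxr).zpow n)).mul
        (Circle.exp.continuous.continuousAt.comp (hy x hxq))).congr ?_
      filter_upwards [isOpen_ne.mem_nhds hxq] with z hz
      simp [hfy z hz]
  · rw [hfd p hpq, degAt_eq_zero_of_notMem hS (C := {q, r}) (f := v) (by simp)
      (fun x hx => hv x (by grind) (by grind)) (by grind), mul_zero, add_zero, hup]
  · rw [hfd r hqr.symm, degAt_eq_zero_of_notMem hS (C := {p, q}) (f := u) (by simp)
      (fun x hx => hu x (by grind) (by grind)) (by grind), zero_add, abs_mul, hn1, hvr, one_mul]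

/-- The relation `p = q ∨ HasDipole p q` is symmetric, transitive and true for nearby points, so on
a connected surface it always holds. -/
lemma hasDipole [T4Space S] [PreconnectedSpace S] (hS : LocallyPlanar S) {p q : S} (hpq : p ≠ q) :
    HasDipole p q := by
  have : p = q ∨ HasDipole p q := by
    refine PreconnectedSpace.induction₂' (fun p q => p = q ∨ HasDipole p q) (fun x => ?_)
      ⟨fun x y z h1 h2 => ?_⟩ p q
    · filter_upwards [eventually_hasDipole hS x] with y hy
      exact ⟨hy, hy.imp Eq.symm HasDipole.symm⟩
    · rcases eq_or_ne x y with rfl | hxy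
      · exact h2
      rcases eq_or_ne y z with rfl | hyz
      · exact h1
      rcases eq_or_ne x z with rfl | hxz
      · exact .inl rfl
      exact .inr ((h1.resolve_left hxy).trans hS hxy hyz hxz (h2.resolve_left hyz))
  exact this.resolve_left hpq

end Dipole

end SpinQuotient

namespace SpinQuotient
open Filter Topology

/-! ### The polygon model of a closed surface -/

/-- The projection of the disc onto the closed surface. -/
def polyMk (g : ℕ) : Metric.closedBall (0 : ℂ) 1 → ClosedSurface g := Quot.mk _

lemma isQuotientMap_polyMk (g : ℕ) : IsQuotientMap (polyMk g) := isQuotientMap_quot_mk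

/-- The number of edges of the polygon. -/
def edgeCount (g : ℕ) : ℕ := if g = 0 then 2 else 4 * g

/-- The edge glued to the edge `k`. -/
def partner (g k : ℕ) : ℕ := if g = 0 then 1 - k else if k % 4 < 2 then k + 2 else k - 2

/-- The point with parameter `s` on the edge `k`. -/
def edgePt (g k : ℕ) (s : ℝ) : Metric.closedBall (0 : ℂ) 1 :=
  boundaryPoint ((k + s) / edgeCount g)

lemma edgeCount_pos (g : ℕ) : 0 < edgeCount g := by
  unfold edgeCount; split_ifs <;> omega

lemma partner_lt {g k : ℕ} (hk : k < edgeCount g) : partner g k < edgeCount g := by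
  unfold edgeCount partner at *; split_ifs at * <;> omega

lemma partner_partner {g k : ℕ} (hk : k < edgeCount g) : partner g (partner g k) = k := by
  unfold edgeCount partner at *; split_ifs at * <;> omega

lemma partner_ne {g k : ℕ} (hk : k < edgeCount g) : partner g k ≠ k := by
  unfold edgeCount partner at *; split_ifs at * <;> omega

lemma boundaryPoint_add_int (t : ℝ) (n : ℤ) : boundaryPoint (t + n) = boundaryPoint t := by
  apply Subtype.ext
  simp only [boundaryPoint]
  rw [mul_add, Circle.exp_add, circle_exp_two_pi_int, mul_one]

@[fun_prop]
lemma continuous_boundaryPoint : Continuous boundaryPoint := by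
  unfold boundaryPoint
  fun_prop

@[fun_prop]
lemma continuous_edgePt (g k : ℕ) : Continuous (edgePt g k) := by
  unfold edgePt
  fun_prop

lemma edgePt_one (g k : ℕ) : edgePt g k 1 = edgePt g (k + 1) 0 := by
  simp [edgePt]

lemma edgePt_edgeCount (g : ℕ) : edgePt g (edgeCount g) 0 = edgePt g 0 0 := by
  have h : (edgeCount g : ℝ) ≠ 0 := by exact_mod_cast (edgeCount_pos g).ne'
  have := boundaryPoint_add_int 0 1
  simp only [edgePt]
  rw [add_zero, div_self h]
  simpa using this

lemma norm_boundaryPoint (t : ℝ) : ‖(boundaryPoint t : ℂ)‖ = 1 := Circle.norm_coe _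

lemma exists_edgePt_of_fract (g : ℕ) (t : ℝ) :
    ∃ k < edgeCount g, ∃ s ∈ Set.Ico (0 : ℝ) 1, boundaryPoint t = edgePt g k s := by
  have h : (0 : ℝ) < edgeCount g := by exact_mod_cast edgeCount_pos g
  have h0 := Int.fract_nonneg t
  have h1 := Int.fract_lt_one t
  have h2 : 0 ≤ edgeCount g * Int.fract t := by positivity
  refine ⟨⌊edgeCount g * Int.fract t⌋₊, ?_, edgeCount g * Int.fract t -
    ⌊edgeCount g * Int.fract t⌋₊, ⟨?_, ?_⟩, ?_⟩
  · rw [Nat.floor_lt h2]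
    nlinarith
  · linarith [Nat.floor_le h2]
  · linarith [Nat.lt_floor_add_one (edgeCount g * Int.fract t)]
  · rw [edgePt, add_sub_cancel, mul_div_cancel_left₀ _ h.ne']
    conv_lhs => rw [← Int.fract_add_floor t]
    rw [boundaryPoint_add_int]

lemma exists_boundaryPoint {x : Metric.closedBall (0 : ℂ) 1} (hx : ‖(x : ℂ)‖ = 1) :
    ∃ t, x = boundaryPoint t := by
  refine ⟨Complex.arg x / (2 * Real.pi), Subtype.ext ?_⟩
  simp only [boundaryPoint]
  rw [mul_div_cancel₀ _ (by positivity), Circle.coe_exp]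
  simpa [hx] using (Complex.norm_mul_exp_arg_mul_I (x : ℂ)).symm

lemma exists_edgePt (g : ℕ) {x : Metric.closedBall (0 : ℂ) 1} (hx : ‖(x : ℂ)‖ = 1) :
    ∃ k < edgeCount g, ∃ s ∈ Set.Ico (0 : ℝ) 1, x = edgePt g k s := by
  obtain ⟨t, rfl⟩ := exists_boundaryPoint hx
  exact exists_edgePt_of_fract g t

/-- The three gluing rules in uniform shape: each edge is glued to its partner with the parameter
reversed. The reversal is what orientability of the surface comes down to. -/
lemma polyMk_edgePt {g k : ℕ} (hk : k < edgeCount g) {s : ℝ} (hs : s ∈ Set.Icc (0 : ℝ) 1) :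
    polyMk g (edgePt g k s) = polyMk g (edgePt g (partner g k) (1 - s)) := by
  have hs' : 1 - s ∈ Set.Icc (0 : ℝ) 1 := ⟨by linarith [hs.2], by linarith [hs.1]⟩
  rcases Nat.eq_zero_or_pos g with rfl | hg
  · have hk2 : k < 2 := hk
    have h1 : ∀ t : ℝ, polyMk 0 (boundaryPoint t) = polyMk 0 (boundaryPoint (1 - t)) := fun t => by
      have h2 := boundaryPoint_add_int (-t) 1
      rw [show (1 : ℝ) - t = -t + (1 : ℤ) by push_cast; ring, h2]
      exact Quot.sound (PolygonGlue.fold rfl t)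
    have h2 : (edgeCount 0 : ℝ) = 2 := by norm_num [edgeCount]
    have h3 : ((partner 0 k : ℕ) : ℝ) = 1 - k := by
      interval_cases k <;> simp [partner]
    rw [edgePt, edgePt, h1, h2, h3]
    congr 2
    ring
  · have hg0 : g ≠ 0 := hg.ne'
    have hN : (edgeCount g : ℝ) = 4 * g := by simp [edgeCount, hg0]
    have hk4 : k < 4 * g := by simpa [edgeCount, hg0] using hk
    have hk' : k = 4 * (k / 4) + k % 4 := by omega
    have hi : k / 4 < g := by omega
    set i := k / 4 with hidef
    have hm : k % 4 < 4 := Nat.mod_lt _ (by norm_num)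
    have ha : ∀ s ∈ Set.Icc (0 : ℝ) 1, polyMk g (edgePt g (4 * i) s) =
        polyMk g (edgePt g (4 * i + 2) (1 - s)) := fun s hs => by
      have : polyMk g _ = polyMk g _ := Quot.sound (PolygonGlue.edge_a i hi s hs)
      rw [edgePt, edgePt, hN]
      push_cast
      rw [this]
      congr 3
      ring
    have hb : ∀ s ∈ Set.Icc (0 : ℝ) 1, polyMk g (edgePt g (4 * i + 1) s) =
        polyMk g (edgePt g (4 * i + 3) (1 - s)) := fun s hs => by
      have : polyMk g _ = polyMk g _ := Quot.sound (PolygonGlue.edge_b i hi s hs)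
      rw [edgePt, edgePt, hN]
      push_cast
      rw [this]
      congr 3
      ring
    obtain hm | hm | hm | hm : k % 4 = 0 ∨ k % 4 = 1 ∨ k % 4 = 2 ∨ k % 4 = 3 := by omega
    · rw [show partner g k = 4 * i + 2 by rw [partner, if_neg hg0]; split_ifs <;> omega, show k = 4 * i by omega]
      exact ha s hs
    · rw [show partner g k = 4 * i + 3 by rw [partner, if_neg hg0]; split_ifs <;> omega, show k = 4 * i + 1 by omega]
      exact hb s hs
    · rw [show partner g k = 4 * i by rw [partner, if_neg hg0]; split_ifs <;> omega, show k = 4 * i + 2 by omega,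
        ha _ hs', sub_sub_cancel]
    · rw [show partner g k = 4 * i + 1 by rw [partner, if_neg hg0]; split_ifs <;> omega,
        show k = 4 * i + 3 by omega, hb _ hs', sub_sub_cancel]

/-- Converse to `polyMk_edgePt`: these identifications generate `PolygonGlue`, so compatibility
needs to be checked on edges only. The fold for `g = 0` runs over all real parameters and is first
brought back to one of the two edges. -/
lemma polygonGlue_invariant {g : ℕ} {Z : Type*} {F : Metric.closedBall (0 : ℂ) 1 → Z}
    (hF : ∀ k < edgeCount g, ∀ s ∈ Set.Icc (0 : ℝ) 1,
      F (edgePt g k s) = F (edgePt g (partner g k) (1 - s)))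
    {x y : Metric.closedBall (0 : ℂ) 1} (h : PolygonGlue g x y) : F x = F y := by
  cases h with
  | edge_a i hi s hs =>
    have hg0 : g ≠ 0 := by omega
    have hN : (edgeCount g : ℝ) = 4 * g := by simp [edgeCount, hg0]
    have h1 := hF (4 * i) (by simp [edgeCount, hg0]; omega) s hs
    rw [show partner g (4 * i) = 4 * i + 2 by simp [partner, hg0], edgePt, edgePt, hN] at h1
    push_cast at h1
    rw [h1]
    congr 3
    ring
  | edge_b i hi s hs =>
    have hg0 : g ≠ 0 := by omega
    have hN : (edgeCount g : ℝ) = 4 * g := by simp [edgeCount, hg0]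
    have h1 := hF (4 * i + 1) (by simp [edgeCount, hg0]; omega) s hs
    rw [show partner g (4 * i + 1) = 4 * i + 3 by rw [partner, if_neg hg0]; split_ifs <;> omega, edgePt, edgePt,
      hN] at h1
    push_cast at h1
    rw [h1]
    congr 3
    ring
  | fold hg s =>
    subst hg
    have h2 : (edgeCount 0 : ℝ) = 2 := by norm_num [edgeCount]
    obtain ⟨k, hk, t, ht, hst⟩ := exists_edgePt_of_fract 0 s
    have hk2 : k < 2 := hk
    have h1 := hF k hk t ⟨ht.1, ht.2.le⟩
    rw [hst, h1]
    have h3 : ((partner 0 k : ℕ) : ℝ) = 1 - k := by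
      interval_cases k <;> simp [partner]
    congr 1
    have h4 : Circle.exp (2 * Real.pi * s) = Circle.exp (2 * Real.pi * ((k + t) / 2)) := by
      have := congrArg (fun x : Metric.closedBall (0 : ℂ) 1 => (x : ℂ)) hst
      simp only [edgePt, boundaryPoint, h2] at this
      exact Subtype.ext this
    apply Subtype.ext
    simp only [edgePt, boundaryPoint, h2, h3]
    congr 1
    rw [show 2 * Real.pi * -s = -(2 * Real.pi * s) by ring, Circle.exp_neg, h4, ← Circle.exp_neg,
      show 2 * Real.pi * ((1 - k + (1 - t)) / 2) = -(2 * Real.pi * ((k + t) / 2)) +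
        2 * Real.pi * (1 : ℤ) by push_cast; ring, Circle.exp_add, circle_exp_two_pi_int, mul_one]

/-- A continuous function on the polygon which respects the gluing descends to the surface. -/
def polyLift {g : ℕ} {Z : Type*} (F : Metric.closedBall (0 : ℂ) 1 → Z)
    (hF : ∀ k < edgeCount g, ∀ s ∈ Set.Icc (0 : ℝ) 1,
      F (edgePt g k s) = F (edgePt g (partner g k) (1 - s))) : ClosedSurface g → Z :=
  Quot.lift F fun _ _ h => polygonGlue_invariant hF h

lemma continuous_polyLift {g : ℕ} {Z : Type*} [TopologicalSpace Z]
    {F : Metric.closedBall (0 : ℂ) 1 → Z} (hF) (hFc : Continuous F) :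
    Continuous (polyLift (g := g) F hF) :=
  (isQuotientMap_polyMk g).continuous_iff.2 hFc

instance (g : ℕ) : CompactSpace (ClosedSurface g) :=
  have : CompactSpace (Metric.closedBall (0 : ℂ) 1) :=
    isCompact_iff_compactSpace.1 (isCompact_closedBall _ _)
  inferInstanceAs (CompactSpace (Quot (PolygonGlue g)))

instance (g : ℕ) : PreconnectedSpace (ClosedSurface g) := by
  have : PreconnectedSpace (Metric.closedBall (0 : ℂ) 1) :=
    isPreconnected_iff_preconnectedSpace.1 (convex_closedBall _ _).isPreconnected
  exact ⟨by
    rw [← (isQuotientMap_polyMk g).surjective.range_eq]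
    exact isPreconnected_range (isQuotientMap_polyMk g).continuous⟩

/-- The norm, as a function on the surface. -/
def polyNorm (g : ℕ) : ClosedSurface g → ℝ :=
  polyLift (fun x => ‖(x : ℂ)‖) fun k _ s _ => by
    rw [edgePt, edgePt, norm_boundaryPoint, norm_boundaryPoint]

/-- The function `(1 - |x|) x` on the surface. -/
def polyCoord (g : ℕ) : ClosedSurface g → ℂ :=
  polyLift (fun x => ((1 - ‖(x : ℂ)‖ : ℝ) : ℂ) * x) fun k _ s _ => by
    rw [edgePt, edgePt, norm_boundaryPoint, norm_boundaryPoint]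
    simp

@[fun_prop]
lemma continuous_polyNorm (g : ℕ) : Continuous (polyNorm g) :=
  continuous_polyLift _ (by fun_prop)

@[fun_prop]
lemma continuous_polyCoord (g : ℕ) : Continuous (polyCoord g) :=
  continuous_polyLift _ (by fun_prop)

/-- Recovers an interior point of the polygon from two functions that are continuous on the surface,
and so provides a coordinate on the open cell. -/
lemma polyCoord_div {g : ℕ} {x : Metric.closedBall (0 : ℂ) 1} (hx : ‖(x : ℂ)‖ < 1) :
    polyCoord g (polyMk g x) / ((1 - polyNorm g (polyMk g x) : ℝ) : ℂ) = x := by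
  have h : ((1 - ‖(x : ℂ)‖ : ℝ) : ℂ) ≠ 0 := by
    exact_mod_cast (sub_pos.2 hx).ne'
  exact mul_div_cancel_left₀ _ h

/-- The image of the centre of the polygon. -/
def polyCenter (g : ℕ) : ClosedSurface g := polyMk g ⟨0, by simp⟩

lemma polyMk_eq_polyCenter_iff {g : ℕ} {x : Metric.closedBall (0 : ℂ) 1} :
    polyMk g x = polyCenter g ↔ (x : ℂ) = 0 := by
  constructor
  · intro h
    have h1 : ‖(x : ℂ)‖ = ‖(0 : ℂ)‖ := congrArg (polyNorm g) h
    simpa using h1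
  · intro h
    rw [polyCenter]
    congr 1
    exact Subtype.ext h

/-- The radial retraction of the plane onto the disc. -/
def discRetr (z : ℂ) : Metric.closedBall (0 : ℂ) 1 :=
  ⟨(((max 1 ‖z‖)⁻¹ : ℝ) : ℂ) * z, by
    have h1 : 0 < max 1 ‖z‖ := lt_max_of_lt_left one_pos
    rw [mem_closedBall_zero_iff, norm_mul, Complex.norm_real, Real.norm_of_nonneg (by positivity),
      inv_mul_le_one₀ h1]
    exact le_max_right _ _⟩

@[fun_prop]
lemma continuous_discRetr : Continuous discRetr := by
  refine Continuous.subtype_mk ((Complex.continuous_ofReal.comp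
    (Continuous.inv₀ (by fun_prop) fun p => ?_)).mul continuous_id) _
  exact (lt_max_of_lt_left one_pos).ne'

lemma discRetr_coe (x : Metric.closedBall (0 : ℂ) 1) : discRetr x = x := by
  have : ‖(x : ℂ)‖ ≤ 1 := mem_closedBall_zero_iff.1 x.2
  apply Subtype.ext
  simp [discRetr, this]

lemma discRetr_coe_eq_zero {z : ℂ} : (discRetr z : ℂ) = 0 ↔ z = 0 := by
  have h1 : 0 < max 1 ‖z‖ := lt_max_of_lt_left one_pos
  rw [discRetr, mul_eq_zero, or_iff_right]
  exact_mod_cast (inv_pos.2 h1).ne'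

/-- The changes of a logarithm along glued edges are opposite. -/
lemma edge_log_sub {g : ℕ} {L : ℕ → ℝ → ℝ} (hL : ∀ k, Continuous (L k))
    {f : ClosedSurface g → Circle}
    (hf : ∀ k s, Circle.exp (L k s) = f (polyMk g (edgePt g k s))) {k : ℕ}
    (hk : k < edgeCount g) : ∃ n : ℤ, ∀ s ∈ Set.Icc (0 : ℝ) 1,
      L k s - L (partner g k) (1 - s) = 2 * Real.pi * n :=
  exists_int_of_circle_exp_eq_one_on isPreconnected_Icc
    (((hL k).sub ((hL _).comp (continuous_const.sub continuous_id))).continuousOn) fun s hs => by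
      show Circle.exp (L k s - L _ (1 - s)) = 1
      rw [Circle.exp_sub, hf, hf, ← polyMk_edgePt hk hs, div_self']

/-- The difference in `edge_log_sub` is constant; it is compared at the two ends, using that glued
edges run in opposite directions. -/
lemma edge_change_add {g : ℕ} {L : ℕ → ℝ → ℝ} (hL : ∀ k, Continuous (L k))
    {f : ClosedSurface g → Circle}
    (hf : ∀ k s, Circle.exp (L k s) = f (polyMk g (edgePt g k s))) {k : ℕ}
    (hk : k < edgeCount g) :
    (L k 1 - L k 0) + (L (partner g k) 1 - L (partner g k) 0) = 0 := by
  obtain ⟨n, hn⟩ := edge_log_sub hL hf hk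
  have h0 := hn 0 (by simp)
  have h1 := hn 1 (by simp)
  rw [sub_zero] at h0
  rw [sub_self] at h1
  linarith

/-- A function which is continuous off the centre has degree zero there. -/
lemma hasLogAt_polyCenter {g : ℕ} {f : ClosedSurface g → Circle}
    (hf : ∀ x ≠ polyCenter g, ContinuousAt f x) : HasLogAt f (polyCenter g) := by
  obtain ⟨n, v, hv, h⟩ := punctured_plane_log (f := fun z => f (polyMk g (discRetr z)))
    fun z hz => ContinuousAt.comp (g := f) (f := fun z => polyMk g (discRetr z))
      (hf _ fun h => hz (discRetr_coe_eq_zero.1 (polyMk_eq_polyCenter_iff.1 h)))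
      ((isQuotientMap_polyMk g).continuous.comp continuous_discRetr).continuousAt
  have hb : ∀ t, (boundaryPoint t : ℂ) ≠ 0 := fun t h => by
    have := norm_boundaryPoint t
    rw [h] at this
    simp at this
  -- The logarithm grows by `2πn` along the whole boundary of the polygon, whereas the contributions
  -- of the edges cancel in pairs under `partner`.
  have hn : n = 0 := by
    set L : ℕ → ℝ → ℝ := fun k s =>
      2 * Real.pi * n * ((k + s) / edgeCount g) + v (edgePt g k s) with hL
    have hLc : ∀ k, Continuous (L k) := fun k => by
      have h1 : Continuous fun s => v (edgePt g k s) := continuous_iff_continuousAt.2 fun s =>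
        ContinuousAt.comp (g := v) (f := fun s => (edgePt g k s : ℂ)) (hv _ (hb _))
          (by fun_prop)
      exact (by fun_prop : Continuous fun s : ℝ => 2 * Real.pi * n * ((k + s) / edgeCount g)).add h1
    have hLf : ∀ k s, Circle.exp (L k s) = f (polyMk g (edgePt g k s)) := fun k s => by
      have h1 := h _ (hb ((k + s) / edgeCount g))
      rw [discRetr_coe] at h1
      simp only [edgePt, hL]
      rw [h1, Circle.exp_add]
      congr 1
      rw [show (boundaryPoint ((k + s) / edgeCount g) : ℂ) =
        (Circle.exp (2 * Real.pi * ((k + s) / edgeCount g)) : ℂ) from rfl, dirn_circle,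
        ← Circle.exp_zsmul, zsmul_eq_mul]
      congr 1
      ring
    have hsum : ∑ k ∈ Finset.range (edgeCount g), (L k 1 - L k 0) = 0 :=
      Finset.sum_involution (fun k _ => partner g k)
        (fun k hk => edge_change_add hLc hLf (Finset.mem_range.1 hk))
        (fun k hk _ => partner_ne (Finset.mem_range.1 hk))
        (fun k hk => Finset.mem_range.2 (partner_lt (Finset.mem_range.1 hk)))
        (fun k hk => partner_partner (Finset.mem_range.1 hk))
    have hstep : ∀ k, L k 1 = L (k + 1) 0 := fun k => by
      simp only [hL, edgePt_one]
      push_cast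
      ring
    simp only [hstep] at hsum
    rw [Finset.sum_range_sub (fun k => L k 0)] at hsum
    have hN : (edgeCount g : ℝ) ≠ 0 := by exact_mod_cast (edgeCount_pos g).ne'
    simp only [hL, edgePt_edgeCount, add_zero, Nat.cast_zero, zero_div, mul_zero,
      div_self hN] at hsum
    have h3 : 2 * Real.pi * (n : ℝ) = 0 := by linarith
    simpa [Real.pi_ne_zero] using h3
  -- With `n = 0` the logarithm `v` on the punctured disc is transported to the open cell by the
  -- coordinate of `polyCoord_div`.
  refine ⟨fun x => v (polyCoord g x / ((1 - polyNorm g x : ℝ) : ℂ)), ?_⟩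
  have h1 : ∀ᶠ x in 𝓝 (polyCenter g), polyNorm g x < 1 := by
    refine (continuous_polyNorm g).continuousAt.eventually_lt continuousAt_const ?_
    show ‖(0 : ℂ)‖ < 1
    simp
  filter_upwards [nhdsWithin_le_nhds h1, self_mem_nhdsWithin] with x hx hxc
  obtain ⟨w, rfl⟩ := (isQuotientMap_polyMk g).surjective x
  have hw1 : ‖(w : ℂ)‖ < 1 := hx
  have hw0 : (w : ℂ) ≠ 0 := fun h => hxc (polyMk_eq_polyCenter_iff.2 h)
  have hd : ((1 - polyNorm g (polyMk g w) : ℝ) : ℂ) ≠ 0 := by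
    exact_mod_cast (sub_pos.2 hx).ne'
  refine ⟨ContinuousAt.comp (g := v) ?_ ?_, ?_⟩
  · rw [polyCoord_div hw1]
    exact hv _ hw0
  · refine ContinuousAt.div (by fun_prop) ?_ hd
    exact Complex.continuous_ofReal.continuousAt.comp (by fun_prop)
  · have := h _ hw0
    rw [hn, zpow_zero, one_mul, discRetr_coe] at this
    rw [polyCoord_div hw1, this]

/-- Functions on consecutive edges of the polygon define a function on the circle. -/
lemma exists_circle_of_edges {Z : Type*} [TopologicalSpace Z] {N : ℕ} (hN : 0 < N)
    {W : ℕ → ℝ → Z} (hW : ∀ k < N, ContinuousOn (W k) (Set.Icc 0 1))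
    (hstep : ∀ k < N, W k 1 = W ((k + 1) % N) 0) :
    ∃ V : Circle → Z, Continuous V ∧ ∀ k < N, ∀ s ∈ Set.Icc (0 : ℝ) 1,
      V (Circle.exp (2 * Real.pi * ((k + s) / N))) = W k s := by
  have hN' : (0 : ℝ) < N := by exact_mod_cast hN
  have hNz : (0 : ℤ) < N := by exact_mod_cast hN
  set i : ℤ → ℕ := fun m => (m % N).toNat with hi
  have hiN : ∀ m, i m < N := fun m => by
    have h1 := Int.emod_nonneg m hNz.ne'
    have h2 := Int.emod_lt_of_pos m hNz
    simp only [hi]; omega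
  have hi1 : ∀ m, i (m + 1) = (i m + 1) % N := fun m => by
    have h1 := Int.emod_nonneg m hNz.ne'
    zify
    rw [show ((i (m + 1) : ℕ) : ℤ) = (m + 1) % N from
      Int.toNat_of_nonneg (Int.emod_nonneg _ hNz.ne'),
      show ((i m : ℕ) : ℤ) = m % N from Int.toNat_of_nonneg h1]
    simp
  -- The functions laid end to end form an `N`-periodic function on the line; `hstep` makes it
  -- continuous at the integers, and periodicity lets it descend to the circle.
  set f : ℝ → Z := fun t => W (i ⌊t⌋) (Int.fract t) with hf
  have hfn : ∀ (m : ℤ) (t : ℝ), t ∈ Set.Icc (m : ℝ) (m + 1) → f t = W (i m) (t - m) := by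
    intro m t ht
    rcases ht.2.lt_or_eq with h | h
    · have h1 : ⌊t⌋ = m := Int.floor_eq_iff.2 ⟨ht.1, h⟩
      simp only [hf, Int.fract, h1]
    · have h1 : ⌊t⌋ = m + 1 := by
        rw [h]; exact_mod_cast Int.floor_intCast (m + 1)
      simp only [hf, Int.fract, h1, hi1]
      rw [show t - ((m + 1 : ℤ) : ℝ) = 0 by push_cast; linarith, show t - m = 1 by linarith,
        hstep _ (hiN m)]
  have hfI : ∀ m : ℤ, ContinuousOn f (Set.Icc (m : ℝ) (m + 1)) := fun m => by
    refine ContinuousOn.congr ?_ (hfn m)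
    refine (hW _ (hiN m)).comp (by fun_prop) fun t ht => ⟨?_, ?_⟩ <;> linarith [ht.1, ht.2]
  have hfc : Continuous f := continuous_iff_continuousAt.2 fun t => by
    have h1 := (hfI (⌊t⌋ - 1)).union_of_isClosed (hfI ⌊t⌋) isClosed_Icc isClosed_Icc
    refine h1.continuousAt (mem_of_superset (Ioo_mem_nhds (a := (⌊t⌋ : ℝ) - 1)
      (b := (⌊t⌋ : ℝ) + 1) ?_ ?_) ?_)
    · linarith [Int.floor_le t]
    · exact Int.lt_floor_add_one t
    · intro x hx
      rcases le_total x ⌊t⌋ with h | h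
      · left; constructor <;> push_cast <;> linarith [hx.1, hx.2]
      · right; constructor <;> linarith [hx.1, hx.2]
  have hfp : Function.Periodic f N := fun t => by
    have h1 : ⌊t + N⌋ = ⌊t⌋ + N := by exact_mod_cast Int.floor_add_intCast t N
    have h2 : Int.fract (t + N) = Int.fract t := by exact_mod_cast Int.fract_add_natCast t N
    simp only [hf, h1, h2, hi, Int.add_emod_right]
  have hVe : ∀ x, f (N * (Complex.arg (Circle.exp x) / (2 * Real.pi))) =
      f (N * (x / (2 * Real.pi))) := fun x => by
    obtain ⟨m, hm⟩ := Circle.exp_eq_exp.1 (Circle.exp_arg (Circle.exp x))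
    rw [hm, show (N : ℝ) * ((x + m * (2 * Real.pi)) / (2 * Real.pi)) =
      N * (x / (2 * Real.pi)) + m * N by field_simp]
    exact hfp.int_mul m _
  refine ⟨fun z => f (N * (Complex.arg z / (2 * Real.pi))), ?_, fun k hk s hs => ?_⟩
  · refine (Circle.isCoveringMap_exp.isQuotientMap fun z => ⟨_, Circle.exp_arg z⟩).continuous_iff.2 ?_
    have : Continuous fun x => f (N * (x / (2 * Real.pi))) := by fun_prop
    convert! this using 2 with x
    exact hVe x
  · simp only [hVe]
    rw [show (N : ℝ) * (2 * Real.pi * ((k + s) / N) / (2 * Real.pi)) = k + s by field_simp,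
      hfn k _ ⟨by simpa using hs.1, by simpa using hs.2⟩]
    congr 1
    · simp only [hi]
      rw [Int.emod_eq_of_lt (by omega) (by exact_mod_cast hk)]
      simp
    · simp

end SpinQuotient

/-! ### Sections of circle bundles over the closed surface, off the centre of the polygon. -/

namespace SpinQuotient
open Filter Topology

lemma edgePt_succ_mod {g k : ℕ} (hk : k < edgeCount g) :
    edgePt g ((k + 1) % edgeCount g) 0 = edgePt g k 1 := by
  rw [edgePt_one]
  rcases (Nat.succ_le_of_lt hk).lt_or_eq with h | h
  · rw [Nat.mod_eq_of_lt h]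
  · rw [Nat.succ_eq_add_one] at h
    rw [h, Nat.mod_self, edgePt_edgeCount]

lemma coe_edgePt (g k : ℕ) (s : ℝ) :
    (edgePt g k s : ℂ) = Circle.exp (2 * Real.pi * ((k + s) / edgeCount g)) := rfl

/-- A circle bundle over the surface has a section off the centre. -/
lemma IsTwist.exists_section_off_center {g : ℕ} {τ : ClosedSurface g → ClosedSurface g → Circle}
    (hτ : IsTwist τ) [T1Space (ClosedSurface g)] :
    ∃ h, ∀ y ≠ polyCenter g, IsSectionAt τ h y := by
  have hπ := (isQuotientMap_polyMk g).continuous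
  obtain ⟨σ, hσ⟩ := (hτ.comp hπ).exists_section_disc
  set N := edgeCount g with hN
  set c : ℕ → ℝ → Circle := fun k s => σ (edgePt g k s) with hc
  -- paths between the prescribed values at the vertices
  set P : ℕ → ℝ → Circle := fun k s => (c k 0)⁻¹ *
    Circle.exp (s * Complex.arg ((c k 1)⁻¹ / (c k 0)⁻¹ : Circle)) with hP
  have hP0 : ∀ k, P k 0 = (c k 0)⁻¹ := fun k => by simp [hP]
  have hP1 : ∀ k, P k 1 = (c k 1)⁻¹ := fun k => by
    simp only [hP]
    rw [one_mul, ← circle_exp_arg_div]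
  have hPc : ∀ k, Continuous (P k) := fun k => by fun_prop
  classical
  -- `W` is the factor by which the section `σ` is corrected on the boundary. The corrected section
  -- is to equal one at every vertex, so that consecutive edges match. In each pair of glued edges
  -- the factor is a free choice `P` on the first edge and is forced by the gluing on the second.
  set W : ℕ → ℝ → Circle := fun k s => if k < partner g k then P k s else
    P (partner g k) (1 - s) * (c (partner g k) (1 - s) / c k s) with hW
  have hW0 : ∀ k, W k 0 = (c k 0)⁻¹ := fun k => by
    simp only [hW]
    split_ifs with h
    · exact hP0 k
    · rw [sub_zero, hP1, mul_div, inv_mul_cancel, one_div]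
  have hW1 : ∀ k, W k 1 = (c k 1)⁻¹ := fun k => by
    simp only [hW]
    split_ifs with h
    · exact hP1 k
    · rw [sub_self, hP0, mul_div, inv_mul_cancel, one_div]
  -- The values `c` are relative to a discontinuous global frame and need not be continuous. Points
  -- glued together have the same image, so both values can be measured against one local frame, and
  -- their ratio is continuous.
  have hratio : ∀ k < N, ContinuousOn (fun s => c (partner g k) (1 - s) / c k s)
      (Set.Icc 0 1) := fun k hk s hs => by
    set γ : ℝ → ClosedSurface g := fun s => polyMk g (edgePt g k s)
    have h1 : ContinuousWithinAt (fun t => c k t / τ (γ s) (γ t)) (Set.Icc 0 1) s :=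
      (ContinuousAt.comp (f := fun t => edgePt g k t) (hσ (edgePt g k s))
        (by fun_prop)).continuousWithinAt
    have h2 : ContinuousWithinAt (fun t => c (partner g k) (1 - t) / τ (γ s) (γ t))
        (Set.Icc 0 1) s := by
      have h3 := (ContinuousAt.comp (x := s) (f := fun t => edgePt g (partner g k) (1 - t))
        (hσ (edgePt g (partner g k) (1 - s))) (by fun_prop)).continuousWithinAt (s := Set.Icc 0 1)
      refine h3.congr (fun t ht => ?_) ?_ <;>
        simp only [Function.comp, γ, hc, polyMk_edgePt hk hs]
      rw [polyMk_edgePt hk ht]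
    refine (h2.div' h1).congr (fun t _ => ?_) ?_ <;> simp
  obtain ⟨V, hVc, hV⟩ := exists_circle_of_edges (edgeCount_pos g) (W := W) (fun k hk => by
      simp only [hW]
      split_ifs
      · exact (hPc k).continuousOn
      · exact ((hPc _).comp (continuous_const.sub continuous_id)).continuousOn.mul (hratio k hk))
    (fun k hk => by
      rw [hW0, hW1]
      simp only [hc]
      rw [edgePt_succ_mod hk])
  -- The boundary correction is extended along radii, which is continuous except at the centre.
  set h : Metric.closedBall (0 : ℂ) 1 → Circle := fun x => V (dirn x) * σ x with hh
  have hhe : ∀ k < N, ∀ s ∈ Set.Icc (0 : ℝ) 1, h (edgePt g k s) = W k s * c k s :=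
    fun k hk s hs => by
      simp only [hh, hc]
      rw [coe_edgePt, dirn_circle, hV k hk s hs]
  have hglue : ∀ k < N, ∀ s ∈ Set.Icc (0 : ℝ) 1, k < partner g k →
      h (edgePt g k s) = h (edgePt g (partner g k) (1 - s)) := fun k hk s hs hkp => by
    have hs' : 1 - s ∈ Set.Icc (0 : ℝ) 1 := ⟨by linarith [hs.2], by linarith [hs.1]⟩
    rw [hhe k hk s hs, hhe _ (partner_lt hk) _ hs']
    simp only [hW]
    rw [if_pos hkp, partner_partner hk, if_neg (by omega), sub_sub_cancel]
    simp [mul_assoc]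
  have hF : ∀ k < N, ∀ s ∈ Set.Icc (0 : ℝ) 1,
      h (edgePt g k s) = h (edgePt g (partner g k) (1 - s)) := fun k hk s hs => by
    have hs' : 1 - s ∈ Set.Icc (0 : ℝ) 1 := ⟨by linarith [hs.2], by linarith [hs.1]⟩
    rcases lt_or_gt_of_ne (partner_ne hk) with hkp | hkp
    · have h1 := hglue _ (partner_lt hk) _ hs' (by rwa [partner_partner hk])
      rw [partner_partner hk, sub_sub_cancel] at h1
      exact h1.symm
    · exact hglue k hk s hs hkp
  refine ⟨polyLift h hF, fun y hy => ?_⟩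
  refine hτ.isSectionAt_of_comp (isQuotientMap_polyMk g) isOpen_compl_singleton
    (fun x hx => ?_) (O := {polyCenter g}ᶜ) hy
  have hx0 : (x : ℂ) ≠ 0 := fun h => hx (polyMk_eq_polyCenter_iff.2 h)
  have h1 : ContinuousAt (fun x : Metric.closedBall (0 : ℂ) 1 => V (dirn x)) x :=
    hVc.continuousAt.comp (ContinuousAt.comp (g := dirn) (continuousAt_dirn hx0)
      continuous_subtype_val.continuousAt)
  refine (h1.mul (hσ x)).congr (Eventually.of_forall fun z => ?_)
  simp only [Pi.mul_apply, hh, Function.comp, mul_div_assoc, polyLift, polyMk]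

/-! #### Functions on the closed surface -/

/-- The edges `a_i`, `b_i` of the polygon. -/
def mainEdge {g : ℕ} (e : Fin g × Fin 2) : ℕ := 4 * e.1 + e.2

lemma mainEdge_lt {g : ℕ} (e : Fin g × Fin 2) : mainEdge e < edgeCount g := by
  have := e.1.2
  have := e.2.2
  unfold mainEdge edgeCount
  split_ifs <;> omega

lemma partner_mainEdge {g : ℕ} (e : Fin g × Fin 2) : partner g (mainEdge e) = mainEdge e + 2 := by
  have := e.1.2
  have := e.2.2
  unfold partner mainEdge
  split_ifs <;> omega

lemma mainEdge_injective (g : ℕ) : Function.Injective (mainEdge (g := g)) := by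
  rintro ⟨i, j⟩ ⟨i', j'⟩ h
  have := j.2
  have := j'.2
  simp only [mainEdge] at h
  ext <;> simp <;> omega

lemma exists_mainEdge {g k : ℕ} (hg : g ≠ 0) (hk : k < edgeCount g) :
    ∃ e : Fin g × Fin 2, k = mainEdge e ∨ k = partner g (mainEdge e) := by
  have hk4 : k < 4 * g := by simpa [edgeCount, hg] using hk
  refine ⟨⟨⟨k / 4, by omega⟩, ⟨k % 4 % 2, by omega⟩⟩, ?_⟩
  rw [partner_mainEdge]
  simp only [mainEdge]
  omega

/-- The gluing of `a b a⁻¹ b⁻¹` identifies the five vertices of a block of four edges, and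
successive blocks share a vertex. For `g = 0` the folded disc has two distinct vertices. -/
lemma polyMk_vertex {g : ℕ} (hg : g ≠ 0) (k : ℕ) (hk : k ≤ edgeCount g) :
    polyMk g (edgePt g k 0) = polyMk g (edgePt g 0 0) := by
  have hN : edgeCount g = 4 * g := by simp [edgeCount, hg]
  have key : ∀ i < g, ∀ j ≤ 4, polyMk g (edgePt g (4 * i + j) 0) =
      polyMk g (edgePt g (4 * i) 0) := by
    intro i hi
    have h0 : (0 : ℝ) ∈ Set.Icc (0 : ℝ) 1 := by simp
    have h1 : (1 : ℝ) ∈ Set.Icc (0 : ℝ) 1 := by simp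
    have pa : partner g (4 * i) = 4 * i + 2 := by rw [partner, if_neg hg]; split_ifs <;> omega
    have pb : partner g (4 * i + 1) = 4 * i + 3 := by rw [partner, if_neg hg]; split_ifs <;> omega
    have a0 := polyMk_edgePt (g := g) (k := 4 * i) (by omega) h0
    have a1 := polyMk_edgePt (g := g) (k := 4 * i) (by omega) h1
    have b0 := polyMk_edgePt (g := g) (k := 4 * i + 1) (by omega) h0
    have b1 := polyMk_edgePt (g := g) (k := 4 * i + 1) (by omega) h1
    rw [pa, sub_zero, edgePt_one] at a0
    rw [pa, sub_self, edgePt_one] at a1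
    rw [pb, sub_zero, edgePt_one] at b0
    rw [pb, sub_self, edgePt_one] at b1
    intro j hj
    interval_cases j
    · rfl
    · exact a1.trans (b1.trans a0.symm)
    · exact b1.trans a0.symm
    · exact a0.symm
    · exact b0.symm.trans (a1.trans (b1.trans a0.symm))
  have key2 : ∀ i ≤ g, polyMk g (edgePt g (4 * i) 0) = polyMk g (edgePt g 0 0) := by
    intro i
    induction i with
    | zero => intro _; rfl
    | succ i ih =>
      intro hi
      rw [← ih (by omega), show 4 * (i + 1) = 4 * i + 4 by ring]
      exact key i (by omega) 4 le_rfl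
  rcases hk.lt_or_eq with h | h
  · rw [show k = 4 * (k / 4) + k % 4 by omega, key (k / 4) (by omega) (k % 4) (by omega)]
    exact key2 _ (by omega)
  · rw [h, hN]
    exact key2 g le_rfl

/-- The real function on the edges which increases by one along the edge `m`, and decreases by one
along the edge `m + 2`. -/
def edgeRamp (m k : ℕ) (s : ℝ) : ℝ :=
  if k < m then 0 else if k = m then s else if k < m + 2 then 1 else if k = m + 2 then 1 - s else 0

/-- A circle-valued function on the surface with winding number one along a given edge. -/
lemma exists_edgeFun {g : ℕ} (e : Fin g × Fin 2) : ∃ U : C(ClosedSurface g, Circle),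
    ∀ k < edgeCount g, ∀ s ∈ Set.Icc (0 : ℝ) 1,
      U (polyMk g (edgePt g k s)) = Circle.exp (2 * Real.pi * edgeRamp (mainEdge e) k s) := by
  set m := mainEdge e with hm
  have hm2 : m + 2 < edgeCount g := by
    rw [← partner_mainEdge]; exact partner_lt (mainEdge_lt e)
  obtain ⟨V, hVc, hV⟩ := exists_circle_of_edges (edgeCount_pos g) (W := edgeRamp m)
    (fun k hk => by
      unfold edgeRamp
      split_ifs <;> fun_prop)
    (fun k hk => by
      rcases (Nat.succ_le_of_lt hk).lt_or_eq with h | h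
      · rw [Nat.succ_eq_add_one] at h
        rw [Nat.mod_eq_of_lt h]
        unfold edgeRamp
        split_ifs <;> first | omega | norm_num
      · rw [Nat.succ_eq_add_one] at h
        rw [h, Nat.mod_self]
        unfold edgeRamp
        split_ifs <;> first | omega | norm_num)
  -- The ramp on the boundary is extended radially to a real function on the disc. Only `exp (2πiF)`
  -- descends: the ramp takes opposite edges `m`, `m + 2` to matching values and is the integer zero
  -- or one on the other edges.
  set F : Metric.closedBall (0 : ℂ) 1 → ℝ := fun x => ‖(x : ℂ)‖ * V (dirn x) with hF
  have hFc : Continuous F := by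
    obtain ⟨M, hM⟩ := (isCompact_range hVc).isBounded.exists_norm_le
    refine continuous_iff_continuousAt.2 fun x => ?_
    by_cases hx : (x : ℂ) = 0
    · rw [ContinuousAt, show F x = 0 by simp [hF, hx]]
      refine squeeze_zero_norm (a := fun x : Metric.closedBall (0 : ℂ) 1 => ‖(x : ℂ)‖ * M)
        (fun z => ?_) ?_
      · simp only [hF, norm_mul, norm_norm]
        gcongr
        exact hM _ ⟨_, rfl⟩
      · have : Continuous fun x : Metric.closedBall (0 : ℂ) 1 => ‖(x : ℂ)‖ * M := by fun_prop
        simpa [hx] using this.tendsto x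
    · exact (by fun_prop : ContinuousAt (fun x : Metric.closedBall (0 : ℂ) 1 => ‖(x : ℂ)‖) x).mul
        (hVc.continuousAt.comp (ContinuousAt.comp (g := dirn) (continuousAt_dirn hx)
          continuous_subtype_val.continuousAt))
  have hFe : ∀ k < edgeCount g, ∀ s ∈ Set.Icc (0 : ℝ) 1, F (edgePt g k s) = edgeRamp m k s :=
    fun k hk s hs => by
      simp only [hF]
      rw [coe_edgePt, dirn_circle, hV k hk s hs, Circle.norm_coe, one_mul]
  have hglue : ∀ k < edgeCount g, ∀ s ∈ Set.Icc (0 : ℝ) 1,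
      Circle.exp (2 * Real.pi * F (edgePt g k s)) =
        Circle.exp (2 * Real.pi * F (edgePt g (partner g k) (1 - s))) := fun k hk s hs => by
    have hs' : 1 - s ∈ Set.Icc (0 : ℝ) 1 := ⟨by linarith [hs.2], by linarith [hs.1]⟩
    rw [hFe k hk s hs, hFe _ (partner_lt hk) _ hs']
    have hpm : partner g m = m + 2 := partner_mainEdge e
    by_cases h1 : k = m
    · rw [h1, hpm]
      simp [edgeRamp]
    by_cases h2 : k = m + 2
    · rw [h2, ← hpm, partner_partner (mainEdge_lt e), ← hm, hpm]
      simp [edgeRamp]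
    have hint : ∀ k s, k ≠ m → k ≠ m + 2 → ∃ n : ℤ, edgeRamp m k s = n := fun k s h1 h2 => by
      unfold edgeRamp
      split_ifs
      exacts [⟨0, by simp⟩, ⟨1, by simp⟩, ⟨0, by simp⟩]
    obtain ⟨n, hn⟩ := hint k s h1 h2
    obtain ⟨n', hn'⟩ := hint (partner g k) (1 - s)
      (fun h => h2 (by rw [← hpm, ← h, partner_partner hk]))
      (fun h => h1 (by rw [← partner_partner hk, h, ← hpm, partner_partner (mainEdge_lt e)]))
    rw [hn, hn', circle_exp_two_pi_int, circle_exp_two_pi_int]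
  refine ⟨⟨polyLift (fun x => Circle.exp (2 * Real.pi * F x)) hglue,
    continuous_polyLift _ (by fun_prop)⟩, fun k hk s hs => ?_⟩
  show Circle.exp (2 * Real.pi * F (edgePt g k s)) = _
  rw [hFe k hk s hs]

/-- The function given by `exists_edgeFun`. -/
def edgeFun {g : ℕ} (e : Fin g × Fin 2) : C(ClosedSurface g, Circle) := (exists_edgeFun e).choose

lemma edgeFun_apply {g : ℕ} (e : Fin g × Fin 2) {k : ℕ} (hk : k < edgeCount g) {s : ℝ}
    (hs : s ∈ Set.Icc (0 : ℝ) 1) : edgeFun e (polyMk g (edgePt g k s)) =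
      Circle.exp (2 * Real.pi * edgeRamp (mainEdge e) k s) :=
  (exists_edgeFun e).choose_spec k hk s hs

lemma edgeFun_mainEdge {g : ℕ} (e e' : Fin g × Fin 2) {s : ℝ} (hs : s ∈ Set.Icc (0 : ℝ) 1) :
    edgeFun e (polyMk g (edgePt g (mainEdge e') s)) =
      Circle.exp (2 * Real.pi * if e' = e then s else 0) := by
  rw [edgeFun_apply e (mainEdge_lt e') hs]
  by_cases h : e' = e
  · simp [h, edgeRamp]
  · have h1 : mainEdge e' ≠ mainEdge e := fun h' => h (mainEdge_injective g h')
    have h2 : mainEdge e' ≠ mainEdge e + 2 := by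
      have := e.2.2
      have := e'.2.2
      simp only [mainEdge]
      omega
    unfold edgeRamp
    split_ifs
    · rfl
    · simp
    · rfl

/-- Continuous functions with Hausdorff target separate the points: `polyNorm` and `polyCoord` deal
with the open cell, the edge functions with the glued boundary, and for `g = 0` the real part does
so instead. -/
instance (g : ℕ) : T2Space (ClosedSurface g) := by
  have sep : ∀ x y : ClosedSurface g, polyNorm g x = polyNorm g y → polyCoord g x = polyCoord g y →
      (∀ e, edgeFun e x = edgeFun e y) → (g = 0 → ∀ F : Metric.closedBall (0 : ℂ) 1 → ℝ, ∀ hF,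
        Continuous F → polyLift (g := g) F hF x = polyLift (g := g) F hF y) → x = y := by
    intro x y h1 h2 h3 h4
    obtain ⟨x, rfl⟩ := (isQuotientMap_polyMk g).surjective x
    obtain ⟨y, rfl⟩ := (isQuotientMap_polyMk g).surjective y
    have hxy : ‖(x : ℂ)‖ = ‖(y : ℂ)‖ := h1
    rcases (mem_closedBall_zero_iff.1 x.2).lt_or_eq with hx | hx
    · congr 1
      apply Subtype.ext
      rw [← polyCoord_div (g := g) hx, ← polyCoord_div (g := g) (hxy ▸ hx), h1, h2]
    have hy : ‖(y : ℂ)‖ = 1 := hxy ▸ hx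
    rcases Nat.eq_zero_or_pos g with hg | hg
    · subst hg
      obtain ⟨t, rfl⟩ := exists_boundaryPoint hx
      obtain ⟨u, rfl⟩ := exists_boundaryPoint hy
      have hre : ∀ t, (boundaryPoint t : ℂ).re = Real.cos (2 * Real.pi * t) := fun t => by
        simp [boundaryPoint, Circle.coe_exp, Complex.exp_re]
      -- The fold identifies `t` with `-t` on the boundary, so the real part `cos (2πt)` descends
      -- and determines the class of a boundary point.
      have h5 := h4 rfl (fun x => (x : ℂ).re) (fun k hk s hs => by
        have hk2 : k < 2 := hk
        have h2 : (edgeCount 0 : ℝ) = 2 := by norm_num [edgeCount]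
        have h3 : ((partner 0 k : ℕ) : ℝ) = 1 - k := by
          interval_cases k <;> simp [partner]
        rw [edgePt, edgePt, hre, hre, h2, h3, ← Real.cos_neg, ← Real.cos_add_two_pi]
        congr 1
        ring) (by fun_prop)
      have h6 : Real.cos (2 * Real.pi * t) = Real.cos (2 * Real.pi * u) := by
        rw [← hre, ← hre]; exact h5
      obtain ⟨n, hn | hn⟩ := Real.cos_eq_cos_iff.1 h6
      · congr 1
        rw [show u = t + n by
          have := Real.pi_pos
          field_simp at hn
          linarith, boundaryPoint_add_int]
      · have : u = -t + n := by
          have := Real.pi_pos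
          field_simp at hn
          linarith
        rw [this, boundaryPoint_add_int]
        exact Quot.sound (PolygonGlue.fold rfl t)
    · have hg0 : g ≠ 0 := hg.ne'
      have norm_form : ∀ x : Metric.closedBall (0 : ℂ) 1, ‖(x : ℂ)‖ = 1 → ∃ e : Fin g × Fin 2,
          ∃ s ∈ Set.Icc (0 : ℝ) 1, polyMk g x = polyMk g (edgePt g (mainEdge e) s) := by
        intro x hx
        obtain ⟨k, hk, s, hs, rfl⟩ := exists_edgePt g hx
        have hs1 : s ∈ Set.Icc (0 : ℝ) 1 := ⟨hs.1, hs.2.le⟩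
        obtain ⟨e, rfl | rfl⟩ := exists_mainEdge hg0 hk
        · exact ⟨e, s, hs1, rfl⟩
        · refine ⟨e, 1 - s, ⟨by linarith [hs.2], by linarith [hs.1]⟩, ?_⟩
          rw [polyMk_edgePt hk hs1, partner_partner (mainEdge_lt e)]
      have vertex : ∀ e : Fin g × Fin 2, ∀ s ∈ Set.Icc (0 : ℝ) 1,
          Circle.exp (2 * Real.pi * s) = 1 →
          polyMk g (edgePt g (mainEdge e) s) = polyMk g (edgePt g 0 0) := by
        intro e s hs h
        obtain ⟨n, hn⟩ := exists_int_of_circle_exp_eq_one h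
        have hsn : s = n := mul_left_cancel₀ (by positivity) hn
        have h0 : (0 : ℤ) ≤ n := by exact_mod_cast hsn ▸ hs.1
        have h1 : n ≤ 1 := by exact_mod_cast hsn ▸ hs.2
        obtain rfl | rfl : n = 0 ∨ n = 1 := by omega
        · rw [hsn, Int.cast_zero]
          exact polyMk_vertex hg0 _ (mainEdge_lt e).le
        · rw [hsn, Int.cast_one, edgePt_one]
          exact polyMk_vertex hg0 _ (mainEdge_lt e)
      obtain ⟨e, s, hs, hxe⟩ := norm_form x hx
      obtain ⟨e', s', hs', hye⟩ := norm_form y hy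
      rw [hxe, hye]
      have h5 := h3 e
      have h6 := h3 e'
      rw [hxe, hye, edgeFun_mainEdge _ _ hs, edgeFun_mainEdge _ _ hs'] at h5 h6
      by_cases hee : e = e'
      · subst hee
        simp only [if_true] at h5
        obtain ⟨n, hn⟩ := Circle.exp_eq_exp.1 h5
        have hsn : s = s' + n := by
          have := Real.pi_pos
          field_simp at hn
          linarith
        rcases eq_or_ne n 0 with rfl | hn0
        · simp [hsn]
        -- Parameters in `[0, 1]` that differ by a nonzero integer are the two ends of the edge, and
        -- all vertices are identified.
        · have hsn1 : s - s' ≤ 1 := by linarith [hs.2, hs'.1]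
          have hsn2 : -1 ≤ s - s' := by linarith [hs.1, hs'.2]
          have h7 : n ≤ 1 := by exact_mod_cast (by linarith : (n : ℝ) ≤ 1)
          have h8 : -1 ≤ n := by exact_mod_cast (by push_cast; linarith : ((-1 : ℤ) : ℝ) ≤ n)
          have h9 : Circle.exp (2 * Real.pi * s) = 1 := by
            obtain rfl | rfl : n = 1 ∨ n = -1 := by omega
            · have : s = (1 : ℤ) := by push_cast at hsn ⊢; linarith [hs.2, hs'.1]
              rw [this, circle_exp_two_pi_int]
            · have : s = (0 : ℤ) := by push_cast at hsn ⊢; linarith [hs.1, hs'.2]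
              rw [this, circle_exp_two_pi_int]
          rw [vertex e s hs h9, vertex e s' hs' (by rw [← h5, h9])]
      -- Each of the two edge functions is one along the other edge, which forces both points to be
      -- vertices.
      · rw [if_pos rfl, if_neg (Ne.symm hee), mul_zero, Circle.exp_zero] at h5
        rw [if_pos rfl, if_neg hee, mul_zero, Circle.exp_zero] at h6
        rw [vertex e s hs h5, vertex e' s' hs' h6.symm]
  refine ⟨fun x y hxy => ?_⟩
  by_contra hsep
  refine hxy (sep x y ?_ ?_ (fun e => ?_) fun _ F hF hFc => ?_) <;> by_contra h <;>
    refine hsep (separated_by_continuous ?_ h)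
  exacts [continuous_polyNorm g, continuous_polyCoord g, (edgeFun e).continuous,
    continuous_polyLift _ hFc]

end SpinQuotient

/-! ### Winding numbers along the edges, and logarithms on the closed surface. -/

namespace SpinQuotient
open Filter Topology

/-- `n` is the winding number of `f` along the edge `k`. -/
def IsWinding {g : ℕ} (f : ClosedSurface g → Circle) (k : ℕ) (n : ℤ) : Prop :=
  ∃ L : ℝ → ℝ, ContinuousOn L (Set.Icc 0 1) ∧
    (∀ s ∈ Set.Icc (0 : ℝ) 1, Circle.exp (L s) = f (polyMk g (edgePt g k s))) ∧
    L 1 - L 0 = 2 * Real.pi * n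

lemma IsWinding.mul {g k : ℕ} {f f' : ClosedSurface g → Circle} {n n' : ℤ}
    (h : IsWinding f k n) (h' : IsWinding f' k n') : IsWinding (f * f') k (n + n') := by
  obtain ⟨L, hL, hLf, hLn⟩ := h
  obtain ⟨L', hL', hLf', hLn'⟩ := h'
  refine ⟨L + L', hL.add hL', fun s hs => ?_, ?_⟩
  · rw [Pi.add_apply, Circle.exp_add, hLf s hs, hLf' s hs, Pi.mul_apply]
  · simp only [Pi.add_apply]
    push_cast
    linarith

lemma IsWinding.zpow {g k : ℕ} {f : ClosedSurface g → Circle} {n : ℤ}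
    (h : IsWinding f k n) (m : ℤ) : IsWinding (f ^ m) k (m * n) := by
  obtain ⟨L, hL, hLf, hLn⟩ := h
  refine ⟨fun s => m * L s, continuousOn_const.mul hL, fun s hs => ?_, ?_⟩
  · rw [Pi.pow_apply, ← hLf s hs, ← Circle.exp_zsmul, zsmul_eq_mul]
  · push_cast
    linear_combination (m : ℝ) * hLn

lemma IsWinding.unique {g k : ℕ} {f : ClosedSurface g → Circle} {n n' : ℤ}
    (h : IsWinding f k n) (h' : IsWinding f k n') : n = n' := by
  obtain ⟨L, hL, hLf, hLn⟩ := h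
  obtain ⟨L', hL', hLf', hLn'⟩ := h'
  obtain ⟨m, hm⟩ := exists_int_of_circle_exp_eq_one_on isPreconnected_Icc (hL.sub hL')
    fun s hs => by
      show Circle.exp (L s - L' s) = 1
      rw [Circle.exp_sub, hLf s hs, hLf' s hs, div_self']
  have h0 : L 0 - L' 0 = _ := hm 0 (by simp)
  have h1 : L 1 - L' 1 = _ := hm 1 (by simp)
  have : 2 * Real.pi * (n : ℝ) = 2 * Real.pi * n' := by linarith
  exact_mod_cast mul_left_cancel₀ (by positivity) this

lemma isWinding_edgeFun {g : ℕ} (e e' : Fin g × Fin 2) :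
    IsWinding (edgeFun e) (mainEdge e') (if e' = e then 1 else 0) := by
  refine ⟨fun s => 2 * Real.pi * if e' = e then s else 0, ?_, fun s hs => ?_, ?_⟩
  · split_ifs <;> fun_prop
  · rw [edgeFun_mainEdge e e' hs]
  · split_ifs <;> simp

lemma isWinding_prod {g : ℕ} (n : Fin g × Fin 2 → ℤ) (e' : Fin g × Fin 2) :
    IsWinding (fun x => ∏ e, edgeFun e x ^ n e) (mainEdge e') (n e') := by
  classical
  have key : ∀ t : Finset (Fin g × Fin 2), IsWinding (fun x => ∏ e ∈ t, edgeFun e x ^ n e)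
      (mainEdge e') (∑ e ∈ t, n e * if e' = e then 1 else 0) := by
    intro t
    induction t using Finset.induction_on with
    | empty => exact ⟨0, continuousOn_const, by simp, by simp⟩
    | insert e t het ih =>
      have h1 := ((isWinding_edgeFun e e').zpow (n e)).mul ih
      rw [Finset.sum_insert het]
      convert! h1 using 2 with x
      rw [Finset.prod_insert het]
      rfl
  simpa using key Finset.univ

/-- A continuous circle-valued function on the surface has a logarithm on the polygon. -/
lemma exists_polygon_log {g : ℕ} (f : C(ClosedSurface g, Circle)) :
    ∃ v : C(Metric.closedBall (0 : ℂ) 1, ℝ), ∀ x, Circle.exp (v x) = f (polyMk g x) := by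
  obtain ⟨v, hv⟩ := exists_circle_lift (Y := ℂ) ⟨fun z => f (polyMk g (discRetr z)),
    f.continuous.comp ((isQuotientMap_polyMk g).continuous.comp continuous_discRetr)⟩
  refine ⟨⟨fun x => v x, by fun_prop⟩, fun x => ?_⟩
  have := hv x
  simpa [discRetr_coe] using this

/-- Both ends of an edge are the one vertex of the surface, so a logarithm changes by a multiple of
`2π` along it. -/
lemma exists_winding {g : ℕ} (f : C(ClosedSurface g, Circle)) (e : Fin g × Fin 2) :
    ∃ n, IsWinding f (mainEdge e) n := by
  have hg : g ≠ 0 := by have := e.1.2; omega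
  obtain ⟨v, hv⟩ := exists_polygon_log f
  obtain ⟨n, hn⟩ := exists_int_of_circle_exp_eq_one
    (x := v (edgePt g (mainEdge e) 1) - v (edgePt g (mainEdge e) 0)) (by
      rw [Circle.exp_sub, hv, hv, edgePt_one, polyMk_vertex hg _ (mainEdge_lt e),
        polyMk_vertex hg _ (mainEdge_lt e).le, div_self'])
  exact ⟨n, fun s => v (edgePt g (mainEdge e) s), (by fun_prop), fun s _ => hv _, hn⟩

/-- A function with zero winding numbers along the main edges has a logarithm. -/
lemma exists_log_of_isWinding_zero {g : ℕ} (f : C(ClosedSurface g, Circle))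
    (hf : ∀ e : Fin g × Fin 2, IsWinding f (mainEdge e) 0) :
    ∃ y : C(ClosedSurface g, ℝ), ∀ x, f x = Circle.exp (y x) := by
  obtain ⟨v, hv⟩ := exists_polygon_log f
  set L : ℕ → ℝ → ℝ := fun k s => v (edgePt g k s) with hL
  have hLc : ∀ k, Continuous (L k) := fun k => by fun_prop
  have hLf : ∀ k s, Circle.exp (L k s) = f (polyMk g (edgePt g k s)) := fun k s => hv _
  have hstep : ∀ k, L k 1 = L (k + 1) 0 := fun k => by simp only [hL, edgePt_one]
  -- The constant in `edge_log_sub` is its value at `s = 0`, which compares the start of the edge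
  -- `k` with the end of its partner. Once these agree, the logarithm respects the gluing. When `g`
  -- is positive, vanishing winding numbers make it equal at all vertices.
  have hvert : ∀ k < edgeCount g, L k 0 = L (partner g k + 1) 0 := by
    rcases Nat.eq_zero_or_pos g with rfl | hg
    · intro k hk
      have hk2 : k < 2 := hk
      have h2 : L 2 0 = L 0 0 := by
        have := edgePt_edgeCount 0
        simp only [hL]
        exact congrArg v this
      interval_cases k
      · exact h2.symm
      · rfl
    · have hg0 : g ≠ 0 := hg.ne'
      have hmain : ∀ e : Fin g × Fin 2, L (mainEdge e) 1 - L (mainEdge e) 0 = 0 := fun e => by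
        have h1 : IsWinding f (mainEdge e) 0 := hf e
        obtain ⟨n, hn⟩ := exists_int_of_circle_exp_eq_one
          (x := L (mainEdge e) 1 - L (mainEdge e) 0) (by
            rw [Circle.exp_sub, hLf, hLf, edgePt_one, polyMk_vertex hg0 _ (mainEdge_lt e),
              polyMk_vertex hg0 _ (mainEdge_lt e).le, div_self'])
        have h2 : IsWinding f (mainEdge e) n :=
          ⟨L (mainEdge e), (hLc _).continuousOn, fun s _ => hLf _ s, hn⟩
        rw [hn, h2.unique h1]
        simp
      have hall : ∀ k < edgeCount g, L k 1 = L k 0 := fun k hk => by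
        obtain ⟨e, rfl | rfl⟩ := exists_mainEdge hg0 hk
        · linarith [hmain e]
        · linarith [edge_change_add hLc hLf (mainEdge_lt e), hmain e]
      have hzero : ∀ k ≤ edgeCount g, L k 0 = L 0 0 := fun k => by
        induction k with
        | zero => intro _; rfl
        | succ k ih => intro hk; rw [← hstep, hall k hk, ih (by omega)]
      intro k hk
      rw [hzero k hk.le, hzero _ (partner_lt hk)]
  have hglue : ∀ k < edgeCount g, ∀ s ∈ Set.Icc (0 : ℝ) 1,
      v (edgePt g k s) = v (edgePt g (partner g k) (1 - s)) := fun k hk s hs => by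
    obtain ⟨n, hn⟩ := edge_log_sub hLc hLf hk
    have h0 := hn 0 (by simp)
    rw [sub_zero, hstep, ← hvert k hk, sub_self] at h0
    have := hn s hs
    rw [← h0] at this
    exact sub_eq_zero.1 this
  refine ⟨⟨polyLift v hglue, continuous_polyLift _ v.continuous⟩, fun x => ?_⟩
  obtain ⟨x, rfl⟩ := (isQuotientMap_polyMk g).surjective x
  exact (hv x).symm

/-- The edge functions span the circle-valued functions, up to functions with a logarithm. -/
lemma exists_edgeFun_prod {g : ℕ} (f : C(ClosedSurface g, Circle)) :
    ∃ (n : Fin g × Fin 2 → ℤ) (y : C(ClosedSurface g, ℝ)),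
      ∀ x, f x = (∏ e, edgeFun e x ^ n e) * Circle.exp (y x) := by
  choose n hn using exists_winding f
  set f' : C(ClosedSurface g, Circle) := ⟨fun x => f x * (∏ e, edgeFun e x ^ n e) ^ (-1 : ℤ), by
    have h1 : Continuous fun x => ∏ e, edgeFun e x ^ n e :=
      continuous_finsetProd _ fun e _ => (edgeFun e).continuous.zpow _
    exact f.continuous.mul (h1.zpow _)⟩ with hf'
  obtain ⟨y, hy⟩ := exists_log_of_isWinding_zero f' fun e => by
    have := (hn e).mul ((isWinding_prod n e).zpow (-1))
    rwa [show n e + -1 * n e = 0 by ring] at this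
  refine ⟨n, y, fun x => ?_⟩
  rw [← hy x]
  show _ = _ * (f x * _ ^ (-1 : ℤ))
  rw [_root_.zpow_neg_one, mul_comm (f x), mul_inv_cancel_left]

/-- The winding number of the product along `mainEdge e` is `n e`, and that of `w ^ 2` is twice that
of `w`. -/
lemma even_of_sq_eq_edgeFun_prod {g : ℕ} {w : C(ClosedSurface g, Circle)}
    {n : Fin g × Fin 2 → ℤ} (h : ∀ x, w x ^ 2 = ∏ e, edgeFun e x ^ n e) (e : Fin g × Fin 2) :
    Even (n e) := by
  obtain ⟨m, hm⟩ := exists_winding w e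
  have h1 := hm.zpow 2
  rw [show ((w : ClosedSurface g → Circle) ^ (2 : ℤ)) = fun x => ∏ e, edgeFun e x ^ n e from
    funext fun x => by rw [← h x, Pi.pow_apply, _root_.zpow_ofNat]] at h1
  exact ⟨m, by rw [(isWinding_prod n e).unique h1]; ring⟩

end SpinQuotient

/-! ### Removable singularities and square roots near punctures. -/

namespace SpinQuotient
open Filter Topology

variable {S : Type*} [TopologicalSpace S]

lemma PuncCont.of_continuousAt {f : S → Circle} {p : S} (hf : ∀ᶠ x in 𝓝 p, ContinuousAt f x) :
    PuncCont f p :=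
  hf.filter_mono nhdsWithin_le_nhds

lemma puncCont_prod {ι : Type*} (s : Finset ι) {f : ι → S → Circle} {p : S} (n : ι → ℤ)
    (hf : ∀ i ∈ s, PuncCont (f i) p) : PuncCont (∏ i ∈ s, f i ^ n i) p := by
  classical
  induction s using Finset.induction_on with
  | empty => exact Eventually.of_forall fun x => (continuousAt_const :
      ContinuousAt (fun _ : S => (1 : Circle)) x)
  | insert i s hi ih =>
    rw [Finset.prod_insert hi]
    exact ((hf i (by simp)).zpow _).mul (ih fun j hj => hf j (by simp [hj]))

lemma degAt_one (hS : LocallyPlanar S) (p : S) : degAt (1 : S → Circle) p = 0 :=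
  (degAt_eq_zero_iff hS (Eventually.of_forall fun _ => continuousAt_const)).2
    (hasLogAt_of_continuousAt (Eventually.of_forall fun _ => continuousAt_const))

lemma degAt_prod (hS : LocallyPlanar S) {ι : Type*} (s : Finset ι) {f : ι → S → Circle} {p : S}
    (n : ι → ℤ) (hf : ∀ i ∈ s, PuncCont (f i) p) :
    degAt (∏ i ∈ s, f i ^ n i) p = ∑ i ∈ s, n i * degAt (f i) p := by
  classical
  induction s using Finset.induction_on with
  | empty => simpa using degAt_one hS p
  | insert i s hi ih =>
    have h1 : ∀ j ∈ s, PuncCont (f j) p := fun j hj => hf j (by simp [hj])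
    rw [Finset.prod_insert hi, Finset.sum_insert hi,
      degAt_mul hS ((hf i (by simp)).zpow _) (puncCont_prod s n h1),
      degAt_zpow hS (hf i (by simp)), ih h1]

lemma degAt_exp (hS : LocallyPlanar S) {y : S → ℝ} {p : S}
    (hy : ∀ᶠ x in 𝓝[≠] p, ContinuousAt y x) : degAt (fun x => Circle.exp (y x)) p = 0 :=
  (degAt_eq_zero_iff hS (hy.mono fun _ hx => (Circle.exp.continuous.continuousAt.comp hx :))).2
    (hasLogAt_exp hy)

lemma continuousAt_prod {ι : Type*} (s : Finset ι) {f : ι → S → Circle} {p : S} (n : ι → ℤ)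
    (hf : ∀ i ∈ s, ContinuousAt (f i) p) : ContinuousAt (∏ i ∈ s, f i ^ n i) p := by
  rw [show (∏ i ∈ s, f i ^ n i) = fun x => ∏ i ∈ s, f i x ^ n i from
    funext fun x => by simp]
  exact tendsto_finsetProd s fun i hi => (hf i hi).zpow _

lemma mul_self_of_abs_eq_one {a : ℤ} (h : |a| = 1) : a * a = 1 := by
  rw [← abs_mul_abs_self, h, one_mul]

/-- The singularities in `D` are removed one at a time. Each correction is the exponential of a
function continuous off the point removed, hence has degree zero at the remaining ones and leaves
their degrees unchanged. -/
lemma exists_extension_of_degAt_eq_zero [T4Space S] (hS : LocallyPlanar S) (D : Finset S) :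
    ∀ {A : Set S} {f : S → Circle}, A.Finite → (∀ x ∉ A, ContinuousAt f x) →
    (∀ p ∈ D, degAt f p = 0) → ∃ (f' : S → Circle) (y : S → ℝ),
      (∀ x ∉ D, ContinuousAt y x) ∧ (∀ x ∉ D, f' x = f x * Circle.exp (y x)) ∧
      ∀ x, x ∉ A ∨ x ∈ D → ContinuousAt f' x := by
  classical
  induction D using Finset.induction_on with
  | empty =>
    intro A f hA hf h0
    exact ⟨f, 0, fun _ _ => continuousAt_const, fun x _ => by simp, fun x hx => hf x (by simpa using hx)⟩
  | insert p D hp ih =>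
    intro A f hA hf h0
    obtain ⟨f₁, y₁, hy₁, hf₁, hc₁⟩ := exists_function_extension
      ((degAt_eq_zero_iff hS (puncCont_of_finite hA hf p)).1 (h0 p (by simp)))
    have hA' : (A \ {p}).Finite := hA.subset Set.sdiff_subset
    have hcont : ∀ x ∉ A \ {p}, ContinuousAt f₁ x := fun x hx => by
      by_cases hxp : x = p
      · rw [hxp]; exact hc₁
      · have hxA : x ∉ A := fun h => hx ⟨h, hxp⟩
        have : f₁ =ᶠ[𝓝 x] fun x => f x * Circle.exp (y₁ x) :=
          (isOpen_ne.mem_nhds hxp : {z | z ≠ p} ∈ 𝓝 x) |> fun h => by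
            filter_upwards [h] with z hz using hf₁ z hz
        exact ((hf x hxA).mul (Circle.exp.continuous.continuousAt.comp (hy₁ x hxp))).congr this.symm
    have hdeg : ∀ q ∈ D, degAt f₁ q = 0 := fun q hq => by
      have hqp : q ≠ p := fun h => hp (h ▸ hq)
      have hne : ∀ᶠ x in 𝓝[≠] q, x ≠ p :=
        (isOpen_ne.mem_nhds hqp : {z | z ≠ p} ∈ 𝓝 q) |> fun h => nhdsWithin_le_nhds h
      have hy : ∀ᶠ x in 𝓝[≠] q, ContinuousAt y₁ x := hne.mono hy₁
      have h1 := degAt_mul hS (puncCont_of_finite hA hf q)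
        (hy.mono fun _ hx => (Circle.exp.continuous.continuousAt.comp hx :) :
          PuncCont (fun x => Circle.exp (y₁ x)) q)
      rw [degAt_exp hS hy, h0 q (by simp [hq]), add_zero] at h1
      rw [← h1]
      refine degAt_congr hS ((puncCont_of_finite hA hf q).mul
        (hy.mono fun _ hx => (Circle.exp.continuous.continuousAt.comp hx :))) ?_
      filter_upwards [hne] with x hx using (hf₁ x hx).symm
    obtain ⟨f', y, hy, hf', hc⟩ := ih hA' hcont hdeg
    refine ⟨f', y₁ + y, fun x hx => ?_, fun x hx => ?_, fun x hx => ?_⟩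
    · simp only [Finset.mem_insert, not_or] at hx
      exact (hy₁ x hx.1).add (hy x hx.2)
    · simp only [Finset.mem_insert, not_or] at hx
      rw [hf' x hx.2, hf₁ x hx.1, Pi.add_apply, Circle.exp_add, mul_assoc]
    · by_cases hxp : x = p
      · exact hc x (Or.inl fun h => h.2 hxp)
      · refine hc x (hx.imp (fun h h' => h h'.1) fun h => ?_)
        simpa [hxp] using h

section Square

lemma isPreconnected_punctured_ball (ε : ℝ) :
    IsPreconnected (Metric.ball (0 : ℂ) ε \ {0}) := by
  have : (fun a : ℝ × ℝ => (a.1 : ℂ) * Circle.exp a.2) '' (Set.Ioo 0 ε ×ˢ Set.univ) =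
      Metric.ball (0 : ℂ) ε \ {0} := by
    ext z
    constructor
    · rintro ⟨⟨s, θ⟩, ⟨⟨h0, h1⟩, -⟩, rfl⟩
      simp only [Set.mem_sdiff, mem_ball_zero_iff, norm_mul, Circle.norm_coe, mul_one,
        Complex.norm_real, Real.norm_eq_abs, abs_of_pos h0, Set.mem_singleton_iff]
      exact ⟨h1, mul_ne_zero (by exact_mod_cast h0.ne') (Circle.coe_ne_zero _)⟩
    · rintro ⟨h1, h0⟩
      rw [mem_ball_zero_iff] at h1
      refine ⟨(‖z‖, z.arg), ⟨⟨norm_pos_iff.2 h0, h1⟩, trivial⟩, ?_⟩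
      simp only [Circle.coe_exp]
      exact Complex.norm_mul_exp_arg_mul_I z
  rw [← this]
  exact (isPreconnected_Ioo.prod isPreconnected_univ).image _
    (by fun_prop)

lemma exists_isPreconnected_punctured (hS : LocallyPlanar S) {p : S} {P : S → Prop}
    (hP : ∀ᶠ x in 𝓝[≠] p, P x) : ∃ A ∈ 𝓝[≠] p, IsPreconnected A ∧ A.Nonempty ∧ ∀ x ∈ A, P x := by
  obtain ⟨e, hp, h0⟩ := hS p
  have h1 : ∀ᶠ z in 𝓝 (0 : ℂ), z ∈ e.target ∧ (e.symm z ≠ p → P (e.symm z)) := by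
    have ht : (0 : ℂ) ∈ e.target := h0 ▸ e.map_source hp
    have hs : e.symm 0 = p := by rw [← h0, e.left_inv hp]
    have hc : Tendsto e.symm (𝓝 0) (𝓝 p) := hs ▸ (e.continuousAt_symm ht)
    exact (e.open_target.eventually_mem ht).and (hc.eventually (eventually_nhdsWithin_iff.1 hP))
  obtain ⟨ε, hε, hball⟩ := Metric.eventually_nhds_iff_ball.1 h1
  refine ⟨e.symm '' (Metric.ball 0 ε \ {0}), ?_, ?_, ?_, ?_⟩
  · have h2 : ∀ᶠ x in 𝓝 p, x ∈ e.source ∧ e x ∈ Metric.ball 0 ε :=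
      (e.open_source.eventually_mem hp).and ((e.continuousAt hp).eventually
        (h0 ▸ Metric.ball_mem_nhds _ hε))
    filter_upwards [nhdsWithin_le_nhds h2, self_mem_nhdsWithin] with x hx hxp
    refine ⟨e x, ⟨hx.2, fun h => hxp ?_⟩, e.left_inv hx.1⟩
    exact e.injOn hx.1 hp (h.trans h0.symm)
  · exact (isPreconnected_punctured_ball ε).image _
      (e.continuousOn_symm.mono fun z hz => (hball z hz.1).1)
  · refine ⟨_, (ε / 2 : ℂ), ⟨?_, ?_⟩, rfl⟩
    · rw [mem_ball_zero_iff]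
      simp [abs_of_pos hε]
      linarith
    · simp [hε.ne']
  · rintro _ ⟨z, hz, rfl⟩
    refine (hball z hz.1).2 fun h => hz.2 ?_
    rw [Set.mem_singleton_iff, ← e.right_inv (hball z hz.1).1, h, h0]

/-- A square root of a continuous function, defined off a point, extends to that point. -/
lemma exists_tendsto_of_sq_eq (hS : LocallyPlanar S) {v P : S → Circle} {p : S}
    (hv : PuncCont v p) (hP : ∀ᶠ x in 𝓝 p, ContinuousAt P x)
    (h : ∀ᶠ x in 𝓝[≠] p, v x ^ 2 = P x) : ∃ a, a ^ 2 = P p ∧ Tendsto v (𝓝[≠] p) (𝓝 a) := by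
  set b := Circle.exp (Complex.arg (P p) / 2) with hb
  have hb2 : b ^ 2 = P p := by
    rw [hb, pow_two, ← Circle.exp_add, add_halves, Circle.exp_arg]
  -- A square root of `P` continuous near `p`. On a connected punctured neighbourhood `v` is either
  -- `r` or `-r`, and so has a limit.
  set r : S → Circle := fun x => b * Circle.exp (Complex.arg ((P x / P p : Circle) : ℂ) / 2) with hr
  have hr2 : ∀ x, r x ^ 2 = P x := fun x => by
    rw [hr]
    simp only
    rw [mul_pow, hb2, pow_two (Circle.exp _), ← Circle.exp_add, add_halves]
    exact (circle_exp_arg_div _ _).symm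
  have hrc : ∀ᶠ x in 𝓝 p, ContinuousAt r x := by
    filter_upwards [hP, hP.self_of_nhds.eventually (eventually_circle_slitPlane (P p))] with x h1 h2
    refine continuousAt_const.mul (Circle.exp.continuous.continuousAt.comp
      (ContinuousAt.div_const ?_ 2))
    have h3 : ContinuousAt (fun x => P x / P p) x := h1.div' continuousAt_const
    have h4 : ContinuousAt (fun x => ((P x / P p : Circle) : ℂ)) x :=
      continuous_subtype_val.continuousAt.comp h3
    exact ContinuousAt.comp (g := Complex.arg) (Complex.continuousAt_arg h2) h4
  have hrp : r p = b := by simp [hr]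
  obtain ⟨A, hA, hAc, -, hAP⟩ := exists_isPreconnected_punctured hS
    (hv.and ((hrc.filter_mono nhdsWithin_le_nhds).and h))
  have key := hAc.eq_or_eq_neg_of_sq_eq (f := fun x => (v x : ℂ)) (g := fun x => (r x : ℂ))
    (fun x hx => (continuous_subtype_val.continuousAt.comp (hAP x hx).1).continuousWithinAt)
    (fun x hx => (continuous_subtype_val.continuousAt.comp (hAP x hx).2.1).continuousWithinAt)
    (fun x hx => by
      have := congrArg (fun c : Circle => (c : ℂ)) ((hAP x hx).2.2.trans (hr2 x).symm)
      simpa using this)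
    (fun _ => Circle.coe_ne_zero _)
  have hrt : Tendsto r (𝓝[≠] p) (𝓝 b) :=
    hrp ▸ (hrc.self_of_nhds.mono_left nhdsWithin_le_nhds)
  rcases key with key | key
  · refine ⟨b, hb2, hrt.congr' ?_⟩
    filter_upwards [hA] with x hx using (Circle.ext (key hx)).symm
  · refine ⟨-b, by rw [neg_sq, hb2], hrt.neg.congr' ?_⟩
    filter_upwards [hA] with x hx using (Circle.ext (by simpa using key hx)).symm

/-- Used to pass from a square root on the punctured surface to one on the closed surface, where
winding numbers along the edges decide. -/
lemma exists_extension_of_sq_eq [T1Space S] (hS : LocallyPlanar S) {C : Set S} (hC : C.Finite)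
    {v : S → Circle} {P : C(S, Circle)} (hv : ∀ x ∉ C, ContinuousAt v x)
    (h : ∀ x ∉ C, v x ^ 2 = P x) : ∃ w : C(S, Circle), ∀ x, w x ^ 2 = P x := by
  classical
  have hCc : ∀ p, ∀ᶠ x in 𝓝[≠] p, x ∉ C := fun p => by
    have h1 : IsOpen (C \ {p})ᶜ := (hC.subset Set.sdiff_subset).isClosed.isOpen_compl
    have h2 : (C \ {p})ᶜ ∈ 𝓝 p := h1.mem_nhds (by simp)
    filter_upwards [nhdsWithin_le_nhds h2, self_mem_nhdsWithin] with x hx hxp hxC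
    exact hx ⟨hxC, hxp⟩
  choose a ha hat using fun p => exists_tendsto_of_sq_eq hS (P := P) (p := p)
    (puncCont_of_finite hC hv p) (Eventually.of_forall fun x => P.continuous.continuousAt)
    ((hCc p).mono h)
  have hav : ∀ x ∉ C, ∀ᶠ z in 𝓝 x, z ∉ C := fun x hx => hC.isClosed.isOpen_compl.mem_nhds hx
  refine ⟨⟨fun x => if x ∈ C then a x else v x, continuous_iff_continuousAt.2 fun x => ?_⟩,
    fun x => ?_⟩
  · by_cases hx : x ∈ C
    · rw [← continuousWithinAt_compl_self]
      show Tendsto _ _ (𝓝 (if x ∈ C then a x else v x))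
      rw [if_pos hx]
      refine (hat x).congr' ?_
      filter_upwards [hCc x] with z hz
      rw [if_neg hz]
    · refine (hv x hx).congr ?_
      filter_upwards [hav x hx] with z hz
      rw [if_neg hz]
  · show (if x ∈ C then a x else v x) ^ 2 = P x
    split_ifs with hx
    · exact ha x
    · exact h x hx

end Square

end SpinQuotient

/-! ### Generators of the circle-valued functions on the punctured surface. -/

namespace SpinQuotient
open Filter Topology

/-- A function with singularities at `p` and `q` only, of degree `±1` there. -/
def dipoleFun {S : Type*} [TopologicalSpace S] (p q : S) : S → Circle :=
  open Classical in if h : HasDipole p q then h.choose else 1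

section

variable {g : ℕ}

instance : DecidableEq (ClosedSurface g) := Classical.decEq _

lemma dipoleFun_spec (hS : LocallyPlanar (ClosedSurface g)) {p q : ClosedSurface g} (hpq : p ≠ q) :
    (∀ x, x ≠ p → x ≠ q → ContinuousAt (dipoleFun p q) x) ∧ |degAt (dipoleFun p q) p| = 1 ∧
      |degAt (dipoleFun p q) q| = 1 := by
  have h := hasDipole hS hpq
  rw [dipoleFun, dif_pos h]
  exact h.choose_spec

lemma degAt_dipoleFun_of_ne (hS : LocallyPlanar (ClosedSurface g)) {p q x : ClosedSurface g}
    (hpq : p ≠ q) (hp : x ≠ p)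
    (hq : x ≠ q) : degAt (dipoleFun p q) x = 0 :=
  degAt_eq_zero_of_notMem hS (C := {p, q}) (by simp)
    (fun y hy => (dipoleFun_spec hS hpq).1 y (fun h => hy (by simp [h])) fun h => hy (by simp [h]))
    (by simp [hp, hq])

lemma puncCont_dipoleFun (hS : LocallyPlanar (ClosedSurface g)) {p q : ClosedSurface g}
    (hpq : p ≠ q) (x : ClosedSurface g) :
    PuncCont (dipoleFun p q) x :=
  puncCont_of_pair (dipoleFun_spec hS hpq).1 x

/-- On the closed surface, a function with only one singularity has degree zero there. -/
lemma degAt_eq_zero_of_forall_ne (hS : LocallyPlanar (ClosedSurface g))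
    {f : ClosedSurface g → Circle} {p : ClosedSurface g}
    (hf : ∀ x ≠ p, ContinuousAt f x) : degAt f p = 0 := by
  have hfp : ∀ x, PuncCont f x := puncCont_of_finite (C := {p}) (by simp) fun x hx => hf x hx
  by_cases hp : p = polyCenter g
  · subst hp
    exact (degAt_eq_zero_iff hS (hfp _)).2 (hasLogAt_polyCenter hf)
  have hpc : polyCenter g ≠ p := Ne.symm hp
  obtain ⟨huc, hu0, hup⟩ := dipoleFun_spec hS hpc
  set u := dipoleFun (polyCenter g) p with hu
  have hupc : ∀ x, PuncCont u x := puncCont_dipoleFun hS hpc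
  -- Since the degree of the dipole at `p` is `±1`, this exponent cancels the degree of `f` at `p`
  -- and moves the singularity to the centre.
  set k := -(degAt f p * degAt u p) with hk
  set f₁ := f * u ^ k with hf₁
  have hc₁ : ∀ x ∉ ({polyCenter g, p} : Set (ClosedSurface g)), ContinuousAt f₁ x := fun x hx => by
    simp only [Set.mem_insert_iff, Set.mem_singleton_iff, not_or] at hx
    exact (hf x hx.2).mul ((huc x hx.1 hx.2).zpow k)
  have hd : ∀ x, degAt f₁ x = degAt f x + k * degAt u x := fun x => by
    rw [hf₁, degAt_mul hS (hfp x) ((hupc x).zpow _), degAt_zpow hS (hupc x)]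
  obtain ⟨f', y, hy, hf', hc'⟩ := exists_extension_of_degAt_eq_zero hS {p} (A := {polyCenter g, p})
    (by simp) hc₁ (fun q hq => by
      rw [Finset.mem_singleton.1 hq, hd, hk]
      linear_combination -degAt f p * mul_self_of_abs_eq_one hup)
  -- Now the centre is the only possible singularity, so `hasLogAt_polyCenter` applies. The degree
  -- there is also `k` times `±1`, which forces `degAt f p = 0`.
  have h0' : degAt f' (polyCenter g) = 0 := by
    have : ∀ x ≠ polyCenter g, ContinuousAt f' x := fun x hx => hc' x (by
      by_cases hxp : x = p
      · right; simp [hxp]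
      · left; simp [hx, hxp])
    exact (degAt_eq_zero_iff hS (puncCont_of_finite (C := {polyCenter g}) (by simp)
      (fun x hx => this x hx) _)).2 (hasLogAt_polyCenter this)
  have hne : ∀ᶠ x in 𝓝[≠] (polyCenter g), x ∉ ({p} : Finset (ClosedSurface g)) :=
    ((isOpen_ne.eventually_mem hpc : ∀ᶠ x in 𝓝 (polyCenter g), x ∈ {z | z ≠ p}).filter_mono
      nhdsWithin_le_nhds).mono fun x hx => by simpa using hx
  have hye : ∀ᶠ x in 𝓝[≠] (polyCenter g), ContinuousAt y x := hne.mono hy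
  have hyp : PuncCont (fun x => Circle.exp (y x)) (polyCenter g) :=
    hye.mono fun _ hx => (Circle.exp.continuous.continuousAt.comp hx :)
  have h1 := degAt_mul hS (puncCont_of_finite (by simp) hc₁ (polyCenter g)) hyp
  rw [degAt_exp hS hye, add_zero] at h1
  have h2 : degAt f' (polyCenter g) = degAt f₁ (polyCenter g) := by
    rw [← h1]
    refine degAt_congr hS ((puncCont_of_finite (by simp) hc₁ _).mul hyp) ?_
    filter_upwards [hne] with x hx using (hf' x hx).symm
  rw [h0', hd, degAt_eq_zero_of_notMem hS (C := {p}) (by simp) (fun x hx => hf x hx)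
    (by simpa using hpc), zero_add, hk] at h2
  have hu0' := mul_self_of_abs_eq_one hu0
  have hup' := mul_self_of_abs_eq_one hup
  have h3 : degAt f p * degAt u p * degAt u (polyCenter g) = 0 := by linarith
  rcases mul_eq_zero.1 h3 with h3 | h3
  · rcases mul_eq_zero.1 h3 with h3 | h3
    · exact h3
    · rw [h3] at hup'; simp at hup'
  · rw [h3] at hu0'; simp at hu0'

/-- A twist on the closed surface has a section off any given point. -/
lemma IsTwist.exists_section_off {τ : ClosedSurface g → ClosedSurface g → Circle} (hτ : IsTwist τ)
    (hS : LocallyPlanar (ClosedSurface g))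
    (c : ClosedSurface g) : ∃ h, ∀ y ≠ c, IsSectionAt τ h y := by
  classical
  obtain ⟨h, hh⟩ := hτ.exists_section_off_center
  by_cases hc : c = polyCenter g
  · subst hc; exact ⟨h, hh⟩
  set p := polyCenter g with hp
  have hpc : p ≠ c := Ne.symm hc
  obtain ⟨huc, hu0, -⟩ := dipoleFun_spec hS hpc
  set u := dipoleFun p c with hu
  have hD : PuncCont (fun x => h x / τ p x) p := by
    filter_upwards [nhdsWithin_le_nhds (hτ.eventually_section p), self_mem_nhdsWithin] with x hx hxp
    have h1 := hh x hxp
    refine (h1.div' hx).congr (Eventually.of_forall fun z => ?_)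
    simp [Pi.div_apply]
  -- The section may fail to extend over the centre `p`; multiplying it by a power of a dipole from
  -- `p` to `c` cancels this obstruction and creates one at `c` instead.
  set k := -(degAt (fun x => h x / τ p x) p * degAt u p) with hk
  have hupc : PuncCont u p := puncCont_dipoleFun hS hpc p
  have hlog : HasLogAt (fun x => (h x * u x ^ k) / τ p x) p := by
    have h1 : (fun x => (h x * u x ^ k) / τ p x) = (fun x => h x / τ p x) * u ^ k := by
      funext x
      simp [div_mul_eq_mul_div]
    rw [h1, ← degAt_eq_zero_iff hS (hD.mul (hupc.zpow k)), degAt_mul hS hD (hupc.zpow k),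
      degAt_zpow hS hupc, hk]
    linear_combination -degAt (fun x => h x / τ p x) p * mul_self_of_abs_eq_one hu0
  obtain ⟨y, hy, hext⟩ := exists_section_extension (τ := τ) hlog
  refine ⟨Function.update (fun x => h x * u x ^ k * Circle.exp (y x)) p (τ p p), fun x hx => ?_⟩
  by_cases hxp : x = p
  · subst hxp
    exact hext _ (fun x hx => by simp [hx]) (by simp)
  · have h1 : ContinuousAt (fun z => h z / τ x z * u z ^ k * Circle.exp (y z)) x :=
      (ContinuousAt.mul (hh x hxp) ((huc x hxp hx).zpow k)).mul
        (Circle.exp.continuous.continuousAt.comp (hy x hxp))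
    refine h1.congr ?_
    filter_upwards [(isOpen_ne.eventually_mem hxp : ∀ᶠ z in 𝓝 x, z ∈ {z | z ≠ p})] with z hz
    rw [Function.update_of_ne hz]
    simp only [div_mul_eq_mul_div]

/-- The index set of a basis of the circle-valued functions modulo squares. -/
abbrev SurfaceIndex (C : Finset (ClosedSurface g))
    (c₀ : ClosedSurface g) : Type := (Fin g × Fin 2) ⊕ {c // c ∈ C.erase c₀}

/-- The basis functions on the closed surface, with singularities in `C`. -/
def surfaceFun (C : Finset (ClosedSurface g))
    (c₀ : ClosedSurface g) : SurfaceIndex C c₀ → ClosedSurface g → Circle :=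
  Sum.elim (fun e => edgeFun e) fun c => dipoleFun c₀ c.1

variable {C : Finset (ClosedSurface g)} {c₀ : ClosedSurface g}

lemma SurfaceIndex.ne (c : {c // c ∈ C.erase c₀}) : c₀ ≠ c.1 :=
  ((Finset.mem_erase.1 c.2).1).symm

lemma continuousAt_surfaceFun (hS : LocallyPlanar (ClosedSurface g)) (hc₀ : c₀ ∈ C)
    (i : SurfaceIndex C c₀) {x : ClosedSurface g}
    (hx : x ∉ C) : ContinuousAt (surfaceFun C c₀ i) x := by
  rcases i with e | c
  · exact (edgeFun e).continuous.continuousAt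
  · exact (dipoleFun_spec hS (SurfaceIndex.ne c)).1 x (fun h => hx (h ▸ hc₀))
      fun h => hx (h ▸ (Finset.mem_erase.1 c.2).2)

lemma puncCont_surfaceFun (hS : LocallyPlanar (ClosedSurface g)) (i : SurfaceIndex C c₀)
    (x : ClosedSurface g) :
    PuncCont (surfaceFun C c₀ i) x := by
  rcases i with e | c
  · exact PuncCont.of_continuousAt (Eventually.of_forall fun _ => (edgeFun e).continuous.continuousAt)
  · exact puncCont_dipoleFun hS (SurfaceIndex.ne c) x

lemma degAt_edgeFun (hS : LocallyPlanar (ClosedSurface g)) (e : Fin g × Fin 2)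
    (x : ClosedSurface g) :
    degAt (edgeFun e) x = 0 :=
  degAt_eq_zero_of_notMem hS (C := ∅) (by simp)
    (fun _ _ => (edgeFun e).continuous.continuousAt) (by simp)

/-- At a puncture other than `c₀` a single basic function is singular, so the degree there isolates
one exponent. -/
lemma degAt_prod_surfaceFun (hS : LocallyPlanar (ClosedSurface g)) (n : SurfaceIndex C c₀ → ℤ)
    (c : {c // c ∈ C.erase c₀}) :
    degAt (∏ i, surfaceFun C c₀ i ^ n i) c = n (Sum.inr c) * degAt (dipoleFun c₀ c.1) c := by
  classical
  rw [degAt_prod hS _ _ fun i _ => puncCont_surfaceFun hS i _, Fintype.sum_sum_type,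
    Finset.sum_eq_zero fun e _ => by
      show n _ * degAt (edgeFun e) c.1 = 0
      rw [degAt_edgeFun hS, mul_zero], zero_add,
    Finset.sum_eq_single c]
  · rfl
  · intro c' _ hc'
    show n _ * degAt (dipoleFun c₀ c'.1) c.1 = 0
    rw [degAt_dipoleFun_of_ne hS (SurfaceIndex.ne c') (SurfaceIndex.ne c).symm
      (fun h => hc' (Subtype.ext h.symm)), mul_zero]
  · simp

/-- All dipoles end at `c₀`; this sum is where the parity of the number of cusps enters. -/
lemma degAt_prod_surfaceFun_base (hS : LocallyPlanar (ClosedSurface g))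
    (n : SurfaceIndex C c₀ → ℤ) :
    degAt (∏ i, surfaceFun C c₀ i ^ n i) c₀ =
      ∑ c : {c // c ∈ C.erase c₀}, n (Sum.inr c) * degAt (dipoleFun c₀ c.1) c₀ := by
  rw [degAt_prod hS _ _ fun i _ => puncCont_surfaceFun hS i _, Fintype.sum_sum_type,
    Finset.sum_eq_zero fun e _ => by
      show n _ * degAt (edgeFun e) c₀ = 0
      rw [degAt_edgeFun hS, mul_zero], zero_add]
  rfl

/-- The basis functions span all functions with singularities in `C`, up to functions with a
logarithm. -/
lemma exists_surfaceFun_prod (hS : LocallyPlanar (ClosedSurface g)) (hc₀ : c₀ ∈ C)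
    {f : ClosedSurface g → Circle}
    (hf : ∀ x ∉ C, ContinuousAt f x) :
    ∃ (n : SurfaceIndex C c₀ → ℤ) (y : ClosedSurface g → ℝ), (∀ x ∉ C, ContinuousAt y x) ∧
      ∀ x ∉ C, f x = (∏ i, surfaceFun C c₀ i x ^ n i) * Circle.exp (y x) := by
  classical
  have hfp := puncCont_of_finite (f := f) (C.finite_toSet) (fun x hx => hf x hx)
  -- These exponents cancel the degrees of `f` at all punctures except `c₀`, the degree of each
  -- dipole at its end being `±1`.
  set n₀ : SurfaceIndex C c₀ → ℤ :=
    Sum.elim 0 fun c => -(degAt f c.1 * degAt (dipoleFun c₀ c.1) c) with hn₀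
  set P := ∏ i, surfaceFun C c₀ i ^ n₀ i with hP
  have hPp : ∀ x, PuncCont P x := fun x => puncCont_prod _ _ fun i _ => puncCont_surfaceFun hS i _
  have hPc : ∀ x ∉ C, ContinuousAt P x := fun x hx =>
    continuousAt_prod _ _ fun i _ => continuousAt_surfaceFun hS hc₀ i hx
  have h0 : ∀ c ∈ C.erase c₀, degAt (f * P) c = 0 := fun c hc => by
    have h1 := degAt_prod_surfaceFun hS n₀ ⟨c, hc⟩
    rw [degAt_mul hS (hfp _) (hPp _), hP, h1]
    have h2 := mul_self_of_abs_eq_one (dipoleFun_spec hS (SurfaceIndex.ne ⟨c, hc⟩)).2.2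
    simp only [hn₀, Sum.elim_inr] at h2 ⊢
    linear_combination -degAt f c * h2
  obtain ⟨f₁, y₁, hy₁, hf₁, hc₁⟩ := exists_extension_of_degAt_eq_zero hS (C.erase c₀) (A := C)
    C.finite_toSet (fun x hx => (hf x hx).mul (hPc x hx)) h0
  have hc₁' : ∀ x ∉ ({c₀} : Set (ClosedSurface g)), ContinuousAt f₁ x := fun x hx => hc₁ x (by
    simp only [Set.mem_singleton_iff] at hx
    by_cases hxC : x ∈ C
    · right; simp [hxC, hx]
    · left; exact hxC)
  -- At `c₀` there is nothing left to cancel: as the only remaining singularity it has degree zero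
  -- by `degAt_eq_zero_of_forall_ne`.
  obtain ⟨f₂, y₂, hy₂, hf₂, hc₂⟩ := exists_extension_of_degAt_eq_zero hS {c₀} (by simp) hc₁'
    (fun p hp => by
      rw [Finset.mem_singleton.1 hp]
      exact degAt_eq_zero_of_forall_ne hS fun x hx => hc₁' x hx)
  obtain ⟨n, y, hy⟩ := exists_edgeFun_prod ⟨f₂, continuous_iff_continuousAt.2 fun x =>
    hc₂ x (by simpa using em' _)⟩
  have hne : ∀ {x}, x ∉ C → x ∉ C.erase c₀ ∧ x ∉ ({c₀} : Finset (ClosedSurface g)) := fun {x} hx =>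
    ⟨fun h => hx (Finset.mem_erase.1 h).2, fun h => hx (Finset.mem_singleton.1 h ▸ hc₀)⟩
  refine ⟨fun i => Sum.elim n 0 i - n₀ i, fun x => y x - y₁ x - y₂ x, fun x hx => ?_,
    fun x hx => ?_⟩
  · exact (y.continuous.continuousAt.sub (hy₁ x (hne hx).1)).sub (hy₂ x (hne hx).2)
  · have e1 : f₂ x = _ := hy x
    rw [hf₂ x (hne hx).2, hf₁ x (hne hx).1] at e1
    have e2 : (∏ i, surfaceFun C c₀ i x ^ (Sum.elim n 0 i - n₀ i)) =
        (∏ e, edgeFun e x ^ n e) / P x := by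
      simp only [_root_.zpow_sub, ← div_eq_mul_inv, Finset.prod_div_distrib]
      congr 1
      · rw [Fintype.prod_sum_type]
        simp [surfaceFun]
      · simp [hP]
    simp only [Pi.mul_apply] at e1
    rw [e2, Circle.exp_sub, Circle.exp_sub]
    generalize (∏ e, edgeFun e x ^ n e) = a at *
    generalize Circle.exp (y x) = b at *
    have e3 : f x = a * b / (P x * Circle.exp (y₁ x) * Circle.exp (y₂ x)) := by
      rw [eq_div_iff_mul_eq', ← e1]
      ac_rfl
    rw [e3]
    simp only [div_eq_mul_inv, _root_.mul_inv_rev]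
    ac_rfl

/-- The basis functions are independent modulo squares. -/
lemma even_of_sq_eq_surfaceFun_prod (hS : LocallyPlanar (ClosedSurface g)) (hc₀ : c₀ ∈ C)
    {v : ClosedSurface g → Circle}
    (hv : ∀ x ∉ C, ContinuousAt v x) {n : SurfaceIndex C c₀ → ℤ}
    (h : ∀ x ∉ C, v x ^ 2 = ∏ i, surfaceFun C c₀ i x ^ n i) (i : SurfaceIndex C c₀) :
    Even (n i) := by
  classical
  have hvp := puncCont_of_finite (f := v) (C.finite_toSet) (fun x hx => hv x hx)
  have hCc : ∀ p, ∀ᶠ x in 𝓝[≠] p, x ∉ C := fun p => by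
    have h1 : IsOpen ((C : Set (ClosedSurface g)) \ {p})ᶜ :=
      (C.finite_toSet.subset Set.sdiff_subset).isClosed.isOpen_compl
    filter_upwards [nhdsWithin_le_nhds (h1.mem_nhds (show p ∈ _ by simp)), self_mem_nhdsWithin]
      with x hx hxp hxC
    exact hx ⟨hxC, hxp⟩
  -- Degrees at `c` are compared: `2 * degAt v c` equals `n c` times `±1`.
  have hinr : ∀ c, Even (n (Sum.inr c)) := fun c => by
    have h1 := degAt_prod_surfaceFun hS n c
    have h2 := degAt_congr hS ((hvp c.1).zpow 2) (g := ∏ i, surfaceFun C c₀ i ^ n i) (by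
      filter_upwards [hCc c.1] with x hx
      have := h x hx
      simp only [Finset.prod_apply, Pi.pow_apply, ← this, _root_.zpow_ofNat])
    rw [degAt_zpow hS (hvp _), h1] at h2
    have h3 := mul_self_of_abs_eq_one (dipoleFun_spec hS (SurfaceIndex.ne c)).2.2
    refine ⟨degAt v c.1 * degAt (dipoleFun c₀ c.1) c, ?_⟩
    linear_combination degAt (dipoleFun c₀ c.1) c * h2 - n (Sum.inr c) * h3
  choose k hk using hinr
  rcases i with e | c
  swap
  · exact ⟨k c, hk c⟩
  -- As the dipole exponents are even, `D` is a square root of the dipole part. Dividing `v` by it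
  -- leaves a square root of the product of edge functions, which is continuous on the whole
  -- surface.
  set D : ClosedSurface g → Circle := ∏ c, surfaceFun C c₀ (Sum.inr c) ^ k c with hD
  have hDc : ∀ x ∉ C, ContinuousAt D x := fun x hx =>
    continuousAt_prod _ _ fun i _ => continuousAt_surfaceFun hS hc₀ _ hx
  obtain ⟨w, hw⟩ := exists_extension_of_sq_eq hS C.finite_toSet (v := v / D)
    (P := ⟨fun x => ∏ e, edgeFun e x ^ n (Sum.inl e),
      continuous_finsetProd _ fun e _ => (edgeFun e).continuous.zpow _⟩)
    (fun x hx => (hv x hx).div' (hDc x hx)) (fun x hx => by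
      have h1 := h x hx
      rw [Fintype.prod_sum_type] at h1
      have h2 : ∏ c, surfaceFun C c₀ (Sum.inr c) x ^ n (Sum.inr c) = D x ^ 2 := by
        simp only [hD, Finset.prod_apply, Pi.pow_apply, ← Finset.prod_pow]
        refine Finset.prod_congr rfl fun c _ => ?_
        rw [hk c, _root_.zpow_add, pow_two]
      rw [Pi.div_apply, div_pow, h1, h2, mul_div_cancel_right]
      rfl)
  exact even_of_sq_eq_edgeFun_prod (n := fun e => n (Sum.inl e)) hw e

end

end SpinQuotient

/-! ### Widths and stabilizers of the cusps. -/

namespace SpinQuotient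
open Filter Topology UpperHalfPlane

lemma unip_add (s t : ℝ) : unip (s + t) = unip s * unip t := by
  ext i j
  show (unip (s + t)).1 i j = ((unip s).1 * (unip t).1) i j
  fin_cases i <;> fin_cases j <;> simp [unip, Matrix.mul_apply, Fin.sum_univ_two, add_comm]

lemma unip_zero : unip 0 = 1 := by
  ext i j
  fin_cases i <;> fin_cases j <;> simp [unip]

lemma unip_neg (t : ℝ) : unip (-t) = (unip t)⁻¹ := by
  rw [eq_inv_iff_mul_eq_one, ← unip_add, neg_add_cancel, unip_zero]

lemma unip_injective : Function.Injective unip := fun s t h => by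
  have := congrArg (fun g : SL(2, ℝ) => g 0 1) h
  simpa [unip] using this

lemma continuous_unip : Continuous unip := by
  refine Continuous.subtype_mk (continuous_matrix fun i j => ?_) _
  fin_cases i <;> fin_cases j <;> simp <;> fun_prop

lemma unip_smul (t : ℝ) (z : ℍ) : unip t • z = t +ᵥ z := by
  rw [UpperHalfPlane.ext_iff, coe_vadd, coe_specialLinearGroup_apply]
  simp [unip, add_comm]

lemma im_smul_of_lower_eq_zero {h : SL(2, ℝ)} (h0 : h 1 0 = 0) (z : ℍ) :
    (h • z).im = h 0 0 ^ 2 * z.im := by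
  have hdet : h 0 0 * h 1 1 = 1 := by
    have := h.det_coe
    rw [Matrix.det_fin_two, h0, mul_zero, sub_zero] at this
    exact this
  have h1 : h 1 1 = (h 0 0)⁻¹ := eq_inv_of_mul_eq_one_right hdet
  have h00 : h 0 0 ≠ 0 := fun h => by simp [h] at hdet
  have := congrArg Complex.im (coe_specialLinearGroup_apply h z)
  rw [h0, h1] at this
  simp only [Algebra.algebraMap_self, RingHom.id_apply, Complex.ofReal_zero, zero_mul, zero_add,
    Complex.ofReal_inv, div_inv_eq_mul, Complex.mul_im, Complex.add_re, Complex.add_im,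
    Complex.ofReal_im, Complex.ofReal_re, Complex.mul_re] at this
  rw [UpperHalfPlane.im, this]
  simp
  ring

/-- From `|cz + d| ≥ |c| Im z`. An element that moves the cusp sends points high up to points far
down. -/
lemma im_smul_le {h : SL(2, ℝ)} (h0 : h 1 0 ≠ 0) (z : ℍ) :
    (h • z).im ≤ 1 / (h 1 0 ^ 2 * z.im) := by
  have h1 : (h • z).im = z.im / Complex.normSq (denom h z) := by
    have := UpperHalfPlane.im_smul_eq_div_normSq (h : GL (Fin 2) ℝ) z
    rw [SpecialLinearGroup.coeToGL_det] at this
    simp only [Units.val_one, abs_one, one_mul] at this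
    exact this
  have h2 := UpperHalfPlane.c_mul_im_sq_le_normSq_denom (h : GL (Fin 2) ℝ) z
  have h3 : (h 1 0 * z.im) ^ 2 ≤ Complex.normSq (denom h z) := by simpa using h2
  have hz := z.im_pos
  rw [h1]
  have h4 : 0 < (h 1 0 * z.im) ^ 2 := by positivity
  calc z.im / Complex.normSq (denom h z) ≤ z.im / (h 1 0 * z.im) ^ 2 := by gcongr
    _ = 1 / (h 1 0 ^ 2 * z.im) := by field_simp

lemma neg_one_smul_uhp (z : ℍ) : (-1 : SL(2, ℝ)) • z = z := by
  rw [UpperHalfPlane.ext_iff, coe_specialLinearGroup_apply]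
  simp

lemma neg_smul_uhp (h : SL(2, ℝ)) (z : ℍ) : (-h) • z = h • z := by
  rw [← neg_one_mul, mul_smul, neg_one_smul_uhp]

variable {Γ : Subgroup SL(2, ℝ)}

lemma mapGL_smul_infty_eq_iff {a b : SL(2, ℝ)} :
    SpecialLinearGroup.mapGL ℝ a • (OnePoint.infty : OnePoint ℝ) =
      SpecialLinearGroup.mapGL ℝ b • OnePoint.infty ↔ (a⁻¹ * b) 1 0 = 0 := by
  have h1 : SpecialLinearGroup.mapGL ℝ a • (OnePoint.infty : OnePoint ℝ) =
      SpecialLinearGroup.mapGL ℝ b • OnePoint.infty ↔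
      SpecialLinearGroup.mapGL ℝ (a⁻¹ * b) • (OnePoint.infty : OnePoint ℝ) = OnePoint.infty := by
    rw [map_mul, map_inv, mul_smul, inv_smul_eq_iff, eq_comm]
  rw [h1, OnePoint.smul_infty_eq_self_iff]
  rfl

lemma lower_det {h : SL(2, ℝ)} (h0 : h 1 0 = 0) : h 0 0 * h 1 1 = 1 := by
  have := h.det_coe
  rw [Matrix.det_fin_two, h0, mul_zero, sub_zero] at this
  exact this

lemma eq_unip_or_of_sq {h : SL(2, ℝ)} (h0 : h 1 0 = 0) (h1 : h 0 0 ^ 2 = 1) :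
    ∃ t, h = unip t ∨ h = -unip t := by
  have hdet := lower_det h0
  rcases mul_self_eq_one_iff.1 ((pow_two (h 0 0)).symm.trans h1) with h2 | h2
  · refine ⟨h 0 1, Or.inl ?_⟩
    have h3 : h 1 1 = 1 := by rw [h2] at hdet; linarith
    ext i j
    fin_cases i <;> fin_cases j <;> simp [unip, h0, h2, h3]
  · refine ⟨-h 0 1, Or.inr ?_⟩
    have h3 : h 1 1 = -1 := by rw [h2] at hdet; linarith
    ext i j
    show h.1 i j = (-(unip (-h 0 1)).1) i j
    fin_cases i <;> fin_cases j <;> simp [unip, h0, h2, h3]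

/-- A cusp of `Γ` is fixed by a unipotent element of `Γ`. -/
lemma exists_unip_mem (hneg : -1 ∈ Γ) {a : SL(2, ℝ)}
    (ha : IsCusp (SpecialLinearGroup.mapGL ℝ a • OnePoint.infty) (toGL Γ)) :
    ∃ x ≠ 0, a * unip x * a⁻¹ ∈ Γ := by
  obtain ⟨_, ⟨γ, hγ, rfl⟩, hp, hfix⟩ := ha
  set h := a⁻¹ * γ * a with hh
  have hγh : γ = a * h * a⁻¹ := by rw [hh]; group
  have h0 : h 1 0 = 0 := by
    rw [← mul_smul, ← map_mul, eq_comm, mapGL_smul_infty_eq_iff] at hfix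
    rw [hh, mul_assoc]; exact hfix
  have hp' : (SpecialLinearGroup.mapGL ℝ h).IsParabolic := by
    rw [hγh, map_mul, map_mul, map_inv, GeneralLinearGroup.isParabolic_conj_iff] at hp
    exact hp
  rw [GeneralLinearGroup.isParabolic_iff_of_upperTriangular h0] at hp'
  obtain ⟨h1, h2⟩ : h 0 0 = h 1 1 ∧ h 0 1 ≠ 0 := hp'
  have hdet := lower_det h0
  rcases eq_unip_or_of_sq h0 (by rw [pow_two]; nth_rw 2 [h1]; exact hdet) with ⟨t, ht | ht⟩
  · refine ⟨t, fun h => h2 (by rw [ht, h]; rfl), ?_⟩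
    rw [← ht, ← hγh]; exact hγ
  · refine ⟨t, fun h => h2 (by rw [ht, h, unip_zero]; show -(1 : Matrix (Fin 2) (Fin 2) ℝ) 0 1 = 0; simp), ?_⟩
    have := Γ.mul_mem hneg hγ
    rw [hγh, ht] at this
    simpa using this

/-- Every cusp has a width. -/
lemma exists_isWidth (hd : DiscreteTopology Γ) (hneg : -1 ∈ Γ) {a : SL(2, ℝ)}
    (ha : IsCusp (SpecialLinearGroup.mapGL ℝ a • OnePoint.infty) (toGL Γ)) :
    ∃ l, IsWidth Γ a l := by
  -- The translation lengths at the cusp form a discrete subgroup of `ℝ`, which is cyclic; it is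
  -- nonzero because the cusp is fixed by a parabolic element.
  let P : AddSubgroup ℝ :=
    { carrier := {t | a * unip t * a⁻¹ ∈ Γ}
      zero_mem' := by simp [unip_zero]
      add_mem' := fun {s t} hs ht => by
        have := Γ.mul_mem hs ht
        rw [show a * unip s * a⁻¹ * (a * unip t * a⁻¹) = a * (unip s * unip t) * a⁻¹ by group,
          ← unip_add] at this
        exact this
      neg_mem' := fun {s} hs => by
        have := Γ.inv_mem hs
        rw [show (a * unip s * a⁻¹)⁻¹ = a * (unip s)⁻¹ * a⁻¹ by group, ← unip_neg] at this
        exact this }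
  have hPd : DiscreteTopology P := by
    refine DiscreteTopology.of_continuous_injective
      (f := fun t : P => (⟨a * unip t * a⁻¹, t.2⟩ : Γ)) ?_ fun s t h => ?_
    · exact Continuous.subtype_mk
        ((continuous_const.mul (continuous_unip.comp continuous_subtype_val)).mul continuous_const) _
    · have := congrArg Subtype.val h
      exact Subtype.ext (unip_injective (mul_left_cancel (mul_right_cancel this)))
  obtain ⟨l, hl⟩ := P.isAddCyclic_iff_exists_zmultiples_eq_top.mp
    (AddSubgroup.discrete_iff_addCyclic.mpr hPd)
  obtain ⟨x, hx0, hx⟩ := exists_unip_mem hneg ha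
  have hmem : ∀ t, a * unip t * a⁻¹ ∈ Γ ↔ ∃ n : ℤ, n • l = t := fun t => by
    rw [← AddSubgroup.mem_zmultiples_iff, hl]; rfl
  have hl0 : l ≠ 0 := fun h => by
    obtain ⟨n, hn⟩ := (hmem x).1 hx
    simp [h] at hn
    exact hx0 hn.symm
  refine ⟨|l|, abs_pos.2 hl0, fun t => (hmem t).trans ?_⟩
  simp only [zsmul_eq_mul]
  rcases abs_choice l with h | h <;> rw [h]
  · exact exists_congr fun n => eq_comm
  · exact ⟨fun ⟨n, hn⟩ => ⟨-n, by push_cast; linarith⟩, fun ⟨n, hn⟩ => ⟨-n, by push_cast; linarith⟩⟩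

/-- The stabilizer of a cusp. -/
lemma IsWidth.stabilizer (hneg : -1 ∈ Γ) {a : SL(2, ℝ)} {l : ℝ} (hl : IsWidth Γ a l) {γ : SL(2, ℝ)}
    (hγ : γ ∈ Γ) (h0 : (a⁻¹ * γ * a) 1 0 = 0) :
    ∃ n : ℤ, γ = a * unip (n * l) * a⁻¹ ∨ γ = -(a * unip (n * l) * a⁻¹) := by
  set h := a⁻¹ * γ * a with hh
  have hγh : γ = a * h * a⁻¹ := by rw [hh]; group
  have hdet := lower_det h0
  have hl' : a * unip l * a⁻¹ ∈ Γ := (hl.2 l).2 ⟨1, by simp⟩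
  -- Conjugation by an upper triangular `h` scales translations by `(h 0 0)²`, and conjugation by
  -- `h⁻¹` by `(h 1 1)²`. Both preserve the multiples of `l`, so the two squares are integers with
  -- product one, hence equal to one.
  have hconj : h * unip l = unip (h 0 0 ^ 2 * l) * h := by
    ext i j
    show (h.1 * (unip l).1) i j = ((unip (h 0 0 ^ 2 * l)).1 * h.1) i j
    have h1 : h.1 1 0 = 0 := h0
    have h2 : h.1 0 0 * h.1 1 1 = 1 := hdet
    fin_cases i <;> fin_cases j <;> simp [unip, Matrix.mul_apply, Fin.sum_univ_two, h1]
    linear_combination (-h.1 0 0 * l) * h2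
  obtain ⟨n, hn⟩ := (hl.2 (h 0 0 ^ 2 * l)).1 (by
    have := Γ.mul_mem (Γ.mul_mem hγ hl') (Γ.inv_mem hγ)
    rw [hγh, show a * h * a⁻¹ * (a * unip l * a⁻¹) * (a * h * a⁻¹)⁻¹ =
      a * (h * unip l * h⁻¹) * a⁻¹ by group, hconj, mul_inv_cancel_right] at this
    exact this)
  have hconj' : h⁻¹ * unip l = unip (h 1 1 ^ 2 * l) * h⁻¹ := by
    rw [inv_mul_eq_iff_eq_mul, ← mul_assoc, eq_mul_inv_iff_mul_eq]
    ext i j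
    show ((unip l).1 * h.1) i j = (h.1 * (unip (h 1 1 ^ 2 * l)).1) i j
    have h1 : h.1 1 0 = 0 := h0
    have h2 : h.1 0 0 * h.1 1 1 = 1 := hdet
    have h3 : (h : Matrix (Fin 2) (Fin 2) ℝ) 1 1 = h.1 1 1 := rfl
    fin_cases i <;> fin_cases j <;> simp [unip, Matrix.mul_apply, Fin.sum_univ_two, h1, h3]
    linear_combination (-h.1 1 1 * l) * h2
  obtain ⟨m, hm⟩ := (hl.2 (h 1 1 ^ 2 * l)).1 (by
    have := Γ.mul_mem (Γ.mul_mem (Γ.inv_mem hγ) hl') hγ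
    rw [hγh, show (a * h * a⁻¹)⁻¹ * (a * unip l * a⁻¹) * (a * h * a⁻¹) =
      a * (h⁻¹ * unip l * h) * a⁻¹ by group, hconj', inv_mul_cancel_right] at this
    exact this)
  have hl0 := hl.1.ne'
  have hn' : h 0 0 ^ 2 = n := mul_right_cancel₀ hl0 hn
  have hm' : h 1 1 ^ 2 = m := mul_right_cancel₀ hl0 hm
  have hnm : n * m = 1 := by
    have : (n : ℝ) * m = 1 := by rw [← hn', ← hm', ← mul_pow, hdet, one_pow]
    exact_mod_cast this
  have hn1 : n = 1 := by
    rcases Int.eq_one_or_neg_one_of_mul_eq_one hnm with h4 | h4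
    · exact h4
    · have h5 := sq_nonneg (h 0 0)
      rw [hn', h4] at h5
      norm_num at h5
  obtain ⟨t, ht⟩ := eq_unip_or_of_sq h0 (by rw [hn', hn1, Int.cast_one])
  have htΓ : a * unip t * a⁻¹ ∈ Γ := by
    rcases ht with ht | ht
    · rw [← ht, ← hγh]; exact hγ
    · have := Γ.mul_mem hneg hγ
      rw [hγh, ht] at this
      simpa using this
  obtain ⟨k, rfl⟩ := (hl.2 t).1 htΓ
  refine ⟨k, ht.imp (fun ht => by rw [hγh, ht]) fun ht => by rw [hγh, ht]; simp⟩

end SpinQuotient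

/-! ### The compactification: its topology, horoballs at the cusps, and charts at ordinary points.
-/

namespace SpinQuotient
open Filter Topology UpperHalfPlane

/-- The projection `ℍ → Γ\ℍ`. -/
abbrev baseMk (Γ : Subgroup SL(2, ℝ)) (z : ℍ) : Base Γ := Quotient.mk _ z

variable {Γ : Subgroup SL(2, ℝ)}

lemma baseMk_eq_iff {z w : ℍ} : baseMk Γ z = baseMk Γ w ↔ ∃ γ ∈ Γ, γ • w = z := by
  rw [Quotient.eq'', MulAction.orbitRel_apply]
  constructor
  · rintro ⟨γ, h⟩
    exact ⟨γ.1, γ.2, h⟩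
  · rintro ⟨γ, hγ, h⟩
    exact ⟨⟨γ, hγ⟩, h⟩

lemma baseMk_smul {γ : SL(2, ℝ)} (hγ : γ ∈ Γ) (z : ℍ) : baseMk Γ (γ • z) = baseMk Γ z :=
  baseMk_eq_iff.2 ⟨γ, hγ, rfl⟩

lemma isOpenQuotientMap_baseMk (Γ : Subgroup SL(2, ℝ)) : IsOpenQuotientMap (baseMk Γ) :=
  MulAction.isOpenQuotientMap_quotientMk

lemma ofCusp_eq_iff {c c' : OnePoint ℝ} (h : IsCusp c (toGL Γ)) (h' : IsCusp c' (toGL Γ)) :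
    Compactified.ofCusp c h = Compactified.ofCusp c' h' ↔
      ∃ γ ∈ Γ, SpecialLinearGroup.mapGL ℝ γ • c' = c := by
  refine Sum.inr_injective.eq_iff.trans ?_
  rw [Quotient.eq'', MulAction.orbitRel_apply]
  constructor
  · rintro ⟨⟨_, γ, hγ, rfl⟩, h⟩
    exact ⟨γ, hγ, congrArg Subtype.val h⟩
  · rintro ⟨γ, hγ, h⟩
    exact ⟨⟨_, γ, hγ, rfl⟩, Subtype.ext h⟩

lemma Compactified.isOpenEmbedding_ofBase :
    IsOpenEmbedding (Compactified.ofBase : Base Γ → Compactified Γ) := by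
  refine .of_continuous_injective_isOpenMap ⟨fun U hU => hU.1⟩ Sum.inl_injective fun W hW => ⟨?_, ?_⟩
  · show IsOpen (Sum.inl ⁻¹' (Sum.inl '' W))
    rwa [Set.preimage_image_eq _ Sum.inl_injective]
  · rintro a h ⟨x, -, hx⟩
    exact absurd hx Sum.inl_ne_inr

lemma Compactified.eq_ofCusp_or (p : Compactified Γ) :
    (∃ z, p = Compactified.ofBase (baseMk Γ z)) ∨
      ∃ (a : SL(2, ℝ)) (h : IsCusp (SpecialLinearGroup.mapGL ℝ a • OnePoint.infty) (toGL Γ)),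
        p = Compactified.ofCusp _ h := by
  rcases p with x | x
  · obtain ⟨z, rfl⟩ := (isOpenQuotientMap_baseMk Γ).surjective x
    exact Or.inl ⟨z, rfl⟩
  · obtain ⟨⟨c, hc⟩, rfl⟩ := Quotient.mk_surjective x
    obtain ⟨a, rfl⟩ := OnePoint.exists_mem_SL2 ℝ c
    exact Or.inr ⟨a, hc, rfl⟩

lemma IsWidth.baseMk_vadd {a : SL(2, ℝ)} {l : ℝ} (hl : IsWidth Γ a l) (n : ℤ) (z : ℍ) :
    baseMk Γ (a • (((n : ℝ) * l) +ᵥ z)) = baseMk Γ (a • z) := by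
  have h1 := (hl.2 (n * l)).2 ⟨n, rfl⟩
  rw [← unip_smul, show a • unip (n * l) • z = (a * unip (n * l) * a⁻¹) • a • z by
    simp only [← mul_smul]; congr 1; group]
  exact baseMk_smul h1 _

/-- Far up in a cusp, only the stabilizer of the cusp identifies points. -/
lemma exists_horoball [T2Space (Compactified Γ)] {a : SL(2, ℝ)} {l : ℝ} (hl : IsWidth Γ a l)
    (ha : IsCusp (SpecialLinearGroup.mapGL ℝ a • OnePoint.infty) (toGL Γ)) :
    ∃ M : ℝ, 0 < M ∧ ∀ γ ∈ Γ, ∀ z : ℍ, M < z.im → M < ((a⁻¹ * γ * a) • z).im →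
      (a⁻¹ * γ * a) 1 0 = 0 := by
  set F : ℍ → Compactified Γ := fun z => Compactified.ofBase (baseMk Γ (a • z)) with hF
  have hFc : Continuous F := Compactified.isOpenEmbedding_ofBase.continuous.comp
    ((isOpenQuotientMap_baseMk Γ).continuous.comp (continuous_const_smul a))
  -- The image of the horocycle at height one is compact, hence closed in a Hausdorff space. Its
  -- complement is a neighbourhood of the cusp, so beyond some height `M` no point is equivalent to
  -- one at height one.
  set K : Set (Compactified Γ) := (fun t : ℝ => F (t +ᵥ I)) '' Set.Icc 0 l with hK
  have hKc : IsCompact K := isCompact_Icc.image (hFc.comp (by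
    simp only [← unip_smul]
    exact continuous_unip.smul continuous_const))
  have hKmem : ∀ z : ℍ, z.im = 1 → F z ∈ K := fun z hz => by
    obtain ⟨n, hn, -⟩ := existsUnique_add_zsmul_mem_Ico hl.1 z.re 0
    refine ⟨z.re + n • l, ⟨hn.1, by simpa using hn.2.le⟩, ?_⟩
    have h1 : (z.re + n • l) +ᵥ I = ((n : ℝ) * l) +ᵥ z := by
      apply UpperHalfPlane.ext
      apply Complex.ext <;> simp [hz]
      ring
    show F _ = F z
    rw [h1, hF]
    simp only [hl.baseMk_vadd]
  obtain ⟨-, h2⟩ := hKc.isClosed.isOpen_compl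
  obtain ⟨M, hM⟩ := h2 a ha (by rintro ⟨t, -, ht⟩; exact absurd ht Sum.inl_ne_inr)
  refine ⟨max M 1, by positivity, fun γ hγ z hz hγz => ?_⟩
  set h := a⁻¹ * γ * a with hh
  by_contra h0
  have hmem : ∀ w : ℍ, max M 1 < w.im → (h • w).im ≠ 1 := fun w hw h1 => by
    apply hM w (lt_of_le_of_lt (le_max_left _ _) hw)
    have := hKmem _ h1
    simp only [hF] at this
    rw [show a • h • w = γ • a • w by simp only [← mul_smul, hh]; congr 1; group,
      baseMk_smul hγ] at this
    exact this
  have hz0 := z.im_pos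
  -- The vertical path going up from `z`. If `h` moved the cusp, the image of this path would start
  -- above height one and come down to it, against the choice of `M`.
  set w : ℝ → ℍ := fun s => ⟨⟨z.re, z.im * Real.exp s⟩, by simpa using by positivity⟩ with hw
  have hwim : ∀ s, (w s).im = z.im * Real.exp s := fun s => rfl
  have hwc : Continuous w := by
    rw [isEmbedding_coe.continuous_iff]
    have : (UpperHalfPlane.coe ∘ w) = fun s => (z.re : ℂ) + (z.im * Real.exp s : ℝ) * Complex.I := by
      funext s
      apply Complex.ext <;> simp [hw, Complex.exp_ofReal_re]
    rw [this]
    fun_prop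
  have hφ : Continuous fun s => (h • w s).im :=
    UpperHalfPlane.continuous_im.comp (hwc.const_smul h)
  -- Large enough for `c² * Im z * exp s₁ ≥ 1`, so that `im_smul_le` bounds the height at the end of
  -- the image path by one.
  set s₁ := 2 / (h 1 0 ^ 2 * z.im) with hs₁
  have hs₁0 : 0 < s₁ := by positivity
  have hw0 : w 0 = z := by
    apply UpperHalfPlane.ext
    apply Complex.ext <;> simp [hw]
  have h1 : (h • w s₁).im ≤ 1 := by
    refine (im_smul_le h0 _).trans ?_
    rw [hwim, div_le_one (by positivity)]
    have := Real.add_one_le_exp s₁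
    have h3 : h 1 0 ^ 2 * z.im * s₁ = 2 := by rw [hs₁]; field_simp
    have h4 : 0 < h 1 0 ^ 2 * z.im := by positivity
    nlinarith
  obtain ⟨s, hs, hs1⟩ := intermediate_value_Icc' hs₁0.le hφ.continuousOn
    (show (1 : ℝ) ∈ Set.Icc _ _ from ⟨h1, by
      rw [hw0]; exact ((le_max_right _ _).trans_lt hγz).le⟩)
  refine hmem (w s) (hz.trans_le ?_) hs1
  rw [hwim]
  exact le_mul_of_one_le_right hz0.le (Real.one_le_exp hs.1)

/-- A local parametrization gives a chart. -/
lemma exists_chart_of_param {S : Type*} [TopologicalSpace S] {ψ : ℂ → S} {O : Set ℂ}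
    (hO : IsOpen O) (hc : ContinuousOn ψ O) (hi : Set.InjOn ψ O)
    (ho : ∀ W ⊆ O, IsOpen W → IsOpen (ψ '' W)) {q : ℂ} (hq : q ∈ O) :
    ∃ e : OpenPartialHomeomorph S ℂ, ψ q ∈ e.source ∧ e (ψ q) = 0 ∧
      ∀ᶠ q' in 𝓝 q, ψ q' ∈ e.source ∧ e (ψ q') = q' - q := by
  have hop : IsOpenMap (O.domRestrict ψ) := fun W hW => by
    have h1 := ho _ (Subtype.coe_image_subset O W) (hO.isOpenMap_subtype_val W hW)
    rwa [← Set.image_comp] at h1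
  set e := OpenPartialHomeomorph.ofContinuousOpenRestrict (hi.toPartialEquiv ψ O) hc hop hO with he
  have hes : ∀ q' ∈ O, ψ q' ∈ e.target ∧ e.symm (ψ q') = q' := fun q' hq' =>
    ⟨e.map_source hq', e.left_inv hq'⟩
  refine ⟨e.symm.transHomeomorph (Homeomorph.subRight q), (hes q hq).1, ?_, ?_⟩
  · show e.symm (ψ q) - q = 0
    rw [(hes q hq).2, sub_self]
  · filter_upwards [hO.mem_nhds hq] with q' hq'
    refine ⟨(hes q' hq').1, ?_⟩
    show e.symm (ψ q') - q = q' - q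
    rw [(hes q' hq').2]

/-- By proper discontinuity only stabilizer elements map a small neighbourhood of `z` to one meeting
it. These are `±1` and act trivially, so the projection is injective near `z`. -/
lemma exists_chart_ofBase (hd : DiscreteTopology Γ)
    (hfree : ∀ γ ∈ Γ, ∀ z : UpperHalfPlane, γ • z = z → γ = 1 ∨ γ = -1) (z : ℍ) :
    ∃ e : OpenPartialHomeomorph (Compactified Γ) ℂ,
      Compactified.ofBase (baseMk Γ z) ∈ e.source ∧ e (Compactified.ofBase (baseMk Γ z)) = 0 := by
  obtain ⟨U, hU, hUγ⟩ := ProperlyDiscontinuousSMul.exists_nhds_image_smul_eq_self Γ z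
  obtain ⟨V, hVU, hV, hzV⟩ := mem_nhds_iff.1 hU
  set ψ : ℂ → Compactified Γ := fun q => Compactified.ofBase (baseMk Γ (ofComplex q)) with hψ
  have hψc : ∀ z : ℍ, ψ z = Compactified.ofBase (baseMk Γ z) := fun z => by
    simp only [hψ, ofComplex_apply]
  rw [← hψc]
  suffices ContinuousOn ψ ((↑) '' V) ∧ Set.InjOn ψ ((↑) '' V) ∧
      ∀ W ⊆ (↑) '' V, IsOpen W → IsOpen (ψ '' W) by
    obtain ⟨e, h1, h2, -⟩ := exists_chart_of_param (isOpenEmbedding_coe.isOpenMap V hV) this.1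
      this.2.1 this.2.2 ⟨z, hzV, rfl⟩
    exact ⟨e, h1, h2⟩
  refine ⟨?_, ?_, ?_⟩
  · rintro _ ⟨w, -, rfl⟩
    refine ContinuousAt.continuousWithinAt ?_
    have h3 : ContinuousAt ofComplex (w : ℂ) := ofComplex.continuousAt ⟨w, trivial, rfl⟩
    exact (Compactified.isOpenEmbedding_ofBase.continuous.comp
      (isOpenQuotientMap_baseMk Γ).continuous).continuousAt.comp h3
  · rintro _ ⟨w, hw, rfl⟩ _ ⟨w', hw', rfl⟩ h
    rw [hψc, hψc] at h
    obtain ⟨γ, hγ, hγw⟩ := baseMk_eq_iff.1 (Sum.inl_injective h)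
    have h3 := hUγ ⟨γ, hγ⟩ ⟨w, ⟨w', hVU hw', hγw⟩, hVU hw⟩
    rcases hfree γ hγ z h3 with rfl | rfl
    · rw [← hγw, one_smul]
    · rw [← hγw, neg_one_smul_uhp]
  · intro W hW hWo
    have h3 : ψ '' W = Compactified.ofBase '' (baseMk Γ '' ((↑) ⁻¹' W)) := by
      ext x
      constructor
      · rintro ⟨q, hq, rfl⟩
        obtain ⟨w, -, rfl⟩ := hW hq
        exact ⟨_, ⟨w, hq, rfl⟩, (hψc w).symm⟩
      · rintro ⟨_, ⟨w, hw, rfl⟩, rfl⟩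
        exact ⟨w, hw, hψc w⟩
    rw [h3]
    exact Compactified.isOpenEmbedding_ofBase.isOpenMap _
      ((isOpenQuotientMap_baseMk Γ).isOpenMap _ (hWo.preimage isEmbedding_coe.continuous))

end SpinQuotient

/-! ### Charts at the cusps by `q = exp (2πiz / l)`. -/

namespace SpinQuotient
open Filter Topology UpperHalfPlane

variable {Γ : Subgroup SL(2, ℝ)}

open Function.Periodic

lemma exists_norm_qParam_lt {l : ℝ} (hl : 0 < l) {ε : ℝ} (hε : 0 < ε) :
    ∃ N : ℝ, 0 < N ∧ ∀ z : ℂ, N < z.im → ‖qParam l z‖ < ε := by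
  refine ⟨max 1 (-(l * Real.log ε) / (2 * Real.pi)), by positivity, fun z hz => ?_⟩
  have h1 := (norm_qParam_lt_iff hl (-(l * Real.log ε) / (2 * Real.pi)) z).2
    ((le_max_right _ _).trans_lt hz)
  rwa [show -2 * Real.pi * (-(l * Real.log ε) / (2 * Real.pi)) / l = Real.log ε by
    have := hl.ne'; field_simp, Real.exp_log hε] at h1

lemma isOpenMap_qParam {l : ℝ} (hl : 0 < l) : IsOpenMap fun z : ℍ => qParam l z := by
  have h1 : (fun z : ℍ => qParam l z) = Complex.exp ∘
      (fun z : ℂ => 2 * Real.pi * Complex.I / l * z) ∘ (↑) := by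
    funext z
    simp only [qParam, Function.comp]
    congr 1
    ring
  rw [h1]
  refine Complex.isOpenMap_exp.comp (IsOpenMap.comp ?_ isOpenEmbedding_coe.isOpenMap)
  have h2 : (2 * Real.pi * Complex.I / l : ℂ) ≠ 0 := by
    have := hl.ne'
    simp [this]
  exact (Homeomorph.mulLeft₀ _ h2).isOpenMap

/-- The parametrization of a neighbourhood of the cusp `a • ∞` by `q = exp (2πiz / l)`. -/
def cuspParam {a : SL(2, ℝ)} (ha : IsCusp (SpecialLinearGroup.mapGL ℝ a • OnePoint.infty) (toGL Γ))
    (l : ℝ) (q : ℂ) : Compactified Γ :=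
  if q = 0 then Compactified.ofCusp _ ha
  else Compactified.ofBase (baseMk Γ (a • ofComplex (invQParam l q)))

/-- `invQParam` recovers `z` up to a multiple of the width, which does not change the class in
`Γ\ℍ`. -/
lemma cuspParam_qParam {a : SL(2, ℝ)}
    (ha : IsCusp (SpecialLinearGroup.mapGL ℝ a • OnePoint.infty) (toGL Γ))
    {l : ℝ} (hl : IsWidth Γ a l) (z : ℍ) :
    cuspParam ha l (qParam l z) = Compactified.ofBase (baseMk Γ (a • z)) := by
  rw [cuspParam, if_neg (qParam_ne_zero _)]
  obtain ⟨m, hm⟩ := qParam_left_inv_mod_period hl.1.ne' (z : ℂ)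
  rw [hm, show ((z : ℂ) + m * l) = (((m : ℝ) * l +ᵥ z : ℍ) : ℂ) by
    rw [coe_vadd]; push_cast; ring, ofComplex_apply, hl.baseMk_vadd]

lemma exists_qParam_eq {l : ℝ} (hl : 0 < l) {M : ℝ} (hM : 0 < M) {q : ℂ} (hq0 : q ≠ 0)
    (hq : ‖q‖ < Real.exp (-2 * Real.pi * M / l)) : ∃ z : ℍ, M < z.im ∧ qParam l z = q := by
  have h1 : qParam l (invQParam l q) = q := qParam_right_inv hl.ne' hq0
  have h2 : M < (invQParam l q).im := by rwa [← norm_qParam_lt_iff hl, h1]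
  exact ⟨⟨_, hM.trans h2⟩, h2, h1⟩

/-- A horoball modulo translation by `l` is a punctured disc in the variable `q`. Injectivity
combines `exists_horoball` with `IsWidth.stabilizer`; continuity and openness at `q = 0` are the
horoball topology. The explicit form of the chart is kept for the comparison of degrees with cusp
loops. -/
lemma exists_chart_ofCusp [T2Space (Compactified Γ)] (hneg : -1 ∈ Γ) {a : SL(2, ℝ)}
    (ha : IsCusp (SpecialLinearGroup.mapGL ℝ a • OnePoint.infty) (toGL Γ))
    {l : ℝ} (hl : IsWidth Γ a l) : ∃ e : OpenPartialHomeomorph (Compactified Γ) ℂ,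
      Compactified.ofCusp _ ha ∈ e.source ∧ e (Compactified.ofCusp _ ha) = 0 ∧
      ∃ N : ℝ, ∀ z : ℍ, N < z.im →
        Compactified.ofBase (baseMk Γ (a • z)) ∈ e.source ∧
        e (Compactified.ofBase (baseMk Γ (a • z))) = qParam l z := by
  obtain ⟨M, hM, hsep⟩ := exists_horoball hl ha
  have hl0 := hl.1
  set ψ := cuspParam ha l with hψ
  have hψ0 : ψ 0 = Compactified.ofCusp _ ha := by rw [hψ, cuspParam, if_pos rfl]
  have hψq : ∀ z : ℍ, ψ (qParam l z) = Compactified.ofBase (baseMk Γ (a • z)) :=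
    cuspParam_qParam ha hl
  set ρ := Real.exp (-2 * Real.pi * M / l) with hρ
  have hρ0 : 0 < ρ := Real.exp_pos _
  set O := Metric.ball (0 : ℂ) ρ with hO
  have hex : ∀ q ∈ O, q ≠ 0 → ∃ z : ℍ, M < z.im ∧ qParam l z = q := fun q hq hq0 =>
    exists_qParam_eq hl0 hM hq0 (mem_ball_zero_iff.1 hq)
  have hFc : Continuous fun z : ℍ => Compactified.ofBase (baseMk Γ (a • z)) :=
    Compactified.isOpenEmbedding_ofBase.continuous.comp
      ((isOpenQuotientMap_baseMk Γ).continuous.comp (continuous_const_smul a))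
  have hcont : ContinuousOn ψ O := by
    intro q hq
    refine ContinuousAt.continuousWithinAt ?_
    by_cases hq0 : q = 0
    · subst hq0
      rw [ContinuousAt, hψ0]
      refine tendsto_def.2 fun V hV => ?_
      obtain ⟨V', hV'V, hV'o, hcV⟩ := mem_nhds_iff.1 hV
      obtain ⟨N, hN⟩ := hV'o.2 a ha hcV
      have h1 : Metric.ball (0 : ℂ) (Real.exp (-2 * Real.pi * max N 1 / l)) ∈ 𝓝 (0 : ℂ) :=
        Metric.ball_mem_nhds _ (Real.exp_pos _)
      filter_upwards [h1] with q hq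
      by_cases hq0 : q = 0
      · rw [Set.mem_preimage, hq0, hψ0]; exact hV'V hcV
      · obtain ⟨z, hz, rfl⟩ := exists_qParam_eq hl0 (M := max N 1) (by positivity) hq0
          (mem_ball_zero_iff.1 hq)
        rw [Set.mem_preimage, hψq]
        exact hV'V (hN z ((le_max_left _ _).trans_lt hz))
    · obtain ⟨z, -, rfl⟩ := hex q hq hq0
      -- Away from zero `qParam` is open, so the image filter of `𝓝 z` contains every limit
      -- statement needed at `qParam l z`.
      have h1 : Tendsto ψ (map (fun z : ℍ => qParam l z) (𝓝 z)) (𝓝 (ψ (qParam l z))) := by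
        rw [tendsto_map'_iff, hψq]
        exact (hFc.tendsto z).congr fun z => (hψq z).symm
      exact h1.mono_left ((isOpenMap_qParam hl0).nhds_le z)
  have hinj : Set.InjOn ψ O := by
    intro q hq q' hq' h
    by_cases hq0 : q = 0
    · by_cases hq0' : q' = 0
      · rw [hq0, hq0']
      · obtain ⟨z', -, rfl⟩ := hex q' hq' hq0'
        rw [hq0, hψ0, hψq] at h
        exact absurd h.symm Sum.inl_ne_inr
    obtain ⟨z, hz, rfl⟩ := hex q hq hq0
    by_cases hq0' : q' = 0
    · rw [hq0', hψ0, hψq] at h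
      exact absurd h Sum.inl_ne_inr
    obtain ⟨z', hz', rfl⟩ := hex q' hq' hq0'
    rw [hψq, hψq] at h
    obtain ⟨γ, hγ, hγz⟩ := baseMk_eq_iff.1 (Sum.inl_injective h)
    have h1 : z = (a⁻¹ * γ * a) • z' := by
      rw [mul_smul, mul_smul, hγz, inv_smul_smul]
    have h2 := hsep γ hγ z' hz' (h1 ▸ hz)
    obtain ⟨n, hn⟩ := hl.stabilizer hneg hγ h2
    have h3 : z = ((n : ℝ) * l) +ᵥ z' := by
      rw [h1, ← unip_smul]
      rcases hn with hn | hn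
      · rw [hn]; congr 1; group
      · rw [hn, ← neg_smul_uhp]; congr 1; simp [mul_assoc]
    rw [h3, coe_vadd]
    simp only [qParam]
    have hlC : (l : ℂ) ≠ 0 := by exact_mod_cast hl0.ne'
    rw [show 2 * (Real.pi : ℂ) * Complex.I * ((((n : ℝ) * l : ℝ) : ℂ) + z') / l =
      2 * Real.pi * Complex.I * z' / l + n * (2 * Real.pi * Complex.I) by
        push_cast; field_simp; ring, Complex.exp_add, Complex.exp_int_mul_two_pi_mul_I, mul_one]
  have hopen : ∀ W ⊆ O, IsOpen W → IsOpen (ψ '' W) := by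
    intro W hW hWo
    constructor
    · have h1 : Compactified.ofBase ⁻¹' (ψ '' W) =
          (fun z : ℍ => baseMk Γ (a • z)) '' ((fun z : ℍ => qParam l z) ⁻¹' W) := by
        ext x
        constructor
        · rintro ⟨q, hq, hx⟩
          by_cases hq0 : q = 0
          · rw [hq0, hψ0] at hx
            exact absurd hx.symm Sum.inl_ne_inr
          · obtain ⟨z, -, rfl⟩ := hex q (hW hq) hq0
            rw [hψq] at hx
            exact ⟨z, hq, Sum.inl_injective hx⟩
        · rintro ⟨z, hz, rfl⟩
          exact ⟨_, hz, hψq z⟩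
      rw [h1]
      exact ((isOpenQuotientMap_baseMk Γ).isOpenMap.comp (isOpenMap_smul a)) _
        (hWo.preimage ((continuous_qParam).comp isEmbedding_coe.continuous))
    · rintro b hb ⟨q, hq, hqb⟩
      have hq0 : q = 0 := by
        by_contra hq0
        obtain ⟨z, -, rfl⟩ := hex q (hW hq) hq0
        rw [hψq] at hqb
        exact absurd hqb Sum.inl_ne_inr
      subst hq0
      rw [hψ0] at hqb
      obtain ⟨γ, hγ, hγb⟩ := (ofCusp_eq_iff _ _).1 hqb.symm
      rw [← mul_smul, ← map_mul, mapGL_smul_infty_eq_iff] at hγb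
      set h := (γ * a)⁻¹ * b with hh
      have hdet := lower_det hγb
      have h00 : h 0 0 ≠ 0 := fun h => by simp [h] at hdet
      obtain ⟨ε, hε, hball⟩ := Metric.isOpen_iff.1 hWo 0 hq
      obtain ⟨N, hN, hNq⟩ := exists_norm_qParam_lt hl0 hε
      -- The same cusp may be written with another matrix `b`. The change of matrix is upper
      -- triangular and multiplies heights by `(h 0 0)²`, so the bound is rescaled accordingly.
      refine ⟨N / h 0 0 ^ 2, fun z hz => ⟨qParam l ((h • z : ℍ) : ℂ), hball ?_, ?_⟩⟩
      · rw [mem_ball_zero_iff]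
        apply hNq
        have := im_smul_of_lower_eq_zero hγb z
        rw [UpperHalfPlane.coe_im, this]
        rwa [div_lt_iff₀' (by positivity)] at hz
      · rw [hψq]
        congr 1
        rw [← baseMk_smul hγ (a • h • z)]
        simp only [← mul_smul, hh]
        congr 2
        group
  obtain ⟨e, h1, h2, h3⟩ := exists_chart_of_param Metric.isOpen_ball hcont hinj hopen
    (Metric.mem_ball_self hρ0)
  rw [hψ0] at h1 h2
  obtain ⟨ε, hε, hball⟩ := Metric.eventually_nhds_iff_ball.1 h3
  obtain ⟨N, hN, hNq⟩ := exists_norm_qParam_lt hl0 hε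
  refine ⟨e, h1, h2, N, fun z hz => ?_⟩
  have := hball (qParam l z) (by rw [mem_ball_zero_iff]; exact hNq z hz)
  rwa [sub_zero, hψq] at this

lemma locallyPlanar_compactified [T2Space (Compactified Γ)] (hd : DiscreteTopology Γ)
    (hneg : -1 ∈ Γ) (hfree : ∀ γ ∈ Γ, ∀ z : UpperHalfPlane, γ • z = z → γ = 1 ∨ γ = -1) :
    LocallyPlanar (Compactified Γ) := by
  intro p
  rcases p.eq_ofCusp_or with ⟨z, rfl⟩ | ⟨a, ha, rfl⟩
  · exact exists_chart_ofBase hd hfree z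
  · obtain ⟨l, hl⟩ := exists_isWidth hd hneg ha
    obtain ⟨e, h1, h2, -⟩ := exists_chart_ofCusp hneg ha hl
    exact ⟨e, h1, h2⟩

end SpinQuotient

/-! ### The quotient as a punctured closed surface; automorphy factors. -/

namespace SpinQuotient
open Filter Topology UpperHalfPlane Function.Periodic

/-- `a • ∞` is a cusp of `Γ`, of width `l`. -/
def CuspData (Γ : Subgroup SL(2, ℝ)) (a : SL(2, ℝ)) (l : ℝ) : Prop :=
  IsCusp (SpecialLinearGroup.mapGL ℝ a • OnePoint.infty) (toGL Γ) ∧ IsWidth Γ a l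

/-- `c` is the point at the cusp `a • ∞`, of width `l`. -/
def IsCuspPoint {Γ : Subgroup SL(2, ℝ)} {g : ℕ} (ι : Base Γ → ClosedSurface g) (a : SL(2, ℝ))
    (l : ℝ)
    (c : ClosedSurface g) : Prop :=
  ∃ e : OpenPartialHomeomorph (ClosedSurface g) ℂ, c ∈ e.source ∧ e c = 0 ∧
    ∃ N : ℝ, ∀ z : ℍ, N < z.im →
      ι (baseMk Γ (a • z)) ∈ e.source ∧ e (ι (baseMk Γ (a • z))) = qParam l z

/-- `ι` identifies `Γ\ℍ` with the complement of a finite set `C` of a closed surface. -/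
structure IsModel (Γ : Subgroup SL(2, ℝ)) {g : ℕ} (ι : Base Γ → ClosedSurface g)
    (C : Finset (ClosedSurface g)) : Prop where
  discrete : DiscreteTopology Γ
  neg_one_mem : -1 ∈ Γ
  free : ∀ γ ∈ Γ, ∀ z : ℍ, γ • z = z → γ = 1 ∨ γ = -1
  isOpenEmbedding : IsOpenEmbedding ι
  planar : LocallyPlanar (ClosedSurface g)
  notMem_iff : ∀ x, x ∉ C ↔ x ∈ Set.range ι
  t2Space : T2Space (Compactified Γ)
  exists_cusp : ∀ c ∈ C, ∃ a l, CuspData Γ a l ∧ IsCuspPoint ι a l c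
  exists_point : ∀ a l, CuspData Γ a l → ∃ c ∈ C, IsCuspPoint ι a l c

/-- Everything is transported along the homeomorphism with the polygon model. That model also
supplies the Hausdorff property on which the charts at the cusps rest. -/
lemma exists_isModel {Γ : Subgroup SL(2, ℝ)} (hdiscrete : DiscreteTopology Γ)
    (hneg : -1 ∈ Γ) (hfree : ∀ γ ∈ Γ, ∀ z : UpperHalfPlane, γ • z = z → γ = 1 ∨ γ = -1)
    {g κ : ℕ} (hsig : HasSignature Γ g κ) :
    ∃ (ι : Base Γ → ClosedSurface g) (C : Finset (ClosedSurface g)), IsModel Γ ι C ∧ C.card = κ := by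
  classical
  obtain ⟨hfin, hcard, ⟨Φ⟩⟩ := hsig
  have ht2 : T2Space (Compactified Γ) := Φ.symm.t2Space
  have hpl := locallyPlanar_compactified hdiscrete hneg hfree
  set k : CuspOrbits (toGL Γ) → ClosedSurface g := fun x => Φ (Sum.inr x) with hk
  have hki : Function.Injective k := Φ.injective.comp Sum.inr_injective
  set ι : Base Γ → ClosedSurface g := fun x => Φ (Compactified.ofBase x) with hι
  have hpt : ∀ {a : SL(2, ℝ)} {l : ℝ}
      (ha : IsCusp (SpecialLinearGroup.mapGL ℝ a • OnePoint.infty) (toGL Γ)),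
      IsWidth Γ a l → IsCuspPoint ι a l (Φ (Compactified.ofCusp _ ha)) := fun {a l} ha hl => by
    obtain ⟨e, h1, h2, N, hN⟩ := exists_chart_ofCusp hneg ha hl
    refine ⟨Φ.symm.toOpenPartialHomeomorph.trans e, by simpa using h1, by simpa using h2, N,
      fun z hz => ?_⟩
    have := hN z hz
    simpa [hι] using this
  refine ⟨ι, (Set.finite_range k).toFinset, ⟨hdiscrete, hneg, hfree,
    Φ.isOpenEmbedding.comp Compactified.isOpenEmbedding_ofBase, fun p => ?_, fun x => ?_, ht2,
    fun c hc => ?_, fun a l hal => ?_⟩, ?_⟩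
  · obtain ⟨e, h1, h2⟩ := hpl (Φ.symm p)
    exact ⟨Φ.symm.toOpenPartialHomeomorph.trans e, by simpa using h1, by simpa using h2⟩
  · rw [Set.Finite.mem_toFinset]
    obtain ⟨y, rfl⟩ := Φ.surjective x
    rcases y with y | y
    · refine iff_of_true ?_ ⟨y, rfl⟩
      rintro ⟨z, hz⟩
      exact absurd (Φ.injective hz) Sum.inr_ne_inl
    · refine iff_of_false (fun h => h ⟨y, rfl⟩) ?_
      rintro ⟨z, hz⟩
      exact absurd (Φ.injective hz) Sum.inl_ne_inr
  · rw [Set.Finite.mem_toFinset] at hc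
    obtain ⟨y, rfl⟩ := hc
    rcases Compactified.eq_ofCusp_or (Sum.inr y : Compactified Γ) with ⟨z, hz⟩ | ⟨a, ha, hy⟩
    · exact absurd hz Sum.inr_ne_inl
    · obtain ⟨l, hl⟩ := exists_isWidth hdiscrete hneg ha
      refine ⟨a, l, ⟨ha, hl⟩, ?_⟩
      simp only [hk, hy]
      exact hpt ha hl
  · exact ⟨_, by rw [Set.Finite.mem_toFinset]; exact ⟨_, rfl⟩, hpt hal.1 hal.2⟩
  · rw [← hcard, ← Nat.card_eq_card_finite_toFinset, Nat.card_congr (Equiv.ofInjective k hki)]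

section Equivariant

variable {Γ : Subgroup SL(2, ℝ)} {j : SL(2, ℝ) → ℍ → Circle}

/-- A unitary automorphy factor of `Γ`. -/
structure IsCocycle (Γ : Subgroup SL(2, ℝ)) (j : SL(2, ℝ) → ℍ → Circle) : Prop where
  continuous : ∀ γ ∈ Γ, Continuous (j γ)
  mul : ∀ γ ∈ Γ, ∀ δ ∈ Γ, ∀ z, j (γ * δ) z = j γ (δ • z) * j δ z
  neg_one : ∀ z, j (-1) z = 1

lemma IsCocycle.one (hj : IsCocycle Γ j) (z : ℍ) : j 1 z = 1 := by
  have := hj.mul 1 Γ.one_mem 1 Γ.one_mem z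
  rw [mul_one, one_smul] at this
  exact mul_eq_left.1 this.symm

lemma IsCocycle.neg (hj : IsCocycle Γ j) (hneg : -1 ∈ Γ) {γ : SL(2, ℝ)} (hγ : γ ∈ Γ) (z : ℍ) :
    j (-γ) z = j γ z := by
  rw [← neg_one_mul, hj.mul _ hneg _ hγ, hj.neg_one, one_mul]

/-- Functions on `ℍ` that transform with the automorphy factor `j`. -/
def IsEquivariant (Γ : Subgroup SL(2, ℝ)) (j : SL(2, ℝ) → ℍ → Circle) (F : ℍ → Circle) : Prop :=
  ∀ γ ∈ Γ, ∀ z, F (γ • z) = j γ z * F z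

lemma IsEquivariant.continuousAt (hj : IsCocycle Γ j) {F : ℍ → Circle} (hF : IsEquivariant Γ j F)
    {γ : SL(2, ℝ)} (hγ : γ ∈ Γ) {z : ℍ} (hz : ContinuousAt F z) : ContinuousAt F (γ • z) := by
  have h1 : F = fun w => j γ (γ⁻¹ • w) * F (γ⁻¹ • w) := by
    funext w
    rw [← hF γ hγ, smul_inv_smul]
  have h2 : ContinuousAt (fun w : ℍ => γ⁻¹ • w) (γ • z) := (continuous_const_smul _).continuousAt
  rw [h1]
  refine ContinuousAt.mul (((hj.continuous γ hγ).comp (continuous_const_smul _)).continuousAt) ?_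
  refine ContinuousAt.comp (g := F) ?_ h2
  rwa [inv_smul_smul]

/-- On the orbit of a chosen representative `o` the value at `γ • o` is `j γ o`; this is well
defined because stabilizers are `±1` and `j (-1) = 1`. The function need not be continuous and
serves as the global frame against which local frames are measured. -/
lemma exists_isEquivariant (hj : IsCocycle Γ j) (hneg : -1 ∈ Γ)
    (hfree : ∀ γ ∈ Γ, ∀ z : ℍ, γ • z = z → γ = 1 ∨ γ = -1) : ∃ J, IsEquivariant Γ j J := by
  have hrep : ∀ z : ℍ, ∃ γ ∈ Γ, γ • (Quotient.out (baseMk Γ z) : ℍ) = z := fun z =>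
    baseMk_eq_iff.1 (Quotient.out_eq _).symm
  choose δ hδ hδz using hrep
  refine ⟨fun z => j (δ z) (Quotient.out (baseMk Γ z)), fun γ hγ z => ?_⟩
  have h1 := hδz (γ • z)
  show j (δ (γ • z)) (Quotient.out (baseMk Γ (γ • z))) = j γ z * j (δ z) (Quotient.out (baseMk Γ z))
  rw [baseMk_smul hγ] at h1 ⊢
  set o : ℍ := Quotient.out (baseMk Γ z)
  have h2 := hfree ((γ * δ z)⁻¹ * δ (γ • z))
    (Γ.mul_mem (Γ.inv_mem (Γ.mul_mem hγ (hδ z))) (hδ _)) o (by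
      rw [mul_smul, h1, inv_smul_eq_iff, mul_smul, hδz])
  have h3 : j (δ (γ • z)) o = j (γ * δ z) o := by
    rcases h2 with h2 | h2
    · rw [inv_mul_eq_one] at h2
      rw [← h2]
    · rw [inv_mul_eq_iff_eq_mul] at h2
      rw [h2, mul_neg_one, hj.neg hneg (Γ.mul_mem hγ (hδ z))]
  rw [h3, hj.mul _ hγ _ (hδ z), hδz]

/-- A function on an open set that is compatible with the automorphy factor extends. -/
lemma exists_isEquivariant_extension (hj : IsCocycle Γ j) {J : ℍ → Circle}
    (hJ : IsEquivariant Γ j J) {V : Set ℍ} {E : ℍ → Circle}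
    (hE : ∀ γ ∈ Γ, ∀ v ∈ V, γ • v ∈ V → E (γ • v) = j γ v * E v) :
    ∃ F, IsEquivariant Γ j F ∧ ∀ v ∈ V, F v = E v := by
  classical
  set F : ℍ → Circle := fun z =>
    if h : ∃ γ ∈ Γ, γ • z ∈ V then (j h.choose z)⁻¹ * E (h.choose • z) else J z with hF
  have key : ∀ z, ∀ γ ∈ Γ, γ • z ∈ V → F z = (j γ z)⁻¹ * E (γ • z) := fun z γ hγ hz => by
    have h : ∃ γ ∈ Γ, γ • z ∈ V := ⟨γ, hγ, hz⟩
    rw [hF]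
    simp only
    rw [dif_pos h]
    obtain ⟨hδ, hδz⟩ := h.choose_spec
    set δ := h.choose
    have h1 := hE (δ * γ⁻¹) (Γ.mul_mem hδ (Γ.inv_mem hγ)) _ hz (by
      rwa [mul_smul, inv_smul_smul])
    have h2 := hj.mul (δ * γ⁻¹) (Γ.mul_mem hδ (Γ.inv_mem hγ)) γ hγ z
    rw [inv_mul_cancel_right] at h2
    rw [mul_smul, inv_smul_smul] at h1
    rw [h1, h2]
    group
  refine ⟨F, fun γ hγ z => ?_, fun v hv => ?_⟩
  · by_cases h : ∃ δ ∈ Γ, δ • z ∈ V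
    · obtain ⟨δ, hδ, hδz⟩ := h
      rw [key z δ hδ hδz, key (γ • z) (δ * γ⁻¹) (Γ.mul_mem hδ (Γ.inv_mem hγ)) (by
        rwa [mul_smul, inv_smul_smul]), mul_smul, inv_smul_smul]
      have h2 := hj.mul (δ * γ⁻¹) (Γ.mul_mem hδ (Γ.inv_mem hγ)) γ hγ z
      rw [inv_mul_cancel_right] at h2
      rw [h2]
      group
    · have h' : ¬ ∃ δ ∈ Γ, δ • γ • z ∈ V := fun ⟨δ, hδ, hδz⟩ =>
        h ⟨δ * γ, Γ.mul_mem hδ hγ, by rwa [mul_smul]⟩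
      rw [hF]
      simp only
      rw [dif_neg h, dif_neg h', hJ γ hγ]
  · rw [key v 1 Γ.one_mem (by rwa [one_smul]), hj.one, one_smul, inv_one, one_mul]

end Equivariant

end SpinQuotient

/-! ### Automorphy factors trivial at the cusps have continuous trivializations. -/

namespace SpinQuotient
open Filter Topology UpperHalfPlane Function.Periodic

variable {Γ : Subgroup SL(2, ℝ)} {j : SL(2, ℝ) → ℍ → Circle} {g : ℕ}
  {ι : Base Γ → ClosedSurface g} {C : Finset (ClosedSurface g)}

/-- The automorphy factor is trivialized along the cusp `a • ∞` of width `l`. -/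
def IsCuspTrivialization (j : SL(2, ℝ) → ℍ → Circle) (a : SL(2, ℝ)) (l : ℝ) (E : ℍ → Circle) :
    Prop :=
  Continuous E ∧ ∀ w, E (l +ᵥ w) = j (a * unip l * a⁻¹) (a • w) * E w

lemma IsCuspTrivialization.int (hj : IsCocycle Γ j) {a : SL(2, ℝ)} {l : ℝ} (hl : IsWidth Γ a l)
    {E : ℍ → Circle} (hE : IsCuspTrivialization j a l E) (n : ℤ) (w : ℍ) :
    E ((n * l) +ᵥ w) = j (a * unip (n * l) * a⁻¹) (a • w) * E w := by
  have hmem : ∀ n : ℤ, a * unip (n * l) * a⁻¹ ∈ Γ := fun n => (hl.2 _).2 ⟨n, rfl⟩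
  have h1 : a * unip l * a⁻¹ ∈ Γ := by simpa using hmem 1
  have hstep : ∀ n : ℤ, ∀ w, (E ((n * l) +ᵥ w) = j (a * unip (n * l) * a⁻¹) (a • w) * E w ↔
      E (((n + 1 : ℤ) * l) +ᵥ w) = j (a * unip ((n + 1 : ℤ) * l) * a⁻¹) (a • w) * E w) := by
    intro n w
    have h2 : ((n + 1 : ℤ) * l) = l + n * l := by push_cast; ring
    rw [h2, add_vadd, hE.2, unip_add, show a * (unip l * unip (n * l)) * a⁻¹ =
      (a * unip l * a⁻¹) * (a * unip (n * l) * a⁻¹) by group, hj.mul _ h1 _ (hmem n),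
      show (a * unip (n * l) * a⁻¹) • a • w = a • ((n * l) +ᵥ w) by
        rw [← unip_smul]; simp only [← mul_smul]; congr 1; group,
      mul_assoc (j (a * unip l * a⁻¹) _)]
    exact ⟨fun h => by rw [h], fun h => mul_left_cancel h⟩
  induction n using Int.induction_on generalizing w with
  | zero => simp [unip_zero, hj.one]
  | succ n ih => exact (hstep n w).1 (ih w)
  | pred n ih =>
    refine (hstep (-n - 1) w).2 ?_
    rw [sub_add_cancel]
    exact ih w

/-- `F` is a local frame near `y`: equivariant, and continuous near `y`. -/
def IsLocalFrame (Γ : Subgroup SL(2, ℝ)) (j : SL(2, ℝ) → ℍ → Circle)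
    (ι : Base Γ → ClosedSurface g) (y : ClosedSurface g) (F : ℍ → Circle) : Prop :=
  IsEquivariant Γ j F ∧ ∀ᶠ x in 𝓝 y, ∀ z, ι (baseMk Γ z) = x → ContinuousAt F z

/-- On a neighbourhood meeting its translates by `±1` only, the constant one satisfies the
transformation law and extends equivariantly. -/
lemma exists_isLocalFrame_base (hM : IsModel Γ ι C) (hj : IsCocycle Γ j) {J : ℍ → Circle}
    (hJ : IsEquivariant Γ j J) (z : ℍ) : ∃ F, IsLocalFrame Γ j ι (ι (baseMk Γ z)) F := by
  have := hM.discrete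
  obtain ⟨U, hU, hUγ⟩ := ProperlyDiscontinuousSMul.exists_nhds_image_smul_eq_self Γ z
  obtain ⟨V, hVU, hV, hzV⟩ := mem_nhds_iff.1 hU
  obtain ⟨F, hF, hFV⟩ := exists_isEquivariant_extension hj hJ (V := V) (E := 1)
    fun γ hγ v hv hγv => by
      have h3 := hUγ ⟨γ, hγ⟩ ⟨γ • v, ⟨v, hVU hv, rfl⟩, hVU hγv⟩
      rcases hM.free γ hγ z h3 with rfl | rfl
      · simp [hj.one]
      · simp [hj.neg_one]
  refine ⟨F, hF, ?_⟩
  have h1 : ι '' (baseMk Γ '' V) ∈ 𝓝 (ι (baseMk Γ z)) :=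
    (hM.isOpenEmbedding.isOpenMap _ ((isOpenQuotientMap_baseMk Γ).isOpenMap _ hV)).mem_nhds
      ⟨_, ⟨z, hzV, rfl⟩, rfl⟩
  filter_upwards [h1]
  rintro _ ⟨_, ⟨v, hv, rfl⟩, rfl⟩ w hw
  obtain ⟨γ, hγ, rfl⟩ := baseMk_eq_iff.1 (hM.isOpenEmbedding.injective hw)
  refine hF.continuousAt hj hγ ?_
  refine (continuousAt_const (y := (1 : Circle))).congr ?_
  filter_upwards [hV.mem_nhds hv] with w hw using (hFV w hw).symm

lemma IsCuspPoint.eventually {a : SL(2, ℝ)} {l : ℝ} {c : ClosedSurface g}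
    (hc : IsCuspPoint ι a l c) (hl : 0 < l) {M : ℝ} :
    ∀ᶠ x in 𝓝 c, x = c ∨ ∃ w : ℍ, M < w.im ∧ ι (baseMk Γ (a • w)) = x := by
  obtain ⟨e, he, h0, N, hN⟩ := hc
  have h1 : ∀ᶠ x in 𝓝 c, e x ∈ Metric.ball (0 : ℂ) (Real.exp (-2 * Real.pi * (max M (max N 1)) / l)) :=
    (e.continuousAt he).eventually (h0 ▸ Metric.ball_mem_nhds _ (Real.exp_pos _))
  filter_upwards [h1, e.open_source.mem_nhds he] with x hx hxe
  by_cases hx0 : e x = 0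
  · exact Or.inl (e.injOn hxe he (hx0.trans h0.symm))
  · obtain ⟨w, hw, hwq⟩ := exists_qParam_eq hl (M := max M (max N 1)) (by positivity) hx0
      (mem_ball_zero_iff.1 hx)
    obtain ⟨h2, h3⟩ := hN w (((le_max_left _ _).trans (le_max_right _ _)).trans_lt hw)
    exact Or.inr ⟨w, (le_max_left _ _).trans_lt hw, e.injOn h2 hxe (h3.trans hwq)⟩

/-- On a horoball only the stabilizer of the cusp identifies points, and for it `E` has the right
transformation law. Declaring `E` a frame extends the circle bundle over the puncture. -/
lemma exists_isLocalFrame_cusp (hM : IsModel Γ ι C) (hj : IsCocycle Γ j) {J : ℍ → Circle}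
    (hJ : IsEquivariant Γ j J) {a : SL(2, ℝ)} {l : ℝ} (ha : CuspData Γ a l) {c : ClosedSurface g}
    (hcC : c ∈ C) (hc : IsCuspPoint ι a l c) {E : ℍ → Circle} (hE : IsCuspTrivialization j a l E) :
    ∃ F, IsLocalFrame Γ j ι c F := by
  have := hM.t2Space
  obtain ⟨M, hM0, hsep⟩ := exists_horoball ha.2 ha.1
  set V : Set ℍ := {v | M < (a⁻¹ • v).im} with hV
  have hVo : IsOpen V := isOpen_lt continuous_const
    (UpperHalfPlane.continuous_im.comp (continuous_const_smul a⁻¹))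
  obtain ⟨F, hF, hFV⟩ := exists_isEquivariant_extension hj hJ (V := V) (E := fun v => E (a⁻¹ • v))
    fun γ hγ v hv hγv => by
      have h1 := hsep γ hγ (a⁻¹ • v) hv (by
        rwa [mul_smul, mul_smul, smul_inv_smul])
      obtain ⟨n, hn⟩ := ha.2.stabilizer hM.neg_one_mem hγ h1
      have hmem : a * unip (n * l) * a⁻¹ ∈ Γ := (ha.2.2 _).2 ⟨n, rfl⟩
      have h2 := hE.int hj ha.2 n (a⁻¹ • v)
      rw [smul_inv_smul] at h2
      have h3 : a⁻¹ • (a * unip (n * l) * a⁻¹) • v = (n * l) +ᵥ a⁻¹ • v := by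
        rw [← unip_smul]; simp only [← mul_smul]; congr 1; group
      rcases hn with rfl | rfl
      · rw [h3, h2]
      · rw [hj.neg hM.neg_one_mem hmem, neg_smul_uhp, h3, h2]
  refine ⟨F, hF, ?_⟩
  filter_upwards [hc.eventually ha.2.1 (M := M)] with x hx w hw
  rcases hx with rfl | ⟨v, hv, hvx⟩
  · exact absurd hcC ((hM.notMem_iff _).2 ⟨_, hw⟩)
  · obtain ⟨γ, hγ, rfl⟩ := baseMk_eq_iff.1 (hM.isOpenEmbedding.injective (hw.trans hvx.symm))
    refine hF.continuousAt hj hγ ?_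
    have hvV : a • v ∈ V := by rw [hV, Set.mem_ofPred_eq, inv_smul_smul]; exact hv
    refine ((hE.1.comp (continuous_const_smul a⁻¹)).continuousAt).congr ?_
    filter_upwards [hVo.mem_nhds hvV] with w hw using (hFV w hw).symm

/-- A unitary automorphy factor that is trivial along the cusps is trivial. -/
theorem exists_continuous_isEquivariant (hM : IsModel Γ ι C) (hC : C.Nonempty)
    (hj : IsCocycle Γ j)
    (hE : ∀ a l, CuspData Γ a l → ∃ E, IsCuspTrivialization j a l E) :
    ∃ F : C(ℍ, Circle), IsEquivariant Γ j F := by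
  classical
  obtain ⟨c₀, hc₀⟩ := hC
  obtain ⟨J, hJ⟩ := exists_isEquivariant hj hM.neg_one_mem hM.free
  have hframe : ∀ y, ∃ F, IsLocalFrame Γ j ι y F := fun y => by
    by_cases hy : y ∈ C
    · obtain ⟨a, l, hal, hp⟩ := hM.exists_cusp y hy
      obtain ⟨E, hE⟩ := hE a l hal
      exact exists_isLocalFrame_cusp hM hj hJ hal hy hp hE
    · obtain ⟨x, rfl⟩ := (hM.notMem_iff y).1 hy
      obtain ⟨z, rfl⟩ := (isOpenQuotientMap_baseMk Γ).surjective x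
      exact exists_isLocalFrame_base hM hj hJ z
  choose F hF using hframe
  have hrep : ∀ x : Base Γ, baseMk Γ (Quotient.out x) = x := fun x => Quotient.out_eq x
  have hpre : ∀ z, ∃ γ ∈ Γ, γ • (Quotient.out (baseMk Γ z) : ℍ) = z := fun z =>
    baseMk_eq_iff.1 (hrep _).symm
  have hinv : ∀ {F G : ℍ → Circle}, IsEquivariant Γ j F → IsEquivariant Γ j G → ∀ z,
      F (Quotient.out (baseMk Γ z)) / G (Quotient.out (baseMk Γ z)) = F z / G z := by
    intro F G hF hG z
    obtain ⟨γ, hγ, h⟩ := hpre z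
    conv_rhs => rw [← h]
    rw [hF γ hγ, hG γ hγ, mul_div_mul_left_eq_div]
  -- The quotient of two equivariant functions is invariant and descends to the surface. Its value
  -- at the punctures is immaterial.
  set τ : ClosedSurface g → ClosedSurface g → Circle := fun y x =>
    if h : x ∈ Set.range ι then F y (Quotient.out h.choose) / J (Quotient.out h.choose) else 1 with hτ
  have hτz : ∀ y z, τ y (ι (baseMk Γ z)) = F y z / J z := fun y z => by
    have h : ι (baseMk Γ z) ∈ Set.range ι := ⟨_, rfl⟩
    simp only [hτ]
    rw [dif_pos h, hM.isOpenEmbedding.injective h.choose_spec, hinv (hF y).1 hJ]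
  have hop : IsOpenQuotientMap (baseMk Γ) := isOpenQuotientMap_baseMk Γ
  have hcomp : ∀ {φ : ClosedSurface g → Circle} {z : ℍ},
      ContinuousAt (fun w => φ (ι (baseMk Γ w))) z → ContinuousAt φ (ι (baseMk Γ z)) := by
    intro φ z h
    have h1 : IsOpenMap fun w => ι (baseMk Γ w) := hM.isOpenEmbedding.isOpenMap.comp hop.isOpenMap
    exact (tendsto_map'_iff.2 h).mono_left (h1.nhds_le z)
  have htw : IsTwist τ := fun y => by
    have hCy : ∀ᶠ x in 𝓝 y, x ∈ C → x = y := by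
      have h1 : IsOpen ((C : Set (ClosedSurface g)) \ {y})ᶜ :=
        (C.finite_toSet.subset Set.sdiff_subset).isClosed.isOpen_compl
      filter_upwards [h1.mem_nhds (show y ∈ _ by simp)] with x hx hxC
      by_contra hxy
      exact hx ⟨hxC, hxy⟩
    filter_upwards [hCy, (hF y).2] with x hx hFx
    -- Near `y` the only possible puncture is `y` itself, where the two frames compared coincide and
    -- their quotient is constant.
    by_cases hxC : x ∈ C
    · rw [hx hxC]
      simp only [div_self']
      exact continuousAt_const
    · obtain ⟨x, rfl⟩ := (hM.notMem_iff x).1 hxC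
      obtain ⟨z, rfl⟩ := hop.surjective x
      refine hcomp ?_
      have h1 : ContinuousAt (F (ι (baseMk Γ z))) z := (hF _).2.self_of_nhds z rfl
      refine (h1.div' (hFx z rfl)).congr (Eventually.of_forall fun w => ?_)
      simp only [hτz, div_div_div_cancel_right, Pi.div_apply]
  -- The point where the section may fail is put at a cusp, which `ℍ` does not see. This is where
  -- the presence of a cusp is used.
  obtain ⟨h, hh⟩ := htw.exists_section_off hM.planar c₀
  have hcont : ∀ z, ContinuousAt (fun z => h (ι (baseMk Γ z)) * J z) z := fun z => by
    have hne : ι (baseMk Γ z) ≠ c₀ := fun h => (hM.notMem_iff c₀).2 ⟨_, h⟩ hc₀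
    have h1 := hh _ hne
    have h2 : ContinuousAt (fun w => h (ι (baseMk Γ w)) / τ (ι (baseMk Γ z)) (ι (baseMk Γ w))) z :=
      ContinuousAt.comp (f := fun w => ι (baseMk Γ w)) h1
        (hM.isOpenEmbedding.continuous.comp hop.continuous).continuousAt
    have h3 : ContinuousAt (F (ι (baseMk Γ z))) z := (hF _).2.self_of_nhds z rfl
    refine (ContinuousAt.mul h2 h3).congr (Eventually.of_forall fun w => ?_)
    simp only [hτz]
    show h (ι (baseMk Γ w)) / (F (ι (baseMk Γ z)) w / J w) * F (ι (baseMk Γ z)) w = _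
    rw [div_div_eq_mul_div, div_mul_cancel]
  refine ⟨⟨_, continuous_iff_continuousAt.2 hcont⟩, fun γ hγ z => ?_⟩
  show h (ι (baseMk Γ (γ • z))) * J (γ • z) = j γ z * (h (ι (baseMk Γ z)) * J z)
  rw [baseMk_smul hγ, hJ γ hγ, mul_left_comm]

end SpinQuotient

/-! ### Degrees at punctures and square roots along cusp loops. -/

namespace SpinQuotient
open Filter Topology UpperHalfPlane Function.Periodic

variable {Γ : Subgroup SL(2, ℝ)} {g : ℕ}
  {ι : Base Γ → ClosedSurface g} {C : Finset (ClosedSurface g)}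

/-- The extension of a function on `Γ\ℍ` to the closed surface. -/
def extendFun (ι : Base Γ → ClosedSurface g) (f : Base Γ → Circle) : ClosedSurface g → Circle :=
  Function.extend ι f 1

lemma IsModel.extendFun_apply (hM : IsModel Γ ι C) (f : Base Γ → Circle) (x : Base Γ) :
    extendFun ι f (ι x) = f x :=
  hM.isOpenEmbedding.injective.extend_apply _ _ _

lemma IsModel.continuousAt_extendFun (hM : IsModel Γ ι C) (f : C(Base Γ, Circle))
    {x : ClosedSurface g} (hx : x ∉ C) : ContinuousAt (extendFun ι f) x := by
  obtain ⟨x, rfl⟩ := (hM.notMem_iff x).1 hx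
  refine (hM.isOpenEmbedding.continuousAt_iff).1 ?_
  rw [show extendFun ι f ∘ ι = f from funext (hM.extendFun_apply f)]
  exact f.continuous.continuousAt

lemma IsModel.isOpenMap_cusp (hM : IsModel Γ ι C) (a : SL(2, ℝ)) :
    IsOpenMap fun z : ℍ => ι (baseMk Γ (a • z)) :=
  hM.isOpenEmbedding.isOpenMap.comp ((isOpenQuotientMap_baseMk Γ).isOpenMap.comp (isOpenMap_smul a))

lemma continuous_cuspMap (Γ : Subgroup SL(2, ℝ)) (a : SL(2, ℝ)) :
    Continuous fun z : ℍ => baseMk Γ (a • z) :=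
  (isOpenQuotientMap_baseMk Γ).continuous.comp (continuous_const_smul a)

lemma dirn_qParam (l : ℝ) (z : ℂ) : dirn (qParam l z) = Circle.exp (2 * Real.pi * z.re / l) := by
  have h1 : qParam l z = ((Real.exp (-2 * Real.pi * z.im / l) : ℝ) : ℂ) *
      (Circle.exp (2 * Real.pi * z.re / l) : ℂ) := by
    rw [qParam, Circle.coe_exp, Complex.ofReal_exp, ← Complex.exp_add]
    congr 1
    conv_lhs => rw [← Complex.re_add_im z]
    push_cast
    linear_combination (2 * (Real.pi : ℂ) * z.im / l) * Complex.I_sq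
  rw [h1, dirn_real_mul (Real.exp_pos _), dirn_circle]

/-- A circle-valued function near a cusp has a logarithm on `ℍ`, with a period. -/
lemma exists_cusp_log (f : C(Base Γ, Circle)) {a : SL(2, ℝ)} {l : ℝ} (hl : IsWidth Γ a l) :
    ∃ (v : C(ℍ, ℝ)) (n : ℤ), (∀ z, Circle.exp (v z) = f (baseMk Γ (a • z))) ∧
      ∀ z, v (l +ᵥ z) = v z + 2 * Real.pi * n := by
  obtain ⟨v, hv⟩ := exists_circle_lift (Y := ℍ)
    ⟨fun z => f (baseMk Γ (a • z)), f.continuous.comp (continuous_cuspMap Γ a)⟩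
  have hc : Continuous fun z : ℍ => (l +ᵥ z : ℍ) := by
    simp only [← unip_smul]; exact continuous_const_smul _
  obtain ⟨n, hn⟩ := exists_int_of_circle_exp_eq_one_on (v := fun z => v (l +ᵥ z) - v z)
    (isPreconnected_univ (α := ℍ)) ((v.continuous.comp hc).sub v.continuous).continuousOn
    fun z _ => by
      have h1 : baseMk Γ (a • (l +ᵥ z)) = baseMk Γ (a • z) := by simpa using hl.baseMk_vadd 1 z
      rw [Circle.exp_sub, hv, hv]
      simp only [ContinuousMap.coe_mk, h1, div_self']
  exact ⟨v, n, hv, fun z => by linarith [hn z trivial]⟩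

/-- In the chart at the cusp, the period of the logarithm under `z ↦ z + l` counts the winding
around the puncture. It agrees with the degree up to sign, hence in parity. -/
lemma even_degAt_iff (hM : IsModel Γ ι C) (f : C(Base Γ, Circle)) {a : SL(2, ℝ)} {l : ℝ}
    (hl : IsWidth Γ a l) {c : ClosedSurface g} (hc : IsCuspPoint ι a l c) {v : C(ℍ, ℝ)} {n : ℤ}
    (hv : ∀ z, Circle.exp (v z) = f (baseMk Γ (a • z)))
    (hvn : ∀ z, v (l +ᵥ z) = v z + 2 * Real.pi * n) :
    Even (degAt (extendFun ι f) c) ↔ Even n := by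
  obtain ⟨e, he, h0, N, hN⟩ := id hc
  have hl0 := hl.1
  set k : ClosedSurface g → Circle := fun x => dirn (e x) with hk
  have hgen : IsGenAt k c := isGenAt_dirn_of_chart e he h0
  have habs := hgen.abs_degAt hM.planar
  have hfp : PuncCont (extendFun ι f) c := puncCont_of_finite C.finite_toSet
    (fun x hx => hM.continuousAt_extendFun f hx) c
  have hkp : PuncCont k c := hgen.1
  -- `2π * Re z / l` is the argument of `q`. Removing `n` times this argument leaves a function of
  -- period `l`, hence a logarithm on the punctured disc.
  set v' : ℍ → ℝ := fun z => v z - n * (2 * Real.pi * z.re / l) with hv'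
  have hv'c : Continuous v' := by
    have := UpperHalfPlane.continuous_re
    fun_prop
  have hper : ∀ z, v' (l +ᵥ z) = v' z := fun z => by
    simp only [hv', hvn, vadd_re]
    field_simp
    ring
  have hperz : ∀ (m : ℤ) z, v' (((m : ℝ) * l) +ᵥ z) = v' z := by
    have hs : ∀ (m : ℤ) z, v' ((((m + 1 : ℤ) : ℝ) * l) +ᵥ z) = v' (((m : ℝ) * l) +ᵥ z) :=
      fun m z => by
        rw [← hper ((((m : ℝ) * l) +ᵥ z)), ← add_vadd]
        congr 2; push_cast; ring
    intro m z
    induction m using Int.induction_on with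
    | zero => simp
    | succ m ih => rw [hs, ih]
    | pred m ih => rw [← hs, sub_add_cancel, ih]
  have hlog : HasLogAt (extendFun ι f * k ^ (-n)) c := by
    set y : ClosedSurface g → ℝ := fun x => v' (ofComplex (invQParam l (e x))) with hy
    have hyv : ∀ z : ℍ, N < z.im → y (ι (baseMk Γ (a • z))) = v' z := fun z hz => by
      obtain ⟨m, hm⟩ := qParam_left_inv_mod_period hl0.ne' (z : ℂ)
      simp only [hy, (hN z hz).2, hm]
      rw [show ((z : ℂ) + m * l) = (((m : ℝ) * l +ᵥ z : ℍ) : ℂ) by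
        rw [coe_vadd]; push_cast; ring, ofComplex_apply, hperz]
    refine ⟨y, ?_⟩
    filter_upwards [nhdsWithin_le_nhds (hc.eventually hl0 (M := N)), self_mem_nhdsWithin]
      with x hx hxc
    obtain ⟨w, hw, rfl⟩ := hx.resolve_left hxc
    constructor
    · have h1 : Tendsto (fun z : ℍ => y (ι (baseMk Γ (a • z)))) (𝓝 w) (𝓝 (v' w)) := by
        refine (hv'c.tendsto w).congr' ?_
        filter_upwards [(isOpen_lt continuous_const UpperHalfPlane.continuous_im).mem_nhds hw]
          with z hz using (hyv z hz).symm
      rw [ContinuousAt, hyv w hw]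
      exact (tendsto_map'_iff.2 h1).mono_left ((hM.isOpenMap_cusp a).nhds_le w)
    · rw [hyv w hw, Pi.mul_apply, Pi.pow_apply, hM.extendFun_apply, ← hv, hk]
      simp only
      rw [(hN w hw).2, dirn_qParam, ← Circle.exp_zsmul, ← Circle.exp_add, hv', zsmul_eq_mul]
      push_cast
      congr 1
      simp only [coe_re]
      ring
  have hdeg : degAt (extendFun ι f) c = n * degAt k c := by
    have h1 := (degAt_eq_zero_iff hM.planar (hfp.mul (hkp.zpow (-n)))).2 hlog
    rw [degAt_mul hM.planar hfp (hkp.zpow _), degAt_zpow hM.planar hkp] at h1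
    linarith
  have hodd : ¬ Even (degAt k c) := by
    rcases (abs_eq (by norm_num)).1 habs with h | h <;> rw [h] <;> decide
  rw [hdeg, Int.even_mul]
  exact or_iff_left hodd

/-- Up to sign, `exp (L / 2)` is the only continuous square root along the path, and once around the
loop it is multiplied by `exp (πn) = (-1)^n`. The logarithm lives on all of `ℍ`, so it does not
matter that the loop runs at height one and not close to the cusp. -/
lemma exists_sqrt_cuspLoop_iff (hM : IsModel Γ ι C) (f : C(Base Γ, Circle)) {a : SL(2, ℝ)} {l : ℝ}
    (hl : IsWidth Γ a l) {c : ClosedSurface g} (hc : IsCuspPoint ι a l c) :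
    (∃ W : C(unitInterval, Circle), W 0 = W 1 ∧ ∀ t, W t ^ 2 = f (cuspLoop Γ a l t)) ↔
      Even (degAt (extendFun ι f) c) := by
  obtain ⟨v, n, hv, hvn⟩ := exists_cusp_log f hl
  rw [even_degAt_iff hM f hl hc hv hvn]
  set L : unitInterval → ℝ := fun t => v (((t : ℝ) * l) +ᵥ I) with hL
  have hLc : Continuous L := by
    rw [hL]
    simp only [← unip_smul]
    exact v.continuous.comp ((continuous_unip.comp (by fun_prop)).smul continuous_const)
  have hLf : ∀ t, Circle.exp (L t) = f (cuspLoop Γ a l t) := fun t => by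
    rw [hL]
    simp only [hv]
    rw [← unip_smul, ← mul_smul]
    rfl
  have hL01 : L 1 = L 0 + 2 * Real.pi * n := by
    simp [hL, hvn]
  have hhalf : ∀ t, Circle.exp (L t / 2) ^ 2 = f (cuspLoop Γ a l t) := fun t => by
    rw [pow_two, ← Circle.exp_add, add_halves, hLf]
  have hhalf01 : Circle.exp (L 1 / 2) = Circle.exp (L 0 / 2) * Circle.exp (Real.pi * n) := by
    rw [hL01, ← Circle.exp_add]; congr 1; ring
  have hexp : Circle.exp (Real.pi * n) = 1 ↔ Even n := by
    constructor
    · intro h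
      obtain ⟨m, hm⟩ := exists_int_of_circle_exp_eq_one h
      have h2 : Real.pi * (n : ℝ) = Real.pi * (2 * m) := by rw [hm]; ring
      have h3 : (n : ℝ) = 2 * m := mul_left_cancel₀ Real.pi_ne_zero h2
      exact ⟨m, by have : n = 2 * m := by exact_mod_cast h3
                   omega⟩
    · rintro ⟨m, rfl⟩
      rw [← circle_exp_two_pi_int m]
      congr 1
      push_cast; ring
  rw [← hexp]
  constructor
  · rintro ⟨W, hW, hWf⟩
    have hsq : ∀ t, (W t / Circle.exp (L t / 2)) ^ 2 = 1 := fun t => by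
      rw [div_pow, hWf, hhalf, div_self']
    have key := (isPreconnected_univ (α := unitInterval)).eq_one_or_eq_neg_one_of_sq_eq
      (f := fun t => ((W t / Circle.exp (L t / 2) : Circle) : ℂ))
      (continuous_subtype_val.comp (W.continuous.div' (by fun_prop))).continuousOn
      (fun t _ => by
        have := congrArg (fun c : Circle => (c : ℂ)) (hsq t)
        simpa using this)
    have h01 : W 0 / Circle.exp (L 0 / 2) = W 1 / Circle.exp (L 1 / 2) := by
      apply Circle.ext
      rcases key with key | key <;>
        exact (key (Set.mem_univ 0)).trans (key (Set.mem_univ 1)).symm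
    rw [hW, div_right_inj, hhalf01] at h01
    exact mul_eq_left.1 h01.symm
  · intro h
    refine ⟨⟨fun t => Circle.exp (L t / 2), by fun_prop⟩, ?_, hhalf⟩
    show Circle.exp (L 0 / 2) = Circle.exp (L 1 / 2)
    rw [hhalf01, h, mul_one]

end SpinQuotient

/-! ### The automorphy factor of weight two, and rotations. -/

namespace SpinQuotient
open Filter Topology UpperHalfPlane

/-- The automorphy factor `cz + d`. -/
def autFactor (g : SL(2, ℝ)) (z : ℍ) : ℂ := g 1 0 * z + g 1 1

lemma autFactor_ne_zero (g : SL(2, ℝ)) (z : ℍ) : autFactor g z ≠ 0 :=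
  UpperHalfPlane.denom_ne_zero (g : GL (Fin 2) ℝ) z

lemma autFactor_mul (g h : SL(2, ℝ)) (z : ℍ) :
    autFactor (g * h) z = autFactor g (h • z) * autFactor h z := by
  have h0 := autFactor_ne_zero h z
  have h1 : ((h • z : ℍ) : ℂ) = ((h 0 0 : ℂ) * z + h 0 1) / autFactor h z :=
    coe_specialLinearGroup_apply h z
  have h2 : ∀ i j, (g * h) i j = g i 0 * h 0 j + g i 1 * h 1 j := fun i j => by
    show (g.1 * h.1) i j = _
    rw [Matrix.mul_apply, Fin.sum_univ_two]
  have h3 : autFactor g (h • z) * autFactor h z =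
      g 1 0 * ((h 0 0 : ℂ) * z + h 0 1) + g 1 1 * autFactor h z := by
    rw [autFactor, h1]
    field_simp
  rw [h3, autFactor, h2, h2, autFactor]
  push_cast
  ring

/-- The automorphy factor `((cz + d) / |cz + d|) ^ 2`. -/
def weightTwo (g : SL(2, ℝ)) (z : ℍ) : Circle := dirn (autFactor g z) ^ 2

lemma weightTwo_mul (g h : SL(2, ℝ)) (z : ℍ) :
    weightTwo (g * h) z = weightTwo g (h • z) * weightTwo h z := by
  rw [weightTwo, autFactor_mul, dirn_mul (autFactor_ne_zero _ _) (autFactor_ne_zero _ _), mul_pow]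
  rfl

lemma continuous_weightTwo : Continuous fun x : SL(2, ℝ) × ℍ => weightTwo x.1 x.2 := by
  have h1 : Continuous fun x : SL(2, ℝ) × ℍ => autFactor x.1 x.2 := by
    have hij : ∀ i j, Continuous fun x : SL(2, ℝ) × ℍ => ((x.1 i j : ℝ) : ℂ) := fun i j =>
      Complex.continuous_ofReal.comp
        ((continuous_id.matrix_elem i j).comp (continuous_subtype_val.comp continuous_fst))
    exact ((hij 1 0).mul (isEmbedding_coe.continuous.comp continuous_snd)).add (hij 1 1)
  exact continuous_iff_continuousAt.2 fun x =>
    (ContinuousAt.comp (f := fun x : SL(2, ℝ) × ℍ => autFactor x.1 x.2)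
      (continuousAt_dirn (autFactor_ne_zero _ _)) h1.continuousAt).pow 2

lemma continuous_weightTwo_right (g : SL(2, ℝ)) : Continuous (weightTwo g) := by
  have h1 : Continuous fun z : ℍ => (g, z) := by fun_prop
  have h2 : weightTwo g = (fun x : SL(2, ℝ) × ℍ => weightTwo x.1 x.2) ∘ fun z => (g, z) := rfl
  rw [h2]
  exact continuous_weightTwo.comp h1

lemma weightTwo_neg_one (z : ℍ) : weightTwo (-1) z = 1 := by
  have h1 : autFactor (-1) z = ((-1 : Circle) : ℂ) := by simp [autFactor]
  rw [weightTwo, h1, dirn_circle, neg_one_sq]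

lemma isCocycle_weightTwo (Γ : Subgroup SL(2, ℝ)) : IsCocycle Γ weightTwo where
  continuous γ _ := continuous_weightTwo_right γ
  mul γ _ δ _ z := weightTwo_mul γ δ z
  neg_one := weightTwo_neg_one

lemma weightTwo_unip (t : ℝ) (z : ℍ) : weightTwo (unip t) z = 1 := by
  have h1 : autFactor (unip t) z = 1 := by simp [autFactor, unip]
  rw [weightTwo, h1, dirn_one, one_pow]

/-- A continuous unitary automorphic function of weight two. -/
lemma exists_weightTwo {Γ : Subgroup SL(2, ℝ)} {g : ℕ} {ι : Base Γ → ClosedSurface g}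
    {C : Finset (ClosedSurface g)} (hM : IsModel Γ ι C) (hC : C.Nonempty) :
    ∃ F : C(ℍ, Circle), IsEquivariant Γ weightTwo F :=
  exists_continuous_isEquivariant hM hC (isCocycle_weightTwo Γ) fun a l _ =>
    -- By the cocycle identity, `weightTwo a` trivializes the factor along the cusp `a • ∞`, because
    -- unipotent matrices have factor one.
    ⟨weightTwo a, continuous_weightTwo_right a, fun w => by
      rw [← weightTwo_mul, inv_mul_cancel_right, weightTwo_mul, weightTwo_unip, mul_one, unip_smul]⟩

/-- The rotation matrix `exp (θ C)`. -/
def rotMat (θ : ℝ) : SL(2, ℝ) :=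
  ⟨!![Real.cos θ, Real.sin θ; -Real.sin θ, Real.cos θ], by
    rw [Matrix.det_fin_two_of]; linarith [Real.sin_sq_add_cos_sq θ]⟩

lemma continuous_rotMat : Continuous rotMat := by
  refine Continuous.subtype_mk (continuous_matrix fun i j => ?_) _
  fin_cases i <;> fin_cases j <;> simp <;> fun_prop

lemma rotMat_smul_I (θ : ℝ) : rotMat θ • I = I := by
  have h : (-(Real.sin θ : ℂ) * Complex.I + Real.cos θ) ≠ 0 := by
    have := autFactor_ne_zero (rotMat θ) I
    simpa [autFactor, rotMat] using this
  rw [UpperHalfPlane.ext_iff, coe_specialLinearGroup_apply]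
  simp only [rotMat, Algebra.algebraMap_self, RingHom.id_apply, of_apply, cons_val', cons_val_zero,
    cons_val_fin_one, cons_val_one, coe_I, Complex.ofReal_neg]
  rw [div_eq_iff h]
  linear_combination (Real.sin θ : ℂ) * Complex.I_sq

lemma autFactor_rotMat (θ : ℝ) : autFactor (rotMat θ) I = (Circle.exp (-θ) : ℂ) := by
  rw [Circle.coe_exp]
  push_cast
  rw [Complex.exp_mul_I]
  simp [autFactor, rotMat]
  ring

lemma weightTwo_rotMat (θ : ℝ) : weightTwo (rotMat θ) I = Circle.exp (-(2 * θ)) := by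
  rw [weightTwo, autFactor_rotMat, dirn_circle, pow_two, ← Circle.exp_add]
  congr 1; ring

lemma exists_rotMat {p : SL(2, ℝ)} (hp : p • I = I) : ∃ θ, p = rotMat θ := by
  have h1 : ((p • I : ℍ) : ℂ) * autFactor p I = (p 0 0 : ℂ) * I + p 0 1 := by
    rw [coe_specialLinearGroup_apply]
    exact div_mul_cancel₀ _ (autFactor_ne_zero p I)
  rw [hp, autFactor] at h1
  have hre := congrArg Complex.re h1
  have him := congrArg Complex.im h1
  simp at hre him
  have hdet := p.det_coe
  rw [Matrix.det_fin_two] at hdet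
  have hsq : p 0 0 ^ 2 + p 0 1 ^ 2 = 1 := by
    have e1 : p 1 1 = p 0 0 := him
    have e2 : p 1 0 = -p 0 1 := by linarith
    have e3 : p 0 0 * p 1 1 - p 0 1 * p 1 0 = 1 := hdet
    rw [e1, e2] at e3
    linarith
  have hz : ‖(⟨p 0 0, p 0 1⟩ : ℂ)‖ = 1 := by
    rw [Complex.norm_def, Complex.normSq_mk, ← pow_two, ← pow_two, hsq, Real.sqrt_one]
  have hc := Complex.norm_mul_cos_arg (⟨p 0 0, p 0 1⟩ : ℂ)
  have hs := Complex.norm_mul_sin_arg (⟨p 0 0, p 0 1⟩ : ℂ)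
  rw [hz, one_mul] at hc hs
  refine ⟨Complex.arg ⟨p 0 0, p 0 1⟩, ?_⟩
  ext i j
  show p.1 i j = _
  have e1 : p.1 1 1 = p.1 0 0 := him
  have e2 : p.1 1 0 = -p.1 0 1 := by
    have : -p.1 1 0 = p.1 0 1 := hre
    linarith
  fin_cases i <;> fin_cases j <;> simp [rotMat, hc, hs, e1, e2]

lemma autFactor_toSL2R (z : ℍ) : autFactor z.toSL2R I = ((1 / √z.im : ℝ) : ℂ) := by
  have h : ∀ i j, z.toSL2R i j = !![√z.im, z.re / √z.im; 0, 1 / √z.im] i j := fun i j => by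
    rw [coe_toSL2R]
  rw [autFactor, h, h]
  simp

lemma weightTwo_toSL2R (z : ℍ) : weightTwo z.toSL2R I = 1 := by
  have h := dirn_real_mul (r := 1 / √z.im) (by have := z.im_pos; positivity) 1
  rw [mul_one, dirn_one] at h
  rw [weightTwo, autFactor_toSL2R, h, one_pow]

end SpinQuotient

/-! ### The fibre coordinate and the triviality of the circle bundle. -/

namespace SpinQuotient
open Filter Topology UpperHalfPlane

variable {Γ : Subgroup SL(2, ℝ)}

/-- The projection `G → Γ\G`. -/
abbrev xMk (Γ : Subgroup SL(2, ℝ)) (p : SL(2, ℝ)) : X Γ := Quotient.mk _ p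

lemma xMk_eq_iff {p q : SL(2, ℝ)} : xMk Γ p = xMk Γ q ↔ ∃ γ ∈ Γ, γ * q = p := by
  rw [Quotient.eq'', MulAction.orbitRel_apply]
  constructor
  · rintro ⟨γ, h⟩
    exact ⟨γ.1, γ.2, h⟩
  · rintro ⟨γ, hγ, h⟩
    exact ⟨⟨γ, hγ⟩, h⟩

lemma toBase_xMk (p : SL(2, ℝ)) : toBase Γ (xMk Γ p) = baseMk Γ (p • I) := rfl

lemma isOpenQuotientMap_xMk (Γ : Subgroup SL(2, ℝ)) : IsOpenQuotientMap (xMk Γ) :=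
  MulAction.isOpenQuotientMap_quotientMk

lemma continuous_toBase (Γ : Subgroup SL(2, ℝ)) : Continuous (toBase Γ) := by
  refine (isOpenQuotientMap_xMk Γ).isQuotientMap.continuous_iff.2 ?_
  exact (isOpenQuotientMap_baseMk Γ).continuous.comp (continuous_id.smul continuous_const)

/-- The circle coordinate on `Γ\G` given by an automorphic function of weight two. -/
def fibreCoord {F : ℍ → Circle} (hF : IsEquivariant Γ weightTwo F) : X Γ → Circle :=
  Quotient.lift (fun p : SL(2, ℝ) => F (p • I) / weightTwo p I) (by
    rintro _ q ⟨⟨γ, hγ⟩, rfl⟩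
    show F ((γ * q) • I) / weightTwo (γ * q) I = _
    rw [mul_smul, hF γ hγ, weightTwo_mul, mul_div_mul_left_eq_div])

lemma fibreCoord_xMk {F : ℍ → Circle} (hF : IsEquivariant Γ weightTwo F) (p : SL(2, ℝ)) :
    fibreCoord hF (xMk Γ p) = F (p • I) / weightTwo p I := rfl

lemma continuous_fibreCoord {F : C(ℍ, Circle)} (hF : IsEquivariant Γ weightTwo F) :
    Continuous (fibreCoord hF) := by
  refine (isOpenQuotientMap_xMk Γ).isQuotientMap.continuous_iff.2 ?_
  have h1 : Continuous fun p : SL(2, ℝ) => weightTwo p I := by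
    have h2 : Continuous fun p : SL(2, ℝ) => (p, I) := by fun_prop
    have h3 : (fun p : SL(2, ℝ) => weightTwo p I) =
      (fun x : SL(2, ℝ) × ℍ => weightTwo x.1 x.2) ∘ fun p => (p, I) := rfl
    rw [h3]
    exact continuous_weightTwo.comp h2
  exact (F.continuous.comp (continuous_id.smul continuous_const)).div' h1

/-- The doubled angle is the reason for weight two: as `-1 ∈ Γ`, a fibre of `X` is the rotation
group modulo `±1`, on which `exp (2θ)` is a bijective coordinate. -/
lemma fibreCoord_rotMat {F : ℍ → Circle} (hF : IsEquivariant Γ weightTwo F) (p : SL(2, ℝ)) (θ : ℝ) :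
    fibreCoord hF (xMk Γ (p * rotMat θ)) = fibreCoord hF (xMk Γ p) * Circle.exp (2 * θ) := by
  rw [fibreCoord_xMk, fibreCoord_xMk, weightTwo_mul, mul_smul, rotMat_smul_I, weightTwo_rotMat,
    Circle.exp_neg, ← div_eq_mul_inv, div_div_eq_mul_div, div_mul_eq_mul_div]

lemma rotMat_pi_int (n : ℤ) : rotMat (Real.pi * n) = 1 ∨ rotMat (Real.pi * n) = -1 := by
  have hs : Real.sin (Real.pi * n) = 0 := by rw [mul_comm]; exact Real.sin_int_mul_pi n
  have hc : Real.cos (Real.pi * n) = 1 ∨ Real.cos (Real.pi * n) = -1 := by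
    have := Real.sin_sq_add_cos_sq (Real.pi * n)
    rw [hs] at this
    exact mul_self_eq_one_iff.1 (by linarith)
  refine hc.imp (fun hc => ?_) fun hc => ?_ <;> ext i j
  · fin_cases i <;> fin_cases j <;> simp [rotMat, hc, hs]
  · show (rotMat (Real.pi * n)).1 i j = (-(1 : Matrix (Fin 2) (Fin 2) ℝ)) i j
    fin_cases i <;> fin_cases j <;> simp [rotMat, hc, hs]

/-- Over one point of the base, representatives differ by an element of `Γ` and a rotation. Equal
coordinates make the angle a multiple of `π`, so that the rotation is `±1` and can be absorbed into
`Γ`. -/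
lemma eq_of_toBase_eq_of_fibreCoord_eq (hneg : -1 ∈ Γ) {F : ℍ → Circle}
    (hF : IsEquivariant Γ weightTwo F) {x y : X Γ} (h1 : toBase Γ x = toBase Γ y)
    (h2 : fibreCoord hF x = fibreCoord hF y) : x = y := by
  obtain ⟨p, rfl⟩ := (isOpenQuotientMap_xMk Γ).surjective x
  obtain ⟨q, rfl⟩ := (isOpenQuotientMap_xMk Γ).surjective y
  obtain ⟨γ, hγ, h⟩ := baseMk_eq_iff.1 h1
  obtain ⟨θ, hθ⟩ := exists_rotMat (p := (γ * q)⁻¹ * p) (by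
    rw [mul_smul, inv_smul_eq_iff, mul_smul, h])
  have hp : p = γ * q * rotMat θ := by rw [← hθ, mul_inv_cancel_left]
  have hq : xMk Γ (γ * q) = xMk Γ q := xMk_eq_iff.2 ⟨γ, hγ, rfl⟩
  rw [hp, fibreCoord_rotMat, hq] at h2
  obtain ⟨n, hn⟩ := exists_int_of_circle_exp_eq_one (mul_eq_left.1 h2)
  have hθ' : θ = Real.pi * n := by linarith
  rcases rotMat_pi_int n with h3 | h3
  · rw [hp, hθ', h3, mul_one, hq]
  · rw [hp, hθ', h3, mul_neg_one]
    exact xMk_eq_iff.2 ⟨-γ, by rw [← neg_one_mul]; exact Γ.mul_mem hneg hγ, by rw [neg_mul]⟩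

/-- The circle bundle `X → Σ` is trivial. -/
lemma exists_homeomorph (hneg : -1 ∈ Γ) {F : C(ℍ, Circle)} (hF : IsEquivariant Γ weightTwo F) :
    ∃ Ψ : X Γ ≃ₜ Base Γ × Circle, ∀ x, (Ψ x).1 = toBase Γ x := by
  obtain ⟨v, hv⟩ := exists_circle_lift F
  -- `toSL2R` is a section with factor one at `i`; rotating by `(θ - v) / 2` makes the fibre
  -- coordinate of the result `exp θ`. Thus `m` lifts the inverse of the trivialization to a
  -- quotient presentation, whence its continuity.
  set m : ℍ × ℝ → X Γ := fun y => xMk Γ (y.1.toSL2R * rotMat ((y.2 - v y.1) / 2)) with hm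
  have hmc : Continuous m := by
    refine (isOpenQuotientMap_xMk Γ).continuous.comp ((continuous_toSL2R.comp continuous_fst).mul
      (continuous_rotMat.comp ?_))
    fun_prop
  have hm1 : ∀ y, toBase Γ (m y) = baseMk Γ y.1 := fun y => by
    rw [hm, toBase_xMk, mul_smul, rotMat_smul_I, toSL2R_smul_I]
  have hm2 : ∀ y, fibreCoord hF (m y) = Circle.exp y.2 := fun y => by
    rw [hm]
    simp only
    rw [fibreCoord_rotMat, fibreCoord_xMk, toSL2R_smul_I, weightTwo_toSL2R, div_one, ← hv,
      ← Circle.exp_add]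
    congr 1; ring
  set π : ℍ × ℝ → Base Γ × Circle := Prod.map (baseMk Γ) Circle.exp with hπ
  have hπq : IsOpenQuotientMap π := (isOpenQuotientMap_baseMk Γ).prodMap
    ⟨fun w => ⟨_, Circle.exp_arg w⟩, Circle.exp.continuous, isLocalHomeomorph_circleExp.isOpenMap⟩
  set Ψ : X Γ → Base Γ × Circle := fun x => (toBase Γ x, fibreCoord hF x) with hΨ
  have hΨm : ∀ y, Ψ (m y) = π y := fun y => Prod.ext (hm1 y) (hm2 y)
  have hbij : Function.Bijective Ψ := by
    refine ⟨fun x y h => eq_of_toBase_eq_of_fibreCoord_eq hneg hF (congrArg Prod.fst h)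
      (congrArg Prod.snd h), fun y => ?_⟩
    obtain ⟨y, rfl⟩ := hπq.surjective y
    exact ⟨m y, hΨm y⟩
  refine ⟨⟨Equiv.ofBijective Ψ hbij, (continuous_toBase Γ).prodMk (continuous_fibreCoord hF), ?_⟩,
    fun _ => rfl⟩
  refine hπq.isQuotientMap.continuous_iff.2 ?_
  refine hmc.congr fun y => ?_
  exact ((Equiv.ofBijective Ψ hbij).symm_apply_eq.2 (hΨm y).symm).symm

end SpinQuotient

/-! ### The covering `Spin(3) → SO(3)` and its local sections. -/

namespace SpinQuotient
open Filter Topology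

lemma conjMatrix_mul (p q : Quaternion ℝ) : conjMatrix (p * q) = conjMatrix p * conjMatrix q := by
  ext i j
  simp only [conjMatrix_eq, Matrix.mul_apply, Fin.sum_univ_three, Quaternion.re_mul,
    Quaternion.imI_mul, Quaternion.imJ_mul, Quaternion.imK_mul]
  fin_cases i <;> fin_cases j <;> simp <;> ring

lemma continuous_conjMatrix : Continuous conjMatrix := by
  have h1 := Quaternion.continuous_re
  have h2 := Quaternion.continuous_imI
  have h3 := Quaternion.continuous_imJ
  have h4 := Quaternion.continuous_imK
  refine continuous_matrix fun i j => ?_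
  simp only [conjMatrix_eq]
  fin_cases i <;> fin_cases j <;> simp <;> fun_prop

/-- The double covering `Spin(3) → SO(3)` as a homomorphism. -/
def spinHom : Spin3 →* SO3 where
  toFun := spinToSO
  map_one' := Subtype.ext (by
    show conjMatrix 1 = 1
    rw [conjMatrix_eq]
    ext i j
    fin_cases i <;> fin_cases j <;> simp [Quaternion.re_one, Quaternion.imI_one, Quaternion.imJ_one,
      Quaternion.imK_one])
  map_mul' p q := Subtype.ext (conjMatrix_mul p.1 q.1)

lemma spinHom_apply (q : Spin3) : spinHom q = spinToSO q := rfl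

lemma spin_sq_sum (q : Spin3) : q.1.re ^ 2 + q.1.imI ^ 2 + q.1.imJ ^ 2 + q.1.imK ^ 2 = 1 := by
  have h1 : ‖q.1‖ = 1 := by simp
  have h2 := Quaternion.normSq_eq_norm_mul_self q.1
  rw [h1, Quaternion.normSq_def'] at h2
  simpa using h2

lemma spinToSO_eq_one_iff {q : Spin3} : spinToSO q = 1 ↔ q = 1 ∨ q = -1 := by
  constructor
  · intro h
    have h1 : conjMatrix q.1 = 1 := congrArg Subtype.val h
    have h2 := spin_sq_sum q
    rw [conjMatrix_eq] at h1
    have a := congrFun (congrFun h1 0) 0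
    have b := congrFun (congrFun h1 1) 1
    have c := congrFun (congrFun h1 2) 2
    simp at a b c
    have hI : q.1.imI = 0 := by nlinarith [sq_nonneg q.1.imI, sq_nonneg q.1.imJ, sq_nonneg q.1.imK]
    have hJ : q.1.imJ = 0 := by nlinarith [sq_nonneg q.1.imI, sq_nonneg q.1.imJ, sq_nonneg q.1.imK]
    have hK : q.1.imK = 0 := by nlinarith [sq_nonneg q.1.imI, sq_nonneg q.1.imJ, sq_nonneg q.1.imK]
    rw [hI, hJ, hK] at h2
    rcases mul_self_eq_one_iff.1 (show q.1.re * q.1.re = 1 by linarith) with hr | hr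
    · left
      refine Subtype.ext (Quaternion.ext _ _ ?_ ?_ ?_ ?_) <;>
        simp [hr, hI, hJ, hK, Quaternion.re_one, Quaternion.imI_one, Quaternion.imJ_one, Quaternion.imK_one]
    · right
      refine Subtype.ext (Quaternion.ext _ _ ?_ ?_ ?_ ?_) <;>
        simp [hr, hI, hJ, hK, Quaternion.re_one, Quaternion.imI_one, Quaternion.imJ_one, Quaternion.imK_one]
  · rintro (rfl | rfl)
    · exact spinHom.map_one
    · refine Subtype.ext ?_
      show conjMatrix ((-1 : Spin3) : Quaternion ℝ) = 1
      rw [conjMatrix_eq]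
      ext i j
      fin_cases i <;> fin_cases j <;> simp [Quaternion.re_one, Quaternion.imI_one,
        Quaternion.imJ_one, Quaternion.imK_one]

lemma so_relations (R : SO3) : R.1 * R.1ᵀ = 1 ∧ R.1ᵀ * R.1 = 1 ∧ R.1.adjugate = R.1ᵀ := by
  obtain ⟨h1, h2⟩ := Matrix.mem_specialOrthogonalGroup_iff.1 R.2
  have h4 := (Matrix.mem_orthogonalGroup_iff' _ _).1 h1
  rw [Matrix.mem_orthogonalGroup_iff] at h1
  have h3 : R.1 * R.1ᵀ = 1 := h1
  refine ⟨h1, h4, ?_⟩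
  rw [← Matrix.mul_one R.1.adjugate, ← h3, ← Matrix.mul_assoc, Matrix.adjugate_mul, h2, one_smul,
    Matrix.one_mul]

/-- The unnormalized quaternion of a rotation matrix. -/
def rotQuaternion (R : Matrix (Fin 3) (Fin 3) ℝ) : Quaternion ℝ :=
  ⟨1 + R 0 0 + R 1 1 + R 2 2, R 2 1 - R 1 2, R 0 2 - R 2 0, R 1 0 - R 0 1⟩

/-- For the rotation of a unit quaternion `q`, `rotQuaternion` is `4 * q.re` times `q`. The
identities follow from orthogonality and from the equality of the adjugate with the transpose. -/
lemma rotQuaternion_spec (R : SO3) :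
    ((rotQuaternion R.1).re ^ 2 + (rotQuaternion R.1).imI ^ 2 + (rotQuaternion R.1).imJ ^ 2 +
      (rotQuaternion R.1).imK ^ 2 = 4 * (1 + R.1 0 0 + R.1 1 1 + R.1 2 2)) ∧
    conjMatrix (rotQuaternion R.1) = (4 * (1 + R.1 0 0 + R.1 1 1 + R.1 2 2)) • R.1 := by
  obtain ⟨h1, h2, h3⟩ := so_relations R
  rw [Matrix.adjugate_fin_three] at h3
  generalize R.1 = M at *
  have k1 := fun i j => congrFun (congrFun h1 i) j
  have k2 := fun i j => congrFun (congrFun h2 i) j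
  have k3 := fun i j => congrFun (congrFun h3 i) j
  simp only [Matrix.mul_apply, Fin.sum_univ_three, Matrix.transpose_apply, Fin.forall_fin_succ,
    Fin.isValue, Matrix.one_apply, Fin.forall_fin_zero, Fin.succ_zero_eq_one, Fin.succ_one_eq_two,
    Matrix.of_apply, Matrix.cons_val, and_true] at k1 k2 k3
  norm_num [Fin.ext_iff] at k1 k2 k3
  obtain ⟨⟨a00, a01, a02⟩, ⟨a10, a11, a12⟩, a20, a21, a22⟩ := k1
  obtain ⟨⟨b00, b01, b02⟩, ⟨b10, b11, b12⟩, b20, b21, b22⟩ := k2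
  obtain ⟨⟨c00, c01, c02⟩, ⟨c10, c11, c12⟩, c20, c21, c22⟩ := k3
  constructor
  · simp only [rotQuaternion]
    linarith
  · rw [conjMatrix_eq]
    ext i j
    fin_cases i <;> fin_cases j <;> simp [rotQuaternion] <;> linarith

lemma conjMatrix_smul (c : ℝ) (q : Quaternion ℝ) : conjMatrix (c • q) = c ^ 2 • conjMatrix q := by
  rw [conjMatrix_eq, conjMatrix_eq]
  ext i j
  fin_cases i <;> fin_cases j <;> simp <;> ring

lemma continuous_rotQuaternion : Continuous fun R : SO3 => rotQuaternion R.1 := by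
  have h : ∀ i j, Continuous fun R : SO3 => R.1 i j := fun i j =>
    (continuous_subtype_val.matrix_elem i j)
  have h1 : (fun R : SO3 => rotQuaternion R.1) = fun R : SO3 =>
      (1 + R.1 0 0 + R.1 1 1 + R.1 2 2) • (1 : Quaternion ℝ) + (R.1 2 1 - R.1 1 2) • imBasis 0 +
        (R.1 0 2 - R.1 2 0) • imBasis 1 + (R.1 1 0 - R.1 0 1) • imBasis 2 := by
    funext R
    refine Quaternion.ext _ _ ?_ ?_ ?_ ?_ <;>
      simp [rotQuaternion, Quaternion.re_one, Quaternion.imI_one, Quaternion.imJ_one,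
        Quaternion.imK_one] <;> simp [imBasis]
  rw [h1]
  exact ((((((continuous_const.add (h 0 0)).add (h 1 1)).add (h 2 2)).smul continuous_const).add
    (((h 2 1).sub (h 1 2)).smul continuous_const)).add
    (((h 0 2).sub (h 2 0)).smul continuous_const)).add
    (((h 1 0).sub (h 0 1)).smul continuous_const)

open Classical in
/-- A unit quaternion inducing the rotation `R`, unless `R` is a half turn. -/
def rotSpin (R : SO3) : Spin3 :=
  if h : rotQuaternion R.1 = 0 then 1 else
    ⟨‖rotQuaternion R.1‖⁻¹ • rotQuaternion R.1, by simp [norm_smul, h]⟩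

lemma rotQuaternion_ne_zero {R : SO3} (h : 0 < 1 + R.1 0 0 + R.1 1 1 + R.1 2 2) :
    rotQuaternion R.1 ≠ 0 := fun h0 => h.ne' (congrArg QuaternionAlgebra.re h0)

lemma spinToSO_rotSpin {R : SO3} (h : 0 < 1 + R.1 0 0 + R.1 1 1 + R.1 2 2) :
    spinToSO (rotSpin R) = R := by
  have h0 := rotQuaternion_ne_zero h
  obtain ⟨h1, h2⟩ := rotQuaternion_spec R
  have h3 := Quaternion.normSq_eq_norm_mul_self (rotQuaternion R.1)
  rw [Quaternion.normSq_def', h1] at h3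
  refine Subtype.ext ?_
  show conjMatrix (rotSpin R).1 = R.1
  rw [rotSpin, dif_neg h0, conjMatrix_smul, h2, smul_smul, h3, ← sq, inv_pow,
    inv_mul_cancel₀ (pow_ne_zero 2 (norm_ne_zero_iff.2 h0)), one_smul]

lemma continuousAt_rotSpin {R : SO3} (h : 0 < 1 + R.1 0 0 + R.1 1 1 + R.1 2 2) :
    ContinuousAt rotSpin R := by
  have h0 := rotQuaternion_ne_zero h
  have hc := continuous_rotQuaternion.continuousAt (x := R)
  refine Topology.IsInducing.subtypeVal.continuousAt_iff.2 ?_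
  have h1 : ContinuousAt (fun R : SO3 => ‖rotQuaternion R.1‖⁻¹ • rotQuaternion R.1) R :=
    (hc.norm.inv₀ (norm_ne_zero_iff.2 h0)).smul hc
  refine h1.congr ?_
  filter_upwards [hc.eventually_ne h0] with R' hR'
  show _ = (rotSpin R').1
  rw [rotSpin, dif_neg hR']

/-- For `q = 1, i, j, k` the four numbers in question add up to `4`, so one of them is positive. -/
lemma exists_spin_trace_pos (R : SO3) : ∃ q : Spin3, 0 < 1 + (spinToSO q * R).1 0 0 +
    (spinToSO q * R).1 1 1 + (spinToSO q * R).1 2 2 := by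
  have hb : ∀ i, ‖imBasis i‖ = 1 := by
    intro i
    have h := Quaternion.normSq_eq_norm_mul_self (imBasis i)
    have h2 : Quaternion.normSq (imBasis i) = 1 := by
      rw [Quaternion.normSq_def']
      fin_cases i <;> simp [imBasis]
    rw [h2] at h
    nlinarith [norm_nonneg (imBasis i)]
  have hm : ∀ i, (conjMatrix (imBasis i) * R.1) 0 0 + (conjMatrix (imBasis i) * R.1) 1 1 +
      (conjMatrix (imBasis i) * R.1) 2 2 =
      2 * R.1 i i - (R.1 0 0 + R.1 1 1 + R.1 2 2) := by
    intro i
    rw [conjMatrix_eq]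
    fin_cases i <;> simp [Matrix.mul_apply, Fin.sum_univ_three, imBasis] <;> ring
  by_contra! hn
  have h1 := hn 1
  rw [← spinHom_apply, map_one, one_mul] at h1
  have h2 : ∀ i, 1 + (2 * R.1 i i - (R.1 0 0 + R.1 1 1 + R.1 2 2)) ≤ 0 := by
    intro i
    have h3 := hn ⟨imBasis i, by simp [hb]⟩
    rw [← hm]
    refine le_trans (le_of_eq ?_) h3
    show _ = 1 + (conjMatrix (imBasis i) * R.1) 0 0 + (conjMatrix (imBasis i) * R.1) 1 1 +
      (conjMatrix (imBasis i) * R.1) 2 2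
    ring
  linarith [h2 0, h2 1, h2 2]

/-- `R₀` is translated into the region of positive `1 + trace`, where `rotSpin` is a continuous
section, and the result is translated back. -/
lemma exists_spin_section (R₀ : SO3) :
    ∃ τ : SO3 → Spin3, ContinuousAt τ R₀ ∧ ∀ᶠ R in 𝓝 R₀, spinToSO (τ R) = R ∧ ContinuousAt τ R := by
  obtain ⟨q, hq⟩ := exists_spin_trace_pos R₀
  have hc : Continuous fun R : SO3 => spinToSO q * R := continuous_const.mul continuous_id
  have he : ∀ R : SO3, 0 < 1 + (spinToSO q * R).1 0 0 + (spinToSO q * R).1 1 1 +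
      (spinToSO q * R).1 2 2 → ContinuousAt (fun R => q⁻¹ * rotSpin (spinToSO q * R)) R :=
    fun R hR => continuousAt_const.mul
      ((continuousAt_rotSpin hR).comp (f := fun R : SO3 => spinToSO q * R) hc.continuousAt)
  refine ⟨fun R => q⁻¹ * rotSpin (spinToSO q * R), he R₀ hq, ?_⟩
  have ho : Continuous fun R : SO3 => 1 + (spinToSO q * R).1 0 0 + (spinToSO q * R).1 1 1 +
      (spinToSO q * R).1 2 2 := by
    have h : ∀ i, Continuous fun R : SO3 => (spinToSO q * R).1 i i := fun i =>
      (continuous_subtype_val.comp hc).matrix_elem i i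
    have h0 := h 0
    have h1 := h 1
    have h2 := h 2
    exact ((continuous_const.add h0).add h1).add h2
  filter_upwards [continuousAt_const.eventually_lt ho.continuousAt hq] with R hR
  refine ⟨?_, he R hR⟩
  rw [← spinHom_apply, map_mul, map_inv, spinHom_apply (rotSpin _), spinToSO_rotSpin hR,
    spinHom_apply, inv_mul_cancel_left]

end SpinQuotient

/-! ### The left invariant trivialization of the frame bundle. -/

namespace SpinQuotient
open Filter Topology

variable {Γ : Subgroup SL(2, ℝ)} {r : ℝ}

/-- The coordinates of an element of `sl(2, ℝ)` with respect to `lieBasis r`. -/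
def lieCoord (r : ℝ) (M : Matrix (Fin 2) (Fin 2) ℝ) : Fin 3 → ℝ :=
  ![r * ((M 0 1 - M 1 0) / 2), (M 0 1 + M 1 0) / 2, M 0 0]

lemma lieCoord_sum (hr : r ≠ 0) (v : Fin 3 → ℝ) :
    lieCoord r (∑ j, v j • lieBasis r j) = v := by
  ext i
  fin_cases i <;> simp [lieCoord, lieBasis, Fin.sum_univ_three]
  field_simp
  ring

/-- The coordinates of a frame of `G` with respect to the left invariant frame. -/
def frameCoord (f : FrameG r) : Matrix (Fin 3) (Fin 3) ℝ :=
  Matrix.of fun j i => lieCoord r ((f.1.1⁻¹ : SL(2, ℝ)).1 * f.1.2 i) j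

lemma frameCoord_eq (hr : r ≠ 0) {f : FrameG r} {R : SO3}
    (h : ∀ i, f.1.2 i = (f.1.1 : Matrix (Fin 2) (Fin 2) ℝ) * ∑ j, R.1 j i • lieBasis r j) :
    frameCoord f = R.1 := by
  have h1 : (f.1.1⁻¹ : SL(2, ℝ)).1 * f.1.1.1 = 1 :=
    congrArg Subtype.val (inv_mul_cancel f.1.1)
  ext j i
  show lieCoord r ((f.1.1⁻¹ : SL(2, ℝ)).1 * f.1.2 i) j = _
  rw [h, ← Matrix.mul_assoc, h1, Matrix.one_mul, lieCoord_sum hr]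

lemma continuous_frameCoord : Continuous (frameCoord : FrameG r → _) := by
  have h0 : Continuous fun f : FrameG r => f.1.1 := continuous_fst.comp continuous_subtype_val
  have h1 : Continuous fun f : FrameG r => (f.1.1⁻¹ : SL(2, ℝ)).1 :=
    continuous_subtype_val.comp h0.inv
  refine continuous_matrix fun j i => ?_
  have h2 : Continuous fun f : FrameG r => f.1.2 i :=
    (continuous_apply i).comp (continuous_snd.comp continuous_subtype_val)
  have h3 : ∀ a b, Continuous fun f : FrameG r => ((f.1.1⁻¹ : SL(2, ℝ)).1 * f.1.2 i) a b :=
    fun a b => (h1.matrix_mul h2).matrix_elem a b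
  have h01 := h3 0 1
  have h10 := h3 1 0
  show Continuous fun f : FrameG r => lieCoord r ((f.1.1⁻¹ : SL(2, ℝ)).1 * f.1.2 i) j
  fin_cases j
  · exact continuous_const.mul ((h01.sub h10).div_const 2)
  · exact (h01.add h10).div_const 2
  · exact h3 0 0

namespace FrameX

/-- The class of a frame of `G`. -/
abbrev mk (Γ : Subgroup SL(2, ℝ)) (f : FrameG r) : FrameX Γ r := Quotient.mk _ f

lemma coord_aux (hr : r ≠ 0) (f : FrameG r) :
    frameCoord f ∈ Matrix.specialOrthogonalGroup (Fin 3) ℝ := by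
  obtain ⟨R, hR⟩ := f.2
  rw [frameCoord_eq hr hR]
  exact R.2

/-- The coordinates of a frame of `X` with respect to the left invariant frame. -/
def coord (hr : r ≠ 0) : FrameX Γ r → SO3 :=
  Quotient.lift (fun f : FrameG r => (⟨frameCoord f, coord_aux hr f⟩ : SO3)) (by
    rintro _ f ⟨γ, rfl⟩
    refine Subtype.ext ?_
    obtain ⟨R, hR⟩ := f.2
    show frameCoord (γ • f) = frameCoord f
    rw [frameCoord_eq hr hR]
    refine frameCoord_eq hr fun i => ?_
    show γ.1.1 * f.1.2 i = (γ.1.1 * f.1.1.1) * _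
    rw [hR i, Matrix.mul_assoc])

lemma continuous_coord (hr : r ≠ 0) : Continuous (coord hr : FrameX Γ r → SO3) :=
  Continuous.quotient_lift (Continuous.subtype_mk continuous_frameCoord _) _

lemma continuous_base : Continuous (base : FrameX Γ r → X Γ) :=
  Continuous.quotient_map' (continuous_fst.comp continuous_subtype_val) _

lemma base_rotate (f : FrameX Γ r) (R : SO3) : (f.rotate R).base = f.base := by
  induction f using Quotient.inductionOn with | _ f => rfl

lemma rotate_rotate (f : FrameX Γ r) (R R' : SO3) :
    (f.rotate R).rotate R' = f.rotate (R * R') := by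
  induction f using Quotient.inductionOn with | _ f =>
  refine congrArg (FrameX.mk Γ) (Subtype.ext (Prod.ext rfl (funext fun i => ?_)))
  show ∑ j, R'.1 j i • ∑ k, R.1 k j • f.1.2 k = ∑ j, (R.1 * R'.1) j i • f.1.2 j
  simp only [Matrix.mul_apply, Finset.sum_smul, Finset.smul_sum, smul_smul]
  rw [Finset.sum_comm]
  exact Finset.sum_congr rfl fun k _ => Finset.sum_congr rfl fun j _ => by rw [mul_comm]

lemma rotate_one (f : FrameX Γ r) : f.rotate 1 = f := by
  induction f using Quotient.inductionOn with | _ f =>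
  refine congrArg (FrameX.mk Γ) (Subtype.ext (Prod.ext rfl (funext fun i => ?_)))
  show ∑ j, (1 : Matrix (Fin 3) (Fin 3) ℝ) j i • f.1.2 j = f.1.2 i
  simp [Matrix.one_apply]

lemma base_leftInvariantFrame (x : X Γ) : (leftInvariantFrame Γ r x).base = x := by
  induction x using Quotient.inductionOn with | _ p => rfl

/-- Together with `coord_rotate_leftInvariantFrame`, this identifies `FrameX Γ r` with `X Γ × SO3`
through `base` and `coord`. -/
lemma rotate_coord (hr : r ≠ 0) (f : FrameX Γ r) :
    (leftInvariantFrame Γ r f.base).rotate (f.coord hr) = f := by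
  induction f using Quotient.inductionOn with | _ f =>
  refine congrArg (FrameX.mk Γ) (Subtype.ext (Prod.ext rfl (funext fun i => ?_)))
  obtain ⟨R, hR⟩ := f.2
  show ∑ j, frameCoord f j i • (f.1.1.1 * lieBasis r j) = f.1.2 i
  rw [frameCoord_eq hr hR, hR i, Finset.mul_sum]
  simp only [Matrix.mul_smul]

lemma coord_rotate_leftInvariantFrame (hr : r ≠ 0) (x : X Γ) (R : SO3) :
    ((leftInvariantFrame Γ r x).rotate R).coord hr = R := by
  induction x using Quotient.inductionOn with | _ p =>
  refine Subtype.ext (frameCoord_eq hr fun i => ?_)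
  show ∑ j, R.1 j i • (p.1 * lieBasis r j) = p.1 * _
  rw [Finset.mul_sum]
  simp only [Matrix.mul_smul]

lemma coord_rotate (hr : r ≠ 0) (f : FrameX Γ r) (R : SO3) :
    (f.rotate R).coord hr = f.coord hr * R := by
  conv_lhs => rw [← rotate_coord hr f, rotate_rotate]
  exact coord_rotate_leftInvariantFrame hr _ _

lemma ext_coord (hr : r ≠ 0) {f f' : FrameX Γ r} (h : f.base = f'.base)
    (h' : f.coord hr = f'.coord hr) : f = f' := by
  rw [← rotate_coord hr f, h, h', rotate_coord]

lemma continuous_rotate_leftInvariantFrame :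
    Continuous fun y : X Γ × SO3 => (leftInvariantFrame Γ r y.1).rotate y.2 := by
  have hq : IsOpenQuotientMap (Prod.map (xMk Γ) (id : SO3 → SO3)) :=
    (isOpenQuotientMap_xMk Γ).prodMap IsOpenQuotientMap.id
  refine hq.isQuotientMap.continuous_iff.2 ?_
  have h1 : Continuous fun y : SL(2, ℝ) × SO3 =>
      ((y.1, fun i => ∑ j, y.2.1 j i • (y.1.1 * lieBasis r j)) :
        SL(2, ℝ) × (Fin 3 → Matrix (Fin 2) (Fin 2) ℝ)) := by
    refine continuous_fst.prodMk (continuous_pi fun i => continuous_finsetSum _ fun j _ => ?_)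
    exact ((continuous_subtype_val.comp continuous_snd).matrix_elem j i).smul
      ((continuous_subtype_val.comp continuous_fst).matrix_mul continuous_const)
  exact continuous_quotient_mk'.comp (Continuous.subtype_mk h1 fun y =>
    (FrameG.rotate (r := r) ⟨(y.1, fun i => y.1.1 * lieBasis r i), 1, fun i => by
      simp [Matrix.one_apply]⟩ y.2).2)

end FrameX

end SpinQuotient

/-! ### The double covering of `X` defined by a spin structure. -/

namespace SpinQuotient
open Filter Topology

variable {Γ : Subgroup SL(2, ℝ)} {r : ℝ}

instance : ContinuousInv SO3 where
  continuous_inv := Continuous.subtype_mk (f := fun R : SO3 => R.1ᵀ)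
    continuous_subtype_val.matrix_transpose _

lemma spin_neg_one_ne_one : (-1 : Spin3) ≠ 1 := fun h => by
  have h1 : ((-1 : Spin3) : Quaternion ℝ).re = ((1 : Spin3) : Quaternion ℝ).re := by rw [h]
  simp [Quaternion.re_one] at h1
  norm_num at h1

namespace SpinStructure

variable (S : SpinStructure Γ r)

/-- The projection of a spin structure to `X`. -/
def proj (p : S.P) : X Γ := (S.ξ p).base

lemma continuous_proj : Continuous S.proj := FrameX.continuous_base.comp S.continuous_ξ

lemma proj_act (p : S.P) (q : Spin3) : S.proj (S.act p q) = S.proj p := by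
  rw [proj, S.equivariant, FrameX.base_rotate, proj]

lemma coord_act (hr : r ≠ 0) (p : S.P) (q : Spin3) :
    (S.ξ (S.act p q)).coord hr = (S.ξ p).coord hr * spinToSO q := by
  rw [S.equivariant, FrameX.coord_rotate]

/-- A spin structure has local sections `e` lifting the left invariant frame, which trivialize
the bundle. -/
lemma exists_local_frame (hr : r ≠ 0) (x₀ : X Γ) :
    ∃ (U : Set (X Γ)) (e : X Γ → S.P) (k : S.P → Spin3), IsOpen U ∧ x₀ ∈ U ∧
      (∀ x ∈ U, S.proj (e x) = x ∧ (S.ξ (e x)).coord hr = 1) ∧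
      ContinuousOn (fun y : X Γ × Spin3 => S.act (e y.1) y.2) (U ×ˢ Set.univ) ∧
      ContinuousOn k (S.proj ⁻¹' U) ∧
      (∀ p, S.proj p ∈ U → S.act (e (S.proj p)) (k p) = p) ∧
      ∀ p q, S.proj p ∈ U → k (S.act p q) = k p * q := by
  classical
  obtain ⟨V, hV, hx₀, φ, hφ1, hφ2⟩ := S.locally_trivial x₀
  have hinv : ∀ x : V, ∀ q q', (φ.symm (x, q * q')).1 = S.act (φ.symm (x, q)).1 q' := by
    intro x q q'
    have hm : (S.ξ (S.act (φ.symm (x, q)).1 q')).base ∈ V := by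
      have := (φ.symm (x, q)).2
      rw [S.equivariant, FrameX.base_rotate]
      exact this
    have h2 := hφ2 (φ.symm (x, q)) ⟨_, hm⟩ q' rfl
    have h1 : φ ⟨_, hm⟩ = (x, q * q') := by
      refine Prod.ext (Subtype.ext ?_) ?_
      · rw [hφ1, S.equivariant, FrameX.base_rotate, ← hφ1, φ.apply_symm_apply]
      · rw [h2, φ.apply_symm_apply]
    rw [← h1, φ.symm_apply_apply]
  have hpr : ∀ x : V, ∀ q, S.proj (φ.symm (x, q)).1 = x := by
    intro x q
    rw [proj, ← hφ1, φ.apply_symm_apply]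
  -- `ρ` records the frame under the unit section of the given trivialization. Moving that section
  -- by a local lift `τ` of `ρ⁻¹` to `Spin(3)` puts it over the left invariant frame.
  let ρ : V → SO3 := fun x => (S.ξ (φ.symm (x, 1)).1).coord hr
  have hρ : Continuous ρ := (FrameX.continuous_coord hr).comp (S.continuous_ξ.comp
    (continuous_subtype_val.comp (φ.symm.continuous.comp (continuous_id.prodMk continuous_const))))
  obtain ⟨τ, -, hτ⟩ := exists_spin_section (ρ ⟨x₀, hx₀⟩)⁻¹
  have hρ' : ∀ᶠ x in 𝓝 (⟨x₀, hx₀⟩ : V), spinToSO (τ (ρ x)⁻¹) = (ρ x)⁻¹ ∧ ContinuousAt τ (ρ x)⁻¹ :=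
    (hρ.inv.tendsto ⟨x₀, hx₀⟩).eventually hτ
  rw [hV.isOpenEmbedding_subtypeVal.isInducing.nhds_eq_comap] at hρ'
  obtain ⟨W, hW, hWs⟩ := Filter.mem_comap.1 hρ'
  obtain ⟨O, hOW, hO, hxO⟩ := mem_nhds_iff.1 hW
  have hVO : ∀ x (hx : x ∈ V ∩ O), spinToSO (τ (ρ ⟨x, hx.1⟩)⁻¹) = (ρ ⟨x, hx.1⟩)⁻¹ ∧
      ContinuousAt τ (ρ ⟨x, hx.1⟩)⁻¹ := fun x hx => hWs (show (⟨x, hx.1⟩ : V).1 ∈ W from hOW hx.2)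
  let p₀ : S.P := (φ.symm (⟨x₀, hx₀⟩, 1)).1
  let e : X Γ → S.P := fun x => if hx : x ∈ V then (φ.symm (⟨x, hx⟩, τ (ρ ⟨x, hx⟩)⁻¹)).1 else p₀
  -- The fibre coordinate relative to the corrected section `e`; the values off `V` are
  -- placeholders.
  let k : S.P → Spin3 := fun p => if hp : S.proj p ∈ V then
    (τ (ρ ⟨S.proj p, hp⟩)⁻¹)⁻¹ * (φ ⟨p, hp⟩).2 else 1
  have hact : ∀ x (hx : x ∈ V) q, S.act (e x) q = (φ.symm (⟨x, hx⟩, τ (ρ ⟨x, hx⟩)⁻¹ * q)).1 := by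
    intro x hx q
    rw [hinv]
    simp only [e, dif_pos hx]
  have hτc : ContinuousOn (fun x : V => τ (ρ x)⁻¹) (Subtype.val ⁻¹' O) := fun x hx =>
    (ContinuousAt.comp (f := fun x : V => (ρ x)⁻¹) (hVO x.1 ⟨x.2, hx⟩).2
      hρ.inv.continuousAt).continuousWithinAt
  refine ⟨V ∩ O, e, k, hV.inter hO, ⟨hx₀, hxO⟩, ?_, ?_, ?_, ?_, ?_⟩
  · rintro x ⟨hx, hxo⟩
    have he : e x = S.act (φ.symm (⟨x, hx⟩, 1)).1 (τ (ρ ⟨x, hx⟩)⁻¹) := by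
      rw [← hinv, one_mul]
      simp only [e, dif_pos hx]
    refine ⟨?_, ?_⟩
    · simp only [e, dif_pos hx]
      exact hpr _ _
    · rw [he, coord_act, (hVO x ⟨hx, hxo⟩).1]
      exact mul_inv_cancel (ρ ⟨x, hx⟩)
  · rintro ⟨x, q⟩ ⟨⟨hx, hxo⟩, -⟩
    refine ContinuousAt.continuousWithinAt ?_
    have hemb : IsOpenEmbedding (Prod.map (Subtype.val : V → X Γ) (id : Spin3 → Spin3)) :=
      hV.isOpenEmbedding_subtypeVal.prodMap .id
    refine (hemb.continuousAt_iff (x := (⟨x, hx⟩, q))).1 ?_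
    have h1 : ((fun y : X Γ × Spin3 => S.act (e y.1) y.2) ∘ Prod.map (Subtype.val : V → X Γ) id) =
        fun y : V × Spin3 => (φ.symm (y.1, τ (ρ y.1)⁻¹ * y.2)).1 := by
      funext y
      exact hact y.1.1 y.1.2 y.2
    rw [h1]
    refine continuous_subtype_val.continuousAt.comp (φ.symm.continuous.continuousAt.comp ?_)
    refine continuousAt_fst.prodMk (ContinuousAt.mul ?_ continuousAt_snd)
    exact ContinuousAt.comp (g := fun x : V => τ (ρ x)⁻¹) (f := fun y : V × Spin3 => y.1)
      (hτc.continuousAt ((hO.preimage continuous_subtype_val).mem_nhds hxo)) continuousAt_fst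
  · rintro p ⟨hp, hpo⟩
    refine ContinuousAt.continuousWithinAt ?_
    have hemb : IsOpenEmbedding (Subtype.val : {p : S.P // (S.ξ p).base ∈ V} → S.P) :=
      (hV.preimage S.continuous_proj).isOpenEmbedding_subtypeVal
    refine (hemb.continuousAt_iff (x := ⟨p, hp⟩)).1 ?_
    have h1 : k ∘ (Subtype.val : {p : S.P // (S.ξ p).base ∈ V} → S.P) =
        fun p => (τ (ρ (φ p).1)⁻¹)⁻¹ * (φ p).2 := by
      funext p
      have hp : S.proj p.1 ∈ V := p.2
      have h2 : (φ p).1 = ⟨S.proj p.1, hp⟩ := Subtype.ext (hφ1 p)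
      show k p.1 = _
      rw [h2]
      exact dif_pos hp
    rw [h1]
    have h3 : ContinuousAt (fun p => τ (ρ (φ p).1)⁻¹) ⟨p, hp⟩ := by
      refine ContinuousAt.comp (g := fun x : V => τ (ρ x)⁻¹) (f := fun p => (φ p).1)
        (hτc.continuousAt ((hO.preimage continuous_subtype_val).mem_nhds ?_))
        (continuous_fst.comp φ.continuous).continuousAt
      show ((φ ⟨p, hp⟩).1 : X Γ) ∈ O
      rw [hφ1]
      exact hpo
    exact h3.inv.mul (continuous_snd.comp φ.continuous).continuousAt
  · rintro p ⟨hp, -⟩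
    have h2 : (φ ⟨p, hp⟩).1 = ⟨S.proj p, hp⟩ := Subtype.ext (hφ1 ⟨p, hp⟩)
    rw [hact _ hp]
    simp only [k, dif_pos hp]
    rw [mul_inv_cancel_left, ← h2, φ.symm_apply_apply]
  · rintro p q ⟨hp, -⟩
    have hp' : S.proj (S.act p q) ∈ V := by rwa [proj_act]
    have h3 : (⟨S.proj (S.act p q), hp'⟩ : V) = ⟨S.proj p, hp⟩ := Subtype.ext (S.proj_act p q)
    simp only [k, dif_pos hp, dif_pos hp']
    rw [hφ2 ⟨p, hp⟩ ⟨S.act p q, hp'⟩ q rfl, h3, mul_assoc]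

lemma act_injective (p : S.P) {q q' : Spin3} (hr : r ≠ 0) (h : S.act p q = S.act p q') :
    q = q' := by
  obtain ⟨U, e, k, -, hx, -, -, -, -, h2⟩ := S.exists_local_frame hr (S.proj p)
  have h3 := h2 p q hx
  rw [h, h2 p q' hx] at h3
  exact (mul_left_cancel h3).symm

lemma exists_act_eq (hr : r ≠ 0) {p p' : S.P} (h : S.proj p = S.proj p') :
    ∃ q, S.act p q = p' := by
  obtain ⟨U, e, k, -, hx, -, -, -, h1, -⟩ := S.exists_local_frame hr (S.proj p)
  refine ⟨(k p)⁻¹ * k p', ?_⟩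
  calc S.act p ((k p)⁻¹ * k p') = S.act (S.act (e (S.proj p)) (k p)) ((k p)⁻¹ * k p') := by
        rw [h1 p hx]
    _ = p' := by rw [← S.act_mul, mul_inv_cancel_left, h, h1 p' (h ▸ hx)]

/-- Continuity of the action is not a field of `SpinStructure`; it follows from local triviality,
the action being multiplication in the fibre coordinate. -/
lemma continuous_act (hr : r ≠ 0) : Continuous fun y : S.P × Spin3 => S.act y.1 y.2 := by
  rw [continuous_iff_continuousAt]
  rintro ⟨p, q⟩
  obtain ⟨U, e, k, hU, hx, -, hc, hk, h1, -⟩ := S.exists_local_frame hr (S.proj p)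
  have hpU : S.proj ⁻¹' U ∈ 𝓝 p := S.continuous_proj.continuousAt.preimage_mem_nhds (hU.mem_nhds hx)
  have h2 : ContinuousAt (fun y : X Γ × Spin3 => S.act (e y.1) y.2) (S.proj p, k p * q) :=
    hc.continuousAt ((hU.prod isOpen_univ).mem_nhds ⟨hx, trivial⟩)
  have h3 : ContinuousAt (fun y : S.P × Spin3 => (S.proj y.1, k y.1 * y.2)) (p, q) :=
    (S.continuous_proj.continuousAt.comp continuousAt_fst).prodMk
      ((ContinuousAt.comp (g := k) (hk.continuousAt hpU) continuousAt_fst).mul continuousAt_snd)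
  refine (ContinuousAt.comp (f := fun y : S.P × Spin3 => (S.proj y.1, k y.1 * y.2)) h2 h3).congr ?_
  filter_upwards [continuousAt_fst.preimage_mem_nhds hpU] with y hy
  show S.act (e (S.proj y.1)) (k y.1 * y.2) = _
  rw [S.act_mul, h1 y.1 hy]

/-- The double covering of `X` formed by the lifts of the left invariant frame. -/
def Lifts (hr : r ≠ 0) : Type := {p : S.P // (S.ξ p).coord hr = 1}

instance (hr : r ≠ 0) : TopologicalSpace (S.Lifts hr) :=
  inferInstanceAs (TopologicalSpace {p : S.P // (S.ξ p).coord hr = 1})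

variable {S}

namespace Lifts

variable {hr : r ≠ 0}

/-- The projection of the double covering. -/
def proj (e : S.Lifts hr) : X Γ := S.proj e.1

/-- The deck transformation of the double covering. -/
def neg (e : S.Lifts hr) : S.Lifts hr := ⟨S.act e.1 (-1), by
  rw [S.coord_act, e.2, one_mul, spinToSO_eq_one_iff.2 (Or.inr rfl)]⟩

lemma continuous_val : Continuous (Subtype.val : S.Lifts hr → S.P) := continuous_subtype_val

lemma continuous_proj : Continuous (proj : S.Lifts hr → X Γ) :=
  S.continuous_proj.comp continuous_val

lemma continuous_neg : Continuous (neg : S.Lifts hr → S.Lifts hr) :=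
  Continuous.subtype_mk
    ((S.continuous_act hr).comp (continuous_val.prodMk continuous_const)) _

lemma proj_neg (e : S.Lifts hr) : (neg e).proj = e.proj := S.proj_act _ _

lemma neg_neg (e : S.Lifts hr) : neg (neg e) = e := by
  refine Subtype.ext ?_
  show S.act (S.act e.1 (-1)) (-1) = e.1
  rw [← S.act_mul, neg_one_mul, _root_.neg_neg, S.act_one]

lemma neg_ne (e : S.Lifts hr) : neg e ≠ e := fun h => by
  have h1 : S.act e.1 (-1) = S.act e.1 1 := by
    rw [S.act_one]
    exact congrArg Subtype.val h
  exact spin_neg_one_ne_one (S.act_injective e.1 hr h1)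

lemma eq_or_of_act_eq {e e' : S.Lifts hr} {q : Spin3} (h : S.act e.1 q = e'.1) :
    (e' = e ∧ q = 1) ∨ (e' = neg e ∧ q = -1) := by
  have h1 := e'.2
  rw [← h, S.coord_act, e.2, one_mul, spinToSO_eq_one_iff] at h1
  rcases h1 with rfl | rfl
  · exact Or.inl ⟨Subtype.ext (by rw [← h, S.act_one]), rfl⟩
  · exact Or.inr ⟨Subtype.ext h.symm, rfl⟩

lemma eq_or_of_proj_eq {e e' : S.Lifts hr} (h : e.proj = e'.proj) : e' = e ∨ e' = neg e := by
  obtain ⟨q, hq⟩ := S.exists_act_eq hr h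
  exact (eq_or_of_act_eq hq).imp And.left And.left

lemma exists_local_section (x₀ : X Γ) : ∃ U : Set (X Γ), IsOpen U ∧ x₀ ∈ U ∧
    ∃ e : U → S.Lifts hr, Continuous e ∧ (∀ x, (e x).proj = x) ∧
      ∃ k : S.P → Spin3, ContinuousOn k (S.proj ⁻¹' U) ∧
        ∀ p (hp : S.proj p ∈ U), S.act (e ⟨_, hp⟩).1 (k p) = p := by
  obtain ⟨U, e, k, hU, hx, he, hc, hk, h1, -⟩ := S.exists_local_frame hr x₀
  refine ⟨U, hU, hx, fun x => ⟨e x, (he x x.2).2⟩, ?_, fun x => (he x x.2).1, k, hk, h1⟩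
  refine Continuous.subtype_mk ?_ _
  have h2 : Continuous fun x : U => S.act (e x.1) 1 :=
    hc.comp_continuous (f := fun x : U => (x.1, (1 : Spin3))) (by fun_prop)
      fun x => ⟨x.2, trivial⟩
  simpa only [S.act_one] using h2

lemma proj_surjective : Function.Surjective (proj : S.Lifts hr → X Γ) := fun x => by
  obtain ⟨U, -, hx, e, -, he, -⟩ := exists_local_section (S := S) (hr := hr) x
  exact ⟨e ⟨x, hx⟩, he _⟩

end Lifts

end SpinStructure

end SpinQuotient

/-! ### Spin structures classified by circle-valued functions modulo squares. -/

namespace SpinQuotient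
open Filter Topology

variable {Γ : Subgroup SL(2, ℝ)} {r : ℝ}

set_option synthInstance.maxHeartbeats 200000 in
lemma spin_neg_one_mul_mul (q : Spin3) : -1 * (-1 * q) = q := by
  have h : (-1 : Spin3) * (-1 : Spin3) = 1 := Subtype.ext (by simp)
  rw [← mul_assoc, h, one_mul]

lemma circle_neg_ne (z : Circle) : -z ≠ z := fun h => by
  have h1 : ((-z : Circle) : ℂ) = z := by rw [h]
  rw [Circle.coe_neg] at h1
  exact Circle.coe_ne_zero z (self_eq_neg.1 h1.symm)

lemma circle_sq_eq_sq {z w : Circle} (h : z ^ 2 = w ^ 2) : z = w ∨ z = -w := by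
  have h1 : (z : ℂ) ^ 2 = (w : ℂ) ^ 2 := by exact_mod_cast congrArg (Subtype.val) h
  rcases sq_eq_sq_iff_eq_or_eq_neg.1 h1 with h2 | h2
  · exact Or.inl (Circle.ext h2)
  · exact Or.inr (Circle.ext (by rw [Circle.coe_neg]; exact h2))

/-- Two square roots of the same value are equal or opposite, and continuous functions that agree at
a point are not opposite nearby. -/
lemma eventually_eq_of_sq_eq {Y : Type*} [TopologicalSpace Y] {f g : Y → Circle} {y : Y}
    (hf : ContinuousAt f y) (hg : ContinuousAt g y) (h : ∀ x, f x ^ 2 = g x ^ 2) (hy : f y = g y) :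
    ∀ᶠ x in 𝓝 y, f x = g x := by
  have h1 : f y ≠ -g y := hy ▸ (circle_neg_ne (f y)).symm
  have h2 : ContinuousAt (fun x => -g x) y := hg.neg
  filter_upwards [(hf.ne_iff_eventually_ne h2).1 h1] with x hx
  exact (circle_sq_eq_sq (h x)).resolve_right hx

namespace SpinStructure

variable {S S' : SpinStructure Γ r} {hr : r ≠ 0}

namespace Lifts

/-- If the local section passes through the other point of the fibre, it is composed with the deck
transformation and the coordinate `k` changes sign. -/
lemma exists_section_through (e₀ : S.Lifts hr) : ∃ U : Set (X Γ), IsOpen U ∧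
    ∃ hx : e₀.proj ∈ U, ∃ e : U → S.Lifts hr, Continuous e ∧ (∀ x, (e x).proj = x) ∧
      e ⟨_, hx⟩ = e₀ ∧ ∃ k : S.P → Spin3, ContinuousOn k (S.proj ⁻¹' U) ∧
        ∀ p (hp : S.proj p ∈ U), S.act (e ⟨_, hp⟩).1 (k p) = p := by
  obtain ⟨U, hU, hx, e, he, hp, k, hk, h1⟩ := exists_local_section e₀.proj
  rcases eq_or_of_proj_eq (e := e ⟨_, hx⟩) (hp _) with h | h
  · exact ⟨U, hU, hx, e, he, hp, h.symm, k, hk, h1⟩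
  · refine ⟨U, hU, hx, fun x => neg (e x), continuous_neg.comp he,
      fun x => (proj_neg _).trans (hp x), h.symm, fun p => -1 * k p, continuousOn_const.mul hk,
      fun p hp => ?_⟩
    show S.act (S.act (e ⟨_, hp⟩).1 (-1)) (-1 * k p) = p
    rw [← S.act_mul, spin_neg_one_mul_mul]
    exact h1 p hp

lemma isOpenMap_proj : IsOpenMap (proj : S.Lifts hr → X Γ) := by
  rw [isOpenMap_iff_nhds_le]
  intro e₀ N hN
  obtain ⟨U, hU, hx, e, he, hp, h0, -⟩ := exists_section_through e₀
  have h1 : e ⁻¹' (proj ⁻¹' N) ∈ 𝓝 (⟨_, hx⟩ : U) :=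
    he.continuousAt.preimage_mem_nhds (by rw [h0]; exact hN)
  have h2 := hU.isOpenMap_subtype_val.image_mem_nhds h1
  refine mem_of_superset h2 ?_
  rintro _ ⟨x, hx, rfl⟩
  rw [← hp x]
  exact hx

lemma isOpenQuotientMap_proj : IsOpenQuotientMap (proj : S.Lifts hr → X Γ) :=
  ⟨proj_surjective, continuous_proj, isOpenMap_proj⟩

instance : MulAction ℤˣ (S.Lifts hr) where
  smul u e := if u = 1 then e else neg e
  one_smul e := if_pos rfl
  mul_smul u v e := by
    rcases Int.units_eq_one_or u with rfl | rfl <;> rcases Int.units_eq_one_or v with rfl | rfl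
    · rfl
    · rfl
    · rfl
    · exact (neg_neg e).symm

/-- On the lifts the coordinate `k` takes the values `±1`, so the condition `k ≠ -1` selects the
sheet through `e₀` and separates it from its image under `neg`. -/
lemma isQuotientCoveringMap_proj : IsQuotientCoveringMap (proj : S.Lifts hr → X Γ) ℤˣ where
  toIsQuotientMap := isOpenQuotientMap_proj.isQuotientMap
  continuous_const_smul u := by
    rcases Int.units_eq_one_or u with rfl | rfl
    · simp only [one_smul]
      exact continuous_id
    · exact continuous_neg
  apply_eq_iff_mem_orbit {e e'} := by
    constructor
    · intro h
      rcases eq_or_of_proj_eq h.symm with rfl | rfl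
      · exact ⟨1, one_smul _ _⟩
      · exact ⟨-1, rfl⟩
    · rintro ⟨u, rfl⟩
      rcases Int.units_eq_one_or u with rfl | rfl
      · rfl
      · exact proj_neg e'
  disjoint e₀ := by
    obtain ⟨U, hU, hx, e, he, hp, h0, k, hk, h1⟩ := exists_section_through e₀
    have hkc : ContinuousAt (fun e : S.Lifts hr => k e.1) e₀ :=
      ContinuousAt.comp (f := fun e : S.Lifts hr => e.1) (g := k)
        (hk.continuousAt (S.continuous_proj.continuousAt.preimage_mem_nhds (hU.mem_nhds hx)))
        continuous_val.continuousAt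
    have hk0 : k e₀.1 = 1 := by
      have h2 := h1 e₀.1 hx
      rcases eq_or_of_act_eq h2 with h3 | h3
      · exact h3.2
      · exact absurd (h3.1.symm.trans h0.symm) (neg_ne _)
    have h2 : ∀ᶠ e in 𝓝 e₀, k e.1 ≠ -1 :=
      hkc.eventually_ne (by rw [hk0]; exact spin_neg_one_ne_one.symm)
    have h3 : ∀ᶠ e in 𝓝 e₀, e.proj ∈ U := continuous_proj.continuousAt.eventually_mem
      (hU.mem_nhds hx)
    have key : ∀ e' : S.Lifts hr, k e'.1 ≠ -1 → ∀ hu : e'.proj ∈ U, e' = e ⟨_, hu⟩ := by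
      intro e' hk' hu
      rcases eq_or_of_act_eq (h1 e'.1 hu) with h4 | h4
      · exact h4.1
      · exact absurd h4.2 hk'
    refine ⟨_, h2.and h3, ?_⟩
    rintro u ⟨_, ⟨e', ⟨ha, hb⟩, rfl⟩, ⟨hc, hd⟩⟩
    rcases Int.units_eq_one_or u with rfl | rfl
    · rfl
    · have h4 := key e' ha hb
      have h5 := key (neg e') hc hd
      have h6 : (⟨(neg e').proj, hd⟩ : U) = ⟨e'.proj, hb⟩ := Subtype.ext (proj_neg e')
      rw [h6, ← h4] at h5
      exact absurd h5 (neg_ne _)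

lemma isCoveringMap_proj : IsCoveringMap (proj : S.Lifts hr → X Γ) :=
  isQuotientCoveringMap_proj.isCoveringMap

end Lifts

/-- The double covering of `X` given by the spin structure `S` is that of the square roots
of `u`. -/
def HasClass (S : SpinStructure Γ r) (hr : r ≠ 0) (u : X Γ → Circle) : Prop :=
  ∃ h : C(S.Lifts hr, Circle), (∀ e, h (Lifts.neg e) = -h e) ∧ ∀ e, h e ^ 2 = u e.proj

/-- Multiplying the root function by `v` keeps it odd under `neg`; thus the class depends on `u`
modulo squares at most. -/
lemma HasClass.mul_sq {u : X Γ → Circle} (hS : S.HasClass hr u) (v : C(X Γ, Circle)) :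
    S.HasClass hr fun x => u x * v x ^ 2 := by
  obtain ⟨h, h1, h2⟩ := hS
  refine ⟨⟨fun e => h e * v e.proj, h.continuous.mul (v.continuous.comp Lifts.continuous_proj)⟩,
    fun e => ?_, fun e => ?_⟩
  · show h _ * v _ = -(h e * v e.proj)
    rw [h1, Lifts.proj_neg, neg_mul]
  · show (h e * v e.proj) ^ 2 = _
    rw [mul_pow, h2]

lemma HasClass.congr {u u' : X Γ → Circle} (hS : S.HasClass hr u) (h : ∀ x, u x = u' x) :
    S.HasClass hr u' := funext h ▸ hS

/-- The quotient of two root functions on the same covering is invariant under the deck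
transformation, so it descends to the required `v`. -/
lemma HasClass.exists_eq_mul_sq {u u' : X Γ → Circle} (hS : S.HasClass hr u)
    (hS' : S.HasClass hr u') : ∃ v : C(X Γ, Circle), ∀ x, u x = u' x * v x ^ 2 := by
  obtain ⟨h, h1, h2⟩ := hS
  obtain ⟨h', h1', h2'⟩ := hS'
  have hw : ∀ e e' : S.Lifts hr, e.proj = e'.proj → h e / h' e = h e' / h' e' := by
    intro e e' he
    rcases Lifts.eq_or_of_proj_eq he with rfl | rfl
    · rfl
    · rw [h1, h1', div_eq_div_iff_mul_eq_mul, mul_neg, neg_mul]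
  let v : X Γ → Circle := fun x =>
    h (Lifts.proj_surjective x).choose / h' (Lifts.proj_surjective x).choose
  have hv : ∀ e : S.Lifts hr, v e.proj = h e / h' e := fun e =>
    hw _ _ (Lifts.proj_surjective e.proj).choose_spec
  have hvc : Continuous v := by
    refine Lifts.isOpenQuotientMap_proj.isQuotientMap.continuous_iff.2
      ((h.continuous.div' h'.continuous).congr fun e => (hv e).symm)
  refine ⟨⟨v, hvc⟩, fun x => ?_⟩
  obtain ⟨e, rfl⟩ := Lifts.proj_surjective (S := S) (hr := hr) x
  show _ = _ * v e.proj ^ 2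
  rw [hv, div_pow, h2, h2', mul_div_cancel]

lemma HasClass.of_equivalent {u : X Γ → Circle} (hS : S.HasClass hr u) (hE : S.Equivalent S') :
    S'.HasClass hr u := by
  obtain ⟨f, hf, ha⟩ := (SpinStructure.setoid Γ r).symm hE
  obtain ⟨h, h1, h2⟩ := hS
  let F : S'.Lifts hr → S.Lifts hr := fun e => ⟨f e.1, by rw [hf, e.2]⟩
  have hF : Continuous F := Continuous.subtype_mk (f.continuous.comp Lifts.continuous_val) _
  refine ⟨⟨fun e => h (F e), h.continuous.comp hF⟩, fun e => ?_, fun e => ?_⟩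
  · refine Eq.trans ?_ (h1 (F e))
    exact congrArg h (Subtype.ext (ha _ _))
  · show h (F e) ^ 2 = _
    rw [h2]
    exact congrArg (fun f => u (FrameX.base f)) (hf e.1)

/-- Corresponding points of two spin structures whose double coverings are given by the square
roots of the same function. -/
def Corresponds (h : C(S.Lifts hr, Circle)) (h' : C(S'.Lifts hr, Circle)) (p : S.P) (p' : S'.P) :
    Prop := ∃ (e : S.Lifts hr) (e' : S'.Lifts hr) (q : Spin3), e.proj = e'.proj ∧ h e = h' e' ∧
      S.act e.1 q = p ∧ S'.act e'.1 q = p'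

variable {h : C(S.Lifts hr, Circle)} {h' : C(S'.Lifts hr, Circle)}

lemma Corresponds.symm {p : S.P} {p' : S'.P} (hp : Corresponds h h' p p') :
    Corresponds h' h p' p := by
  obtain ⟨e, e', q, h1, h2, h3, h4⟩ := hp
  exact ⟨e', e, q, h1.symm, h2.symm, h4, h3⟩

lemma Lifts.eq_of_apply_eq (h1 : ∀ e, h (Lifts.neg e) = -h e) {e e' : S.Lifts hr}
    (hp : e.proj = e'.proj) (hh : h e = h e') : e' = e := by
  rcases Lifts.eq_or_of_proj_eq hp with h2 | h2
  · exact h2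
  · rw [h2, h1] at hh
    exact absurd hh.symm (circle_neg_ne _)

lemma Lifts.exists_apply_eq {u : X Γ → Circle} (h1 : ∀ e, h (Lifts.neg e) = -h e)
    (h2 : ∀ e, h e ^ 2 = u e.proj) {x : X Γ} {w : Circle} (hw : w ^ 2 = u x) :
    ∃ e : S.Lifts hr, e.proj = x ∧ h e = w := by
  obtain ⟨e, rfl⟩ := Lifts.proj_surjective (S := S) (hr := hr) x
  rcases circle_sq_eq_sq ((h2 e).trans hw.symm) with h3 | h3
  · exact ⟨e, rfl, h3⟩
  · exact ⟨Lifts.neg e, Lifts.proj_neg e, by rw [h1, h3, _root_.neg_neg]⟩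

/-- A point determines the pair `(e, q)` up to a simultaneous change of sign. Oddness of `h` and
`h'` makes `e'` change sign too, and the two signs cancel in `S'.act e'.1 q`. -/
lemma Corresponds.unique (h1 : ∀ e, h (Lifts.neg e) = -h e)
    (h1' : ∀ e, h' (Lifts.neg e) = -h' e) {p : S.P} {p₁ p₂ : S'.P} (hp₁ : Corresponds h h' p p₁)
    (hp₂ : Corresponds h h' p p₂) : p₁ = p₂ := by
  obtain ⟨e, e', q, ha, hb, hc, rfl⟩ := hp₁
  obtain ⟨d, d', s, ka, kb, kc, rfl⟩ := hp₂
  have h3 : S.act e.1 (q * s⁻¹) = d.1 := by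
    rw [S.act_mul, hc, ← kc, ← S.act_mul, mul_inv_cancel, S.act_one]
  rcases Lifts.eq_or_of_act_eq h3 with ⟨rfl, h4⟩ | ⟨rfl, h4⟩
  · rw [Lifts.eq_of_apply_eq h1' (ha.symm.trans ka) (hb.symm.trans kb), mul_inv_eq_one.1 h4]
  · rw [Lifts.proj_neg] at ka
    rw [h1] at kb
    have h5 : d' = Lifts.neg e' := Lifts.eq_of_apply_eq h1'
      (((Lifts.proj_neg e').trans ha.symm).trans ka) (by rw [h1', ← hb, kb])
    have h6 : q = -1 * s := by rw [← h4, inv_mul_cancel_right]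
    rw [h5, h6, S'.act_mul]
    rfl

lemma exists_corresponds {u : X Γ → Circle} (h2 : ∀ e, h e ^ 2 = u e.proj)
    (h1' : ∀ e, h' (Lifts.neg e) = -h' e) (h2' : ∀ e, h' e ^ 2 = u e.proj) (p : S.P) :
    ∃ p', Corresponds h h' p p' := by
  obtain ⟨e, he⟩ := Lifts.proj_surjective (S := S) (hr := hr) (S.proj p)
  obtain ⟨q, hq⟩ := S.exists_act_eq hr he
  obtain ⟨e', he', hh⟩ := Lifts.exists_apply_eq h1' h2' (h2 e)
  exact ⟨S'.act e'.1 q, e, e', q, he'.symm, hh.symm, hq, rfl⟩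

/-- Local sections of the two coverings with equal roots at one point have equal roots nearby, so
locally the correspondence is given by the continuous action on one such pair. -/
lemma Corresponds.continuous {u : X Γ → Circle} (h1 : ∀ e, h (Lifts.neg e) = -h e)
    (h1' : ∀ e, h' (Lifts.neg e) = -h' e) (h2 : ∀ e, h e ^ 2 = u e.proj)
    (h2' : ∀ e, h' e ^ 2 = u e.proj)
    {G : S.P → S'.P} (hG : ∀ p, Corresponds h h' p (G p)) : Continuous G := by
  rw [continuous_iff_continuousAt]
  intro p
  obtain ⟨e₀, e₀', q, ha, hb, hc, -⟩ := hG p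
  obtain ⟨U, hU, hx, e, he, hp, h0, k, hk, h3⟩ := Lifts.exists_section_through e₀
  obtain ⟨U', hU', hx', e', he', hp', h0', -⟩ := Lifts.exists_section_through e₀'
  have hpp : S.proj p = e₀.proj := by rw [← hc, S.proj_act]; rfl
  let O : Set S.P := S.proj ⁻¹' U ∩ S.proj ⁻¹' U'
  have hO : IsOpen O := (hU.preimage S.continuous_proj).inter (hU'.preimage S.continuous_proj)
  have hpO : p ∈ O := ⟨by rw [Set.mem_preimage, hpp]; exact hx,
    by rw [Set.mem_preimage, hpp, ha]; exact hx'⟩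
  refine (hO.isOpenEmbedding_subtypeVal.continuousAt_iff (x := ⟨p, hpO⟩)).1 ?_
  let a : O → S.Lifts hr := fun y => e ⟨S.proj y.1, y.2.1⟩
  let a' : O → S'.Lifts hr := fun y => e' ⟨S.proj y.1, y.2.2⟩
  have hac : Continuous a :=
    he.comp (Continuous.subtype_mk (S.continuous_proj.comp continuous_subtype_val) _)
  have hac' : Continuous a' :=
    he'.comp (Continuous.subtype_mk (S.continuous_proj.comp continuous_subtype_val) _)
  have ha0 : a ⟨p, hpO⟩ = e₀ := by
    rw [← h0]
    exact congrArg e (Subtype.ext hpp)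
  have ha0' : a' ⟨p, hpO⟩ = e₀' := by
    rw [← h0']
    exact congrArg e' (Subtype.ext (hpp.trans ha))
  have hev : ∀ᶠ y in 𝓝 (⟨p, hpO⟩ : O), h (a y) = h' (a' y) := by
    refine eventually_eq_of_sq_eq (h.continuous.comp hac).continuousAt
      (h'.continuous.comp hac').continuousAt (fun y => ?_) ?_
    · rw [h2, h2', hp, hp']
    · rw [ha0, ha0', hb]
  have hkc : ContinuousAt (fun y : O => k y.1) ⟨p, hpO⟩ :=
    ContinuousAt.comp (f := fun y : O => y.1) (g := k)
      (hk.continuousAt ((hU.preimage S.continuous_proj).mem_nhds hpO.1))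
      continuous_subtype_val.continuousAt
  have hF : ContinuousAt (fun y : O => S'.act (a' y).1 (k y.1)) ⟨p, hpO⟩ :=
    ContinuousAt.comp (g := fun y : S'.P × Spin3 => S'.act y.1 y.2)
      (f := fun y : O => ((a' y).1, k y.1)) (S'.continuous_act hr).continuousAt
      ((Lifts.continuous_val.comp hac').continuousAt.prodMk hkc)
  refine hF.congr ?_
  filter_upwards [hev] with y hy
  refine Corresponds.unique h1 h1' (p := y.1)
    ⟨a y, a' y, k y.1, (hp ⟨_, y.2.1⟩).trans (hp' ⟨_, y.2.2⟩).symm, hy, h3 _ _, rfl⟩ (hG y.1)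

/-- Matching square roots identifies the two double coverings, and the bundle is `Lifts ×_{±1}
Spin(3)`; `Corresponds` is the graph of the resulting isomorphism. -/
theorem HasClass.equivalent {u : X Γ → Circle} (hS : S.HasClass hr u) (hS' : S'.HasClass hr u) :
    S.Equivalent S' := by
  obtain ⟨h, h1, h2⟩ := hS
  obtain ⟨h', h1', h2'⟩ := hS'
  choose G hG using exists_corresponds (S := S) (S' := S') h2 h1' h2'
  choose G' hG' using exists_corresponds (S := S') (S' := S) h2' h1 h2
  refine ⟨⟨⟨G, G', fun p => ?_, fun p => ?_⟩, Corresponds.continuous h1 h1' h2 h2' hG,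
    Corresponds.continuous h1' h1 h2' h2 hG'⟩, fun p => ?_, fun p q => ?_⟩
  · exact (hG' (G p)).unique h1' h1 (hG p).symm
  · exact (hG (G' p)).unique h1 h1' (hG' p).symm
  · obtain ⟨e, e', q, ha, -, hc, hd⟩ := hG p
    show S'.ξ (G p) = S.ξ p
    refine Eq.trans (congrArg S'.ξ hd.symm) (Eq.trans ?_ (congrArg S.ξ hc))
    rw [S.equivariant, S'.equivariant]
    refine congrArg (fun f => FrameX.rotate f _) (FrameX.ext_coord hr ha.symm ?_)
    rw [e.2, e'.2]
  · obtain ⟨e, e', q', ha, hb, hc, hd⟩ := hG p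
    refine (hG (S.act p q)).unique h1 h1' ⟨e, e', q' * q, ha, hb, ?_, ?_⟩
    · rw [S.act_mul, hc]
    · rw [S'.act_mul, hd]
      rfl

/-- A lift of the frame along `c` is a path in `Lifts`, which the root function maps to a square
root of `u ∘ c`. Conversely, a path is lifted from the point with root `W 0`; its roots then agree
with `W` throughout, so it closes up when `W` does. -/
lemma HasClass.trivialAlong_iff {u : X Γ → Circle} (hS : S.HasClass hr u)
    {c : unitInterval → X Γ} (hc : Continuous c) (h01 : c 0 = c 1) :
    S.TrivialAlong c ↔
      ∃ W : C(unitInterval, Circle), W 0 = W 1 ∧ ∀ t, W t ^ 2 = u (c t) := by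
  obtain ⟨h, h1, h2⟩ := hS
  constructor
  · rintro ⟨c', hc', hl⟩
    have hk : ∀ t, (S.ξ (c' t)).coord hr = 1 := fun t => by
      rw [hl, ← FrameX.rotate_one (leftInvariantFrame Γ r (c t)),
        FrameX.coord_rotate_leftInvariantFrame]
    let d : unitInterval → S.Lifts hr := fun t => ⟨c' t, hk t⟩
    have hd : Continuous d := Continuous.subtype_mk c'.continuous _
    refine ⟨⟨fun t => h (d t), h.continuous.comp hd⟩, congrArg h (Subtype.ext hc'), fun t => ?_⟩
    show h (d t) ^ 2 = _
    rw [h2]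
    refine congrArg u ?_
    show (S.ξ (c' t)).base = c t
    rw [hl, FrameX.base_leftInvariantFrame]
  · rintro ⟨W, hW, hu⟩
    obtain ⟨e₀, he₀, hh₀⟩ := Lifts.exists_apply_eq h1 h2 (hu 0)
    obtain ⟨d, hd, hd0⟩ := Lifts.isCoveringMap_proj.exists_path_lifts ⟨c, hc⟩ e₀ he₀.symm
    have hdp : ∀ t, (d t).proj = c t := fun t => congrFun hd t
    have hWd : ∀ t, W t = h (d t) := by
      have hcl : IsClosed {t | W t = h (d t)} :=
        isClosed_eq W.continuous (h.continuous.comp d.continuous)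
      have hop : IsOpen {t | W t = h (d t)} := isOpen_iff_mem_nhds.2 fun t ht =>
        eventually_eq_of_sq_eq W.continuous.continuousAt
          (h.continuous.comp d.continuous).continuousAt
          (fun s => by rw [hu, h2, hdp]) ht
      have := IsClopen.eq_univ ⟨hcl, hop⟩ ⟨0, show W 0 = h (d 0) by rw [hd0, hh₀]⟩
      exact fun t => (this ▸ Set.mem_univ t : t ∈ {t | W t = h (d t)})
    refine ⟨⟨fun t => (d t).1, Lifts.continuous_val.comp d.continuous⟩, ?_, fun t => ?_⟩
    · refine congrArg Subtype.val (Lifts.eq_of_apply_eq h1 ?_ ?_)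
      · rw [hdp, hdp, h01]
      · rw [← hWd, ← hWd, hW]
    · refine FrameX.ext_coord hr ?_ ?_
      · rw [FrameX.base_leftInvariantFrame]
        exact hdp t
      · rw [← FrameX.rotate_one (leftInvariantFrame Γ r (c t)),
          FrameX.coord_rotate_leftInvariantFrame]
        exact (d t).2

end SpinStructure

end SpinQuotient

/-! ### Every double covering of `X` consists of square roots of a function. -/

namespace SpinQuotient
open Filter Topology UpperHalfPlane

/-- The signs as complex numbers of absolute value one. -/
def circleSign : ℤˣ →* Circle where
  toFun u := if u = 1 then 1 else -1
  map_one' := if_pos rfl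
  map_mul' u v := by
    rcases Int.units_eq_one_or u with rfl | rfl <;> rcases Int.units_eq_one_or v with rfl | rfl <;>
      simp

lemma circleSign_neg_one : circleSign (-1) = -1 := by
  show (if (-1 : ℤˣ) = 1 then (1 : Circle) else -1) = -1
  exact if_neg (by decide)

lemma circleSign_sq (u : ℤˣ) : circleSign u ^ 2 = 1 := by
  rw [← map_pow, Int.units_sq, map_one]

lemma circleSign_neg (u : ℤˣ) : circleSign (-u) = -circleSign u := by
  rw [← neg_one_mul u, map_mul, circleSign_neg_one, neg_one_mul]

lemma exists_circle_exp_mul_pi (u : ℤˣ) : ∃ b : ℕ, Circle.exp (b * Real.pi) = circleSign u := by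
  rcases Int.units_eq_one_or u with rfl | rfl
  · exact ⟨0, by simp⟩
  · refine ⟨1, ?_⟩
    rw [circleSign_neg_one]
    ext
    simp

variable {Γ : Subgroup SL(2, ℝ)} {r : ℝ} {S : SpinStructure Γ r} {hr : r ≠ 0}

namespace SpinStructure.Lifts

lemma smul_eq_smul {u v : ℤˣ} {e : S.Lifts hr} (h : u • e = v • e) : u = v := by
  rcases Int.units_eq_one_or u with rfl | rfl <;> rcases Int.units_eq_one_or v with rfl | rfl
  · rfl
  · exact absurd h.symm (neg_ne e)
  · exact absurd h (neg_ne e)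
  · rfl

lemma proj_smul (u : ℤˣ) (e : S.Lifts hr) : (u • e).proj = e.proj := by
  rcases Int.units_eq_one_or u with rfl | rfl
  · rfl
  · exact proj_neg e

lemma continuous_smul (u : ℤˣ) : Continuous fun e : S.Lifts hr => u • e :=
  isQuotientCoveringMap_proj.continuous_const_smul u

lemma exists_smul_eq {Y : Type*} [TopologicalSpace Y] [PreconnectedSpace Y] [Nonempty Y]
    {a b : Y → S.Lifts hr} (ha : Continuous a) (hb : Continuous b)
    (h : ∀ y, (a y).proj = (b y).proj) : ∃ u : ℤˣ, ∀ y, a y = u • b y := by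
  obtain ⟨y₀⟩ := ‹Nonempty Y›
  obtain ⟨u, hu⟩ := isQuotientCoveringMap_proj.apply_eq_iff_mem_orbit.1 (h y₀)
  refine ⟨u, fun y => congrFun (isCoveringMap_proj.eq_of_comp_eq ha ((continuous_smul u).comp hb)
    (funext fun y => ?_) y₀ hu.symm) y⟩
  show (a y).proj = (u • b y).proj
  rw [h, proj_smul]

lemma isOpenMap_of_proj_comp {Y : Type*} [TopologicalSpace Y] {a : Y → S.Lifts hr}
    (ha : Continuous a) (h : IsOpenMap fun y => (a y).proj) : IsOpenMap a := by
  rw [isOpenMap_iff_nhds_le]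
  intro y N hN
  obtain ⟨φ, hφ, hφe⟩ := isCoveringMap_proj.isLocalHomeomorph (a y)
  have h1 : a ⁻¹' φ.source ∈ 𝓝 y := ha.continuousAt.preimage_mem_nhds (φ.open_source.mem_nhds hφ)
  have h2 := h.image_mem_nhds (inter_mem hN h1)
  have h3 := continuous_proj.continuousAt.preimage_mem_nhds h2
  filter_upwards [h3, φ.open_source.mem_nhds hφ] with e he hes
  obtain ⟨y', ⟨hy1, hy2⟩, hy3⟩ := he
  have h4 : a y' = e := φ.injOn hy2 hes (by rw [← hφe]; exact hy3)
  exact h4 ▸ hy1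

end SpinStructure.Lifts

open SpinStructure

variable {g : ℕ} {ι : Base Γ → ClosedSurface g} {C : Finset (ClosedSurface g)}

/-- A flat cocycle with values in `±1` comes from a continuous function on `ℍ`. -/
lemma exists_equivariant_of_sign (hM : IsModel Γ ι C) (hC : C.Nonempty) (φ : SL(2, ℝ) → ℤˣ)
    (hφ : ∀ γ ∈ Γ, ∀ δ ∈ Γ, φ (γ * δ) = φ γ * φ δ) (hφ1 : φ (-1) = 1) :
    ∃ F : C(ℍ, Circle), ∀ γ ∈ Γ, ∀ z, F (γ • z) = circleSign (φ γ) * F z := by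
  refine exists_continuous_isEquivariant (j := fun γ _ => circleSign (φ γ)) hM hC
    ⟨fun _ _ => continuous_const, fun γ hγ δ hδ _ => by rw [hφ γ hγ δ hδ, map_mul],
      fun _ => by rw [hφ1, map_one]⟩ ?_
  rintro a l ⟨-, hl, -⟩
  -- A sign along the cusp is trivialized by a function turning by `bπ` over one width.
  obtain ⟨b, hb⟩ := exists_circle_exp_mul_pi (φ (a * unip l * a⁻¹))
  refine ⟨fun w => Circle.exp (b * Real.pi * (w.re / l)), ?_, fun w => ?_⟩
  · have : Continuous fun w : ℍ => w.re := UpperHalfPlane.continuous_re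
    exact Circle.exp.continuous.comp (continuous_const.mul (this.div_const l))
  · simp only
    rw [← hb, ← Circle.exp_add, UpperHalfPlane.vadd_re]
    congr 1
    field_simp

/-- Over the simply connected space `ℍ × ℝ` the covering has a section `ε`, and its monodromy is a
sign character `φ` of `Γ` together with a sign `t` for the fibre. A circle-valued function on `ℍ ×
ℝ` with the same changes of sign is a root function, and its square descends to `X`. -/
theorem SpinStructure.exists_hasClass (hM : IsModel Γ ι C) (hC : C.Nonempty)
    {Ψ : X Γ ≃ₜ Base Γ × Circle} (hΨ : ∀ x, (Ψ x).1 = toBase Γ x) (S : SpinStructure Γ r)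
    (hr : r ≠ 0) :
    ∃ (f : C(Base Γ, Circle)) (b : ℕ),
      S.HasClass hr fun x => f (toBase Γ x) * (Ψ x).2 ^ b := by
  let m : C(ℍ × ℝ, X Γ) := ⟨fun y => Ψ.symm (baseMk Γ y.1, Circle.exp y.2),
    Ψ.symm.continuous.comp (((isOpenQuotientMap_baseMk Γ).continuous.comp continuous_fst).prodMk
      (Circle.exp.continuous.comp continuous_snd))⟩
  have hmo : IsOpenQuotientMap m := by
    have h1 : IsOpenQuotientMap (Prod.map (baseMk Γ) Circle.exp) :=
      (isOpenQuotientMap_baseMk Γ).prodMap ⟨fun w => ⟨_, Circle.exp_arg w⟩, Circle.exp.continuous,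
        isLocalHomeomorph_circleExp.isOpenMap⟩
    exact Ψ.symm.isOpenQuotientMap.comp h1
  have hΨm : ∀ y, Ψ (m y) = (baseMk Γ y.1, Circle.exp y.2) := fun y => Ψ.apply_symm_apply _
  obtain ⟨e₀, he₀⟩ := Lifts.proj_surjective (S := S) (hr := hr) (m (I, 0))
  obtain ⟨ε, ⟨-, hε⟩, -⟩ :=
    Lifts.isCoveringMap_proj.existsUnique_continuousMap_lifts m (I, 0) e₀ he₀
  have hεm : ∀ y, (ε y).proj = m y := fun y => congrFun hε y
  have hdeck : ∀ γ : SL(2, ℝ), ∃ u : ℤˣ, γ ∈ Γ → ∀ y, ε (γ • y.1, y.2) = u • ε y := by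
    intro γ
    by_cases hγ : γ ∈ Γ
    · have h1 : Continuous fun y : ℍ × ℝ => ε (γ • y.1, y.2) := ε.continuous.comp
        ((continuous_fst.const_smul γ).prodMk continuous_snd)
      obtain ⟨u, hu⟩ := Lifts.exists_smul_eq h1 ε.continuous fun y => by
        rw [hεm, hεm]
        show Ψ.symm _ = Ψ.symm _
        rw [baseMk_smul hγ]
      exact ⟨u, fun _ => hu⟩
    · exact ⟨1, fun h => absurd h hγ⟩
  choose φ hφ using hdeck
  -- The monodromy along the fibre of `X`, which corresponds to `2π` in the second variable.
  obtain ⟨t, ht⟩ : ∃ t : ℤˣ, ∀ y, ε (y.1, y.2 + 2 * Real.pi) = t • ε y := by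
    have h1 : Continuous fun y : ℍ × ℝ => ε (y.1, y.2 + 2 * Real.pi) := ε.continuous.comp
      (continuous_fst.prodMk (continuous_snd.add continuous_const))
    refine Lifts.exists_smul_eq h1 ε.continuous fun y => ?_
    rw [hεm, hεm]
    show Ψ.symm _ = Ψ.symm _
    rw [Circle.exp_add, Circle.exp_two_pi, mul_one]
  have htn : ∀ n : ℤ, ∀ y, ε (y.1, y.2 + 2 * Real.pi * n) = t ^ n • ε y := by
    intro n
    induction n using Int.induction_on with
    | zero => intro y; simp
    | succ n ih =>
      intro y
      have h1 := ht (y.1, y.2 + 2 * Real.pi * n)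
      have h2 := ih y
      push_cast at h2 ⊢
      rw [h2, ← mul_smul] at h1
      rw [_root_.zpow_add_one, mul_comm _ t, ← h1]
      congr 2
      ring
    | pred n ih =>
      intro y
      have h1 := ht (y.1, y.2 + 2 * Real.pi * (-n - 1))
      have h2 := ih y
      have h3 : y.2 + 2 * Real.pi * (-n - 1) + 2 * Real.pi = y.2 + 2 * Real.pi * (-n : ℤ) := by
        push_cast; ring
      simp only [h3, h2] at h1
      push_cast
      rw [_root_.zpow_sub_one, mul_comm _ t⁻¹, mul_smul, h1, inv_smul_smul]
  obtain ⟨F, hF⟩ := exists_equivariant_of_sign hM hC φ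
    (fun γ hγ δ hδ => Lifts.smul_eq_smul (e := ε (I, 0)) (by
      rw [← hφ _ (Γ.mul_mem hγ hδ) (I, 0), mul_smul (φ γ), ← hφ δ hδ (I, 0),
        ← hφ γ hγ (δ • I, 0)]
      simp only [mul_smul]))
    (Lifts.smul_eq_smul (e := ε (I, 0)) (by
      rw [← hφ _ hM.neg_one_mem (I, 0), neg_smul_uhp, one_smul, one_smul]))
  obtain ⟨b, hb⟩ := exists_circle_exp_mul_pi t
  have hbn : ∀ n : ℤ, Circle.exp (b * Real.pi * n) = circleSign (t ^ n) := by
    intro n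
    rw [map_zpow, ← hb]
    ext
    simp only [Circle.coe_zpow, Circle.coe_exp, ← Complex.exp_int_mul]
    congr 1
    push_cast
    ring
  -- `F` changes sign according to `φ`, and `exp (bθ / 2)` according to `t` when `θ` grows by `2π`.
  -- The square is the invariant function `F²` times the `b`-th power of the fibre coordinate.
  let H : ℍ × ℝ → Circle := fun y => F y.1 * Circle.exp (b * y.2 / 2)
  have hHc : Continuous H := (F.continuous.comp continuous_fst).mul
    (Circle.exp.continuous.comp ((continuous_const.mul continuous_snd).div_const 2))
  -- Both sheets over `ℍ × ℝ` together form a quotient presentation of the covering, on which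
  -- functions can be tested for continuity.
  let Q : (ℍ × ℝ) × ℤˣ → S.Lifts hr := fun x => x.2 • ε x.1
  have hε_open : IsOpenMap ε := Lifts.isOpenMap_of_proj_comp ε.continuous (by
    simpa only [hεm] using hmo.isOpenMap)
  have hQc : Continuous Q := continuous_prod_of_discrete_right.2 fun u =>
    (Lifts.continuous_smul u).comp ε.continuous
  have hQo : IsOpenMap Q := Lifts.isOpenMap_of_proj_comp hQc (by
    have h1 : (fun x => (Q x).proj) = m ∘ Prod.fst := by
      funext x
      show (x.2 • ε x.1).proj = m x.1
      rw [Lifts.proj_smul, hεm]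
    rw [h1]
    exact hmo.isOpenMap.comp isOpenMap_fst)
  have hQs : Function.Surjective Q := by
    intro e
    obtain ⟨y, hy⟩ := hmo.surjective e.proj
    obtain ⟨u, hu⟩ := Lifts.isQuotientCoveringMap_proj.apply_eq_iff_mem_orbit.1
      (hy.symm.trans (hεm y).symm)
    exact ⟨(y, u), hu⟩
  let W : (ℍ × ℝ) × ℤˣ → Circle := fun x => circleSign x.2 * H x.1
  have hWc : Continuous W := continuous_prod_of_discrete_right.2 fun u =>
    (continuous_const (y := circleSign u)).mul hHc
  -- Two points with the same image differ by some `γ` in the first variable, by `2πn` in the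
  -- second, and by the sign this monodromy produces; `W` undergoes the same changes and so
  -- descends.
  have hWQ : ∀ x x', Q x = Q x' → W x = W x' := by
    rintro ⟨⟨z, θ⟩, u⟩ ⟨⟨z', θ'⟩, u'⟩ h
    have h1 : m (z, θ) = m (z', θ') := by
      rw [← hεm, ← hεm, ← Lifts.proj_smul u (ε (z, θ)), ← Lifts.proj_smul u' (ε (z', θ'))]
      exact congrArg Lifts.proj h
    have h2 := congrArg Ψ h1
    rw [hΨm, hΨm] at h2
    obtain ⟨γ, hγ, hz⟩ := baseMk_eq_iff.1 (congrArg Prod.fst h2)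
    have h3 : Circle.exp (θ - θ') = 1 := by
      rw [Circle.exp_sub, div_eq_one]
      exact congrArg Prod.snd h2
    obtain ⟨n, hn⟩ := exists_int_of_circle_exp_eq_one h3
    obtain rfl : θ = θ' + 2 * Real.pi * n := by linarith
    simp only at hz
    subst hz
    have h4 : ε (γ • z', θ' + 2 * Real.pi * n) = (t ^ n * φ γ) • ε (z', θ') := by
      rw [htn n (γ • z', θ'), hφ γ hγ (z', θ'), mul_smul]
    have h5 : u * (t ^ n * φ γ) = u' := by
      refine Lifts.smul_eq_smul (e := ε (z', θ')) ?_
      rw [mul_smul, ← h4]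
      exact h
    show circleSign u * (F (γ • z') * Circle.exp (b * (θ' + 2 * Real.pi * n) / 2)) =
      circleSign u' * (F z' * Circle.exp (b * θ' / 2))
    rw [hF γ hγ, ← h5, map_mul, map_mul, ← hbn, show b * (θ' + 2 * Real.pi * n) / 2 =
      b * Real.pi * n + b * θ' / 2 by ring, Circle.exp_add]
    simp only [mul_assoc, mul_comm, mul_left_comm]
  choose R hR using hQs
  have hWR : ∀ x, W (R (Q x)) = W x := fun x => hWQ _ _ (hR _)
  have hQq : IsOpenQuotientMap Q := ⟨fun e => ⟨R e, hR e⟩, hQc, hQo⟩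
  have hcont : Continuous fun e => W (R e) := hQq.isQuotientMap.continuous_iff.2 (by
    show Continuous fun x => W (R (Q x))
    simpa only [hWR] using hWc)
  let f : Base Γ → Circle := Quotient.lift (fun z : ℍ => F z ^ 2) (by
    rintro _ z ⟨γ, rfl⟩
    show F (γ.1 • z) ^ 2 = F z ^ 2
    rw [hF γ.1 γ.2, mul_pow, circleSign_sq, one_mul])
  have hf : Continuous f := (isOpenQuotientMap_baseMk Γ).isQuotientMap.continuous_iff.2
    (F.continuous.pow 2)
  refine ⟨⟨f, hf⟩, b, ⟨fun e => W (R e), hcont⟩, fun e => ?_, fun e => ?_⟩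
  · have h1 : Lifts.neg e = Q ((R e).1, -(R e).2) := by
      show _ = (-(R e).2) • ε (R e).1
      rw [← neg_one_mul, mul_smul]
      exact congrArg Lifts.neg (hR e).symm
    show W (R (Lifts.neg e)) = -W (R e)
    rw [h1, hWR]
    show circleSign _ * _ = -(circleSign _ * _)
    rw [circleSign_neg, neg_mul]
  · have h1 : e.proj = m (R e).1 := by
      conv_lhs => rw [← hR e]
      exact (Lifts.proj_smul _ _).trans (hεm _)
    show (circleSign _ * (F _ * Circle.exp _)) ^ 2 = f (toBase Γ e.proj) * (Ψ e.proj).2 ^ b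
    rw [mul_pow, mul_pow, circleSign_sq, one_mul, ← hΨ, h1, hΨm]
    show _ = F _ ^ 2 * _
    congr 1
    ext
    simp only [Circle.coe_pow, Circle.coe_exp, ← Complex.exp_nat_mul]
    congr 1
    push_cast
    ring

end SpinQuotient

/-! ### Construction of the spin structure belonging to a function. -/

namespace SpinQuotient
open Filter Topology

variable {Γ : Subgroup SL(2, ℝ)} {r : ℝ}

lemma circle_re_sq_add_im_sq (w : Circle) : (w : ℂ).re ^ 2 + (w : ℂ).im ^ 2 = 1 := by
  have h := Circle.normSq_coe w
  rw [Complex.normSq_apply] at h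
  linarith

/-- The spin bundle `E ×_{±1} Spin(3)`, where `E` is the double covering of `X` by the square roots
of `u`: the class of `(x, w, q)` is encoded by `w ⊗ q = (Re w • q, Im w • q)`. -/
def RootBundle (u : X Γ → Circle) : Type :=
  {y : X Γ × Quaternion ℝ × Quaternion ℝ // ∃ (w : Circle) (q : Spin3), w ^ 2 = u y.1 ∧
    y.2.1 = (w : ℂ).re • q.1 ∧ y.2.2 = (w : ℂ).im • q.1}

namespace RootBundle

variable {u : X Γ → Circle}

instance : TopologicalSpace (RootBundle u) := inferInstanceAs (TopologicalSpace {y :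
  X Γ × Quaternion ℝ × Quaternion ℝ // ∃ (w : Circle) (q : Spin3), w ^ 2 = u y.1 ∧
    y.2.1 = (w : ℂ).re • q.1 ∧ y.2.2 = (w : ℂ).im • q.1})

lemma continuous_val : Continuous (Subtype.val : RootBundle u → _) := continuous_subtype_val

/-- The point of the bundle given by a square root and a unit quaternion. -/
def mk (x : X Γ) (w : Circle) (hw : w ^ 2 = u x) (q : Spin3) : RootBundle u :=
  ⟨(x, (w : ℂ).re • q.1, (w : ℂ).im • q.1), w, q, hw, rfl, rfl⟩

lemma eq_mk (y : RootBundle u) {w : Circle} (hw : w ^ 2 = u y.1.1) :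
    ∃ q, y = mk y.1.1 w hw q := by
  obtain ⟨⟨x, a, b⟩, w', q, hw', ha, hb⟩ := y
  simp only at hw' ha hb
  subst ha hb
  rcases circle_sq_eq_sq (hw.trans hw'.symm) with rfl | rfl
  · exact ⟨q, rfl⟩
  · refine ⟨-q, Subtype.ext (Prod.ext rfl (Prod.ext ?_ ?_))⟩ <;> simp [mk]

/-- The right action of `Spin(3)`. -/
def act (y : RootBundle u) (q : Spin3) : RootBundle u :=
  ⟨(y.1.1, y.1.2.1 * q.1, y.1.2.2 * q.1), by
    obtain ⟨w, s, hw, ha, hb⟩ := y.2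
    refine ⟨w, s * q, hw, ?_, ?_⟩
    · show y.1.2.1 * q.1 = _ • (s.1 * q.1)
      rw [ha, smul_mul_assoc]
    · show y.1.2.2 * q.1 = _ • (s.1 * q.1)
      rw [hb, smul_mul_assoc]⟩

lemma mk_act {x : X Γ} {w : Circle} {hw : w ^ 2 = u x} {q q' : Spin3} :
    act (mk x w hw q) q' = mk x w hw (q * q') := by
  refine Subtype.ext (Prod.ext rfl (Prod.ext ?_ ?_))
  · exact smul_mul_assoc _ _ _
  · exact smul_mul_assoc _ _ _

lemma conjMatrix_add_conjMatrix (w : Circle) (q : Spin3) :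
    conjMatrix ((w : ℂ).re • q.1) + conjMatrix ((w : ℂ).im • q.1) = (spinToSO q).1 := by
  rw [conjMatrix_smul, conjMatrix_smul, ← add_smul, circle_re_sq_add_im_sq, one_smul]
  rfl

/-- The rotation belonging to a point of the bundle. -/
def rotation (y : RootBundle u) : SO3 :=
  ⟨conjMatrix y.1.2.1 + conjMatrix y.1.2.2, by
    obtain ⟨w, s, hw, ha, hb⟩ := y.2
    rw [ha, hb, conjMatrix_add_conjMatrix]
    exact (spinToSO s).2⟩

lemma rotation_mk {x : X Γ} {w : Circle} {hw : w ^ 2 = u x} {q : Spin3} :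
    rotation (mk x w hw q) = spinToSO q := Subtype.ext (conjMatrix_add_conjMatrix w q)

lemma continuous_rotation : Continuous (rotation : RootBundle u → SO3) := by
  refine Continuous.subtype_mk ?_ _
  have h1 : Continuous fun y : RootBundle u => y.1.2.1 :=
    (continuous_fst.comp continuous_snd).comp continuous_val
  have h2 : Continuous fun y : RootBundle u => y.1.2.2 :=
    (continuous_snd.comp continuous_snd).comp continuous_val
  exact (continuous_conjMatrix.comp h1).add (continuous_conjMatrix.comp h2)

/-- The quaternion coordinate of a point with respect to the square root `w`. -/
def quat (w : Circle) (y : RootBundle u) : Quaternion ℝ :=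
  (w : ℂ).re • y.1.2.1 + (w : ℂ).im • y.1.2.2

lemma quat_mk {x : X Γ} {w : Circle} {hw : w ^ 2 = u x} {q : Spin3} :
    quat w (mk x w hw q) = q.1 := by
  show (w : ℂ).re • ((w : ℂ).re • q.1) + (w : ℂ).im • ((w : ℂ).im • q.1) = q.1
  rw [smul_smul, smul_smul, ← add_smul, ← sq, ← sq, circle_re_sq_add_im_sq, one_smul]

lemma quat_mem {w : Circle} {y : RootBundle u} (hw : w ^ 2 = u y.1.1) :
    quat w y ∈ Metric.sphere (0 : Quaternion ℝ) 1 := by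
  obtain ⟨q, hq⟩ := eq_mk y hw
  rw [hq, quat_mk]
  exact q.2

lemma exists_local_root {Y : Type*} [TopologicalSpace Y] (u : C(Y, Circle)) (x₀ : Y) :
    ∃ (U : Set Y) (ζ : U → Circle), IsOpen U ∧ x₀ ∈ U ∧ Continuous ζ ∧ ∀ x, ζ x ^ 2 = u x := by
  obtain ⟨N, hN, hNo, hxN⟩ := eventually_nhds_iff.1 (eventually_circle_slitPlane (u x₀))
  have hexp : ∀ t : ℝ, Circle.exp (t / 2) ^ 2 = Circle.exp t := fun t => by
    rw [sq, ← Circle.exp_add, add_halves]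
  refine ⟨u ⁻¹' N, fun x => Circle.exp (Complex.arg (u x₀ : ℂ) / 2) *
    Circle.exp (Complex.arg ((u x / u x₀ : Circle) : ℂ) / 2), hNo.preimage u.continuous, hxN, ?_,
    fun x => ?_⟩
  · refine continuous_const.mul (Circle.exp.continuous.comp (Continuous.div_const ?_ 2))
    rw [continuous_iff_continuousAt]
    intro x
    refine (Complex.continuousAt_arg (hN _ x.2)).comp (f := fun x : u ⁻¹' N =>
      ((u x / u x₀ : Circle) : ℂ)) ?_
    exact (continuous_subtype_val.comp ((u.continuous.comp continuous_subtype_val).div'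
      continuous_const)).continuousAt
  · rw [mul_pow, hexp, hexp, Circle.exp_arg]
    exact (circle_exp_arg_div (u x) (u x₀)).symm

/-- The local trivializations of the bundle. -/
def trivialization (u : C(X Γ, Circle)) {U : Set (X Γ)} {ζ : U → Circle} (hζ : Continuous ζ)
    (h : ∀ x, ζ x ^ 2 = u x) {b : RootBundle u → X Γ} (hb : ∀ y, b y ∈ U → y.1.1 ∈ U)
    (hb' : ∀ y, y.1.1 ∈ U → b y ∈ U) :
    {y : RootBundle u // b y ∈ U} ≃ₜ U × Spin3 where
  toFun y := (⟨y.1.1.1, hb y.1 y.2⟩, ⟨quat (ζ ⟨y.1.1.1, hb y.1 y.2⟩) y.1, quat_mem (h _)⟩)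
  invFun x := ⟨mk x.1.1 (ζ x.1) (h x.1) x.2, hb' _ x.1.2⟩
  left_inv y := by
    obtain ⟨y, hy⟩ := y
    obtain ⟨q, hq⟩ := eq_mk y (h ⟨y.1.1, hb y hy⟩)
    refine Subtype.ext (Eq.trans (congrArg (mk y.1.1 _ _) (Subtype.ext ?_)) hq.symm)
    exact (congrArg (quat (ζ ⟨y.1.1, hb y hy⟩)) hq).trans quat_mk
  right_inv x := Prod.ext rfl (Subtype.ext (quat_mk (hw := h x.1)))
  continuous_toFun := by
    have h0 : Continuous fun y : {y : RootBundle (u : X Γ → Circle) // b y ∈ U} => y.1.1 :=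
      continuous_val.comp continuous_subtype_val
    have h1 : Continuous fun y : {y : RootBundle (u : X Γ → Circle) // b y ∈ U} =>
        (⟨y.1.1.1, hb y.1 y.2⟩ : U) := Continuous.subtype_mk (continuous_fst.comp h0) _
    have h2 : Continuous fun y : {y : RootBundle (u : X Γ → Circle) // b y ∈ U} =>
        (ζ ⟨y.1.1.1, hb y.1 y.2⟩ : ℂ) := continuous_subtype_val.comp (hζ.comp h1)
    refine h1.prodMk (Continuous.subtype_mk ?_ _)
    exact ((Complex.continuous_re.comp h2).smul
      ((continuous_fst.comp continuous_snd).comp h0)).add ((Complex.continuous_im.comp h2).smul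
        ((continuous_snd.comp continuous_snd).comp h0))
  continuous_invFun := by
    have h2 : Continuous fun x : U × Spin3 => (ζ x.1 : ℂ) :=
      continuous_subtype_val.comp (hζ.comp continuous_fst)
    have h3 : Continuous fun x : U × Spin3 => x.2.1 := continuous_subtype_val.comp continuous_snd
    refine Continuous.subtype_mk (Continuous.subtype_mk ?_ _) _
    exact (continuous_subtype_val.comp continuous_fst).prodMk
      (((Complex.continuous_re.comp h2).smul h3).prodMk ((Complex.continuous_im.comp h2).smul h3))

end RootBundle

/-- The spin structure whose double covering is that of the square roots of `u`. -/
def rootSpinStructure (r : ℝ) (u : C(X Γ, Circle)) : SpinStructure Γ r where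
  P := RootBundle (u : X Γ → Circle)
  act := RootBundle.act
  act_one y := Subtype.ext (Prod.ext rfl (Prod.ext (mul_one y.1.2.1) (mul_one y.1.2.2)))
  act_mul y q q' := Subtype.ext (Prod.ext rfl (Prod.ext (mul_assoc y.1.2.1 q.1 q'.1).symm
    (mul_assoc y.1.2.2 q.1 q'.1).symm))
  ξ y := (leftInvariantFrame Γ r y.1.1).rotate y.rotation
  continuous_ξ := FrameX.continuous_rotate_leftInvariantFrame.comp
    ((continuous_fst.comp RootBundle.continuous_val).prodMk RootBundle.continuous_rotation)
  equivariant y q := by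
    obtain ⟨w, hw⟩ : ∃ w : Circle, w ^ 2 = u y.1.1 := ⟨_, y.2.choose_spec.choose_spec.1⟩
    obtain ⟨s, hs⟩ := RootBundle.eq_mk y hw
    rw [FrameX.rotate_rotate]
    refine congrArg (FrameX.rotate _) ?_
    rw [hs, RootBundle.mk_act, RootBundle.rotation_mk, RootBundle.rotation_mk]
    exact spinHom.map_mul s q
  locally_trivial x₀ := by
    obtain ⟨U, ζ, hU, hx, hζ, h⟩ := RootBundle.exists_local_root u x₀
    have hb : ∀ y : RootBundle (u : X Γ → Circle),
        ((leftInvariantFrame Γ r y.1.1).rotate y.rotation).base = y.1.1 := fun y => by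
      rw [FrameX.base_rotate, FrameX.base_leftInvariantFrame]
    refine ⟨U, hU, hx, RootBundle.trivialization u hζ h (fun y hy => hb y ▸ hy)
      (fun y hy => (hb y).symm ▸ hy), fun y => (hb y.1).symm, ?_⟩
    rintro ⟨y, hy⟩ ⟨y', hy'⟩ q rfl
    refine Subtype.ext ?_
    show (_ • (y.1.2.1 * q.1) + _ • (y.1.2.2 * q.1)) = (_ • _ + _ • _) * q.1
    rw [add_mul, smul_mul_assoc, smul_mul_assoc]
    rfl

/-- A lift has trivial rotation, so its quaternion is `±1`. Absorbing the sign into the root, the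
lift is `w ⊗ 1`, and the real parts of its two components give back `w`. -/
lemma hasClass_rootSpinStructure (hr : r ≠ 0) (u : C(X Γ, Circle)) :
    (rootSpinStructure r u).HasClass hr u := by
  have key : ∀ e : (rootSpinStructure r u).Lifts hr, ∃ (w : Circle) (hw : w ^ 2 = u e.proj),
      e.1 = RootBundle.mk e.proj w hw 1 := by
    intro e
    obtain ⟨y, hy⟩ := e
    have hp : SpinStructure.Lifts.proj (⟨y, hy⟩ : (rootSpinStructure r u).Lifts hr) = y.1.1 := by
      show ((leftInvariantFrame Γ r y.1.1).rotate (RootBundle.rotation y)).base = y.1.1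
      rw [FrameX.base_rotate, FrameX.base_leftInvariantFrame]
    obtain ⟨w, hw⟩ : ∃ w : Circle, w ^ 2 = u y.1.1 := ⟨_, y.2.choose_spec.choose_spec.1⟩
    obtain ⟨s, hs⟩ := RootBundle.eq_mk y hw
    have h1 : RootBundle.rotation y = 1 := by
      rw [← hy]
      exact (FrameX.coord_rotate_leftInvariantFrame hr _ _).symm
    rw [hs, RootBundle.rotation_mk, spinToSO_eq_one_iff] at h1
    rw [hp]
    rcases h1 with rfl | rfl
    · exact ⟨w, hw, hs⟩
    · refine ⟨-w, by rw [neg_sq, hw], hs.trans (Subtype.ext (Prod.ext rfl (Prod.ext ?_ ?_)))⟩ <;>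
        simp [RootBundle.mk]
  have hval : ∀ (x : X Γ) (w : Circle) (hw : w ^ 2 = u x),
      (⟨(RootBundle.mk x w hw 1).1.2.1.re, (RootBundle.mk x w hw 1).1.2.2.re⟩ : ℂ) = w := by
    intro x w hw
    apply Complex.ext <;> simp [RootBundle.mk, Quaternion.re_one]
  let hfun : (rootSpinStructure r u).Lifts hr → Circle := fun e =>
    ⟨⟨(e.1 : RootBundle (u : X Γ → Circle)).1.2.1.re,
      (e.1 : RootBundle (u : X Γ → Circle)).1.2.2.re⟩, by
      obtain ⟨w, hw, h⟩ := key e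
      rw [h, hval]
      exact w.2⟩
  have hfun_eq : ∀ (e : (rootSpinStructure r u).Lifts hr) (w : Circle) (hw : w ^ 2 = u e.proj),
      e.1 = RootBundle.mk e.proj w hw 1 → hfun e = w := by
    intro e w hw h
    refine Circle.ext ?_
    show (⟨(e.1 : RootBundle (u : X Γ → Circle)).1.2.1.re,
      (e.1 : RootBundle (u : X Γ → Circle)).1.2.2.re⟩ : ℂ) = w
    rw [h, hval]
  have hcont : Continuous hfun := by
    refine Continuous.subtype_mk ?_ _
    have h0 : Continuous fun e : (rootSpinStructure r u).Lifts hr =>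
        (e.1 : RootBundle (u : X Γ → Circle)).1 :=
      RootBundle.continuous_val.comp SpinStructure.Lifts.continuous_val
    have h1 := Quaternion.continuous_re.comp ((continuous_fst.comp continuous_snd).comp h0)
    have h2 := Quaternion.continuous_re.comp ((continuous_snd.comp continuous_snd).comp h0)
    exact Complex.equivRealProdCLM.symm.continuous.comp (h1.prodMk h2)
  refine ⟨⟨hfun, hcont⟩, fun e => ?_, fun e => ?_⟩
  · obtain ⟨w, hw, h⟩ := key e
    show hfun (SpinStructure.Lifts.neg e) = -hfun e
    rw [hfun_eq e w hw h]
    refine Circle.ext ?_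
    show (⟨((e.1 : RootBundle (u : X Γ → Circle)).1.2.1 * ((-1 : Spin3) : Quaternion ℝ)).re,
      ((e.1 : RootBundle (u : X Γ → Circle)).1.2.2 * ((-1 : Spin3) : Quaternion ℝ)).re⟩ : ℂ) = _
    rw [h, Circle.coe_neg, ← hval e.proj w hw]
    apply Complex.ext <;> simp
  · obtain ⟨w, hw, h⟩ := key e
    show hfun e ^ 2 = u e.proj
    rw [hfun_eq e w hw h, hw]

end SpinQuotient

/-! ### Counting the classes, and parity at the cusps. -/

namespace SpinQuotient
open Filter Topology UpperHalfPlane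

variable {Γ : Subgroup SL(2, ℝ)} {r : ℝ} {g : ℕ} {ι : Base Γ → ClosedSurface g}
  {C : Finset (ClosedSurface g)} {c₀ : ClosedSurface g}

/-- Around the circle the logarithm of `v` changes by `2πm`, and twice this change is `2πk`. Applied
to a fibre of `X`, this makes the fibre coordinate independent modulo squares. -/
lemma even_of_sq_eq_zpow (v : C(Circle, Circle)) (w : Circle) (k : ℤ)
    (h : ∀ c, v c ^ 2 = w * c ^ k) : Even k := by
  obtain ⟨y, hy⟩ := exists_circle_lift (Y := ℝ) (v.comp Circle.exp)
  have hexp : ∀ t : ℝ, Circle.exp (2 * y t - k * t - 2 * y 0) = 1 := by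
    intro t
    have h1 : ∀ s, Circle.exp (2 * y s) = w * Circle.exp (k * s) := fun s => by
      rw [two_mul, Circle.exp_add, hy, ← sq]
      refine (h _).trans ?_
      rw [← Circle.exp_zsmul, zsmul_eq_mul]
    rw [Circle.exp_sub, Circle.exp_sub, h1, h1 0]
    simp
  obtain ⟨n, hn⟩ := exists_int_of_circle_exp_eq_one_on (v := fun t => 2 * y t - k * t - 2 * y 0)
    (isPreconnected_univ (α := ℝ)) (by fun_prop) fun t _ => hexp t
  have h0 := hn 0 trivial
  have h1 := hn (2 * Real.pi) trivial
  have h2 : Circle.exp (y (2 * Real.pi) - y 0) = 1 := by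
    rw [Circle.exp_sub, hy, hy, div_eq_one]
    show v (Circle.exp _) = v (Circle.exp 0)
    rw [Circle.exp_two_pi, Circle.exp_zero]
  obtain ⟨m, hm⟩ := exists_int_of_circle_exp_eq_one h2
  refine ⟨m, ?_⟩
  have h3 : Real.pi * (k : ℝ) = Real.pi * (m + m) := by linarith
  exact_mod_cast mul_left_cancel₀ Real.pi_ne_zero h3

/-- The products of the basic functions on `Γ\ℍ`. -/
def baseProd (hM : IsModel Γ ι C) (hc₀ : c₀ ∈ C) (n : SurfaceIndex C c₀ → ℤ) :
    C(Base Γ, Circle) where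
  toFun z := ∏ i, surfaceFun C c₀ i (ι z) ^ n i
  continuous_toFun := by
    rw [continuous_iff_continuousAt]
    intro z
    have h1 : ContinuousAt (∏ i, surfaceFun C c₀ i ^ n i) (ι z) :=
      continuousAt_prod _ n fun i _ =>
        continuousAt_surfaceFun hM.planar hc₀ i ((hM.notMem_iff _).2 ⟨z, rfl⟩)
    have h2 : (fun z => ∏ i, surfaceFun C c₀ i (ι z) ^ n i) =
        (∏ i, surfaceFun C c₀ i ^ n i) ∘ ι := by
      funext z
      simp [Finset.prod_apply]
    rw [h2]
    exact h1.comp hM.isOpenEmbedding.continuous.continuousAt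

lemma baseProd_apply (hM : IsModel Γ ι C) (hc₀ : c₀ ∈ C) (n : SurfaceIndex C c₀ → ℤ)
    (z : Base Γ) : baseProd hM hc₀ n z = ∏ i, surfaceFun C c₀ i (ι z) ^ n i := rfl

lemma exists_eq_baseProd (hM : IsModel Γ ι C) (hc₀ : c₀ ∈ C) (f : C(Base Γ, Circle)) :
    ∃ (n : SurfaceIndex C c₀ → ℤ) (y : C(Base Γ, ℝ)),
      ∀ z, f z = baseProd hM hc₀ n z * Circle.exp (y z) := by
  obtain ⟨n, y, hy, h⟩ := exists_surfaceFun_prod hM.planar hc₀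
    (fun x hx => hM.continuousAt_extendFun f hx)
  have hz : ∀ z, ι z ∉ C := fun z => (hM.notMem_iff _).2 ⟨z, rfl⟩
  refine ⟨n, ⟨fun z => y (ι z), continuous_iff_continuousAt.2 fun z =>
    (hy _ (hz z)).comp hM.isOpenEmbedding.continuous.continuousAt⟩, fun z => ?_⟩
  rw [← hM.extendFun_apply f z, h _ (hz z)]
  rfl

lemma even_of_sq_eq_baseProd (hM : IsModel Γ ι C) (hc₀ : c₀ ∈ C) (v : C(Base Γ, Circle))
    {n : SurfaceIndex C c₀ → ℤ} (h : ∀ z, v z ^ 2 = baseProd hM hc₀ n z) (i : SurfaceIndex C c₀) :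
    Even (n i) := by
  refine even_of_sq_eq_surfaceFun_prod hM.planar hc₀
    (fun x hx => hM.continuousAt_extendFun v hx) (fun x hx => ?_) i
  obtain ⟨z, rfl⟩ := (hM.notMem_iff x).1 hx
  rw [hM.extendFun_apply, h]
  rfl

lemma baseProd_add_two_mul (hM : IsModel Γ ι C) (hc₀ : c₀ ∈ C) (n m : SurfaceIndex C c₀ → ℤ)
    (z : Base Γ) : baseProd hM hc₀ (n + 2 * m) z = baseProd hM hc₀ n z * baseProd hM hc₀ m z ^ 2 := by
  simp only [baseProd_apply, ← Finset.prod_pow, ← Finset.prod_mul_distrib]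
  refine Finset.prod_congr rfl fun i _ => ?_
  rw [Pi.add_apply, _root_.zpow_add, Pi.mul_apply, mul_comm ((2 : SurfaceIndex C c₀ → ℤ) i),
    _root_.zpow_mul]
  rfl

/-- The functions on `X` representing the spin structures. -/
def classFun (hM : IsModel Γ ι C) (hc₀ : c₀ ∈ C) (Ψ : X Γ ≃ₜ Base Γ × Circle)
    (n : SurfaceIndex C c₀ → ℤ) (b : ℤ) : C(X Γ, Circle) where
  toFun x := baseProd hM hc₀ n (Ψ x).1 * (Ψ x).2 ^ b
  continuous_toFun := ((baseProd hM hc₀ n).continuous.comp (continuous_fst.comp Ψ.continuous)).mul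
    ((continuous_snd.comp Ψ.continuous).zpow b)

/-- The spin structure with given coefficients modulo two. -/
def modTwoClass (hM : IsModel Γ ι C) (hc₀ : c₀ ∈ C) (Ψ : X Γ ≃ₜ Base Γ × Circle)
    (t : (SurfaceIndex C c₀ → Fin 2) × Fin 2) : C(X Γ, Circle) :=
  classFun hM hc₀ Ψ (fun i => ((t.1 i : ℕ) : ℤ)) ((t.2 : ℕ) : ℤ)

lemma modTwoClass_apply (hM : IsModel Γ ι C) (hc₀ : c₀ ∈ C) (Ψ : X Γ ≃ₜ Base Γ × Circle)
    (t : (SurfaceIndex C c₀ → Fin 2) × Fin 2) (x : X Γ) : modTwoClass hM hc₀ Ψ t x =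
      baseProd hM hc₀ (fun i => ((t.1 i : ℕ) : ℤ)) (Ψ x).1 * (Ψ x).2 ^ ((t.2 : ℕ) : ℤ) := rfl

lemma exists_fin_two (k : ℤ) : ∃ (t : Fin 2) (m : ℤ), k = ((t : ℕ) : ℤ) + 2 * m := by
  rcases Int.even_or_odd' k with ⟨m, h | h⟩
  · exact ⟨0, m, by simpa using h⟩
  · exact ⟨1, m, by simpa [add_comm] using h⟩

lemma fin_two_eq_of_even {s t : Fin 2} (h : Even (((s : ℕ) : ℤ) - ((t : ℕ) : ℤ))) : s = t := by
  revert h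
  fin_cases s <;> fin_cases t <;> simp

lemma circle_mul_sq_cancel (p q e w k : Circle) :
    p * q ^ 2 * e ^ 2 * (w * k ^ 2) * ((q * e * k)⁻¹) ^ 2 = p * w := by
  rw [inv_pow, mul_pow, mul_pow, mul_inv_eq_iff_eq_mul]
  ac_rfl

/-- Exponents are reduced modulo two, and the exponential of a real function is the square of the
exponential of its half; both changes multiply `u` by a square. -/
lemma exists_hasClass_modTwoClass (hM : IsModel Γ ι C) (hc₀ : c₀ ∈ C) {Ψ : X Γ ≃ₜ Base Γ × Circle}
    (hΨ : ∀ x, (Ψ x).1 = toBase Γ x) (hr : r ≠ 0) (S : SpinStructure Γ r) :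
    ∃ t, S.HasClass hr (modTwoClass hM hc₀ Ψ t) := by
  obtain ⟨f, b, h⟩ := S.exists_hasClass hM ⟨c₀, hc₀⟩ hΨ hr
  obtain ⟨n, y, hf⟩ := exists_eq_baseProd hM hc₀ f
  choose t m htm using fun i => exists_fin_two (n i)
  obtain ⟨s, k, hs⟩ := exists_fin_two b
  have hn : n = (fun i => ((t i : ℕ) : ℤ)) + 2 * m := funext htm
  have h1 : Continuous fun x => (Ψ x).1 := continuous_fst.comp Ψ.continuous
  have h2 : Continuous fun x => (Ψ x).2 := continuous_snd.comp Ψ.continuous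
  have h3 : Continuous fun x => Circle.exp (y (Ψ x).1 / 2) :=
    Circle.exp.continuous.comp ((y.continuous.comp h1).div_const 2)
  have hv := h.mul_sq ⟨fun x => (baseProd hM hc₀ m (Ψ x).1 * Circle.exp (y (Ψ x).1 / 2) *
    (Ψ x).2 ^ k)⁻¹, ((((baseProd hM hc₀ m).continuous.comp h1).mul h3).mul (h2.zpow k)).inv⟩
  refine ⟨(t, s), hv.congr fun x => ?_⟩
  have hb : (Ψ x).2 ^ b = (Ψ x).2 ^ ((s : ℕ) : ℤ) * ((Ψ x).2 ^ k) ^ 2 := by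
    rw [← _root_.zpow_natCast (Ψ x).2 b, hs, _root_.zpow_add, mul_comm 2 k, _root_.zpow_mul]
    rfl
  have he : Circle.exp (y (Ψ x).1) = Circle.exp (y (Ψ x).1 / 2) ^ 2 := by
    rw [sq, ← Circle.exp_add, add_halves]
  rw [modTwoClass_apply, ← hΨ, hf, hn, baseProd_add_two_mul, hb, he, ContinuousMap.coe_mk]
  exact circle_mul_sq_cancel _ _ _ _ _

/-- Restriction to one fibre isolates the exponent of the fibre coordinate; restriction to the slice
where this coordinate is one isolates the exponents on the base. -/
lemma modTwoClass_injective (hM : IsModel Γ ι C) (hc₀ : c₀ ∈ C) {Ψ : X Γ ≃ₜ Base Γ × Circle}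
    {s t : (SurfaceIndex C c₀ → Fin 2) × Fin 2} (v : C(X Γ, Circle))
    (h : ∀ x, modTwoClass hM hc₀ Ψ s x = modTwoClass hM hc₀ Ψ t x * v x ^ 2) : s = t := by
  have h1 : ∀ z c, v (Ψ.symm (z, c)) ^ 2 =
      baseProd hM hc₀ (fun i => ((s.1 i : ℕ) : ℤ) - ((t.1 i : ℕ) : ℤ)) z *
        c ^ (((s.2 : ℕ) : ℤ) - ((t.2 : ℕ) : ℤ)) := by
    intro z c
    have h2 := h (Ψ.symm (z, c))
    have h3 : ∀ t, modTwoClass hM hc₀ Ψ t (Ψ.symm (z, c)) =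
        baseProd hM hc₀ (fun i => ((t.1 i : ℕ) : ℤ)) z * c ^ ((t.2 : ℕ) : ℤ) := by
      intro t
      rw [modTwoClass_apply, Ψ.apply_symm_apply]
    rw [h3, h3] at h2
    have h4 : baseProd hM hc₀ (fun i => ((s.1 i : ℕ) : ℤ) - ((t.1 i : ℕ) : ℤ)) z =
        baseProd hM hc₀ (fun i => ((s.1 i : ℕ) : ℤ)) z /
          baseProd hM hc₀ (fun i => ((t.1 i : ℕ) : ℤ)) z := by
      simp only [baseProd_apply, ← Finset.prod_div_distrib]
      exact Finset.prod_congr rfl fun i _ => by rw [_root_.zpow_sub, div_eq_mul_inv]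
    rw [h4, _root_.zpow_sub, ← div_eq_mul_inv, div_mul_div_comm, h2, mul_div_cancel_left]
  have hb : Even (((s.2 : ℕ) : ℤ) - ((t.2 : ℕ) : ℤ)) := by
    refine even_of_sq_eq_zpow ⟨fun c => v (Ψ.symm (baseMk Γ I, c)), v.continuous.comp
      (Ψ.symm.continuous.comp (continuous_const.prodMk continuous_id))⟩ _ _ fun c => h1 _ c
  have hn := even_of_sq_eq_baseProd hM hc₀ ⟨fun z => v (Ψ.symm (z, 1)), v.continuous.comp
      (Ψ.symm.continuous.comp (continuous_id.prodMk continuous_const))⟩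
      (fun z => by
        have := h1 z 1
        rw [_root_.one_zpow, mul_one] at this
        exact this)
  exact Prod.ext (funext fun i => fin_two_eq_of_even (hn i)) (fin_two_eq_of_even hb)

theorem card_spinStructures (hM : IsModel Γ ι C) (hc₀ : c₀ ∈ C) {Ψ : X Γ ≃ₜ Base Γ × Circle}
    (hΨ : ∀ x, (Ψ x).1 = toBase Γ x) (hr : r ≠ 0) :
    Nat.card (SpinStructures Γ r) = 2 ^ (2 * g + C.card) := by
  let φ : (SurfaceIndex C c₀ → Fin 2) × Fin 2 → SpinStructures Γ r := fun t =>
    Quotient.mk _ (rootSpinStructure r (modTwoClass hM hc₀ Ψ t))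
  have hφ : Function.Bijective φ := by
    constructor
    · intro s t h
      have h1 : (rootSpinStructure r (modTwoClass hM hc₀ Ψ s)).Equivalent
        (rootSpinStructure r (modTwoClass hM hc₀ Ψ t)) := Quotient.exact h
      obtain ⟨v, hv⟩ := ((hasClass_rootSpinStructure hr _).of_equivalent h1).exists_eq_mul_sq
        (hasClass_rootSpinStructure hr _)
      exact modTwoClass_injective hM hc₀ v hv
    · intro S
      induction S using Quotient.inductionOn with | _ S =>
      obtain ⟨t, ht⟩ := exists_hasClass_modTwoClass hM hc₀ hΨ hr S
      exact ⟨t, Quotient.sound ((hasClass_rootSpinStructure hr _).equivalent ht)⟩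
  rw [← Nat.card_eq_of_bijective φ hφ, Nat.card_eq_fintype_card]
  have hpos : 0 < C.card := Finset.card_pos.2 ⟨c₀, hc₀⟩
  simp only [Fintype.card_prod, Fintype.card_fun, Fintype.card_fin, Fintype.card_sum,
    Fintype.card_coe, Finset.card_erase_of_mem hc₀]
  rw [← pow_succ]
  congr 1
  omega

lemma continuous_cuspLoop (Γ : Subgroup SL(2, ℝ)) (a : SL(2, ℝ)) (l : ℝ) :
    Continuous (cuspLoop Γ a l) := by
  have h1 : Continuous fun t : unitInterval => (a * unip (t * l)) • I :=
    (continuous_const.mul (continuous_unip.comp (by fun_prop))).smul continuous_const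
  exact (isOpenQuotientMap_baseMk Γ).continuous.comp h1

lemma cuspLoop_zero_eq_one {a : SL(2, ℝ)} {l : ℝ} (hl : IsWidth Γ a l) :
    cuspLoop Γ a l 0 = cuspLoop Γ a l 1 := by
  have h : ∀ t : unitInterval, cuspLoop Γ a l t = baseMk Γ (a • ((t * l : ℝ) +ᵥ I)) := fun t => by
    rw [← unip_smul, ← mul_smul]
    rfl
  rw [h, h]
  have h0 := hl.baseMk_vadd 0 I
  have h1 := hl.baseMk_vadd 1 I
  push_cast at h0 h1
  exact h0.trans h1.symm

/-- Triviality along a cusp loop is the existence of a closed square root of `u ∘ s`, which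
`exists_sqrt_cuspLoop_iff` translates into even degree at the puncture. -/
theorem totallyNontrivial_iff (hM : IsModel Γ ι C) {hr : r ≠ 0} {S : SpinStructure Γ r}
    {u : C(X Γ, Circle)} (hS : S.HasClass hr u) (s : C(Base Γ, X Γ)) :
    S.TotallyNontrivial s ↔ ∀ c ∈ C, Odd (degAt (extendFun ι (u.comp s)) c) := by
  have key : ∀ {a l c}, IsWidth Γ a l → IsCuspPoint ι a l c →
      (¬ S.TrivialAlong (fun t => s (cuspLoop Γ a l t)) ↔
        Odd (degAt (extendFun ι (u.comp s)) c)) := by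
    intro a l c hl hc
    rw [hS.trivialAlong_iff (c := fun t => s (cuspLoop Γ a l t)) (s.continuous.comp (continuous_cuspLoop Γ a l))
      (congrArg s (cuspLoop_zero_eq_one hl)), ← Int.not_even_iff_odd,
      ← exists_sqrt_cuspLoop_iff hM (u.comp s) hl hc]
    rfl
  constructor
  · intro h c hc
    obtain ⟨a, l, ha, hp⟩ := hM.exists_cusp c hc
    exact (key ha.2 hp).1 (h _ ha.1 a l rfl ha.2)
  · rintro h _ hc a l rfl hl
    obtain ⟨c, hcC, hp⟩ := hM.exists_point a l ⟨hc, hl⟩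
    exact (key hl hp).2 (h c hcC)

/-- The factor `exp y` has a logarithm on a punctured neighbourhood, so its degree is zero even if
`y` has no limit at the puncture. -/
lemma degAt_extendFun (hM : IsModel Γ ι C) (hc₀ : c₀ ∈ C) {f : C(Base Γ, Circle)}
    {n : SurfaceIndex C c₀ → ℤ} {y : C(Base Γ, ℝ)}
    (hf : ∀ z, f z = baseProd hM hc₀ n z * Circle.exp (y z)) (c : ClosedSurface g) :
    degAt (extendFun ι f) c = degAt (∏ i, surfaceFun C c₀ i ^ n i) c := by
  have hpp : PuncCont (∏ i, surfaceFun C c₀ i ^ n i) c :=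
    puncCont_prod _ n fun i _ => puncCont_surfaceFun hM.planar i c
  have hy : ∀ x ∉ C, ContinuousAt (Function.extend ι y 0) x := by
    intro x hx
    obtain ⟨z, rfl⟩ := (hM.notMem_iff x).1 hx
    refine (hM.isOpenEmbedding.continuousAt_iff).1 ?_
    rw [show Function.extend ι y 0 ∘ ι = y from
      funext (hM.isOpenEmbedding.injective.extend_apply _ _)]
    exact y.continuous.continuousAt
  have hev : ∀ᶠ x in 𝓝[≠] c, x ∉ C := by
    have h1 : IsOpen ((C.erase c : Finset (ClosedSurface g)) : Set (ClosedSurface g))ᶜ :=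
      (C.erase c).finite_toSet.isClosed.isOpen_compl
    filter_upwards [mem_nhdsWithin_of_mem_nhds (h1.mem_nhds (by simp)), self_mem_nhdsWithin]
      with x hx hxc hxC
    exact hx (Finset.mem_coe.2 (Finset.mem_erase.2 ⟨hxc, hxC⟩))
  have hyc : ∀ᶠ x in 𝓝[≠] c, ContinuousAt (Function.extend ι y 0) x := hev.mono hy
  have hep : PuncCont (fun x => Circle.exp (Function.extend ι y 0 x)) c :=
    hyc.mono fun _ hx => (Circle.exp.continuous.continuousAt.comp hx :)
  have h1 := degAt_mul hM.planar hpp hep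
  rw [degAt_exp hM.planar hyc, add_zero] at h1
  rw [← h1]
  refine degAt_congr hM.planar (hpp.mul hep) ?_
  filter_upwards [hev] with x hx
  obtain ⟨z, rfl⟩ := (hM.notMem_iff x).1 hx
  rw [hM.extendFun_apply, hf, Pi.mul_apply, hM.isOpenEmbedding.injective.extend_apply,
    Finset.prod_apply]
  rfl

lemma odd_degAt_dipoleFun (hM : IsModel Γ ι C) (c : {c // c ∈ C.erase c₀}) :
    Odd (degAt (dipoleFun c₀ c.1) c₀) ∧ Odd (degAt (dipoleFun c₀ c.1) c.1) := by
  have h : ∀ k : ℤ, |k| = 1 → Odd k := fun k hk => by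
    rcases (abs_eq zero_le_one).1 hk with rfl | rfl <;> decide
  obtain ⟨-, h1, h2⟩ := dipoleFun_spec hM.planar (SurfaceIndex.ne c)
  exact ⟨h _ h1, h _ h2⟩

lemma odd_sum_iff {α : Type*} (s : Finset α) {f : α → ℤ} (h : ∀ i ∈ s, Odd (f i)) :
    Odd (∑ i ∈ s, f i) ↔ Odd s.card := by
  classical
  induction s using Finset.induction_on with
  | empty => simp
  | insert a s ha ih =>
    rw [Finset.sum_insert ha, Finset.card_insert_of_notMem ha, Int.odd_add, Nat.odd_add_one,
      ← Int.not_odd_iff_even, ih fun i hi => h i (Finset.mem_insert_of_mem hi)]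
    exact iff_true_left (h a (Finset.mem_insert_self _ _))

/-- Dipoles have odd degree at both ends. Away from `c₀` the parity of the degree is that of one
exponent; at `c₀` the degree is then a sum of `C.card - 1` odd numbers, which is odd exactly when
`C.card` is even. -/
lemma forall_odd_degAt_iff (hM : IsModel Γ ι C) (hc₀ : c₀ ∈ C) (n : SurfaceIndex C c₀ → ℤ) :
    (∀ c ∈ C, Odd (degAt (∏ i, surfaceFun C c₀ i ^ n i) c)) ↔
      (∀ c, Odd (n (Sum.inr c))) ∧ Even C.card := by
  have h1 : ∀ c, Odd (degAt (∏ i, surfaceFun C c₀ i ^ n i) c.1) ↔ Odd (n (Sum.inr c)) := fun c => by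
    rw [degAt_prod_surfaceFun hM.planar n c, Int.odd_mul]
    exact and_iff_left (odd_degAt_dipoleFun hM c).2
  have h2 : (∀ c, Odd (n (Sum.inr c))) →
      (Odd (degAt (∏ i, surfaceFun C c₀ i ^ n i) c₀) ↔ Even C.card) := fun h => by
    rw [degAt_prod_surfaceFun_base hM.planar n, odd_sum_iff _ fun c _ => (h c).mul (odd_degAt_dipoleFun hM c).1,
      Finset.card_univ, Fintype.card_coe, Finset.card_erase_of_mem hc₀]
    have hpos : 0 < C.card := Finset.card_pos.2 ⟨c₀, hc₀⟩
    rw [← Nat.not_even_iff_odd, ← Nat.even_add_one, Nat.sub_add_cancel hpos]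
  constructor
  · intro h
    have h3 : ∀ c, Odd (n (Sum.inr c)) := fun c => (h1 c).1 (h _ (Finset.mem_of_mem_erase c.2))
    exact ⟨h3, (h2 h3).1 (h c₀ hc₀)⟩
  · rintro ⟨h3, h4⟩ c hc
    by_cases hcc : c = c₀
    · rw [hcc]
      exact (h2 h3).2 h4
    · exact (h1 ⟨c, Finset.mem_erase.2 ⟨hcc, hc⟩⟩).2 (h3 _)

/-- Necessity needs only that `u ∘ s` is some function on the base. For sufficiency all basic
functions are multiplied together with fibre exponent zero, so that `u ∘ s` is the same function for
every section. -/
theorem exists_totallyNontrivial_iff (hM : IsModel Γ ι C) (hc₀ : c₀ ∈ C)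
    {Ψ : X Γ ≃ₜ Base Γ × Circle} (hΨ : ∀ x, (Ψ x).1 = toBase Γ x) (hr : r ≠ 0)
    {s : C(Base Γ, X Γ)} (hs : ∀ z, toBase Γ (s z) = z) :
    (∃ S : SpinStructure Γ r, S.TotallyNontrivial s) ↔ Even C.card := by
  constructor
  · rintro ⟨S, hS⟩
    obtain ⟨t, ht⟩ := exists_hasClass_modTwoClass hM hc₀ hΨ hr S
    obtain ⟨n, y, hf⟩ := exists_eq_baseProd hM hc₀ ((modTwoClass hM hc₀ Ψ t).comp s)
    have h1 := (totallyNontrivial_iff hM ht s).1 hS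
    simp only [degAt_extendFun hM hc₀ hf] at h1
    exact ((forall_odd_degAt_iff hM hc₀ n).1 h1).2
  · intro h
    refine ⟨rootSpinStructure r (classFun hM hc₀ Ψ 1 0), ?_⟩
    rw [totallyNontrivial_iff hM (hasClass_rootSpinStructure hr _) s]
    have hf : ∀ z, (classFun hM hc₀ Ψ 1 0).comp s z =
        baseProd hM hc₀ 1 z * Circle.exp ((0 : C(Base Γ, ℝ)) z) := fun z => by
      show baseProd hM hc₀ 1 (Ψ (s z)).1 * (Ψ (s z)).2 ^ (0 : ℤ) = _
      rw [hΨ, hs, _root_.zpow_zero, ContinuousMap.zero_apply, Circle.exp_zero]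
    simp only [degAt_extendFun hM hc₀ hf]
    exact (forall_odd_degAt_iff hM hc₀ 1).2 ⟨fun _ => odd_one, h⟩

end SpinQuotient

end

theorem mainTheorem10 (Γ : Subgroup SL(2, ℝ)) (hdiscrete : DiscreteTopology Γ)
    (hneg : -1 ∈ Γ) (hfree : ∀ γ ∈ Γ, ∀ z : UpperHalfPlane, γ • z = z → γ = 1 ∨ γ = -1)
    (g κ : ℕ) (hκ : 0 < κ) (hsig : SpinQuotient.HasSignature Γ g κ)
    (r : ℝ) (hr : 0 < r) :
    Nat.card (SpinQuotient.SpinStructures Γ r) = 2 ^ (2 * g + κ) ∧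
    (∃ s : C(SpinQuotient.Base Γ, SpinQuotient.X Γ), ∀ z, SpinQuotient.toBase Γ (s z) = z) ∧
    ∀ s : C(SpinQuotient.Base Γ, SpinQuotient.X Γ), (∀ z, SpinQuotient.toBase Γ (s z) = z) →
      ((∃ S : SpinQuotient.SpinStructure Γ r, S.TotallyNontrivial s) ↔ Even κ) := by
  obtain ⟨ι, C, hM, rfl⟩ := SpinQuotient.exists_isModel hdiscrete hneg hfree hsig
  obtain ⟨c₀, hc₀⟩ := Finset.card_pos.1 hκ
  obtain ⟨F, hF⟩ := SpinQuotient.exists_weightTwo hM ⟨c₀, hc₀⟩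
  obtain ⟨Ψ, hΨ⟩ := SpinQuotient.exists_homeomorph hneg hF
  refine ⟨SpinQuotient.card_spinStructures hM hc₀ hΨ hr.ne',
    ⟨⟨fun z => Ψ.symm (z, 1), Ψ.symm.continuous.comp
      (continuous_id.prodMk continuous_const)⟩, fun z => ?_⟩,
    fun s hs => SpinQuotient.exists_totallyNontrivial_iff hM hc₀ hΨ hr.ne' hs⟩
  rw [← hΨ]
  exact congrArg Prod.fst (Ψ.apply_symm_apply (z, 1))
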